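/- Notation. For a function $u(x,t)$ on $\mathbb R^3\times\mathbb R$ put $\mathbf L_+u=\nabla u\cdot\frac{x}{|x|}+\frac{u}{|x|}+u_t$, and for initial data $\mathbf L_+(u_0,u_1)=\nabla u_0\cdot\frac{x}{|x|}+\frac{u_0}{|x|}+u_1$. Let $\nabla_{\omega} u$ be the angular part of the gradient, i.e. the component of $\nabla u$ tangent to the sphere of radius $|x|$ centred at the origin. Let $3\le p<5$ and $0<\gamma<1$. Let $a\in C([0,\infty))$ be a real function that is absolutely continuous on $[0,R]$ for every $R>0$ and satisfies $0\le a'(r)\le \gamma a(r)/r$ for almost every $r>0$. Let $u$ be a real global solution of $\partial_t^2u-\Delta u=-|u|^{p-1}u$ on $\mathbb R^3\times\mathbb R$ with initial data $(u_0,u_1)$, that is $(u,u_t)\in C(\mathbb R;\dot H^1\times L^2(\mathbb R^3))$, $u\in L^{2p/(p-3)}L^{2p}([t_1,t_2]\times\mathbb R^3)$ for every compact interval $[t_1,t_2]$ (time exponent $\infty$ if $p=3$), the equation holds in the sense of distributions, and $(u,u_t)|_{t=0}=(u_0,u_1)$. Assume that the energy $E=\int_{\mathbb R^3}\left(\frac12|\nabla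 u_0|^2+\frac12|u_1|^2+\frac1{p+1}|u_0|^{p+1}\right)dx$ is finite and that \[ K_1=\int_{\mathbb R^3}a(|x|)\left[\frac14|\mathbf L_+(u_0,u_1)|^2+\frac14|\nabla_{\omega} u_0|^2+\frac1{2(p+1)}|u_0|^{p+1}\right]dx<\infty . \] Then there is exactly one nonnegative, finite, continuous (atomless) Borel measure $\mu$ on $\mathbb R$ such that for all $t_1<t_2$ \[ \pi\mu([t_1,t_2])=\lim_{r\to0^+}\int_{\{|x|=r,\ t_1<t<t_2\}}\left(\frac14|\mathbf L_+u|^2-\frac14|\nabla_{\omega} u|^2-\frac{|u|^{p+1}}{2(p+1)}\right)dS \] (the measure in the energy flux formula; the surface integral has a meaning for almost every $r$, and the limit is taken along almost every $r$), and this measure satisfies \[ \pi\int_0^\infty a(t)\,d\mu(t)+\iint_{\mathbb R^3\times\mathbb R^+}a(|x|+t)\left(\frac{p-1-2\gamma}{2(p+1)}\cdot\frac{|u|^{p+1}}{|x|} +\frac{1-\gamma}{2}\cdot\frac{|\nabla_{\omega} u|^2}{|x|}\right)dx\,dt\le K_1 . \] -/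

import Mathlib

open MeasureTheory Filter Topology Set
open scoped ENNReal ContDiff

/-- Three-dimensional Euclidean space. -/
abbrev E3 : Type := EuclideanSpace ℝ (Fin 3)

noncomputable section

/-- `g` is the weak gradient of `f` on `ℝ³`. -/
def HasWeakGradient (f : E3 → ℝ) (g : E3 → E3) : Prop :=
  ∀ φ : E3 → ℝ, ContDiff ℝ ∞ φ → HasCompactSupport φ → ∀ e : E3,
    ∫ x, f x * fderiv ℝ φ x e = -∫ x, inner ℝ (g x) e * φ x

/-- `u` is a global-in-time solution of `∂ₜ²u - Δu = -|u|^(p-1) u` on `ℝ³ × ℝ` in the energy space,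
with spatial gradient `gradu` and time derivative `ut`; the first argument of each function is time.

Here `f ∈ Ḣ¹(ℝ³)` means that `f ∈ L⁶` has a weak gradient in `L²`. The initial data are `u 0`
(with gradient `gradu 0`) and `ut 0`. -/
structure IsEnergySolution (p : ℝ) (u ut : ℝ → E3 → ℝ) (gradu : ℝ → E3 → E3) : Prop where
  aestronglyMeasurable_u :
    AEStronglyMeasurable (fun z : ℝ × E3 => u z.1 z.2) volume
  aestronglyMeasurable_ut :
    AEStronglyMeasurable (fun z : ℝ × E3 => ut z.1 z.2) volume
  aestronglyMeasurable_gradu :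
    AEStronglyMeasurable (fun z : ℝ × E3 => gradu z.1 z.2) volume
  memLp_u : ∀ t, MemLp (u t) 6 volume
  memLp_ut : ∀ t, MemLp (ut t) 2 volume
  memLp_gradu : ∀ t, MemLp (gradu t) 2 volume
  hasWeakGradient : ∀ t, HasWeakGradient (u t) (gradu t)
  /-- `(u, uₜ) ∈ C(ℝ; Ḣ¹ × L²)`: continuity of `∇u` in `L²`. -/
  continuous_gradu : ∀ t₀, Tendsto (fun t => eLpNorm (gradu t - gradu t₀) 2 volume) (𝓝 t₀) (𝓝 0)
  /-- `(u, uₜ) ∈ C(ℝ; Ḣ¹ × L²)`: continuity of `uₜ` in `L²`. -/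
  continuous_ut : ∀ t₀, Tendsto (fun t => eLpNorm (ut t - ut t₀) 2 volume) (𝓝 t₀) (𝓝 0)
  /-- `u ∈ L^{2p/(p-3)} L^{2p}([a, b] × ℝ³)` on every compact time interval; the time exponent is
  `∞` if `p = 3`. -/
  strichartz : ∀ a b : ℝ, a < b →
    eLpNorm (fun t => eLpNorm (u t) (ENNReal.ofReal (2 * p)) volume)
      (ENNReal.ofReal (2 * p) / ENNReal.ofReal (p - 3)) (volume.restrict (Icc a b)) < ⊤
  /-- `ut` is the time derivative of `u`, in the sense of distributions on `ℝ × ℝ³`. -/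
  time_deriv : ∀ φ : ℝ × E3 → ℝ, ContDiff ℝ ∞ φ → HasCompactSupport φ →
    ∫ z : ℝ × E3, u z.1 z.2 * deriv (fun s => φ (s, z.2)) z.1 =
      -∫ z : ℝ × E3, ut z.1 z.2 * φ z
  /-- The wave equation, in the sense of distributions on `ℝ × ℝ³`. -/
  equation : ∀ φ : ℝ × E3 → ℝ, ContDiff ℝ ∞ φ → HasCompactSupport φ →
    ∫ z : ℝ × E3, u z.1 z.2 *
        (iteratedDeriv 2 (fun s => φ (s, z.2)) z.1 - Laplacian.laplacian (fun y => φ (z.1, y)) z.2) =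
      -∫ z : ℝ × E3, |u z.1 z.2| ^ (p - 1) * u z.1 z.2 * φ z

/-- The energy of a state `(f, h)` with `g = ∇f`. -/
def waveEnergy (p : ℝ) (f h : E3 → ℝ) (g : E3 → E3) : ℝ≥0∞ :=
  ∫⁻ x, ENNReal.ofReal (‖g x‖ ^ 2 / 2 + |h x| ^ 2 / 2 + |f x| ^ (p + 1) / (p + 1))

/-- `𝐋₊(f, h)(x) = ∇f(x) · x/|x| + f(x)/|x| + h(x)`, with `g = ∇f`. -/
def Lplus (f h : E3 → ℝ) (g : E3 → E3) (x : E3) : ℝ :=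
  inner ℝ (g x) x / ‖x‖ + f x / ‖x‖ + h x

/-- The angular part of the gradient `g` at `x`: its component tangent to the sphere of radius
`|x|` centred at the origin. -/
def angularGrad (g : E3 → E3) (x : E3) : E3 :=
  g x - (inner ℝ (g x) x / ‖x‖ ^ 2) • x

/-- The density of the inward energy of a state `(f, h)` with `g = ∇f`. -/
def inwardEnergyDensity (p : ℝ) (f h : E3 → ℝ) (g : E3 → E3) (x : E3) : ℝ :=
  |Lplus f h g x| ^ 2 / 4 + ‖angularGrad g x‖ ^ 2 / 4 + |f x| ^ (p + 1) / (2 * (p + 1))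

/-- The component of the inward energy flux vector field across `|x| = r`, in the direction
towards the origin. -/
def inwardFluxDensity (p : ℝ) (f h : E3 → ℝ) (g : E3 → E3) (x : E3) : ℝ :=
  |Lplus f h g x| ^ 2 / 4 - ‖angularGrad g x‖ ^ 2 / 4 - |f x| ^ (p + 1) / (2 * (p + 1))

/-- The flux of inward energy through the cylinder `{(x, t) : |x| = r, t₁ < t < t₂}`, oriented
towards the `t`-axis. The measure `volume.toSphere` is the surface measure of the unit sphere. -/
def cylinderFlux (p : ℝ) (u ut : ℝ → E3 → ℝ) (gradu : ℝ → E3 → E3) (t₁ t₂ r : ℝ) : ℝ :=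
  ∫ t in Ioo t₁ t₂, ∫ θ : Metric.sphere (0 : E3) 1,
    r ^ 2 * inwardFluxDensity p (u t) (ut t) (gradu t) (r • (θ : E3))
      ∂((volume : Measure E3).toSphere)

/-- `μ` is the measure on the `t`-axis appearing in the energy flux formula: the nonnegative, finite,
continuous measure such that `π μ([t₁, t₂])` is the limit, as `r → 0⁺`, of the flux of inward energy
through the cylinder `{|x| = r, t₁ < t < t₂}`. The first derivatives of a solution in the
energy space have a meaning on the cylinder `|x| = r` for almost every `r` only, so the limit is
taken along almost every `r`. -/
structure IsAxisFluxMeasure (p : ℝ) (u ut : ℝ → E3 → ℝ) (gradu : ℝ → E3 → E3)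
    (μ : Measure ℝ) : Prop where
  finite : IsFiniteMeasure μ
  continuous : ∀ t : ℝ, μ {t} = 0
  tendsto : ∀ t₁ t₂ : ℝ, t₁ < t₂ →
    Tendsto (fun r => cylinderFlux p u ut gradu t₁ t₂ r) (𝓝[>] (0 : ℝ) ⊓ ae volume)
      (𝓝 (Real.pi * (μ (Icc t₁ t₂)).toReal))

/-- The inward energy of a state `(f, h)`, `g = ∇f`, weighted by `a(|x|)`. -/
def weightedInwardEnergy (p : ℝ) (a : ℝ → ℝ) (f h : E3 → ℝ) (g : E3 → E3) : ℝ≥0∞ :=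
  ∫⁻ x, ENNReal.ofReal (a ‖x‖ * inwardEnergyDensity p f h g x)

end

/-! Write e for the inward energy density, f for the inward flux density, and m for the source |∇_ω
u|²/(2|x|) + (p-1)|u|^(p+1)/(2(p+1)|x|). Testing the wave equation with χ 𝐋₊u, where χ = χ(t,|x|)
vanishes near the axis, gives a balance law (`null_inward`): after integration over the spheres |x|
= r it reads ∂ₜe - ∂ᵣf + m = 0. For solutions of finite regularity the underlying identities are
proved for mollifications and passed to the limit. The delicate term is the nonlinearity times a
first derivative: the space-time bound on u puts |u|^(p-1)u locally in L¹L², the derivatives are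
locally in L^∞L², and mollification respects this pairing
(`tendsto_integral_mollify_mul_of_locL1L2`). A local energy identity with expanding cutoffs keeps
the energy below its initial value, and Hardy's inequality then bounds ∫e uniformly in time. What
follows uses only the facts collected in `InwardFlow`: regularity, the bound on ∫e, the balance law,
m ≥ 0, |f| ≤ e, |x|m ≤ 4e and f ≥ -|x|m/2.

The axis measure. Let Φ(r), M(r) be the integrals of f, m over the cylinder of radius r with a < t ≤
b. Then Φ' = M + N, where N is the difference of the sphere integrals of e at the times b and a.
Both Φ and N are integrable in r, but of M only r M(r) is known to be. Split Φ = H + J with H' = M,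
J' = N and J(0) = 0. If H were negative somewhere, then J would be negligible near r = 0, and Φ ≥
-rM/2 would turn into (rH)' = H + rM ≥ 0; so rH would stay below a negative constant and |Φ| ≥ c/r,
against integrability (`nonneg_of_flux`). Hence H ≥ 0, M is integrable at 0, and Φ(0+) exists and is
nonnegative (`exists_axis_limit`). These limits are additive in the time interval and bounded by sup
∫e. Averaging over r ≤ ρ bounds them by C(b-a)/ρ plus the energy at time a in the ball of radius ρ
(`IsAxisFlux.le`), so short intervals carry little flux. The limits are thus the increments of a
bounded continuous increasing function, and μ is the Stieltjes measure of that function divided by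
π. Its values on compact intervals determine it.

The inequality. Use the balance law on [0,T] with the weight w(t+r), which is constant along
incoming light rays, so that differentiating it produces only w'(e-f). If s w'(s) ≤ γ w(s), then r
w' ≤ γ w, and this term costs at most γ(e-f)/r out of m; what is left is exactly the density on the
left of the claim (`coerciveSource_add`). The final energy is nonnegative and is dropped, and the
derivative of a cutoff near the axis concentrates to π∫w dμ. For a general weight a, the hypothesis
makes r^(-γ) a(r) nonincreasing. Mollifying a in the variable log r gives a smooth w with the
required differential inequality, comparable with a up to c^γ. On the axis a lower step function for
a geometric partition of ratio c is used. The total loss is c^(3γ), and c tends to 1. -/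

noncomputable section

set_option linter.unusedSectionVars false

/-! ### Mollification and its convergence in L². -/

section Mollify

variable {E : Type*} [NormedAddCommGroup E] [NormedSpace ℝ E] [FiniteDimensional ℝ E]
  [MeasureSpace E] [BorelSpace E] [(volume : Measure E).IsAddHaarMeasure]

/-- A sequence of bump functions with radii tending to zero. -/
def stdBump (E : Type*) [NormedAddCommGroup E] (n : ℕ) : ContDiffBump (0 : E) :=
  ⟨1 / (2 * ((n : ℝ) + 1)), 1 / ((n : ℝ) + 1), by positivity, by
    apply one_div_lt_one_div_of_lt <;> linarith [n.cast_nonneg (α := ℝ)]⟩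

theorem stdBump_rOut_le_one (n : ℕ) : (stdBump E n).rOut ≤ 1 := by
  change 1 / ((n : ℝ) + 1) ≤ 1
  rw [div_le_one (by positivity)]
  linarith [n.cast_nonneg (α := ℝ)]

theorem stdBump_tendsto : Tendsto (fun n => (stdBump E n).rOut) atTop (𝓝 0) :=
  tendsto_one_div_add_atTop_nhds_zero_nat

theorem stdBump_le (n : ℕ) : (stdBump E n).rOut ≤ 2 * (stdBump E n).rIn := by
  change 1 / ((n : ℝ) + 1) ≤ 2 * (1 / (2 * ((n : ℝ) + 1)))
  apply le_of_eq
  field_simp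

/-- The smooth approximations of a function. -/
def mollify (n : ℕ) (f : E → ℝ) : E → ℝ :=
  convolution ((stdBump E n).normed volume) f (ContinuousLinearMap.lsmul ℝ ℝ) volume

/-- The probability measure with density the `n`-th normalised bump function. -/
def bumpMeasure (E : Type*) [NormedAddCommGroup E] [NormedSpace ℝ E] [FiniteDimensional ℝ E]
    [MeasureSpace E] [BorelSpace E] [(volume : Measure E).IsAddHaarMeasure] (n : ℕ) : Measure E :=
  volume.withDensity (fun y => ENNReal.ofReal ((stdBump E n).normed volume y))

instance (n : ℕ) : IsProbabilityMeasure (bumpMeasure E n) := by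
  constructor
  rw [bumpMeasure, withDensity_apply _ MeasurableSet.univ, Measure.restrict_univ,
    ← ofReal_integral_eq_lintegral_ofReal (stdBump E n).integrable_normed
      (ae_of_all _ (stdBump E n).nonneg_normed), (stdBump E n).integral_normed, ENNReal.ofReal_one]

theorem bumpMeasure_ae_mem_ball (n : ℕ) :
    ∀ᵐ y ∂bumpMeasure E n, y ∈ Metric.ball (0 : E) (stdBump E n).rOut := by
  have hm : Measurable fun y => ENNReal.ofReal ((stdBump E n).normed volume y) :=
    ((stdBump E n).continuous_normed.measurable).ennreal_ofReal
  rw [bumpMeasure, ae_withDensity_iff hm]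
  refine ae_of_all _ fun y hy => ?_
  rw [← (stdBump E n).support_normed_eq (μ := volume)]
  intro h
  simp [h] at hy

/-- As an average of translates against a probability measure, mollification obeys Jensen's
inequality, preserves monotonicity and sees only values at distance less than one. -/
theorem mollify_eq_integral (n : ℕ) (f : E → ℝ) (z : E) :
    mollify n f z = ∫ y, f (z - y) ∂bumpMeasure E n := by
  have hm : Measurable fun y => Real.toNNReal ((stdBump E n).normed volume y) :=
    ((stdBump E n).continuous_normed.measurable).real_toNNReal
  rw [bumpMeasure]
  change _ = ∫ y, f (z - y) ∂volume.withDensity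
    (fun y => ((Real.toNNReal ((stdBump E n).normed volume y) : NNReal) : ℝ≥0∞))
  rw [integral_withDensity_eq_integral_smul hm]
  simp only [mollify, convolution, ContinuousLinearMap.lsmul_apply, NNReal.smul_def]
  congr 1 with y
  rw [Real.coe_toNNReal _ ((stdBump E n).nonneg_normed y)]

theorem mollify_congr_ae (n : ℕ) {f g : E → ℝ} (h : f =ᵐ[volume] g) : mollify n f = mollify n g := by
  ext z
  rw [mollify, mollify, convolution, convolution]
  apply integral_congr_ae
  have := (quasiMeasurePreserving_sub_left volume z).ae_eq_comp h
  filter_upwards [this] with y hy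
  simp only [Function.comp] at hy
  rw [hy]

theorem mollify_congr_of_eqOn (n : ℕ) {f g : E → ℝ} {z : E}
    (h : ∀ y ∈ Metric.ball z 1, f y = g y) : mollify n f z = mollify n g z := by
  rw [mollify_eq_integral, mollify_eq_integral]
  apply integral_congr_ae
  filter_upwards [bumpMeasure_ae_mem_ball (E := E) n] with y hy
  apply h
  rw [Metric.mem_ball, dist_eq_norm]
  have := stdBump_rOut_le_one (E := E) n
  simp at hy ⊢
  linarith

theorem mollify_contDiff (n : ℕ) {f : E → ℝ} (hf : LocallyIntegrable f volume) :
    ContDiff ℝ ∞ (mollify n f) :=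
  (stdBump E n).hasCompactSupport_normed.contDiff_convolution_left _
    (stdBump E n).contDiff_normed hf

theorem mollify_ae_tendsto {f : E → ℝ} (hf : LocallyIntegrable f volume) :
    ∀ᵐ z, Tendsto (fun n => mollify n f z) atTop (𝓝 (f z)) :=
  ContDiffBump.ae_convolution_tendsto_right_of_locallyIntegrable (K := 2)
    stdBump_tendsto (Eventually.of_forall stdBump_le) hf

/-- The reflected bump function centred at `z`. -/
def bumpAt (n : ℕ) (z : E) : E → ℝ := fun y => (stdBump E n).normed volume (z - y)

theorem bumpAt_contDiff (n : ℕ) (z : E) : ContDiff ℝ ∞ (bumpAt n z) :=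
  (stdBump E n).contDiff_normed.comp (contDiff_const.sub contDiff_id)

theorem bumpAt_hasCompactSupport (n : ℕ) (z : E) : HasCompactSupport (bumpAt n z) :=
  (stdBump E n).hasCompactSupport_normed.comp_homeomorph (Homeomorph.subLeft z)

theorem mollify_eq_integral_mul_bumpAt (n : ℕ) (f : E → ℝ) (z : E) :
    mollify n f z = ∫ y, f y * bumpAt n z y := by
  rw [mollify, convolution_eq_swap]
  congr 1 with y
  simp [bumpAt, mul_comm]

theorem fderiv_mollify_apply (n : ℕ) {f : E → ℝ} (hf : LocallyIntegrable f volume) (z d : E) :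
    fderiv ℝ (mollify n f) z d = -∫ y, f y * fderiv ℝ (bumpAt n z) y d := by
  set φ := (stdBump E n).normed (volume : Measure E) with hφ
  have hφc : HasCompactSupport φ := (stdBump E n).hasCompactSupport_normed
  have hφ1 : ContDiff ℝ 1 φ := (stdBump E n).contDiff_normed
  have h1 := (hφc.hasFDerivAt_convolution_right (ContinuousLinearMap.lsmul ℝ ℝ).flip hf hφ1 z).fderiv
  rw [mollify, ← convolution_flip, h1, convolution_precompR_apply _ hf (hφc.fderiv ℝ)
    (hφ1.continuous_fderiv one_ne_zero), ← convolution_flip, ContinuousLinearMap.flip_flip,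
    convolution_eq_swap, ← integral_neg]
  have hd : ∀ y, fderiv ℝ (bumpAt n z) y d = - fderiv ℝ φ (z - y) d := by
    intro y
    have := (hφ1.differentiable one_ne_zero (z - y)).hasFDerivAt.comp y
      ((hasFDerivAt_const z y).sub (hasFDerivAt_id y))
    have h3 : fderiv ℝ (bumpAt n z) y = _ := this.fderiv
    rw [h3]; simp
  congr 1 with y
  rw [hd]
  simp [mul_comm]

/-- The derivative falls on the bump, and the reflected bump is an admissible test function for the
weak derivative. Mollification thus turns weak derivatives into classical ones. -/
theorem mollify_fderiv (n : ℕ) {f f' : E → ℝ} {d : E} (hf : LocallyIntegrable f volume)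
    (h : ∀ ψ : E → ℝ, ContDiff ℝ ∞ ψ → HasCompactSupport ψ →
      ∫ y, f y * fderiv ℝ ψ y d = -∫ y, f' y * ψ y) (z : E) :
    fderiv ℝ (mollify n f) z d = mollify n f' z := by
  rw [fderiv_mollify_apply n hf, h _ (bumpAt_contDiff n z) (bumpAt_hasCompactSupport n z), neg_neg,
    mollify_eq_integral_mul_bumpAt]

theorem enorm_mollify_le (n : ℕ) (f : E → ℝ) (z : E) :
    ‖mollify n f z‖ₑ ≤ ∫⁻ y, ‖f (z - y)‖ₑ ∂bumpMeasure E n := by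
  rw [mollify_eq_integral]
  exact enorm_integral_le_lintegral_enorm _

/-- Jensen's inequality for the bump measure, then Tonelli and translation invariance. Both sides
may be infinite. -/
theorem eLpNorm_mollify_le (n : ℕ) {f : E → ℝ} (hf : AEStronglyMeasurable f volume) :
    eLpNorm (mollify n f) 2 volume ≤ eLpNorm f 2 volume := by
  obtain ⟨g, hg, hfg⟩ := hf
  have hgm := hg.measurable
  rw [mollify_congr_ae n hfg, eLpNorm_congr_ae hfg]
  have two : (2 : ℝ≥0∞).toReal = 2 := by norm_num
  rw [eLpNorm_eq_lintegral_rpow_enorm_toReal (by norm_num) (by norm_num),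
    eLpNorm_eq_lintegral_rpow_enorm_toReal (by norm_num) (by norm_num), two]
  gcongr ?_ ^ _
  calc ∫⁻ z, ‖mollify n g z‖ₑ ^ (2:ℝ)
      ≤ ∫⁻ z, ∫⁻ y, ‖g (z - y)‖ₑ ^ (2:ℝ) ∂bumpMeasure E n := by
        gcongr with z
        have h1 : eLpNorm (fun y => g (z - y)) 1 (bumpMeasure E n) ≤
            eLpNorm (fun y => g (z - y)) 2 (bumpMeasure E n) :=
          eLpNorm_le_eLpNorm_of_exponent_le (by norm_num)
            (hgm.comp (measurable_const.sub measurable_id)).aestronglyMeasurable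
        rw [eLpNorm_one_eq_lintegral_enorm,
          eLpNorm_eq_lintegral_rpow_enorm_toReal (by norm_num) (by norm_num), two] at h1
        calc ‖mollify n g z‖ₑ ^ (2:ℝ) ≤ (∫⁻ y, ‖g (z - y)‖ₑ ∂bumpMeasure E n) ^ (2:ℝ) := by
              gcongr; exact enorm_mollify_le n g z
          _ ≤ ((∫⁻ y, ‖g (z - y)‖ₑ ^ (2:ℝ) ∂bumpMeasure E n) ^ (1 / (2:ℝ))) ^ (2:ℝ) := by gcongr
          _ = _ := by rw [← ENNReal.rpow_mul]; norm_num
    _ = ∫⁻ y, (∫⁻ z, ‖g (z - y)‖ₑ ^ (2:ℝ)) ∂bumpMeasure E n := by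
        rw [lintegral_lintegral_swap]
        exact ((hgm.comp (measurable_fst.sub measurable_snd)).enorm.pow_const _).aemeasurable
    _ = ∫⁻ z, ‖g z‖ₑ ^ (2:ℝ) := by
        have : ∀ y, ∫⁻ z, ‖g (z - y)‖ₑ ^ (2:ℝ) = ∫⁻ z, ‖g z‖ₑ ^ (2:ℝ) := fun y =>
          lintegral_sub_right_eq_self (fun z => ‖g z‖ₑ ^ (2:ℝ)) y
        rw [lintegral_congr this, lintegral_const, measure_univ, mul_one]

theorem mollify_sub (n : ℕ) {f g : E → ℝ} (hf : LocallyIntegrable f volume)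
    (hg : LocallyIntegrable g volume) : mollify n (f - g) = mollify n f - mollify n g := by
  have h : ∀ k : E → ℝ, LocallyIntegrable k volume → ConvolutionExists
      ((stdBump E n).normed volume) k (ContinuousLinearMap.lsmul ℝ ℝ) volume := fun k hk =>
    (stdBump E n).hasCompactSupport_normed.convolutionExists_left _
      (stdBump E n).continuous_normed hk
  have hneg : f - g = f + (-1 : ℝ) • g := by ext; simp [sub_eq_add_neg]
  rw [hneg, mollify, (h f hf).distrib_add (h _ (hg.smul (-1))), convolution_smul]
  ext; simp [mollify, sub_eq_add_neg]

/-- Uniform continuity makes the convergence uniform, and all differences vanish outside one compact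
neighbourhood of the support of `g`. -/
theorem mollify_tendsto_uniform_L2 {g : E → ℝ} (hg : Continuous g) (hc : HasCompactSupport g) :
    Tendsto (fun n => eLpNorm (mollify n g - g) 2 volume) atTop (𝓝 0) := by
  set K := Metric.cthickening 1 (tsupport g) with hKdef
  have hK : IsCompact K := hc.isCompact.cthickening
  have hKm : MeasurableSet K := hK.isClosed.measurableSet
  have hsupp : ∀ n z, z ∉ K → (mollify n g - g) z = 0 := by
    intro n z hz
    have h0 : ∀ y ∈ Metric.ball z 1, g y = (0 : E → ℝ) y := by
      intro y hy
      by_contra hne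
      apply hz
      refine Metric.mem_cthickening_of_dist_le z y 1 _ (subset_tsupport g hne) ?_
      rw [dist_comm]; exact (Metric.mem_ball.1 hy).le
    have h1 := mollify_congr_of_eqOn n h0
    have h2 : mollify n (0 : E → ℝ) z = 0 := by rw [mollify_eq_integral]; simp
    simp [h1, h2, h0 z (Metric.mem_ball_self one_pos)]
  have hle : ∀ δ : ℝ, 0 < δ → ∀ᶠ n in atTop, eLpNorm (mollify n g - g) 2 volume ≤
      ENNReal.ofReal δ * volume K ^ (1 / (2 : ℝ)) := by
    intro δ hδ
    obtain ⟨η, hη, hgη⟩ := Metric.uniformContinuous_iff.1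
      (hc.uniformContinuous_of_continuous hg) δ hδ
    filter_upwards [(stdBump_tendsto (E := E)).eventually (gt_mem_nhds hη)] with n hn
    have hb : ∀ z, ‖(mollify n g - g) z‖ ≤ ‖K.indicator (fun _ => δ) z‖ := by
      intro z
      by_cases hz : z ∈ K
      · rw [indicator_of_mem hz, Real.norm_of_nonneg hδ.le, Pi.sub_apply, ← dist_eq_norm]
        refine ContDiffBump.dist_normed_convolution_le hg.aestronglyMeasurable fun y hy => ?_
        exact (hgη (lt_trans (Metric.mem_ball.1 hy) hn)).le
      · rw [hsupp n z hz]; simp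
    refine (eLpNorm_mono hb).trans ?_
    rw [eLpNorm_indicator_const hKm (by norm_num) (by norm_num)]
    simp [Real.enorm_eq_ofReal hδ.le]
  have hfin : volume K ^ (1 / (2 : ℝ)) ≠ ⊤ :=
    ENNReal.rpow_ne_top_of_nonneg (by norm_num) hK.measure_lt_top.ne
  rw [ENNReal.tendsto_nhds_zero]
  intro ε hε
  obtain ⟨δ, hδ, hδε⟩ : ∃ δ : ℝ, 0 < δ ∧
      ENNReal.ofReal δ * volume K ^ (1 / (2 : ℝ)) ≤ ε := by
    have ht : Tendsto (fun δ : ℝ => ENNReal.ofReal δ * volume K ^ (1 / (2 : ℝ))) (𝓝[>] 0)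
        (𝓝 (ENNReal.ofReal 0 * volume K ^ (1 / (2 : ℝ)))) :=
      ENNReal.Tendsto.mul_const ((ENNReal.continuous_ofReal.tendsto 0).mono_left
        nhdsWithin_le_nhds) (Or.inr hfin)
    rw [ENNReal.ofReal_zero, zero_mul] at ht
    obtain ⟨δ, h1, h2⟩ := ((ht.eventually (ge_mem_nhds hε)).and self_mem_nhdsWithin).exists
    exact ⟨δ, h2, h1⟩
  filter_upwards [hle δ hδ] with n hn using hn.trans hδε

theorem mollify_tendsto_L2 {f : E → ℝ} (hf : MemLp f 2 volume) :
    Tendsto (fun n => eLpNorm (mollify n f - f) 2 volume) atTop (𝓝 0) := by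
  rw [ENNReal.tendsto_nhds_zero]
  intro ε hε
  obtain ⟨g, hgc, hgε, hgcont, hg2⟩ := hf.exists_hasCompactSupport_eLpNorm_sub_le (by norm_num)
    (ENNReal.div_pos hε.ne' (by norm_num : (3 : ℝ≥0∞) ≠ ⊤)).ne'
  have hfl := hf.locallyIntegrable (by norm_num)
  have hgl := hg2.locallyIntegrable (by norm_num)
  filter_upwards [(ENNReal.tendsto_nhds_zero.1 (mollify_tendsto_uniform_L2 hgcont hgc)) (ε / 3)
    (ENNReal.div_pos hε.ne' (by norm_num))] with n hn
  have hdec : mollify n f - f = (mollify n (f - g) + (mollify n g - g)) + (g - f) := by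
    rw [mollify_sub n hfl hgl]; abel
  have m1 : AEStronglyMeasurable (mollify n (f - g)) volume :=
    (mollify_contDiff n (hfl.sub hgl)).continuous.aestronglyMeasurable
  have m2 : AEStronglyMeasurable (mollify n g - g) volume :=
    ((mollify_contDiff n hgl).continuous.sub hgcont).aestronglyMeasurable
  have m3 : AEStronglyMeasurable (g - f) volume := (hg2.1.sub hf.1)
  rw [hdec]
  calc _ ≤ eLpNorm (mollify n (f - g)) 2 volume + eLpNorm (mollify n g - g) 2 volume +
        eLpNorm (g - f) 2 volume :=
        (eLpNorm_add_le (m1.add m2) m3 (by norm_num)).trans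
          (add_le_add_left (eLpNorm_add_le m1 m2 (by norm_num)) _)
    _ ≤ ε / 3 + ε / 3 + ε / 3 := by
        gcongr
        · exact (eLpNorm_mollify_le n (hf.1.sub hg2.1)).trans hgε
        · rw [eLpNorm_sub_comm]; exact hgε
    _ = ε := ENNReal.add_thirds ε

/-- Local square integrability. -/
def LocL2 (f : E → ℝ) : Prop := ∀ K : Set E, IsCompact K → MemLp f 2 (volume.restrict K)

theorem LocL2.locallyIntegrable {f : E → ℝ} (hf : LocL2 f) : LocallyIntegrable f volume := by
  rw [locallyIntegrable_iff]
  intro K hK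
  have : IsFiniteMeasure ((volume : Measure E).restrict K) := ⟨by simpa using hK.measure_lt_top⟩
  exact (hf K hK).integrable (by norm_num)

theorem _root_.Continuous.locL2 {f : E → ℝ} (hf : Continuous f) : LocL2 f := fun K hK => by
  have : IsFiniteMeasure ((volume : Measure E).restrict K) := ⟨by simpa using hK.measure_lt_top⟩
  obtain ⟨C, hC⟩ := hK.exists_bound_of_continuousOn hf.continuousOn
  exact MemLp.of_bound hf.aestronglyMeasurable C (ae_restrict_of_forall_mem
    hK.isClosed.measurableSet hC)

/-- All bump radii are at most 1, so on `K` only the values of `f` on the closed 1-thickening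
matter; cutting `f` off there reduces to the global statement. -/
theorem LocL2.mollify_tendsto {f : E → ℝ} (hf : LocL2 f) {K : Set E} (hK : IsCompact K) :
    Tendsto (fun n => eLpNorm (mollify n f - f) 2 (volume.restrict K)) atTop (𝓝 0) := by
  set K' := Metric.cthickening 1 K with hK'def
  have hK' : IsCompact K' := hK.cthickening
  have hm : MeasurableSet K' := hK'.isClosed.measurableSet
  have h2 : MemLp (K'.indicator f) 2 volume := (memLp_indicator_iff_restrict hm).2 (hf K' hK')
  refine tendsto_of_tendsto_of_tendsto_of_le_of_le tendsto_const_nhds (mollify_tendsto_L2 h2)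
    (fun _ => zero_le) (fun n => ?_)
  have heq : ∀ z ∈ K, (mollify n f - f) z = (mollify n (K'.indicator f) - K'.indicator f) z := by
    intro z hz
    have hb : ∀ y ∈ Metric.ball z 1, f y = K'.indicator f y := fun y hy => by
      rw [indicator_of_mem]
      exact Metric.mem_cthickening_of_dist_le y z 1 _ hz (Metric.mem_ball.1 hy).le
    simp [mollify_congr_of_eqOn n hb, ← hb z (Metric.mem_ball_self one_pos)]
  rw [eLpNorm_congr_ae (ae_restrict_of_forall_mem hK.isClosed.measurableSet heq)]
  exact eLpNorm_mono_measure _ Measure.restrict_le_self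

theorem tendsto_integral_mul_mul_of_L2 {α : Type*} [MeasurableSpace α] {ν : Measure α}
    {v w c : α → ℝ} {vn wn : ℕ → α → ℝ} {C : ℝ} (hv : MemLp v 2 ν) (hw : MemLp w 2 ν)
    (hvn : ∀ n, MemLp (vn n) 2 ν) (hwn : ∀ n, MemLp (wn n) 2 ν)
    (hcm : AEStronglyMeasurable c ν) (hc : ∀ x, ‖c x‖ ≤ C)
    (hv0 : Tendsto (fun n => eLpNorm (vn n - v) 2 ν) atTop (𝓝 0))
    (hw0 : Tendsto (fun n => eLpNorm (wn n - w) 2 ν) atTop (𝓝 0)) :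
    Tendsto (fun n => ∫ x, c x * vn n x * wn n x ∂ν) atTop (𝓝 (∫ x, c x * v x * w x ∂ν)) := by
  have hint : ∀ a b : α → ℝ, MemLp a 2 ν → MemLp b 2 ν → Integrable (fun x => c x * a x * b x) ν := by
    intro a b ha hb
    have h := (ha.integrable_mul hb).bdd_mul hcm (ae_of_all _ hc)
    refine h.congr (ae_of_all _ fun x => ?_)
    simp [mul_assoc]
  have hmulle : ∀ a b : α → ℝ, MemLp a 2 ν → MemLp b 2 ν →
      eLpNorm (fun x => c x * a x * b x) 1 ν ≤
        ENNReal.ofReal C * (eLpNorm a 2 ν * eLpNorm b 2 ν) := by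
    intro a b ha hb
    have h1 : eLpNorm (fun x => c x * a x * b x) 1 ν ≤ ENNReal.ofReal C * eLpNorm (a • b) 1 ν := by
      apply eLpNorm_le_mul_eLpNorm_of_ae_le_mul
      refine ae_of_all _ fun x => ?_
      rw [mul_assoc, norm_mul]
      exact mul_le_mul_of_nonneg_right (hc x) (norm_nonneg _)
    refine h1.trans ?_
    gcongr
    exact eLpNorm_smul_le_mul_eLpNorm hb.1 ha.1
  refine tendsto_integral_of_L1' _ (hint v w hv hw).1 (Eventually.of_forall fun n =>
    hint _ _ (hvn n) (hwn n)) ?_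
  have hbound : ∀ n, eLpNorm ((fun x => c x * vn n x * wn n x) - fun x => c x * v x * w x) 1 ν ≤
      ENNReal.ofReal C * (eLpNorm (vn n - v) 2 ν * (eLpNorm (wn n - w) 2 ν + eLpNorm w 2 ν)) +
      ENNReal.ofReal C * (eLpNorm v 2 ν * eLpNorm (wn n - w) 2 ν) := by
    intro n
    have e : ((fun x => c x * vn n x * wn n x) - fun x => c x * v x * w x) =
        (fun x => c x * (vn n - v) x * (wn n) x) + (fun x => c x * v x * (wn n - w) x) := by
      ext x; simp; ring
    rw [e]
    refine (eLpNorm_add_le (hint _ _ ((hvn n).sub hv) (hwn n)).1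
      (hint _ _ hv ((hwn n).sub hw)).1 le_rfl).trans ?_
    refine add_le_add ((hmulle _ _ ((hvn n).sub hv) (hwn n)).trans ?_)
      (hmulle _ _ hv ((hwn n).sub hw))
    gcongr
    calc eLpNorm (wn n) 2 ν = eLpNorm ((wn n - w) + w) 2 ν := by simp
      _ ≤ _ := eLpNorm_add_le ((hwn n).1.sub hw.1) hw.1 (by norm_num)
  refine tendsto_of_tendsto_of_tendsto_of_le_of_le tendsto_const_nhds ?_ (fun _ => zero_le) hbound
  have hC : ENNReal.ofReal C ≠ ⊤ := ENNReal.ofReal_ne_top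
  have t1 := ENNReal.Tendsto.const_mul (a := ENNReal.ofReal C)
    (ENNReal.Tendsto.mul hv0 (Or.inr (by simpa using hw.2.ne)) (hw0.add_const (eLpNorm w 2 ν))
      (Or.inr (by simp))) (Or.inr hC)
  have t2 := ENNReal.Tendsto.const_mul (a := ENNReal.ofReal C)
    (ENNReal.Tendsto.const_mul (a := eLpNorm v 2 ν) hw0 (Or.inr hv.2.ne)) (Or.inr hC)
  simpa using t1.add t2

theorem tendsto_integral_mollify_mul {v w c : E → ℝ} (hv : LocL2 v) (hw : LocL2 w)
    (hc : Continuous c) (hcs : HasCompactSupport c) :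
    Tendsto (fun n => ∫ z, c z * mollify n v z * mollify n w z) atTop
      (𝓝 (∫ z, c z * v z * w z)) := by
  set K := tsupport c with hKdef
  have hK : IsCompact K := hcs.isCompact
  obtain ⟨C, hC⟩ := hcs.exists_bound_of_continuous hc
  have hred : ∀ a b : E → ℝ, ∫ z, c z * a z * b z = ∫ z in K, c z * a z * b z := by
    intro a b
    rw [setIntegral_eq_integral_of_forall_compl_eq_zero]
    intro z hz
    rw [image_eq_zero_of_notMem_tsupport hz]; ring
  rw [hred]
  simp only [hred]
  have hsm : ∀ k : E → ℝ, LocL2 k → ∀ n, MemLp (mollify n k) 2 (volume.restrict K) :=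
    fun k hk n => (mollify_contDiff n hk.locallyIntegrable).continuous.locL2 K hK
  exact tendsto_integral_mul_mul_of_L2 (hv K hK) (hw K hK) (hsm v hv) (hsm w hw)
    hc.aestronglyMeasurable hC (hv.mollify_tendsto hK) (hw.mollify_tendsto hK)

end Mollify

/-! ### The pairing of L¹L² with L^∞L² under mollification. -/

instance : (volume : Measure (ℝ × E3)).IsAddHaarMeasure :=
  inferInstanceAs (((volume : Measure ℝ).prod (volume : Measure E3)).IsAddHaarMeasure)

/-- The norm of `L¹(ℝ; L²(ℝ³))`. -/
def normL1L2 (A : ℝ × E3 → ℝ≥0∞) : ℝ≥0∞ := ∫⁻ t, (∫⁻ x, A (t, x) ^ (2 : ℝ)) ^ (1 / 2 : ℝ)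

/-- Cauchy–Schwarz in x, then the supremum in t. The two factors may be shifted differently because
both mixed norms are translation invariant; mollifying both factors requires this. -/
theorem lintegral_mul_le_normL1L2 {A B : ℝ × E3 → ℝ≥0∞} (hA : Measurable A) (hB : Measurable B)
    {C : ℝ≥0∞} (hC : ∀ᵐ t : ℝ, (∫⁻ x, B (t, x) ^ (2 : ℝ)) ^ (1 / 2 : ℝ) ≤ C) (y y' : ℝ × E3) :
    ∫⁻ z, A (z - y) * B (z - y') ≤ normL1L2 A * C := by
  have hmA : Measurable fun z : ℝ × E3 => A (z - y) := hA.comp (measurable_id.sub_const y)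
  have hmB : Measurable fun z : ℝ × E3 => B (z - y') := hB.comp (measurable_id.sub_const y')
  have hmn : Measurable fun t : ℝ => (∫⁻ x, A (t, x) ^ (2 : ℝ)) ^ (1 / 2 : ℝ) :=
    (Measurable.lintegral_prod_right' (hA.pow_const 2)).pow_const _
  rw [Measure.volume_eq_prod, lintegral_prod (fun z => A (z - y) * B (z - y')) (hmA.mul hmB).aemeasurable]
  have hshift : ∀ᵐ t : ℝ, (∫⁻ x, B (t - y'.1, x) ^ (2 : ℝ)) ^ (1 / 2 : ℝ) ≤ C :=
    (measurePreserving_sub_right volume y'.1).quasiMeasurePreserving.ae hC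
  calc ∫⁻ t : ℝ, ∫⁻ x : E3, A ((t, x) - y) * B ((t, x) - y')
      ≤ ∫⁻ t : ℝ, (∫⁻ x, A (t - y.1, x) ^ (2 : ℝ)) ^ (1 / 2 : ℝ) * C := by
        apply lintegral_mono_ae
        filter_upwards [hshift] with t ht
        have h1 := ENNReal.lintegral_mul_le_Lp_mul_Lq (volume : Measure E3)
          (Real.HolderConjugate.two_two)
          (f := fun x => A (t - y.1, x - y.2)) (g := fun x => B (t - y'.1, x - y'.2))
          (hmA.comp measurable_prodMk_left).aemeasurable
          (hmB.comp measurable_prodMk_left).aemeasurable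
        refine h1.trans ?_
        rw [lintegral_sub_right_eq_self (fun x => A (t - y.1, x) ^ (2 : ℝ)) y.2,
          lintegral_sub_right_eq_self (fun x => B (t - y'.1, x) ^ (2 : ℝ)) y'.2]
        gcongr
    _ = normL1L2 A * C := by
        rw [lintegral_mul_const (f := fun t : ℝ => (∫⁻ x, A (t - y.1, x) ^ (2 : ℝ)) ^ (1 / 2 : ℝ)) C
            (hmn.comp (measurable_id.sub_const y.1)),
          lintegral_sub_right_eq_self
            (fun t : ℝ => (∫⁻ x, A (t, x) ^ (2 : ℝ)) ^ (1 / 2 : ℝ)) y.1, normL1L2]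

/-- Both mollifications are averages of translates, so the bound for arbitrary shifts survives
averaging. The point is uniformity in `n`. -/
theorem lintegral_mollify_mul_le (n : ℕ) {f g : ℝ × E3 → ℝ} (hf : Measurable f) (hg : Measurable g)
    {C : ℝ≥0∞} (hC : ∀ᵐ t : ℝ, (∫⁻ x, ‖g (t, x)‖ₑ ^ (2 : ℝ)) ^ (1 / 2 : ℝ) ≤ C) :
    ∫⁻ z, ‖mollify n f z‖ₑ * ‖mollify n g z‖ₑ ≤ normL1L2 (fun z => ‖f z‖ₑ) * C := by
  set ν := bumpMeasure (ℝ × E3) n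
  have hfe : Measurable fun q : (ℝ × E3) × (ℝ × E3) => ‖f (q.1 - q.2)‖ₑ :=
    (hf.comp (measurable_fst.sub measurable_snd)).enorm
  have hge : Measurable fun q : (ℝ × E3) × (ℝ × E3) => ‖g (q.1 - q.2)‖ₑ :=
    (hg.comp (measurable_fst.sub measurable_snd)).enorm
  have hgi : Measurable fun z : ℝ × E3 => ∫⁻ y', ‖g (z - y')‖ₑ ∂ν := hge.lintegral_prod_right'
  calc ∫⁻ z, ‖mollify n f z‖ₑ * ‖mollify n g z‖ₑ
      ≤ ∫⁻ z, (∫⁻ y, ‖f (z - y)‖ₑ ∂ν) * (∫⁻ y', ‖g (z - y')‖ₑ ∂ν) := by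
        gcongr with z
        · exact enorm_mollify_le n f z
        · exact enorm_mollify_le n g z
    _ = ∫⁻ z, ∫⁻ y, ‖f (z - y)‖ₑ * (∫⁻ y', ‖g (z - y')‖ₑ ∂ν) ∂ν := by
        congr 1 with z
        rw [lintegral_mul_const]
        exact hfe.comp measurable_prodMk_left
    _ = ∫⁻ y, (∫⁻ z, ‖f (z - y)‖ₑ * (∫⁻ y', ‖g (z - y')‖ₑ ∂ν)) ∂ν := by
        rw [lintegral_lintegral_swap]
        exact (hfe.mul (hgi.comp measurable_fst)).aemeasurable
    _ ≤ ∫⁻ y, normL1L2 (fun z => ‖f z‖ₑ) * C ∂ν := by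
        gcongr with y
        calc ∫⁻ z, ‖f (z - y)‖ₑ * (∫⁻ y', ‖g (z - y')‖ₑ ∂ν)
            = ∫⁻ z, ∫⁻ y', ‖f (z - y)‖ₑ * ‖g (z - y')‖ₑ ∂ν := by
              congr 1 with z
              rw [lintegral_const_mul]
              exact hge.comp measurable_prodMk_left
          _ = ∫⁻ y', (∫⁻ z, ‖f (z - y)‖ₑ * ‖g (z - y')‖ₑ) ∂ν := by
              rw [lintegral_lintegral_swap]
              exact ((hf.comp (measurable_fst.sub measurable_const)).enorm.mul hge).aemeasurable
          _ ≤ ∫⁻ y', normL1L2 (fun z => ‖f z‖ₑ) * C ∂ν := by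
              gcongr with y'
              exact lintegral_mul_le_normL1L2 hf.enorm hg.enorm hC y y'
          _ = _ := by rw [lintegral_const, measure_univ, mul_one]
    _ = _ := by rw [lintegral_const, measure_univ, mul_one]

theorem lintegral_mul_le_normL1L2' {f g : ℝ × E3 → ℝ} (hf : Measurable f) (hg : Measurable g)
    {C : ℝ≥0∞} (hC : ∀ᵐ t : ℝ, (∫⁻ x, ‖g (t, x)‖ₑ ^ (2 : ℝ)) ^ (1 / 2 : ℝ) ≤ C) :
    ∫⁻ z, ‖f z‖ₑ * ‖g z‖ₑ ≤ normL1L2 (fun z => ‖f z‖ₑ) * C := by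
  simpa using lintegral_mul_le_normL1L2 hf.enorm hg.enorm hC 0 0

/-- Dominated convergence is used twice, in x for almost every t and then in t. -/
theorem tendsto_normL1L2_tail {f : ℝ × E3 → ℝ} (hf : Measurable f)
    (hfin : normL1L2 (fun z => ‖f z‖ₑ) ≠ ⊤) :
    Tendsto (fun N : ℕ => normL1L2 fun z => ‖f z - {z | |f z| ≤ N}.indicator f z‖ₑ) atTop
      (𝓝 0) := by
  have hle : ∀ (N : ℕ) z, ‖f z - {z | |f z| ≤ N}.indicator f z‖ₑ ≤ ‖f z‖ₑ := by
    intro N z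
    by_cases hz : z ∈ {z | |f z| ≤ N}
    · simp [indicator_of_mem hz]
    · simp [indicator_of_notMem hz]
  have hlim : ∀ z, ∀ᶠ N : ℕ in atTop, ‖f z - {z | |f z| ≤ N}.indicator f z‖ₑ = 0 := by
    intro z
    filter_upwards [eventually_ge_atTop (Nat.ceil |f z|)] with N hN
    have : z ∈ {z | |f z| ≤ N} := (Nat.le_ceil |f z|).trans (by exact_mod_cast hN)
    simp [indicator_of_mem this]
  have hmset : ∀ N : ℕ, MeasurableSet {z | |f z| ≤ N} := fun N =>
    measurableSet_le hf.abs measurable_const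
  have hm : ∀ N : ℕ, Measurable fun z => ‖f z - {z | |f z| ≤ N}.indicator f z‖ₑ ^ (2 : ℝ) := fun N =>
    ((hf.sub (hf.indicator (hmset N))).enorm).pow_const _
  have hmf : Measurable fun t : ℝ => (∫⁻ x, ‖f (t, x)‖ₑ ^ (2 : ℝ)) ^ (1 / 2 : ℝ) :=
    (Measurable.lintegral_prod_right' (hf.enorm.pow_const 2)).pow_const _
  have h0 : (0 : ℝ≥0∞) = ∫⁻ _ : ℝ, 0 := by simp
  rw [h0]
  refine tendsto_lintegral_of_dominated_convergence
    (fun t => (∫⁻ x, ‖f (t, x)‖ₑ ^ (2 : ℝ)) ^ (1 / 2 : ℝ))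
    (fun N => (Measurable.lintegral_prod_right' (hm N)).pow_const _)
    (fun N => ae_of_all _ fun t => ?_) hfin ?_
  · exact ENNReal.rpow_le_rpow (lintegral_mono fun x =>
      ENNReal.rpow_le_rpow (hle N (t, x)) (by norm_num)) (by norm_num)
  · filter_upwards [ae_lt_top hmf hfin] with t ht
    have ht' : ∫⁻ x, ‖f (t, x)‖ₑ ^ (2 : ℝ) ≠ ⊤ := by
      intro h
      rw [h, ENNReal.top_rpow_of_pos (by norm_num)] at ht
      exact lt_irrefl _ ht
    have h1 : Tendsto (fun N : ℕ => ∫⁻ x, ‖f (t, x) - {z | |f z| ≤ N}.indicator f (t, x)‖ₑ ^ (2 : ℝ))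
        atTop (𝓝 (∫⁻ _ : E3, 0)) := by
      refine tendsto_lintegral_of_dominated_convergence (fun x => ‖f (t, x)‖ₑ ^ (2 : ℝ))
        (fun N => (hm N).comp measurable_prodMk_left) (fun N => ae_of_all _ fun x => ?_) ht'
        (ae_of_all _ fun x => ?_)
      · exact ENNReal.rpow_le_rpow (hle N (t, x)) (by norm_num)
      · refine tendsto_const_nhds.congr' ?_
        filter_upwards [hlim (t, x)] with N hN
        rw [hN]; simp
    have h2 := ((ENNReal.continuous_rpow_const (y := (1 / 2 : ℝ))).tendsto _).comp h1
    simpa [Function.comp_def] using h2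

/-- Here `f` need not be locally square integrable. Its truncations at height N are, and they fall
under the L² convergence theorem; the truncation error is small uniformly in `n` by
`lintegral_mollify_mul_le`. -/
theorem tendsto_integral_mollify_mul_of_normL1L2 {f w c : ℝ × E3 → ℝ} (hf : Measurable f)
    (hw : Measurable w) (hfin : normL1L2 (fun z => ‖f z‖ₑ) ≠ ⊤) (hfl : LocallyIntegrable f volume)
    (hw2 : LocL2 w) {C : ℝ≥0∞} (hCt : C ≠ ⊤)
    (hC : ∀ᵐ t : ℝ, (∫⁻ x, ‖w (t, x)‖ₑ ^ (2 : ℝ)) ^ (1 / 2 : ℝ) ≤ C)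
    (hc : Continuous c) (hcs : HasCompactSupport c) :
    Integrable (fun z => c z * f z * w z) ∧
    Tendsto (fun n => ∫ z, c z * mollify n f z * mollify n w z) atTop
      (𝓝 (∫ z, c z * f z * w z)) := by
  obtain ⟨M, hM⟩ := hcs.exists_bound_of_continuous hc
  have hM0 : 0 ≤ M := (norm_nonneg _).trans (hM 0)
  have hcw : ∀ a b : ℝ × E3 → ℝ, ∫⁻ z, ‖c z * a z * b z‖ₑ ≤
      ENNReal.ofReal M * ∫⁻ z, ‖a z‖ₑ * ‖b z‖ₑ := by
    intro a b
    rw [← lintegral_const_mul' _ _ ENNReal.ofReal_ne_top]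
    gcongr with z
    rw [enorm_mul, enorm_mul, mul_assoc]
    gcongr
    rw [Real.enorm_eq_ofReal_abs]
    exact ENNReal.ofReal_le_ofReal (hM z)
  have hint : ∀ g : ℝ × E3 → ℝ, Measurable g → normL1L2 (fun z => ‖g z‖ₑ) ≠ ⊤ →
      Integrable (fun z => c z * g z * w z) := by
    intro g hg hgf
    refine ⟨((hc.measurable.mul hg).mul hw).aestronglyMeasurable, ?_⟩
    refine ((hcw g w).trans (mul_le_mul_right (lintegral_mul_le_normL1L2' hg hw hC) _)).trans_lt ?_
    exact ENNReal.mul_lt_top ENNReal.ofReal_lt_top (ENNReal.mul_lt_top hgf.lt_top hCt.lt_top)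
  refine ⟨hint f hf hfin, ?_⟩
  set fN : ℕ → ℝ × E3 → ℝ := fun N => {z | |f z| ≤ N}.indicator f with hfN
  have hmset : ∀ N : ℕ, MeasurableSet {z | |f z| ≤ N} := fun N =>
    measurableSet_le hf.abs measurable_const
  have hfNm : ∀ N, Measurable (fN N) := fun N => hf.indicator (hmset N)
  have hfN2 : ∀ N, LocL2 (fN N) := by
    intro N K' hK'
    have : IsFiniteMeasure ((volume : Measure (ℝ × E3)).restrict K') :=
      ⟨by simpa using hK'.measure_lt_top⟩
    refine MemLp.of_bound (hfNm N).aestronglyMeasurable N (ae_of_all _ fun z => ?_)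
    by_cases hz : z ∈ {z | |f z| ≤ N}
    · have hz' : |f z| ≤ N := hz
      rw [hfN]; simpa only [indicator_of_mem hz, Real.norm_eq_abs] using hz'
    · rw [hfN]; simp only [indicator_of_notMem hz]; simp
  have hfNfin : ∀ N, normL1L2 (fun z => ‖fN N z‖ₑ) ≠ ⊤ := by
    intro N
    refine ne_top_of_le_ne_top hfin (lintegral_mono fun t => ENNReal.rpow_le_rpow
      (lintegral_mono fun x => ENNReal.rpow_le_rpow ?_ (by norm_num)) (by norm_num))
    exact enorm_indicator_le_enorm_self _ _
  set δ : ℕ → ℝ≥0∞ := fun N => normL1L2 fun z => ‖f z - fN N z‖ₑ with hδ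
  have hδ0 : Tendsto δ atTop (𝓝 0) := tendsto_normL1L2_tail hf hfin
  have hsmooth : ∀ k : ℝ × E3 → ℝ, LocallyIntegrable k volume → ∀ n, Continuous (mollify n k) :=
    fun k hk n => (mollify_contDiff n hk).continuous
  have hwl := hw2.locallyIntegrable
  have hcint : ∀ k, LocallyIntegrable k volume → ∀ n,
      Integrable (fun z => c z * mollify n k z * mollify n w z) := by
    intro k hk n
    refine ((hc.mul (hsmooth k hk n)).mul (hsmooth w hwl n)).integrable_of_hasCompactSupport ?_
    exact (hcs.mul_right (f' := mollify n k)).mul_right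
  have hest1 : ∀ N n, ENNReal.ofReal |∫ z, c z * mollify n f z * mollify n w z -
      c z * mollify n (fN N) z * mollify n w z| ≤ ENNReal.ofReal M * (δ N * C) := by
    intro N n
    have e : ∀ z, c z * mollify n f z * mollify n w z - c z * mollify n (fN N) z * mollify n w z =
        c z * mollify n (f - fN N) z * mollify n w z := by
      intro z
      rw [mollify_sub n hfl (hfN2 N).locallyIntegrable, Pi.sub_apply]; ring
    simp only [e]
    rw [← Real.enorm_eq_ofReal_abs]
    refine (enorm_integral_le_lintegral_enorm _).trans ((hcw _ _).trans (mul_le_mul_right ?_ _))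
    exact lintegral_mollify_mul_le n (hf.sub (hfNm N)) hw hC
  have hest2 : ∀ N, ENNReal.ofReal |∫ z, c z * f z * w z - c z * fN N z * w z| ≤
      ENNReal.ofReal M * (δ N * C) := by
    intro N
    have e : ∀ z, c z * f z * w z - c z * fN N z * w z = c z * (f - fN N) z * w z := by
      intro z; rw [Pi.sub_apply]; ring
    simp only [e]
    rw [← Real.enorm_eq_ofReal_abs]
    refine (enorm_integral_le_lintegral_enorm _).trans ((hcw _ _).trans (mul_le_mul_right ?_ _))
    exact lintegral_mul_le_normL1L2' (hf.sub (hfNm N)) hw hC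
  have hsmall : Tendsto (fun N => ENNReal.ofReal M * (δ N * C)) atTop (𝓝 0) := by
    simpa using ENNReal.Tendsto.const_mul (a := ENNReal.ofReal M)
      (ENNReal.Tendsto.mul_const hδ0 (Or.inr hCt)) (Or.inr ENNReal.ofReal_ne_top)
  rw [Metric.tendsto_atTop]
  intro ε hε
  obtain ⟨N, hN⟩ := (hsmall.eventually (gt_mem_nhds (ENNReal.ofReal_pos.2
    (by positivity : (0 : ℝ) < ε / 3)))).exists
  obtain ⟨n₀, hn₀⟩ := Metric.tendsto_atTop.1 (tendsto_integral_mollify_mul (hfN2 N) hw2 hc hcs)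
    (ε / 3) (by positivity)
  refine ⟨n₀, fun n hn => ?_⟩
  have h1 := (ENNReal.ofReal_lt_ofReal_iff (by positivity)).1 ((hest1 N n).trans_lt hN)
  have h2 := (ENNReal.ofReal_lt_ofReal_iff (by positivity)).1 ((hest2 N).trans_lt hN)
  have h3 := hn₀ n hn
  rw [integral_sub (hcint f hfl n) (hcint _ (hfN2 N).locallyIntegrable n)] at h1
  rw [integral_sub (hint f hf hfin) (hint _ (hfNm N) (hfNfin N))] at h2
  rw [Real.dist_eq] at h3 ⊢
  rw [abs_lt] at *
  constructor <;> linarith [h1.1, h1.2, h2.1, h2.2, h3.1, h3.2]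

/-- The box `[-R, R] × B̄(0, R)` in space-time. -/
def spaceTimeBox (R : ℝ) : Set (ℝ × E3) := Icc (-R) R ×ˢ Metric.closedBall 0 R

theorem isCompact_spaceTimeBox (R : ℝ) : IsCompact (spaceTimeBox R) :=
  isCompact_Icc.prod (isCompact_closedBall 0 R)

theorem measurableSet_spaceTimeBox (R : ℝ) : MeasurableSet (spaceTimeBox R) :=
  (isCompact_spaceTimeBox R).isClosed.measurableSet

theorem exists_subset_spaceTimeBox {K : Set (ℝ × E3)} (hK : IsCompact K) :
    ∃ R, 0 < R ∧ K ⊆ spaceTimeBox R := by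
  obtain ⟨R, hR0, hR⟩ := hK.isBounded.subset_closedBall_lt 0 0
  refine ⟨R, hR0, fun z hz => ?_⟩
  have h := hR hz
  rw [Metric.mem_closedBall, Prod.dist_eq, max_le_iff] at h
  refine ⟨?_, by simpa using h.2⟩
  have h1 : |z.1| ≤ R := by simpa using h.1
  exact abs_le.1 h1

/-- Functions in `L¹_loc(ℝ; L²_loc(ℝ³))`. -/
def LocL1L2 (f : ℝ × E3 → ℝ) : Prop :=
  AEStronglyMeasurable f volume ∧
    ∀ R : ℝ, normL1L2 ((spaceTimeBox R).indicator fun z => ‖f z‖ₑ) ≠ ⊤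

/-- Functions in `L^∞_loc(ℝ; L²_loc(ℝ³))`. -/
def LocLinftyL2 (f : ℝ × E3 → ℝ) : Prop :=
  AEStronglyMeasurable f volume ∧ ∀ R : ℝ, ∃ C : ℝ≥0∞, C ≠ ⊤ ∧
    ∀ᵐ t : ℝ, (∫⁻ x, (spaceTimeBox R).indicator (fun z => ‖f z‖ₑ) (t, x) ^ (2 : ℝ)) ^ (1 / 2 : ℝ)
      ≤ C

theorem normL1L2_congr_ae {A B : ℝ × E3 → ℝ≥0∞} (h : A =ᵐ[volume] B) : normL1L2 A = normL1L2 B := by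
  have h' := Measure.ae_ae_of_ae_prod h
  apply lintegral_congr_ae
  filter_upwards [h'] with t ht
  congr 1
  apply lintegral_congr_ae
  filter_upwards [ht] with x hx
  rw [hx]

/-- Pair `f` with the indicator of the box, which is bounded in L^∞L². -/
theorem LocL1L2.locallyIntegrable {f : ℝ × E3 → ℝ} (hf : LocL1L2 f) :
    LocallyIntegrable f volume := by
  rw [locallyIntegrable_iff]
  intro K hK
  obtain ⟨R, hR0, hR⟩ := exists_subset_spaceTimeBox hK
  refine IntegrableOn.mono_set ?_ hR
  refine ⟨hf.1.restrict, ?_⟩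
  obtain ⟨g, hg, hfg⟩ := hf.1
  have hBm := measurableSet_spaceTimeBox R
  set B := spaceTimeBox R with hB
  have hC : ∀ᵐ t : ℝ, (∫⁻ x, ‖B.indicator (fun _ => (1 : ℝ)) (t, x)‖ₑ ^ (2 : ℝ)) ^ (1 / 2 : ℝ) ≤
      volume (Metric.closedBall (0 : E3) R) ^ (1 / 2 : ℝ) := by
    refine ae_of_all _ fun t => ENNReal.rpow_le_rpow ?_ (by norm_num)
    rw [← lintegral_indicator_one Metric.isClosed_closedBall.measurableSet]
    gcongr with x
    by_cases h : (t, x) ∈ B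
    · rw [indicator_of_mem h, indicator_of_mem h.2]; simp
    · rw [indicator_of_notMem h]; simp
  have h1 := lintegral_mul_le_normL1L2' (f := B.indicator g) (hg.measurable.indicator hBm)
    (measurable_const.indicator hBm) hC
  have h2 : normL1L2 (fun z => ‖B.indicator g z‖ₑ) = normL1L2 (B.indicator fun z => ‖f z‖ₑ) := by
    apply normL1L2_congr_ae
    filter_upwards [hfg] with z hz
    by_cases h : z ∈ B
    · simp [indicator_of_mem h, hz]
    · simp [indicator_of_notMem h]
  have h3 : ∫⁻ z, ‖B.indicator g z‖ₑ * ‖B.indicator (fun _ => (1 : ℝ)) z‖ₑ =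
      ∫⁻ z in B, ‖f z‖ₑ := by
    rw [← lintegral_indicator hBm]
    apply lintegral_congr_ae
    filter_upwards [hfg] with z hz
    by_cases h : z ∈ B
    · simp [indicator_of_mem h, hz]
    · simp [indicator_of_notMem h]
  rw [HasFiniteIntegral, ← h3]
  refine h1.trans_lt (ENNReal.mul_lt_top (by rw [h2]; exact (hf.2 R).lt_top) ?_)
  exact ENNReal.rpow_lt_top_of_nonneg (by norm_num) (isCompact_closedBall 0 R).measure_lt_top.ne

theorem LocLinftyL2.locL2 {f : ℝ × E3 → ℝ} (hf : LocLinftyL2 f) : LocL2 f := by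
  intro K hK
  obtain ⟨R, hR0, hR⟩ := exists_subset_spaceTimeBox hK
  refine MemLp.mono_measure (Measure.restrict_mono hR le_rfl) ?_
  obtain ⟨C, hCt, hC⟩ := hf.2 R
  have hBm := measurableSet_spaceTimeBox R
  set B := spaceTimeBox R with hB
  refine ⟨hf.1.restrict, ?_⟩
  rw [eLpNorm_eq_lintegral_rpow_enorm_toReal (by norm_num) (by norm_num)]
  refine ENNReal.rpow_lt_top_of_nonneg (by positivity) (ne_of_lt ?_)
  have two : (2 : ℝ≥0∞).toReal = 2 := by norm_num
  rw [two, ← lintegral_indicator hBm, Measure.volume_eq_prod, lintegral_prod]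
  swap
  · exact ((hf.1.enorm.pow_const 2).indicator hBm)
  calc ∫⁻ t : ℝ, ∫⁻ x : E3, B.indicator (fun z => ‖f z‖ₑ ^ (2 : ℝ)) (t, x)
      ≤ ∫⁻ t : ℝ, (Icc (-R) R).indicator (fun _ => C ^ (2 : ℝ)) t := by
        apply lintegral_mono_ae
        filter_upwards [hC] with t ht
        have e : ∀ x, B.indicator (fun z => ‖f z‖ₑ ^ (2 : ℝ)) (t, x) =
            B.indicator (fun z => ‖f z‖ₑ) (t, x) ^ (2 : ℝ) := by
          intro x
          by_cases h : (t, x) ∈ B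
          · simp [indicator_of_mem h]
          · simp [indicator_of_notMem h]
        by_cases htR : t ∈ Icc (-R) R
        · rw [indicator_of_mem htR]
          simp only [e]
          have := ENNReal.rpow_le_rpow ht (by norm_num : (0 : ℝ) ≤ 2)
          rwa [← ENNReal.rpow_mul, one_div, inv_mul_cancel₀ two_ne_zero, ENNReal.rpow_one] at this
        · rw [indicator_of_notMem htR]
          have : ∀ x, B.indicator (fun z => ‖f z‖ₑ ^ (2 : ℝ)) (t, x) = 0 := fun x =>
            indicator_of_notMem (fun h => htR h.1) _
          rw [lintegral_congr this]; simp
    _ < ⊤ := by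
        rw [lintegral_indicator measurableSet_Icc, setLIntegral_const]
        exact ENNReal.mul_lt_top (ENNReal.rpow_lt_top_of_nonneg (by norm_num) hCt)
          measure_Icc_lt_top

/-- Mollification is compatible with the duality of `L¹_loc(ℝ; L²_loc)` and `L^∞_loc(ℝ; L²_loc)`. -/
theorem tendsto_integral_mollify_mul_of_locL1L2 {f w c : ℝ × E3 → ℝ} (hf : LocL1L2 f)
    (hw : LocLinftyL2 w) (hc : Continuous c) (hcs : HasCompactSupport c) :
    Integrable (fun z => c z * f z * w z) ∧
    Tendsto (fun n => ∫ z, c z * mollify n f z * mollify n w z) atTop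
      (𝓝 (∫ z, c z * f z * w z)) := by
  -- The box contains the 1-thickening of the support of `c`, so restricting both functions to the
  -- box does not change their mollifications on that support.
  obtain ⟨R, hR0, hR⟩ := exists_subset_spaceTimeBox (hcs.isCompact.cthickening (r := 1))
  obtain ⟨g, hg, hfg⟩ := hf.1
  obtain ⟨v, hv, hwv⟩ := hw.1
  obtain ⟨C, hCt, hC⟩ := hw.2 R
  have hBm := measurableSet_spaceTimeBox R
  set B := spaceTimeBox R with hB
  have hcon : ∀ k k' : ℝ × E3 → ℝ, k =ᵐ[volume] k' → ∀ n, ∀ z ∈ tsupport c,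
      mollify n k z = mollify n (B.indicator k') z := by
    intro k k' hkk n z hz
    rw [mollify_congr_ae n hkk]
    apply mollify_congr_of_eqOn
    intro y hy
    rw [indicator_of_mem]
    exact hR (Metric.mem_cthickening_of_dist_le y z 1 _ hz (Metric.mem_ball.1 hy).le)
  have hBsub : tsupport c ⊆ B := (Metric.self_subset_cthickening _).trans hR
  have h1 : ∀ n, ∫ z, c z * mollify n f z * mollify n w z =
      ∫ z, c z * mollify n (B.indicator g) z * mollify n (B.indicator v) z := by
    intro n
    congr 1 with z
    by_cases hz : z ∈ tsupport c
    · rw [hcon f g hfg n z hz, hcon w v hwv n z hz]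
    · rw [image_eq_zero_of_notMem_tsupport hz]; ring
  have h2 : (fun z => c z * f z * w z) =ᵐ[volume]
      fun z => c z * B.indicator g z * B.indicator v z := by
    filter_upwards [hfg, hwv] with z h1 h2
    by_cases hz : z ∈ tsupport c
    · rw [h1, h2, indicator_of_mem (hBsub hz), indicator_of_mem (hBsub hz)]
    · rw [image_eq_zero_of_notMem_tsupport hz]; ring
  have hL : normL1L2 (fun z => ‖B.indicator g z‖ₑ) = normL1L2 (B.indicator fun z => ‖f z‖ₑ) := by
    apply normL1L2_congr_ae
    filter_upwards [hfg] with z hz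
    by_cases h : z ∈ B
    · simp [indicator_of_mem h, hz]
    · simp [indicator_of_notMem h]
  have hC' : ∀ᵐ t : ℝ, (∫⁻ x, ‖B.indicator v (t, x)‖ₑ ^ (2 : ℝ)) ^ (1 / 2 : ℝ) ≤ C := by
    filter_upwards [hC, Measure.ae_ae_of_ae_prod hwv] with t ht htx
    refine le_trans (le_of_eq ?_) ht
    congr 1
    apply lintegral_congr_ae
    filter_upwards [htx] with x hx
    by_cases h : (t, x) ∈ B
    · simp [indicator_of_mem h, hx]
    · simp [indicator_of_notMem h]
  have hgl : LocallyIntegrable (B.indicator g) volume := by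
    have hg' : LocallyIntegrable g volume := by
      rw [locallyIntegrable_iff]
      exact fun K hK => ((locallyIntegrable_iff.1 hf.locallyIntegrable) K hK).congr
        (ae_restrict_of_ae hfg)
    rw [locallyIntegrable_iff] at hg' ⊢
    exact fun K hK => (hg' K hK).indicator hBm
  have hvl : LocL2 (B.indicator v) := by
    intro K hK
    exact (MemLp.ae_eq (ae_restrict_of_ae hwv) (hw.locL2 K hK)).indicator hBm
  simp only [h1]
  rw [integrable_congr h2, integral_congr_ae h2]
  exact tendsto_integral_mollify_mul_of_normL1L2 (hg.measurable.indicator hBm)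
    (hv.measurable.indicator hBm) (by rw [hL]; exact hf.2 R) hgl hvl hCt hC' hc hcs

/-! ### Integration by parts for smooth functions. -/

section SmoothIdentities

variable {E : Type*} [NormedAddCommGroup E] [NormedSpace ℝ E] [FiniteDimensional ℝ E]
  [MeasureSpace E] [BorelSpace E] [(volume : Measure E).IsAddHaarMeasure]

/-- The derivative in the direction `d`. -/
def dirD (d : E) (f : E → ℝ) : E → ℝ := fun z => fderiv ℝ f z d

theorem dirD_contDiff {f : E → ℝ} (hf : ContDiff ℝ ∞ f) (d : E) : ContDiff ℝ ∞ (dirD d f) :=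
  (hf.fderiv_right (by norm_cast)).clm_apply contDiff_const

theorem dirD_hasCompactSupport {f : E → ℝ} (hf : HasCompactSupport f) (d : E) :
    HasCompactSupport (dirD d f) := hf.fderiv_apply ℝ d

theorem smooth_differentiable {f : E → ℝ} (hf : ContDiff ℝ ∞ f) (z : E) : DifferentiableAt ℝ f z :=
  hf.differentiable (by simp) z

theorem dirD_mul {f g : E → ℝ} (hf : ContDiff ℝ ∞ f) (hg : ContDiff ℝ ∞ g) (d z : E) :
    dirD d (fun y => f y * g y) z = dirD d f z * g z + f z * dirD d g z := by
  rw [dirD, fderiv_fun_mul (smooth_differentiable hf z) (smooth_differentiable hg z)]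
  simp [dirD]; ring

theorem dirD_comm {f : E → ℝ} (hf : ContDiff ℝ ∞ f) (a b z : E) :
    dirD a (dirD b f) z = dirD b (dirD a f) z := by
  have hd : DifferentiableAt ℝ (fderiv ℝ f) z :=
    (hf.fderiv_right (m := 1) (by norm_cast)).differentiable one_ne_zero z
  have h : ∀ c e, dirD c (dirD e f) z = fderiv ℝ (fderiv ℝ f) z c e := by
    intro c e
    have : dirD e f = fun y => fderiv ℝ f y e := rfl
    rw [dirD, this, fderiv_clm_apply hd (differentiableAt_const e)]
    simp
  rw [h, h]
  exact (hf.contDiffAt.isSymmSndFDerivAt (by simp; norm_cast)) a b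

theorem integral_dirD_mul {f g : E → ℝ} (hf : ContDiff ℝ ∞ f) (hg : ContDiff ℝ ∞ g)
    (hc : HasCompactSupport g) (d : E) : ∫ z, dirD d f z * g z = -∫ z, f z * dirD d g z := by
  rw [eq_comm, neg_eq_iff_eq_neg]
  refine integral_mul_fderiv_eq_neg_fderiv_mul_of_integrable ?_ ?_ ?_
    (fun z _ => smooth_differentiable hf z) (fun z _ => smooth_differentiable hg z)
  · exact ((dirD_contDiff hf d).continuous.mul hg.continuous).integrable_of_hasCompactSupport
      (hc.mul_left)
  · exact (hf.continuous.mul (dirD_contDiff hg d).continuous).integrable_of_hasCompactSupport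
      ((dirD_hasCompactSupport hc d).mul_left)
  · exact (hf.continuous.mul hg.continuous).integrable_of_hasCompactSupport hc.mul_left

theorem integrable_triple {c f g : E → ℝ} (hc : Continuous c) (hcs : HasCompactSupport c)
    (hf : Continuous f) (hg : Continuous g) : Integrable (fun z => c z * f z * g z) :=
  ((hc.mul hf).mul hg).integrable_of_hasCompactSupport ((hcs.mul_right (f' := f)).mul_right)

theorem smooth_identity_zero {v h : E → ℝ} (hv : ContDiff ℝ ∞ v) (hh : ContDiff ℝ ∞ h)
    (hc : HasCompactSupport h) (a : E) :
    ∫ z, h z * v z * dirD a v z = -(1 / 2) * ∫ z, dirD a h z * v z * v z := by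
  have h1 := integral_dirD_mul (hv.mul hv) hh hc a
  have e1 : ∀ z, dirD a (fun y => v y * v y) z * h z = 2 * (h z * v z * dirD a v z) := by
    intro z; rw [dirD_mul hv hv]; ring
  have e2 : ∀ z, v z * v z * dirD a h z = dirD a h z * v z * v z := by intro z; ring
  simp only [e1, e2] at h1
  rw [integral_const_mul] at h1
  linarith

/-- The multiplier is Y ∂_b v. One integration by parts in direction `a` leaves Y ∂ₐv ∂ₐ∂_b v, which
is Y ∂_b(∂ₐv)²/2 because the derivatives commute. -/
theorem smooth_identity_first {v Y : E → ℝ} (hv : ContDiff ℝ ∞ v) (hY : ContDiff ℝ ∞ Y)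
    (hc : HasCompactSupport Y) (a b : E) :
    ∫ z, Y z * dirD a (dirD a v) z * dirD b v z =
      -(∫ z, dirD a Y z * dirD a v z * dirD b v z) +
        1 / 2 * ∫ z, dirD b Y z * dirD a v z * dirD a v z := by
  have hva := dirD_contDiff hv a
  have hvb := dirD_contDiff hv b
  have h1 := integral_dirD_mul hva (hY.mul hvb) (hc.mul_right) a
  have h2 := smooth_identity_zero hva hY hc b
  have e1 : ∀ z, dirD a (dirD a v) z * (Y z * dirD b v z) =
      Y z * dirD a (dirD a v) z * dirD b v z := by intro z; ring
  have e2 : ∀ z, dirD a v z * dirD a (fun y => Y y * dirD b v y) z =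
      dirD a Y z * dirD a v z * dirD b v z + Y z * dirD a v z * dirD b (dirD a v) z := by
    intro z; rw [dirD_mul hY hvb, dirD_comm hv a b]; ring
  simp only [e1, e2] at h1
  rw [integral_add, h2] at h1
  · linarith
  · exact integrable_triple (dirD_contDiff hY a).continuous (dirD_hasCompactSupport hc a)
      hva.continuous hvb.continuous
  · exact integrable_triple hY.continuous hc hva.continuous (dirD_contDiff hva b).continuous

theorem smooth_identity_second {v f : E → ℝ} (hv : ContDiff ℝ ∞ v) (hf : ContDiff ℝ ∞ f)
    (hc : HasCompactSupport f) (a : E) :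
    ∫ z, f z * dirD a (dirD a v) z * v z =
      -(∫ z, f z * dirD a v z * dirD a v z) - ∫ z, dirD a f z * v z * dirD a v z := by
  have hva := dirD_contDiff hv a
  have h1 := integral_dirD_mul hva (hf.mul hv) (hc.mul_right) a
  have e1 : ∀ z, dirD a (dirD a v) z * (f z * v z) = f z * dirD a (dirD a v) z * v z := by
    intro z; ring
  have e2 : ∀ z, dirD a v z * dirD a (fun y => f y * v y) z =
      f z * dirD a v z * dirD a v z + dirD a f z * v z * dirD a v z := by
    intro z; rw [dirD_mul hf hv]; ring
  simp only [e1, e2] at h1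
  rw [integral_add] at h1
  · linarith
  · exact integrable_triple hf.continuous hc hva.continuous hva.continuous
  · exact integrable_triple (dirD_contDiff hf a).continuous (dirD_hasCompactSupport hc a)
      hv.continuous hva.continuous

end SmoothIdentities

/-! ### The same identities for weak solutions. -/

/-- `u` solves `∑ᵢ εᵢ ∂_{aᵢ}² u = G` in the sense of distributions and has the weak directional
derivatives `D d`. -/
structure WeakWave {ι : Type*} [Fintype ι] (ε : ι → ℝ) (a : ι → ℝ × E3) (u : ℝ × E3 → ℝ)
    (D : ℝ × E3 → ℝ × E3 → ℝ) (G : ℝ × E3 → ℝ) : Prop where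
  u_loc : LocLinftyL2 u
  D_loc : ∀ d, LocLinftyL2 (D d)
  G_loc : LocL1L2 G
  weak_deriv : ∀ d, ∀ ψ : ℝ × E3 → ℝ, ContDiff ℝ ∞ ψ → HasCompactSupport ψ →
    ∫ z, u z * fderiv ℝ ψ z d = -∫ z, D d z * ψ z
  wave : ∀ ψ : ℝ × E3 → ℝ, ContDiff ℝ ∞ ψ → HasCompactSupport ψ →
    ∫ z, u z * ∑ i, ε i * dirD (a i) (dirD (a i) ψ) z = ∫ z, G z * ψ z

namespace WeakWave

variable {ι : Type*} [Fintype ι] {ε : ι → ℝ} {a : ι → ℝ × E3} {u : ℝ × E3 → ℝ}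
  {D : ℝ × E3 → ℝ × E3 → ℝ} {G : ℝ × E3 → ℝ}

theorem dirD_mollify (h : WeakWave ε a u D G) (n : ℕ) (d : ℝ × E3) :
    dirD d (mollify n u) = mollify n (D d) := by
  ext z
  exact mollify_fderiv n h.u_loc.locL2.locallyIntegrable (h.weak_deriv d) z

theorem mollify_smooth (h : WeakWave ε a u D G) (n : ℕ) : ContDiff ℝ ∞ (mollify n u) :=
  mollify_contDiff n h.u_loc.locL2.locallyIntegrable

/-- The reflected bump at `z` is a test function for the equation, so the mollified function solves
the equation with mollified source pointwise. -/
theorem wave_mollify (h : WeakWave ε a u D G) (n : ℕ) (z : ℝ × E3) :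
    ∑ i, ε i * dirD (a i) (dirD (a i) (mollify n u)) z = mollify n G z := by
  have hu := h.u_loc.locL2.locallyIntegrable
  have h2 : ∀ d, dirD d (dirD d (mollify n u)) z =
      ∫ y, u y * dirD d (dirD d (bumpAt n z)) y := by
    intro d
    rw [h.dirD_mollify, dirD, fderiv_mollify_apply n (h.D_loc d).locL2.locallyIntegrable]
    exact (h.weak_deriv d _ (dirD_contDiff (bumpAt_contDiff n z) d)
      (dirD_hasCompactSupport (bumpAt_hasCompactSupport n z) d)).symm
  have h3 := h.wave _ (bumpAt_contDiff n z) (bumpAt_hasCompactSupport n z)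
  rw [mollify_eq_integral_mul_bumpAt, ← h3]
  simp only [Finset.mul_sum, h2, ← integral_const_mul]
  rw [integral_finsetSum]
  · congr 1 with i; congr 1 with y; ring
  · intro i _
    have hc := (dirD_contDiff (dirD_contDiff (bumpAt_contDiff n z) (a i)) (a i)).continuous
    have hs := dirD_hasCompactSupport (dirD_hasCompactSupport (bumpAt_hasCompactSupport n z) (a i))
      (a i)
    have := (hu.integrable_smul_right_of_hasCompactSupport hc hs).const_mul (ε i)
    refine this.congr (ae_of_all _ fun y => ?_)
    simp only [smul_eq_mul]; ring

theorem identity_zero (h : WeakWave ε a u D G) {f : ℝ × E3 → ℝ} (hf : ContDiff ℝ ∞ f)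
    (hc : HasCompactSupport f) (d : ℝ × E3) :
    ∫ z, f z * u z * D d z = -(1 / 2) * ∫ z, dirD d f z * u z * u z := by
  have h1 : ∀ n, ∫ z, f z * mollify n u z * mollify n (D d) z =
      -(1 / 2) * ∫ z, dirD d f z * mollify n u z * mollify n u z := fun n => by
    rw [← smooth_identity_zero (h.mollify_smooth n) hf hc d, h.dirD_mollify]
  refine tendsto_nhds_unique (tendsto_integral_mollify_mul h.u_loc.locL2 (h.D_loc d).locL2
    hf.continuous hc) ?_
  simp only [h1]
  exact (tendsto_integral_mollify_mul h.u_loc.locL2 h.u_loc.locL2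
    (dirD_contDiff hf d).continuous (dirD_hasCompactSupport hc d)).const_mul _

/-- The smooth identity holds for each mollification. The quadratic terms converge by local L²
convergence; the source term is only a product of L¹L² with L^∞L² and needs
`tendsto_integral_mollify_mul_of_locL1L2`. -/
theorem identity_first (h : WeakWave ε a u D G) {Y : ℝ × E3 → ℝ} (hY : ContDiff ℝ ∞ Y)
    (hc : HasCompactSupport Y) (b : ℝ × E3) :
    ∑ i, ε i * (-(∫ z, dirD (a i) Y z * D (a i) z * D b z) +
        1 / 2 * ∫ z, dirD b Y z * D (a i) z * D (a i) z) = ∫ z, Y z * G z * D b z := by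
  have hD := fun d => (h.D_loc d).locL2
  have h1 : ∀ n, ∑ i, ε i *
      (-(∫ z, dirD (a i) Y z * mollify n (D (a i)) z * mollify n (D b) z) +
        1 / 2 * ∫ z, dirD b Y z * mollify n (D (a i)) z * mollify n (D (a i)) z) =
      ∫ z, Y z * mollify n G z * mollify n (D b) z := by
    intro n
    have hs : ∀ i, -(∫ z, dirD (a i) Y z * mollify n (D (a i)) z * mollify n (D b) z) +
        1 / 2 * ∫ z, dirD b Y z * mollify n (D (a i)) z * mollify n (D (a i)) z =
        ∫ z, Y z * dirD (a i) (dirD (a i) (mollify n u)) z * dirD b (mollify n u) z := by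
      intro i
      rw [smooth_identity_first (h.mollify_smooth n) hY hc, h.dirD_mollify, h.dirD_mollify]
    simp only [hs]
    simp only [← integral_const_mul]
    rw [← integral_finsetSum]
    · congr 1 with z
      rw [← h.wave_mollify, Finset.mul_sum, Finset.sum_mul, h.dirD_mollify]
      exact Finset.sum_congr rfl fun i _ => by ring
    · intro i _
      exact (integrable_triple hY.continuous hc
        (dirD_contDiff (dirD_contDiff (h.mollify_smooth n) _) _).continuous
        (dirD_contDiff (h.mollify_smooth n) _).continuous).const_mul _
  refine tendsto_nhds_unique ?_
    (tendsto_integral_mollify_mul_of_locL1L2 h.G_loc (h.D_loc b) hY.continuous hc).2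
  simp only [← h1]
  refine tendsto_finsetSum _ fun i _ => ((Tendsto.neg ?_).add (Tendsto.const_mul _ ?_)).const_mul _
  · exact tendsto_integral_mollify_mul (hD _) (hD _) (dirD_contDiff hY _).continuous
      (dirD_hasCompactSupport hc _)
  · exact tendsto_integral_mollify_mul (hD _) (hD _) (dirD_contDiff hY _).continuous
      (dirD_hasCompactSupport hc _)

theorem identity_second (h : WeakWave ε a u D G) {f : ℝ × E3 → ℝ} (hf : ContDiff ℝ ∞ f)
    (hc : HasCompactSupport f) :
    ∑ i, ε i * (-(∫ z, f z * D (a i) z * D (a i) z) - ∫ z, dirD (a i) f z * u z * D (a i) z) =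
      ∫ z, f z * G z * u z := by
  have hD := fun d => (h.D_loc d).locL2
  have h1 : ∀ n, ∑ i, ε i *
      (-(∫ z, f z * mollify n (D (a i)) z * mollify n (D (a i)) z) -
        ∫ z, dirD (a i) f z * mollify n u z * mollify n (D (a i)) z) =
      ∫ z, f z * mollify n G z * mollify n u z := by
    intro n
    have hs : ∀ i, -(∫ z, f z * mollify n (D (a i)) z * mollify n (D (a i)) z) -
        ∫ z, dirD (a i) f z * mollify n u z * mollify n (D (a i)) z =
        ∫ z, f z * dirD (a i) (dirD (a i) (mollify n u)) z * mollify n u z := by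
      intro i
      rw [smooth_identity_second (h.mollify_smooth n) hf hc, h.dirD_mollify]
    simp only [hs]
    simp only [← integral_const_mul]
    rw [← integral_finsetSum]
    · congr 1 with z
      rw [← h.wave_mollify, Finset.mul_sum, Finset.sum_mul]
      exact Finset.sum_congr rfl fun i _ => by ring
    · intro i _
      exact (integrable_triple hf.continuous hc
        (dirD_contDiff (dirD_contDiff (h.mollify_smooth n) _) _).continuous
        (h.mollify_smooth n).continuous).const_mul _
  refine tendsto_nhds_unique ?_
    (tendsto_integral_mollify_mul_of_locL1L2 h.G_loc h.u_loc hf.continuous hc).2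
  simp only [← h1]
  refine tendsto_finsetSum _ fun i _ => ((Tendsto.neg ?_).sub ?_).const_mul _
  · exact tendsto_integral_mollify_mul (hD _) (hD _) hf.continuous hc
  · exact tendsto_integral_mollify_mul h.u_loc.locL2 (hD _) (dirD_contDiff hf _).continuous
      (dirD_hasCompactSupport hc _)

end WeakWave

/-! ### The chain rule for weak derivatives of the nonlinearity. -/

section ChainRule

variable {E : Type*} [NormedAddCommGroup E] [NormedSpace ℝ E] [FiniteDimensional ℝ E]
  [MeasureSpace E] [BorelSpace E] [(volume : Measure E).IsAddHaarMeasure]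

theorem tendsto_eLpNorm_two_of_bounded {α : Type*} [MeasurableSpace α] {ν : Measure α}
    [IsFiniteMeasure ν] {fn : ℕ → α → ℝ} {f : α → ℝ} {M : ℝ}
    (hm : ∀ n, AEStronglyMeasurable (fn n) ν) (hf : AEStronglyMeasurable f ν)
    (hb : ∀ n x, |fn n x| ≤ M) (hbf : ∀ x, |f x| ≤ M)
    (hlim : ∀ᵐ x ∂ν, Tendsto (fun n => fn n x) atTop (𝓝 (f x))) :
    Tendsto (fun n => eLpNorm (fn n - f) 2 ν) atTop (𝓝 0) := by
  have two : (2 : ℝ≥0∞).toReal = 2 := by norm_num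
  simp only [eLpNorm_eq_lintegral_rpow_enorm_toReal (by norm_num : (2 : ℝ≥0∞) ≠ 0)
    (by norm_num : (2 : ℝ≥0∞) ≠ ⊤), two]
  have h1 : Tendsto (fun n => ∫⁻ x, ‖(fn n - f) x‖ₑ ^ (2 : ℝ) ∂ν) atTop (𝓝 (∫⁻ _, 0 ∂ν)) := by
    refine tendsto_lintegral_of_dominated_convergence' (fun _ => ENNReal.ofReal (2 * M) ^ (2 : ℝ))
      (fun n => ((hm n).sub hf).enorm.pow_const _) (fun n => ae_of_all _ fun x => ?_) ?_ ?_
    · refine ENNReal.rpow_le_rpow ?_ (by norm_num)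
      rw [Real.enorm_eq_ofReal_abs]
      apply ENNReal.ofReal_le_ofReal
      rw [Pi.sub_apply]
      exact (abs_sub _ _).trans (by linarith [hb n x, hbf x])
    · rw [lintegral_const]
      exact ENNReal.mul_ne_top (ENNReal.rpow_ne_top_of_nonneg (by norm_num) ENNReal.ofReal_ne_top)
        (measure_ne_top _ _)
    · filter_upwards [hlim] with x hx
      have h2 : Tendsto (fun n => fn n x - f x) atTop (𝓝 0) := by
        simpa using hx.sub_const (f x)
      have h3 := (((ENNReal.continuous_rpow_const (y := (2 : ℝ))).comp
        (continuous_enorm (E := ℝ))).tendsto 0).comp h2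
      simpa [Function.comp_def] using h3
  have h2 := ((ENNReal.continuous_rpow_const (y := (1 / 2 : ℝ))).tendsto _).comp h1
  simpa [Function.comp_def] using h2

/-- Mollify `u`. Boundedness of `g` gives g(vₙ) → g(u) in L² on compact sets from convergence almost
everywhere, while Φ is Lipschitz, so Φ(vₙ) converges in L² with vₙ. -/
theorem weak_chain_rule {u D : E → ℝ} {d : E} (hu : LocL2 u) (hD : LocL2 D)
    (hw : ∀ ψ : E → ℝ, ContDiff ℝ ∞ ψ → HasCompactSupport ψ →
      ∫ z, u z * fderiv ℝ ψ z d = -∫ z, D z * ψ z)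
    {Φ g : ℝ → ℝ} (hΦ : ∀ s, HasDerivAt Φ (g s) s) (hg : Continuous g) {M : ℝ}
    (hM : ∀ s, |g s| ≤ M) {Y : E → ℝ} (hY : ContDiff ℝ ∞ Y) (hc : HasCompactSupport Y) :
    ∫ z, Y z * g (u z) * D z = -∫ z, dirD d Y z * Φ (u z) := by
  have hul := hu.locallyIntegrable
  have hM0 : 0 ≤ M := (abs_nonneg _).trans (hM 0)
  set v : ℕ → E → ℝ := fun n => mollify n u with hv
  have hvs : ∀ n, ContDiff ℝ ∞ (v n) := fun n => mollify_contDiff n hul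
  have hΦc : Continuous Φ := continuous_iff_continuousAt.2 fun s => (hΦ s).continuousAt
  have hsm : ∀ n, ∫ z, Y z * g (v n z) * mollify n D z = -∫ z, dirD d Y z * Φ (v n z) := by
    intro n
    have hder : ∀ z, HasFDerivAt (fun z => Φ (v n z)) (g (v n z) • fderiv ℝ (v n) z) z := fun z =>
      (hΦ (v n z)).comp_hasFDerivAt z (smooth_differentiable (hvs n) z).hasFDerivAt
    have hder' : ∀ z, fderiv ℝ (fun z => Φ (v n z)) z d = g (v n z) * mollify n D z := by
      intro z
      rw [(hder z).fderiv, ← mollify_fderiv n hul hw z]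
      simp [hv]
    have hD' : Continuous (mollify n D) := (mollify_contDiff n hD.locallyIntegrable).continuous
    have := integral_mul_fderiv_eq_neg_fderiv_mul_of_integrable (𝕜 := ℝ)
      (μ := (volume : Measure E)) (f := Y) (g := fun z => Φ (v n z)) (v := d) ?_ ?_ ?_
      (fun z _ => smooth_differentiable hY z) (fun z _ => (hder z).differentiableAt)
    · simp only [hder'] at this
      refine Eq.trans ?_ this
      congr 1 with z; ring
    · exact ((dirD_contDiff hY d).continuous.mul
        (hΦc.comp (hvs n).continuous)).integrable_of_hasCompactSupport
          (dirD_hasCompactSupport hc d).mul_right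
    · simp only [hder']
      exact (hY.continuous.mul ((hg.comp (hvs n).continuous).mul
        hD')).integrable_of_hasCompactSupport hc.mul_right
    · exact (hY.continuous.mul (hΦc.comp (hvs n).continuous)).integrable_of_hasCompactSupport
        hc.mul_right
  set K := tsupport Y with hKdef
  have hK : IsCompact K := hc.isCompact
  have : IsFiniteMeasure ((volume : Measure E).restrict K) := ⟨by simpa using hK.measure_lt_top⟩
  have hred : ∀ a : E → ℝ, ∀ b : E → ℝ, ∫ z, Y z * a z * b z = ∫ z in K, Y z * a z * b z := by
    intro a b
    rw [setIntegral_eq_integral_of_forall_compl_eq_zero]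
    intro z hz
    rw [image_eq_zero_of_notMem_tsupport hz]; ring
  have hdsub : ∀ z ∉ K, dirD d Y z = 0 := by
    intro z hz
    have : z ∉ tsupport (fderiv ℝ Y) := fun h => hz (tsupport_fderiv_subset ℝ h)
    rw [dirD, image_eq_zero_of_notMem_tsupport this]; simp
  have hred' : ∀ a : E → ℝ, ∫ z, dirD d Y z * a z = ∫ z in K, dirD d Y z * a z * 1 := by
    intro a
    simp only [mul_one]
    rw [setIntegral_eq_integral_of_forall_compl_eq_zero]
    intro z hz
    rw [hdsub z hz]; ring
  have hum : AEStronglyMeasurable u (volume.restrict K) := (hu K hK).1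
  obtain ⟨C, hC⟩ := hc.exists_bound_of_continuous hY.continuous
  obtain ⟨C', hC'⟩ := (dirD_hasCompactSupport hc d).exists_bound_of_continuous
    (dirD_contDiff hY d).continuous
  have L1 : Tendsto (fun n => ∫ z, Y z * g (v n z) * mollify n D z) atTop
      (𝓝 (∫ z, Y z * g (u z) * D z)) := by
    rw [hred (fun z => g (u z))]
    simp only [hred (fun z => g (v _ z))]
    refine tendsto_integral_mul_mul_of_L2 (v := fun z => g (u z)) (vn := fun n z => g (v n z))
      (MemLp.of_bound (hg.comp_aestronglyMeasurable hum) M (ae_of_all _ fun z => hM _)) (hD K hK)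
      (fun n => (hg.comp (hvs n).continuous).locL2 K hK)
      (fun n => (mollify_contDiff n hD.locallyIntegrable).continuous.locL2 K hK)
      hY.continuous.aestronglyMeasurable hC ?_ (hD.mollify_tendsto hK)
    refine tendsto_eLpNorm_two_of_bounded (M := M)
      (fun n => (hg.comp (hvs n).continuous).aestronglyMeasurable)
      (hg.comp_aestronglyMeasurable hum) (fun n x => hM _) (fun x => hM _) ?_
    filter_upwards [ae_restrict_of_ae (mollify_ae_tendsto hul)] with z hz
    exact (hg.tendsto _).comp hz
  have hlip : ∀ s t, ‖Φ s - Φ t‖ ≤ M * ‖s - t‖ := fun s t =>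
    Convex.norm_image_sub_le_of_norm_hasDerivWithin_le (s := univ)
      (fun x _ => (hΦ x).hasDerivWithinAt) (fun x _ => hM x) convex_univ (mem_univ _) (mem_univ _)
  have hΦu : MemLp (fun z => Φ (u z)) 2 (volume.restrict K) := by
    have h1 : MemLp (fun z => M * ‖u z‖ + ‖Φ 0‖) 2 (volume.restrict K) :=
      ((hu K hK).norm.const_mul M).add (memLp_const _)
    refine h1.mono (hΦc.comp_aestronglyMeasurable hum) (ae_of_all _ fun z => ?_)
    have := hlip (u z) 0
    have h3 := norm_sub_norm_le (Φ (u z)) (Φ 0)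
    rw [sub_zero] at this
    rw [Real.norm_of_nonneg (by positivity : 0 ≤ M * ‖u z‖ + ‖Φ 0‖)]
    linarith
  have L2 : Tendsto (fun n => ∫ z, dirD d Y z * Φ (v n z)) atTop
      (𝓝 (∫ z, dirD d Y z * Φ (u z))) := by
    rw [hred' (fun z => Φ (u z))]
    simp only [hred' (fun z => Φ (v _ z))]
    refine tendsto_integral_mul_mul_of_L2 (v := fun z => Φ (u z)) (vn := fun n z => Φ (v n z))
      (w := fun _ => 1) (wn := fun _ _ => 1) hΦu (memLp_const _)
      (fun n => (hΦc.comp (hvs n).continuous).locL2 K hK) (fun n => memLp_const _)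
      (dirD_contDiff hY d).continuous.aestronglyMeasurable hC' ?_ (by simp)
    have hle : ∀ n, eLpNorm ((fun z => Φ (v n z)) - fun z => Φ (u z)) 2 (volume.restrict K) ≤
        ENNReal.ofReal M * eLpNorm (v n - u) 2 (volume.restrict K) := fun n =>
      eLpNorm_le_mul_eLpNorm_of_ae_le_mul (ae_of_all _ fun z => hlip _ _) 2
    refine tendsto_of_tendsto_of_tendsto_of_le_of_le tendsto_const_nhds ?_ (fun _ => zero_le) hle
    simpa using ENNReal.Tendsto.const_mul (a := ENNReal.ofReal M) (hu.mollify_tendsto hK)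
      (Or.inr ENNReal.ofReal_ne_top)
  refine tendsto_nhds_unique L1 ?_
  simp only [hsm]
  exact L2.neg

/-- The truncation of a real number to `[-N, N]`. -/
def clampAt (N s : ℝ) : ℝ := max (-N) (min N s)

theorem abs_clampAt_le {N : ℝ} (hN : 0 ≤ N) (s : ℝ) : |clampAt N s| ≤ |s| := by
  rw [clampAt, abs_le]
  constructor
  · rw [le_max_iff, le_min_iff]
    by_cases h : N ≤ |s|
    · left; linarith
    · right; exact ⟨by linarith [abs_nonneg s], neg_abs_le s⟩
  · exact max_le (by linarith [abs_nonneg s]) ((min_le_right _ _).trans (le_abs_self s))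

theorem abs_clampAt_le' {N : ℝ} (hN : 0 ≤ N) (s : ℝ) : |clampAt N s| ≤ N :=
  abs_le.2 ⟨le_max_left _ _, max_le (by linarith) (min_le_left _ _)⟩

theorem clampAt_eq {N s : ℝ} (h : |s| ≤ N) : clampAt N s = s := by
  rw [clampAt, min_eq_right (le_of_abs_le h), max_eq_right (by linarith [neg_le_of_abs_le h])]

theorem abs_rpow_mul_mul {p : ℝ} (hp : 1 < p) (s : ℝ) : |s| ^ (p - 1) * s * s = |s| ^ (p + 1) := by
  rcases eq_or_ne s 0 with rfl | hs
  · simp [Real.zero_rpow (by linarith : p + 1 ≠ 0)]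
  · rw [mul_assoc, ← pow_two, ← sq_abs, ← Real.rpow_natCast, ← Real.rpow_add (abs_pos.2 hs)]
    congr 1; push_cast; ring

/-- The derivative |s|^(p-1)s is unbounded, so its argument is clamped to [-N,N], `weak_chain_rule`
is applied, and N tends to infinity. The hypotheses `h1` and `h2` supply the dominating functions.
-/
theorem weak_chain_rule_rpow {u D : E → ℝ} {d : E} (hu : LocL2 u) (hD : LocL2 D)
    (hw : ∀ ψ : E → ℝ, ContDiff ℝ ∞ ψ → HasCompactSupport ψ →
      ∫ z, u z * fderiv ℝ ψ z d = -∫ z, D z * ψ z) {p : ℝ} (hp : 1 < p)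
    {Y : E → ℝ} (hY : ContDiff ℝ ∞ Y) (hc : HasCompactSupport Y)
    (hum : AEStronglyMeasurable u volume) (hDm : AEStronglyMeasurable D volume)
    (h1 : Integrable (fun z => Y z * (|u z| ^ (p - 1) * u z) * D z))
    (h2 : Integrable (fun z => dirD d Y z * |u z| ^ (p + 1))) :
    ∫ z, Y z * (|u z| ^ (p - 1) * u z) * D z = -(∫ z, dirD d Y z * |u z| ^ (p + 1)) / (p + 1) := by
  set g : ℝ → ℝ := fun s => |s| ^ (p - 1) * s with hgdef
  have hgc : Continuous g :=
    (continuous_abs.rpow_const fun s => Or.inr (by linarith)).mul continuous_id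
  have hgabs : ∀ s, |g s| = |s| ^ (p - 1) * |s| := by
    intro s
    rw [hgdef]
    simp only [abs_mul, abs_of_nonneg (Real.rpow_nonneg (abs_nonneg s) _)]
  have hgmono : ∀ s t, |s| ≤ |t| → |g s| ≤ |g t| := by
    intro s t hst
    rw [hgabs, hgabs]
    gcongr
  set gN : ℕ → ℝ → ℝ := fun N s => g (clampAt N s) with hgN
  have hcl : ∀ N : ℕ, Continuous (clampAt N) := fun N =>
    continuous_const.max (continuous_const.min continuous_id)
  have hgNc : ∀ N, Continuous (gN N) := fun N => hgc.comp (hcl N)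
  set Φ : ℕ → ℝ → ℝ := fun N s => ∫ x in (0 : ℝ)..s, gN N x with hΦ
  have hΦd : ∀ N s, HasDerivAt (Φ N) (gN N s) s := fun N s =>
    intervalIntegral.integral_hasDerivAt_right ((hgNc N).intervalIntegrable _ _)
      ((hgNc N).stronglyMeasurableAtFilter _ _) (hgNc N).continuousAt
  have hN0 : ∀ N : ℕ, (0 : ℝ) ≤ N := fun N => N.cast_nonneg
  have hgNle : ∀ N s, |gN N s| ≤ |g s| := fun N s => hgmono _ _ (abs_clampAt_le (hN0 N) s)
  have hΦle : ∀ N s, |Φ N s| ≤ |s| ^ (p + 1) := by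
    intro N s
    have := intervalIntegral.norm_integral_le_of_norm_le_const (a := 0) (b := s) (f := gN N)
      (C := |g s|) (fun x hx => (hgNle N x).trans (hgmono _ _ ?_))
    · rw [sub_zero, hgabs, mul_assoc, abs_mul_abs_self, ← mul_assoc, abs_rpow_mul_mul hp] at this
      exact this
    · rw [mem_uIoc] at hx
      rcases hx with hx | hx
      · rw [abs_of_pos hx.1, abs_of_pos (hx.1.trans_le hx.2)]; exact hx.2
      · rw [abs_of_nonpos hx.2, abs_of_neg (hx.1.trans_le hx.2)]; linarith [hx.1]
  -- Once N exceeds |s| the clamp is inactive between 0 and s, so the primitive equals the power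
  -- exactly.
  have hΦlim : ∀ s, ∀ᶠ N : ℕ in atTop, Φ N s = |s| ^ (p + 1) / (p + 1) := by
    intro s
    filter_upwards [eventually_ge_atTop (Nat.ceil |s|)] with N hN
    have hsN : |s| ≤ N := (Nat.le_ceil |s|).trans (by exact_mod_cast hN)
    have hd : ∀ x ∈ uIcc 0 s, HasDerivAt (fun x => |x| ^ (p + 1) / (p + 1)) (gN N x) x := by
      intro x hx
      have hx' : |x| ≤ |s| := by
        rw [mem_uIcc] at hx
        rcases hx with hx | hx
        · rw [abs_of_nonneg hx.1, abs_of_nonneg (hx.1.trans hx.2)]; exact hx.2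
        · rw [abs_of_nonpos hx.2, abs_of_nonpos (hx.1.trans hx.2)]; linarith [hx.1]
      have h := (hasDerivAt_abs_rpow x (by linarith : 1 < p + 1)).div_const (p + 1)
      refine h.congr_deriv ?_
      rw [hgN]
      simp only [clampAt_eq (hx'.trans hsN), hgdef]
      have : p + 1 ≠ 0 := by linarith
      rw [show p + 1 - 2 = p - 1 by ring]
      field_simp
    rw [hΦ]
    simp only
    rw [intervalIntegral.integral_eq_sub_of_hasDerivAt hd ((hgNc N).intervalIntegrable _ _)]
    simp [Real.zero_rpow (by linarith : p + 1 ≠ 0)]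
  have hid : ∀ N, ∫ z, Y z * gN N (u z) * D z = -∫ z, dirD d Y z * Φ N (u z) := fun N =>
    weak_chain_rule hu hD hw (hΦd N) (hgNc N) (M := |g N|)
      (fun s => hgmono _ _ ((abs_clampAt_le' (hN0 N) s).trans (le_abs_self _))) hY hc
  have hΦc : ∀ N, Continuous (Φ N) := fun N =>
    continuous_iff_continuousAt.2 fun s => (hΦd N s).continuousAt
  have T1 : Tendsto (fun N => ∫ z, Y z * gN N (u z) * D z) atTop
      (𝓝 (∫ z, Y z * g (u z) * D z)) := by
    refine tendsto_integral_of_dominated_convergence (fun z => |Y z * g (u z) * D z|)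
      (fun N => (hY.continuous.aestronglyMeasurable.mul
        ((hgNc N).comp_aestronglyMeasurable hum)).mul hDm) h1.abs
      (fun N => ae_of_all _ fun z => ?_) (ae_of_all _ fun z => ?_)
    · rw [Real.norm_eq_abs, abs_mul _ (D z), abs_mul (Y z), abs_mul _ (D z), abs_mul (Y z)]
      exact mul_le_mul_of_nonneg_right (mul_le_mul_of_nonneg_left (hgNle N _) (abs_nonneg _))
        (abs_nonneg _)
    · refine tendsto_const_nhds.congr' ?_
      filter_upwards [eventually_ge_atTop (Nat.ceil |u z|)] with N hN
      rw [hgN]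
      simp only [clampAt_eq ((Nat.le_ceil |u z|).trans (by exact_mod_cast hN : _ ≤ (N : ℝ)))]
  have T2 : Tendsto (fun N => ∫ z, dirD d Y z * Φ N (u z)) atTop
      (𝓝 (∫ z, dirD d Y z * (|u z| ^ (p + 1) / (p + 1)))) := by
    refine tendsto_integral_of_dominated_convergence (fun z => |dirD d Y z * |u z| ^ (p + 1)|)
      (fun N => (dirD_contDiff hY d).continuous.aestronglyMeasurable.mul
        ((hΦc N).comp_aestronglyMeasurable hum)) h2.abs
      (fun N => ae_of_all _ fun z => ?_) (ae_of_all _ fun z => ?_)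
    · rw [Real.norm_eq_abs, abs_mul (dirD d Y z), abs_mul (dirD d Y z)]
      exact mul_le_mul_of_nonneg_left ((hΦle N _).trans (le_abs_self _)) (abs_nonneg _)
    · refine Tendsto.const_mul _ (tendsto_const_nhds.congr' ?_)
      filter_upwards [hΦlim (u z)] with N hN using hN.symm
  simp only [hid] at T1
  have hu' := tendsto_nhds_unique T1 T2.neg
  rw [hu', neg_div, ← integral_div]
  congr 2 with z
  ring

end ChainRule

/-! ### The Sobolev and Hardy inequalities. -/

/-- The standard basis vectors of `ℝ³`. -/
abbrev eb (i : Fin 3) : E3 := EuclideanSpace.single i (1 : ℝ)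

theorem inner_eb (x : E3) (i : Fin 3) : inner ℝ x (eb i) = x i := by
  simp [EuclideanSpace.inner_single_right]

theorem norm_sq_eq_sum (x : E3) : ‖x‖ ^ 2 = ∑ i, x i ^ 2 := by
  rw [EuclideanSpace.norm_sq_eq]; simp

theorem enorm_fderiv_le_sum (φ : E3 → ℝ) (x : E3) :
    ‖fderiv ℝ φ x‖ ≤ ‖∑ i, ‖dirD (eb i) φ x‖‖ := by
  rw [Real.norm_of_nonneg (by positivity)]
  refine ContinuousLinearMap.opNorm_le_bound _ (by positivity) fun y => ?_
  have hy : y = ∑ i, y i • eb i := by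
    ext j
    simp [eb, Finset.sum_apply, Pi.single_apply]
  conv_lhs => rw [hy]
  rw [map_sum, Finset.sum_mul]
  refine (norm_sum_le _ _).trans (Finset.sum_le_sum fun i _ => ?_)
  rw [map_smul, norm_smul, mul_comm]
  exact mul_le_mul_of_nonneg_left (PiLp.norm_apply_le y i) (norm_nonneg _)

/-- The factor 1 gives the statement the shape, weight times function, that `weak_bound` extends to
weakly differentiable functions. -/
theorem sobolev_smooth : ∃ C : ℝ≥0∞, C ≠ ⊤ ∧ ∀ φ : E3 → ℝ, ContDiff ℝ ∞ φ → HasCompactSupport φ →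
    eLpNorm (fun x => 1 * φ x) 6 volume ≤ C * ∑ i, eLpNorm (dirD (eb i) φ) 2 volume := by
  refine ⟨SNormLESNormFDerivOfEqConst ℝ (volume : Measure E3) 2, by simp, fun φ hφ hc => ?_⟩
  have h := eLpNorm_le_eLpNorm_fderiv_of_eq (F := ℝ) (volume : Measure E3)
    (hφ.of_le (by norm_cast)) hc (p := 2) (p' := 6) (by norm_num) (by simp) (by simp; norm_num)
  simp only [one_mul]
  refine h.trans (mul_le_mul_right ?_ _)
  calc eLpNorm (fderiv ℝ φ) (2 : NNReal) volume
      ≤ eLpNorm (∑ i, fun x => ‖dirD (eb i) φ x‖) 2 volume := by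
        refine eLpNorm_mono fun x => ?_
        simpa using enorm_fderiv_le_sum φ x
    _ ≤ ∑ i, eLpNorm (fun x => ‖dirD (eb i) φ x‖) 2 volume :=
        eLpNorm_sum_le (fun i _ => (dirD_contDiff hφ _).continuous.norm.aestronglyMeasurable)
          (by norm_num)
    _ = _ := by simp only [eLpNorm_norm]

/-- With h = 1/(|x|²+δ) and the smooth field H = x h, expand 0 ≤ ∫|∇φ + φH/2|² and integrate the
cross term by parts, using div H = 3h - 2|x|²h². The parameter δ removes the singularity at the
origin and does not enter the constant. -/
theorem hardy_smooth_aux {δ : ℝ} (hδ : 0 < δ) {φ : E3 → ℝ} (hφ : ContDiff ℝ ∞ φ)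
    (hc : HasCompactSupport φ) :
    ∫ x, φ x ^ 2 / (‖x‖ ^ 2 + δ) ≤ 4 * ∑ i, ∫ x, dirD (eb i) φ x ^ 2 := by
  set h : E3 → ℝ := fun x => (‖x‖ ^ 2 + δ)⁻¹ with hh
  have hpos : ∀ x : E3, 0 < ‖x‖ ^ 2 + δ := fun x => by positivity
  have hs : ContDiff ℝ ∞ h := ((contDiff_norm_sq ℝ).add contDiff_const).inv fun x => (hpos x).ne'
  have hhpos : ∀ x, 0 < h x := fun x => inv_pos.2 (hpos x)
  have hco : ∀ i : Fin 3, ContDiff ℝ ∞ fun x : E3 => x i := fun i => by fun_prop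
  have hdco : ∀ (i : Fin 3) (x : E3), dirD (eb i) (fun x : E3 => x i) x = 1 := by
    intro i x
    have : HasFDerivAt (fun x : E3 => x i) (EuclideanSpace.proj i : E3 →L[ℝ] ℝ) x :=
      (EuclideanSpace.proj i : E3 →L[ℝ] ℝ).hasFDerivAt
    rw [dirD, this.fderiv]
    simp
  have hdh : ∀ (i : Fin 3) (x : E3), dirD (eb i) h x = -(2 * x i * h x ^ 2) := by
    intro i x
    have h1 : HasFDerivAt (fun x : E3 => ‖x‖ ^ 2 + δ) (2 • innerSL ℝ x) x :=
      (hasStrictFDerivAt_norm_sq x).hasFDerivAt.add_const δ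
    have h2 := (hasDerivAt_inv (hpos x).ne').comp_hasFDerivAt x h1
    have h3 : fderiv ℝ h x = _ := h2.fderiv
    rw [dirD, h3]
    simp only [smul_apply, innerSL_apply_apply, inner_eb, smul_eq_mul, hh,
      nsmul_eq_mul]
    rw [inv_pow]; push_cast; ring
  set H : Fin 3 → E3 → ℝ := fun i x => x i * h x with hH
  have hHs : ∀ i, ContDiff ℝ ∞ (H i) := fun i => (hco i).mul hs
  have hdH : ∀ i x, dirD (eb i) (H i) x = h x - 2 * x i ^ 2 * h x ^ 2 := by
    intro i x
    rw [hH]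
    simp only
    rw [dirD_mul (hco i) hs, hdco, hdh]; ring
  have hφ2 : HasCompactSupport fun x => φ x * φ x := hc.mul_left
  have hibp : ∀ i, ∫ x, (h x - 2 * x i ^ 2 * h x ^ 2) * (φ x * φ x) =
      -∫ x, H i x * (2 * φ x * dirD (eb i) φ x) := by
    intro i
    have := integral_dirD_mul (hHs i) (hφ.mul hφ) hφ2 (eb i)
    simp only [hdH] at this
    rw [this]
    congr 2 with x
    rw [dirD_mul hφ hφ]; ring
  have hcs : ∀ k : E3 → ℝ, Continuous k → Integrable fun x => k x * (φ x * φ x) := fun k hk =>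
    (hk.mul (hφ.continuous.mul hφ.continuous)).integrable_of_hasCompactSupport hφ2.mul_left
  have hdc : ∀ i, Continuous (dirD (eb i) φ) := fun i => (dirD_contDiff hφ _).continuous
  have i1 : ∀ i, Integrable fun x => dirD (eb i) φ x ^ 2 := fun i =>
    ((hdc i).pow 2).integrable_of_hasCompactSupport (by
      simp only [pow_two]
      exact (dirD_hasCompactSupport hc (eb i)).mul_left)
  have i2 : ∀ i, Integrable fun x => H i x * (2 * φ x * dirD (eb i) φ x) := fun i =>
    ((hHs i).continuous.mul ((continuous_const.mul hφ.continuous).mul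
      (hdc i))).integrable_of_hasCompactSupport
      ((dirD_hasCompactSupport hc (eb i)).mul_left.mul_left)
  have i3 : ∀ i, Integrable fun x => (h x - 2 * x i ^ 2 * h x ^ 2) * (φ x * φ x) := fun i =>
    hcs _ ((hs.continuous).sub ((continuous_const.mul ((hco i).continuous.pow 2)).mul
      (hs.continuous.pow 2)))
  have i4 : ∀ i, Integrable fun x => (x i ^ 2 * h x ^ 2) * (φ x * φ x) := fun i =>
    hcs _ (((hco i).continuous.pow 2).mul (hs.continuous.pow 2))
  have hsq : ∀ i, 0 ≤ (∫ x, dirD (eb i) φ x ^ 2) +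
      1 / 2 * (∫ x, H i x * (2 * φ x * dirD (eb i) φ x)) +
      1 / 4 * ∫ x, (x i ^ 2 * h x ^ 2) * (φ x * φ x) := by
    intro i
    have i12 : Integrable fun x => dirD (eb i) φ x ^ 2 +
        1 / 2 * (H i x * (2 * φ x * dirD (eb i) φ x)) := (i1 i).add ((i2 i).const_mul _)
    rw [← integral_const_mul, ← integral_const_mul, ← integral_add (i1 i) ((i2 i).const_mul _),
      ← integral_add i12 ((i4 i).const_mul _)]
    refine integral_nonneg fun x => ?_
    have : 0 ≤ (dirD (eb i) φ x + 1 / 2 * φ x * H i x) ^ 2 := sq_nonneg _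
    simp only [hH, Pi.zero_apply] at this ⊢
    nlinarith [this]
  -- Summed over the three coordinates, this is h ≤ 6h - 5|x|²h² times φ², that is, |x|²h ≤ 1.
  have hpt : ∀ x, φ x ^ 2 / (‖x‖ ^ 2 + δ) ≤
      ∑ i, (2 * ((h x - 2 * x i ^ 2 * h x ^ 2) * (φ x * φ x)) -
        (x i ^ 2 * h x ^ 2) * (φ x * φ x)) := by
    intro x
    have e1 : ‖x‖ ^ 2 * h x ≤ 1 := by
      rw [hh]; simp only
      rw [← div_eq_mul_inv, div_le_one (hpos x)]; linarith
    have e2 : ‖x‖ ^ 2 = x 0 ^ 2 + x 1 ^ 2 + x 2 ^ 2 := by rw [norm_sq_eq_sum, Fin.sum_univ_three]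
    have e3 : ‖x‖ ^ 2 * h x * (h x * φ x ^ 2) ≤ 1 * (h x * φ x ^ 2) :=
      mul_le_mul_of_nonneg_right e1 (mul_nonneg (hhpos x).le (sq_nonneg _))
    have e4 : φ x ^ 2 / (‖x‖ ^ 2 + δ) = h x * φ x ^ 2 := by rw [hh, div_eq_mul_inv, mul_comm]
    rw [e4, Fin.sum_univ_three]
    rw [e2] at e3
    nlinarith [e3]
  have i34 : ∀ i, Integrable fun x => 2 * ((h x - 2 * x i ^ 2 * h x ^ 2) * (φ x * φ x)) -
      (x i ^ 2 * h x ^ 2) * (φ x * φ x) := fun i => ((i3 i).const_mul 2).sub (i4 i)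
  have hfin : Integrable fun x => ∑ i : Fin 3, (2 * ((h x - 2 * x i ^ 2 * h x ^ 2) * (φ x * φ x)) -
        (x i ^ 2 * h x ^ 2) * (φ x * φ x)) :=
    integrable_finsetSum _ fun i _ => i34 i
  have hl : Integrable fun x => φ x ^ 2 / (‖x‖ ^ 2 + δ) := by
    refine (hcs h hs.continuous).congr (ae_of_all _ fun x => ?_)
    rw [hh]; simp only; rw [div_eq_mul_inv]; ring
  refine (integral_mono hl hfin hpt).trans ?_
  rw [integral_finsetSum _ fun i _ => i34 i, Finset.mul_sum]
  refine Finset.sum_le_sum fun i _ => ?_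
  rw [integral_sub ((i3 i).const_mul 2) (i4 i), integral_const_mul, hibp]
  linarith [hsq i]

theorem lintegral_sq_enorm_eq {α : Type*} [MeasurableSpace α] {ν : Measure α} (f : α → ℝ) :
    eLpNorm f 2 ν = (∫⁻ x, ENNReal.ofReal (f x ^ 2) ∂ν) ^ (1 / 2 : ℝ) := by
  have two : (2 : ℝ≥0∞).toReal = 2 := by norm_num
  rw [eLpNorm_eq_lintegral_rpow_enorm_toReal (by norm_num) (by norm_num), two]
  congr 2 with x
  rw [Real.enorm_eq_ofReal_abs, ENNReal.ofReal_rpow_of_nonneg (abs_nonneg _) (by norm_num)]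
  norm_num

theorem hardy_smooth (φ : E3 → ℝ) (hφ : ContDiff ℝ ∞ φ) (hc : HasCompactSupport φ) :
    eLpNorm (fun x => ‖x‖⁻¹ * φ x) 2 volume ≤ 2 * ∑ i, eLpNorm (dirD (eb i) φ) 2 volume := by
  -- Fatou's lemma as δ = 1/(n+1) tends to 0.
  have hfat : ∫⁻ x, ENNReal.ofReal ((‖x‖⁻¹ * φ x) ^ 2) ≤
      ENNReal.ofReal (4 * ∑ i, ∫ x, dirD (eb i) φ x ^ 2) := by
    have hmeas : ∀ n : ℕ, Measurable fun x : E3 =>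
        ENNReal.ofReal (φ x ^ 2 / (‖x‖ ^ 2 + 1 / ((n : ℝ) + 1))) := fun n =>
      (((hφ.continuous.measurable.pow_const 2).div
        ((measurable_norm.pow_const 2).add_const _))).ennreal_ofReal
    calc ∫⁻ x, ENNReal.ofReal ((‖x‖⁻¹ * φ x) ^ 2)
        ≤ ∫⁻ x, liminf (fun n : ℕ => ENNReal.ofReal (φ x ^ 2 / (‖x‖ ^ 2 + 1 / ((n : ℝ) + 1))))
          atTop := by
          gcongr with x
          rcases eq_or_ne x 0 with rfl | hx
          · simp
          have hx' : ‖x‖ ^ 2 + 0 ≠ 0 := by simpa using hx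
          have ht : Tendsto (fun n : ℕ => ENNReal.ofReal (φ x ^ 2 / (‖x‖ ^ 2 + 1 / ((n : ℝ) + 1))))
              atTop (𝓝 (ENNReal.ofReal (φ x ^ 2 / (‖x‖ ^ 2 + 0)))) :=
            ENNReal.tendsto_ofReal (tendsto_const_nhds.div
              (tendsto_const_nhds.add tendsto_one_div_add_atTop_nhds_zero_nat) hx')
          rw [ht.liminf_eq]
          apply le_of_eq
          congr 1
          rw [add_zero, mul_pow, inv_pow, div_eq_inv_mul]
      _ ≤ liminf (fun n : ℕ => ∫⁻ x, ENNReal.ofReal (φ x ^ 2 / (‖x‖ ^ 2 + 1 / ((n : ℝ) + 1))))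
          atTop := lintegral_liminf_le hmeas
      _ ≤ ENNReal.ofReal (4 * ∑ i, ∫ x, dirD (eb i) φ x ^ 2) := by
          refine liminf_le_of_le (by isBoundedDefault) fun b hb => ?_
          obtain ⟨n, hn⟩ := hb.exists
          refine hn.trans ?_
          rw [← ofReal_integral_eq_lintegral_ofReal]
          · exact ENNReal.ofReal_le_ofReal (hardy_smooth_aux (by positivity) hφ hc)
          · refine Continuous.integrable_of_hasCompactSupport
              ((hφ.continuous.pow 2).div ((continuous_norm.pow 2).add continuous_const)
                fun x => by positivity) ?_
            simp only [pow_two, div_eq_mul_inv]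
            exact (hc.mul_left).mul_right
          · exact ae_of_all _ fun x => by positivity
  have hdi : ∀ i, Integrable fun x => dirD (eb i) φ x ^ 2 := fun i =>
    ((dirD_contDiff hφ _).continuous.pow 2).integrable_of_hasCompactSupport (by
      simp only [pow_two]
      exact (dirD_hasCompactSupport hc (eb i)).mul_left)
  have hcomp : ∀ i, eLpNorm (dirD (eb i) φ) 2 volume =
      (ENNReal.ofReal (∫ x, dirD (eb i) φ x ^ 2)) ^ (1 / 2 : ℝ) := by
    intro i
    rw [lintegral_sq_enorm_eq, ofReal_integral_eq_lintegral_ofReal (hdi i)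
      (ae_of_all _ fun x => sq_nonneg _)]
  rw [lintegral_sq_enorm_eq]
  simp only [hcomp]
  have hnn : ∀ i, 0 ≤ ∫ x, dirD (eb i) φ x ^ 2 := fun i => integral_nonneg fun x => sq_nonneg _
  calc _ ≤ (ENNReal.ofReal (4 * ∑ i, ∫ x, dirD (eb i) φ x ^ 2)) ^ (1 / 2 : ℝ) := by gcongr
    _ = 2 * (∑ i, ENNReal.ofReal (∫ x, dirD (eb i) φ x ^ 2)) ^ (1 / 2 : ℝ) := by
        rw [ENNReal.ofReal_mul (by norm_num), ENNReal.mul_rpow_of_nonneg _ _ (by norm_num),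
          ENNReal.ofReal_sum_of_nonneg fun i _ => hnn i]
        congr 1
        rw [ENNReal.ofReal_rpow_of_nonneg (by norm_num) (by norm_num),
          show (4 : ℝ) = 2 ^ (2 : ℝ) by norm_num, ← Real.rpow_mul (by norm_num)]
        norm_num
    _ ≤ _ := by
        gcongr
        simp only [Fin.sum_univ_three]
        refine (ENNReal.rpow_add_le_add_rpow _ _ (by norm_num) (by norm_num)).trans ?_
        gcongr
        exact ENNReal.rpow_add_le_add_rpow _ _ (by norm_num) (by norm_num)

/-- Mollifications are test functions whose derivatives have no larger L² norm; Fatou's lemma passes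
to the limit on the left. -/
theorem weak_bound_of_hasCompactSupport {w : E3 → ℝ} (hw : Measurable w) {q C : ℝ≥0∞}
    (hsm : ∀ φ : E3 → ℝ, ContDiff ℝ ∞ φ → HasCompactSupport φ →
      eLpNorm (fun x => w x * φ x) q volume ≤ C * ∑ i, eLpNorm (dirD (eb i) φ) 2 volume)
    {f : E3 → ℝ} {D : Fin 3 → E3 → ℝ} (hf : LocallyIntegrable f volume)
    (hcs : HasCompactSupport f) (hD : ∀ i, AEStronglyMeasurable (D i) volume)
    (hweak : ∀ i, ∀ ψ : E3 → ℝ, ContDiff ℝ ∞ ψ → HasCompactSupport ψ →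
      ∫ x, f x * fderiv ℝ ψ x (eb i) = -∫ x, D i x * ψ x) :
    eLpNorm (fun x => w x * f x) q volume ≤ C * ∑ i, eLpNorm (D i) 2 volume := by
  have hs := fun n => mollify_contDiff n hf
  have hb : ∀ n, eLpNorm (fun x => w x * mollify n f x) q volume ≤
      C * ∑ i, eLpNorm (D i) 2 volume := by
    intro n
    have hc : HasCompactSupport (mollify n f) :=
      (stdBump E3 n).hasCompactSupport_normed.convolution _ hcs
    refine (hsm _ (hs n) hc).trans (mul_le_mul_right (Finset.sum_le_sum fun i _ => ?_) _)
    have : dirD (eb i) (mollify n f) = mollify n (D i) := by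
      ext z; exact mollify_fderiv n hf (hweak i) z
    rw [this]
    exact eLpNorm_mollify_le n (hD i)
  refine (Lp.eLpNorm_lim_le_liminf_eLpNorm (f := fun n x => w x * mollify n f x) (fun n =>
    (hw.mul (hs n).continuous.measurable).aestronglyMeasurable) _ ?_).trans ?_
  · filter_upwards [mollify_ae_tendsto hf] with x hx using hx.const_mul _
  · exact liminf_le_of_le (by isBoundedDefault) fun b hb' => by
      obtain ⟨n, hn⟩ := hb'.exists
      exact hn.trans (hb n)

/-- Cutoff functions equal to `1` on the ball of radius `n + 1`. -/
def cutoff (n : ℕ) (x : E3) : ℝ :=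
  (⟨1, 2, one_pos, one_lt_two⟩ : ContDiffBump (0 : E3)) (((n : ℝ) + 1)⁻¹ • x)

theorem cutoff_contDiff (n : ℕ) : ContDiff ℝ ∞ (cutoff n) :=
  (ContDiffBump.contDiff _).comp (contDiff_id.const_smul _)

theorem cutoff_nonneg (n : ℕ) (x : E3) : 0 ≤ cutoff n x := ContDiffBump.nonneg _

theorem cutoff_le_one (n : ℕ) (x : E3) : cutoff n x ≤ 1 := ContDiffBump.le_one _

theorem norm_inv_smul_nat (n : ℕ) (x : E3) : ‖((n : ℝ) + 1)⁻¹ • x‖ = ‖x‖ / ((n : ℝ) + 1) := by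
  rw [norm_smul, norm_inv, Real.norm_of_nonneg (by positivity), div_eq_inv_mul]

theorem cutoff_eq_one {n : ℕ} {x : E3} (hx : ‖x‖ ≤ n + 1) : cutoff n x = 1 := by
  apply ContDiffBump.one_of_mem_closedBall
  rw [mem_closedBall_zero_iff, norm_inv_smul_nat]
  exact (div_le_one (by positivity)).2 hx

theorem cutoff_eq_zero {n : ℕ} {x : E3} (hx : 2 * ((n : ℝ) + 1) ≤ ‖x‖) : cutoff n x = 0 := by
  apply ContDiffBump.zero_of_le_dist
  rw [dist_zero_right, norm_inv_smul_nat]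
  exact (le_div_iff₀ (by positivity)).2 hx

theorem cutoff_hasCompactSupport (n : ℕ) : HasCompactSupport (cutoff n) :=
  HasCompactSupport.intro (isCompact_closedBall (0 : E3) (2 * ((n : ℝ) + 1))) fun x hx =>
    cutoff_eq_zero (by
      rw [mem_closedBall_zero_iff, not_le] at hx
      exact hx.le)

theorem dirD_cutoff_eq_zero {n : ℕ} {x : E3} (hx : ‖x‖ < n + 1 ∨ 2 * ((n : ℝ) + 1) < ‖x‖)
    (d : E3) : dirD d (cutoff n) x = 0 := by
  rcases hx with hx | hx
  · have : cutoff n =ᶠ[𝓝 x] fun _ => 1 := by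
      filter_upwards [(isOpen_lt continuous_norm continuous_const).mem_nhds hx] with y hy
      exact cutoff_eq_one (le_of_lt hy)
    rw [dirD, this.fderiv_eq]; simp
  · have : cutoff n =ᶠ[𝓝 x] fun _ => 0 := by
      filter_upwards [(isOpen_lt continuous_const continuous_norm).mem_nhds hx] with y hy
      exact cutoff_eq_zero (le_of_lt hy)
    rw [dirD, this.fderiv_eq]; simp

theorem exists_dirD_cutoff_bound : ∃ M : ℝ, 0 ≤ M ∧ ∀ (n : ℕ) (x d : E3),
    |dirD d (cutoff n) x| ≤ M / ((n : ℝ) + 1) * ‖d‖ := by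
  set η : ContDiffBump (0 : E3) := ⟨1, 2, one_pos, one_lt_two⟩ with hη
  have hs : ContDiff ℝ ∞ η := η.contDiff
  obtain ⟨M, hM⟩ := (η.hasCompactSupport.fderiv ℝ).exists_bound_of_continuous
    (hs.continuous_fderiv (by simp))
  refine ⟨M, (norm_nonneg _).trans (hM 0), fun n x d => ?_⟩
  have hd : HasFDerivAt (cutoff n) _ x :=
    (hs.differentiable (by simp) (((n : ℝ) + 1)⁻¹ • x)).hasFDerivAt.comp x
      ((hasFDerivAt_id x).const_smul (((n : ℝ) + 1)⁻¹))
  rw [dirD, hd.fderiv]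
  simp only [ContinuousLinearMap.comp_apply, smul_apply, ContinuousLinearMap.id_apply, map_smul,
    smul_eq_mul, abs_mul]
  rw [abs_of_nonneg (by positivity), div_mul_eq_mul_div, inv_mul_eq_div]
  gcongr
  exact ((fderiv ℝ η _).le_opNorm d).trans (mul_le_mul_of_nonneg_right (hM _) (norm_nonneg _))

/-- Hölder's inequality with these exponents bounds the product of an L⁶ function and a cutoff
gradient in L². -/
instance holderTriple_six_three_two : ENNReal.HolderTriple 6 3 2 := ⟨by
  rw [← ENNReal.toReal_eq_toReal_iff' (by simp) (by simp), ENNReal.toReal_add (by simp) (by simp)]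
  simp only [ENNReal.toReal_inv, ENNReal.toReal_ofNat]
  norm_num⟩

theorem tendsto_eLpNorm_indicator_compl_ball {f : E3 → ℝ} (hf : MemLp f 6 volume) :
    Tendsto (fun n : ℕ => eLpNorm ({x : E3 | (n : ℝ) + 1 ≤ ‖x‖}.indicator f) 6 volume) atTop
      (𝓝 0) := by
  have six : (6 : ℝ≥0∞).toReal = 6 := by norm_num
  have hms : ∀ n : ℕ, MeasurableSet {x : E3 | (n : ℝ) + 1 ≤ ‖x‖} := fun n =>
    measurableSet_le measurable_const measurable_norm
  simp only [eLpNorm_eq_lintegral_rpow_enorm_toReal (by norm_num : (6 : ℝ≥0∞) ≠ 0)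
    (by norm_num : (6 : ℝ≥0∞) ≠ ⊤), six]
  have h1 : Tendsto (fun n : ℕ => ∫⁻ x, ‖{x : E3 | (n : ℝ) + 1 ≤ ‖x‖}.indicator f x‖ₑ ^ (6 : ℝ))
      atTop (𝓝 (∫⁻ _ : E3, 0)) := by
    refine tendsto_lintegral_of_dominated_convergence' (fun x => ‖f x‖ₑ ^ (6 : ℝ))
      (fun n => (hf.1.indicator (hms n)).enorm.pow_const _) (fun n => ae_of_all _ fun x =>
        ENNReal.rpow_le_rpow (enorm_indicator_le_enorm_self _ _) (by norm_num)) ?_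
      (ae_of_all _ fun x => tendsto_const_nhds.congr' ?_)
    · have := hf.2
      rw [eLpNorm_lt_top_iff_lintegral_rpow_enorm_lt_top (by norm_num) (by norm_num), six] at this
      exact this.ne
    · filter_upwards [eventually_ge_atTop (Nat.ceil ‖x‖)] with n hn
      have : x ∉ {x : E3 | (n : ℝ) + 1 ≤ ‖x‖} := by
        have h2 : ‖x‖ ≤ n := (Nat.le_ceil ‖x‖).trans (by exact_mod_cast hn)
        simp only [mem_ofPred_eq, not_le]; linarith
      rw [indicator_of_notMem this]; simp
  have h2 := ((ENNReal.continuous_rpow_const (y := (1 / 6 : ℝ))).tendsto _).comp h1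
  simpa [Function.comp_def] using h2

/-- The cutoff gradient is O(1/n) on a ball of volume O(n³), hence bounded in L³, and it vanishes
for |x| < n+1. The L⁶ tail of `f` does the rest. -/
theorem tendsto_eLpNorm_mul_dirD_cutoff {f : E3 → ℝ} (hf : MemLp f 6 volume) (i : Fin 3) :
    Tendsto (fun n : ℕ => eLpNorm (fun x => f x * dirD (eb i) (cutoff n) x) 2 volume) atTop
      (𝓝 0) := by
  obtain ⟨M, hM0, hM⟩ := exists_dirD_cutoff_bound
  set A : ℝ≥0∞ := ENNReal.ofReal (2 * M) * volume (Metric.ball (0 : E3) 1) ^ (1 / 3 : ℝ) with hA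
  have hAt : A ≠ ⊤ := ENNReal.mul_ne_top ENNReal.ofReal_ne_top
    (ENNReal.rpow_ne_top_of_nonneg (by norm_num) measure_ball_lt_top.ne)
  have hms : ∀ n : ℕ, MeasurableSet {x : E3 | (n : ℝ) + 1 ≤ ‖x‖} := fun n =>
    measurableSet_le measurable_const measurable_norm
  have h3 : ∀ n : ℕ, eLpNorm (dirD (eb i) (cutoff n)) 3 volume ≤ A := by
    intro n
    have hpt : ∀ x, ‖dirD (eb i) (cutoff n) x‖ ≤
        ‖(Metric.closedBall (0 : E3) (2 * ((n : ℝ) + 1))).indicator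
          (fun _ => M / ((n : ℝ) + 1)) x‖ := by
      intro x
      by_cases hx : x ∈ Metric.closedBall (0 : E3) (2 * ((n : ℝ) + 1))
      · rw [indicator_of_mem hx, Real.norm_of_nonneg (by positivity : 0 ≤ M / ((n : ℝ) + 1))]
        simpa [eb] using hM n x (eb i)
      · rw [mem_closedBall_zero_iff, not_le] at hx
        rw [dirD_cutoff_eq_zero (Or.inr hx), norm_zero]
        exact norm_nonneg _
    refine (eLpNorm_mono hpt).trans ?_
    rw [eLpNorm_indicator_const Metric.isClosed_closedBall.measurableSet (by norm_num)
      (by norm_num), Measure.addHaar_closedBall _ _ (by positivity), finrank_euclideanSpace_fin,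
      Real.enorm_eq_ofReal (by positivity), ENNReal.mul_rpow_of_nonneg _ _ (by positivity),
      ENNReal.ofReal_rpow_of_nonneg (by positivity) (by positivity), ← mul_assoc,
      ← ENNReal.ofReal_mul (by positivity)]
    apply le_of_eq
    rw [hA]
    have three : (3 : ℝ≥0∞).toReal = 3 := by norm_num
    rw [three]
    congr 2
    rw [← Real.rpow_natCast, ← Real.rpow_mul (by positivity)]
    norm_num
    field_simp
  have hle : ∀ n : ℕ, eLpNorm (fun x => f x * dirD (eb i) (cutoff n) x) 2 volume ≤
      eLpNorm ({x : E3 | (n : ℝ) + 1 ≤ ‖x‖}.indicator f) 6 volume * A := by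
    intro n
    have e : (fun x => f x * dirD (eb i) (cutoff n) x) =
        ({x : E3 | (n : ℝ) + 1 ≤ ‖x‖}.indicator f) • dirD (eb i) (cutoff n) := by
      ext x
      by_cases hx : x ∈ {x : E3 | (n : ℝ) + 1 ≤ ‖x‖}
      · simp only [Pi.smul_apply', indicator_of_mem hx, smul_eq_mul]
      · have hx' : ‖x‖ < n + 1 := not_le.1 hx
        simp only [Pi.smul_apply', indicator_of_notMem hx, smul_eq_mul,
          dirD_cutoff_eq_zero (Or.inl hx'), mul_zero]
    rw [e]
    exact (eLpNorm_smul_le_mul_eLpNorm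
      (dirD_contDiff (cutoff_contDiff n) _).continuous.aestronglyMeasurable
      (hf.1.indicator (hms n))).trans (mul_le_mul_right (h3 n) _)
  refine tendsto_of_tendsto_of_tendsto_of_le_of_le tendsto_const_nhds ?_ (fun _ => zero_le) hle
  simpa using ENNReal.Tendsto.mul_const (tendsto_eLpNorm_indicator_compl_ball hf) (Or.inr hAt)

/-- Apply the compactly supported case to `cutoff n` times `f`. The commutator term tends to 0
because f ∈ L⁶, and Fatou's lemma removes the cutoff. The factor 3 counts the coordinate
derivatives, each bounded by |g|. -/
theorem weak_bound {w : E3 → ℝ} (hw : Measurable w) {q C : ℝ≥0∞} (hC : C ≠ ⊤)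
    (hsm : ∀ φ : E3 → ℝ, ContDiff ℝ ∞ φ → HasCompactSupport φ →
      eLpNorm (fun x => w x * φ x) q volume ≤ C * ∑ i, eLpNorm (dirD (eb i) φ) 2 volume)
    {f : E3 → ℝ} {g : E3 → E3} (hf : MemLp f 6 volume) (hg : MemLp g 2 volume)
    (hweak : HasWeakGradient f g) :
    eLpNorm (fun x => w x * f x) q volume ≤ C * (3 * eLpNorm g 2 volume) := by
  have hfl : LocallyIntegrable f volume := hf.locallyIntegrable (by norm_num)
  set D : Fin 3 → E3 → ℝ := fun i x => inner ℝ (g x) (eb i) with hDdef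
  have hDm : ∀ i, MemLp (D i) 2 volume := fun i => by
    refine hg.mono (hg.1.inner aestronglyMeasurable_const) (ae_of_all _ fun x => ?_)
    refine (norm_inner_le_norm _ _).trans (by simp [eb])
  have hDl : ∀ i, LocallyIntegrable (D i) volume := fun i => (hDm i).locallyIntegrable (by norm_num)
  have hDle : ∀ i, eLpNorm (D i) 2 volume ≤ eLpNorm g 2 volume := fun i =>
    eLpNorm_mono fun x => (norm_inner_le_norm _ _).trans (by simp [eb])
  set fn : ℕ → E3 → ℝ := fun n x => cutoff n x * f x with hfn
  set Dn : ℕ → Fin 3 → E3 → ℝ := fun n i x =>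
    cutoff n x * D i x + f x * dirD (eb i) (cutoff n) x with hDn
  have hcc := fun n => (cutoff_contDiff n).continuous
  have hbd : ∀ n, eLpNorm (fun x => w x * fn n x) q volume ≤
      C * ∑ i, (eLpNorm g 2 volume +
        eLpNorm (fun x => f x * dirD (eb i) (cutoff n) x) 2 volume) := by
    intro n
    have hdc := fun i => (dirD_contDiff (cutoff_contDiff n) (eb i)).continuous
    have m1 : ∀ i, AEStronglyMeasurable (fun x => cutoff n x * D i x) volume := fun i =>
      (hcc n).aestronglyMeasurable.mul (hDm i).1
    have m2 : ∀ i, AEStronglyMeasurable (fun x => f x * dirD (eb i) (cutoff n) x) volume :=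
      fun i => hf.1.mul (hdc i).aestronglyMeasurable
    refine (weak_bound_of_hasCompactSupport hw hsm (f := fn n) (D := Dn n) ?_ ?_ ?_ ?_).trans
      (mul_le_mul_right (Finset.sum_le_sum fun i _ => ?_) _)
    · exact (hfl.integrable_smul_left_of_hasCompactSupport (hcc n)
        (cutoff_hasCompactSupport n)).locallyIntegrable
    · exact (cutoff_hasCompactSupport n).mul_right
    · exact fun i => (m1 i).add (m2 i)
    · intro i ψ hψ hψc
      have hχψ : ContDiff ℝ ∞ fun x => cutoff n x * ψ x := (cutoff_contDiff n).mul hψ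
      have h1 := hweak _ hχψ (hψc.mul_left) (eb i)
      have e1 : ∀ x, f x * fderiv ℝ (fun x => cutoff n x * ψ x) x (eb i) =
          f x * dirD (eb i) (cutoff n) x * ψ x + fn n x * fderiv ℝ ψ x (eb i) := by
        intro x
        have := dirD_mul (cutoff_contDiff n) hψ (eb i) x
        rw [dirD] at this
        rw [this, hfn]; simp only [dirD]; ring
      have j1 : Integrable fun x => f x * dirD (eb i) (cutoff n) x * ψ x := by
        refine (hfl.integrable_smul_right_of_hasCompactSupport ((hdc i).mul hψ.continuous)
          hψc.mul_left).congr (ae_of_all _ fun x => ?_)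
        simp only [smul_eq_mul, Pi.mul_apply]; ring
      have j2 : Integrable fun x => fn n x * fderiv ℝ ψ x (eb i) := by
        refine (hfl.integrable_smul_right_of_hasCompactSupport
          ((hcc n).mul (dirD_contDiff hψ (eb i)).continuous)
          (dirD_hasCompactSupport hψc (eb i)).mul_left).congr (ae_of_all _ fun x => ?_)
        simp only [smul_eq_mul, hfn, Pi.mul_apply, dirD]; ring
      have j3 : Integrable fun x => D i x * (cutoff n x * ψ x) :=
        (hDl i).integrable_smul_right_of_hasCompactSupport ((hcc n).mul hψ.continuous)
          hψc.mul_left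
      simp only [e1] at h1
      rw [integral_add j1 j2] at h1
      have e2 : ∀ x, Dn n i x * ψ x =
          D i x * (cutoff n x * ψ x) + f x * dirD (eb i) (cutoff n) x * ψ x := by
        intro x; rw [hDn]; ring
      simp only [e2]
      rw [integral_add j3 j1]
      linarith
    · refine (eLpNorm_add_le (m1 i) (m2 i) (by norm_num)).trans (add_le_add_left ?_ _)
      refine (eLpNorm_mono fun x => ?_).trans (hDle i)
      rw [norm_mul, Real.norm_of_nonneg (cutoff_nonneg n x)]
      exact mul_le_of_le_one_left (norm_nonneg _) (cutoff_le_one n x)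
  refine (Lp.eLpNorm_lim_le_liminf_eLpNorm (f := fun n x => w x * fn n x) (fun n =>
    hw.aestronglyMeasurable.mul ((hcc n).aestronglyMeasurable.mul hf.1)) _ ?_).trans ?_
  · refine ae_of_all _ fun x => tendsto_const_nhds.congr' ?_
    filter_upwards [eventually_ge_atTop (Nat.ceil ‖x‖)] with n hn
    have h2 : ‖x‖ ≤ n := (Nat.le_ceil ‖x‖).trans (by exact_mod_cast hn)
    rw [hfn]; simp only; rw [cutoff_eq_one (by linarith), one_mul]
  · have hlim : Tendsto (fun n => C * ∑ i : Fin 3, (eLpNorm g 2 volume +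
        eLpNorm (fun x => f x * dirD (eb i) (cutoff n) x) 2 volume)) atTop
        (𝓝 (C * ∑ _i : Fin 3, (eLpNorm g 2 volume + 0))) :=
      ENNReal.Tendsto.const_mul (tendsto_finsetSum _ fun i _ =>
        tendsto_const_nhds.add (tendsto_eLpNorm_mul_dirD_cutoff hf i)) (Or.inr hC)
    calc _ ≤ liminf (fun n => C * ∑ i : Fin 3, (eLpNorm g 2 volume +
        eLpNorm (fun x => f x * dirD (eb i) (cutoff n) x) 2 volume)) atTop :=
          liminf_le_liminf (Eventually.of_forall hbd)
      _ = _ := by rw [hlim.liminf_eq]; simp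

theorem exists_sobolev : ∃ C : ℝ≥0∞, C ≠ ⊤ ∧ ∀ (f : E3 → ℝ) (g : E3 → E3), MemLp f 6 volume →
    MemLp g 2 volume → HasWeakGradient f g →
      eLpNorm f 6 volume ≤ C * eLpNorm g 2 volume := by
  obtain ⟨C, hC, h⟩ := sobolev_smooth
  refine ⟨C * 3, ENNReal.mul_ne_top hC (by norm_num), fun f g hf hg hw => ?_⟩
  have := weak_bound (w := fun _ => 1) measurable_const hC h hf hg hw
  simpa [mul_assoc] using this

theorem hardy {f : E3 → ℝ} {g : E3 → E3} (hf : MemLp f 6 volume)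
    (hg : MemLp g 2 volume) (hw : HasWeakGradient f g) :
    eLpNorm (fun x => ‖x‖⁻¹ * f x) 2 volume ≤ 6 * eLpNorm g 2 volume := by
  have := weak_bound (w := fun x => ‖x‖⁻¹) measurable_norm.inv (by norm_num) hardy_smooth hf hg hw
  rwa [← mul_assoc, show (2 : ℝ≥0∞) * 3 = 6 by norm_num] at this

/-! ### Regularity of energy solutions. -/

theorem continuous_eLpNorm_curve {α F : Type*} [MeasurableSpace α] [NormedAddCommGroup F]
    {ν : Measure α} {q : ℝ≥0∞} (hq : 1 ≤ q) {f : ℝ → α → F} (hf : ∀ t, MemLp (f t) q ν)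
    (hc : ∀ t₀, Tendsto (fun t => eLpNorm (f t - f t₀) q ν) (𝓝 t₀) (𝓝 0)) :
    Continuous fun t => eLpNorm (f t) q ν := by
  rw [continuous_iff_continuousAt]
  intro t₀
  have hup : Tendsto (fun t => eLpNorm (f t₀) q ν + eLpNorm (f t - f t₀) q ν) (𝓝 t₀)
      (𝓝 (eLpNorm (f t₀) q ν)) := by
    simpa using tendsto_const_nhds.add (hc t₀)
  have hlo : Tendsto (fun t => eLpNorm (f t₀) q ν - eLpNorm (f t - f t₀) q ν) (𝓝 t₀)
      (𝓝 (eLpNorm (f t₀) q ν)) := by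
    simpa using ENNReal.Tendsto.sub tendsto_const_nhds (hc t₀) (Or.inl (hf t₀).2.ne)
  refine tendsto_of_tendsto_of_tendsto_of_le_of_le hlo hup (fun t => ?_) (fun t => ?_)
  · simp only
    rw [tsub_le_iff_right]
    calc eLpNorm (f t₀) q ν = eLpNorm (f t - (f t - f t₀)) q ν := by simp
      _ ≤ _ := eLpNorm_sub_le (hf t).1 ((hf t).sub (hf t₀)).1 hq
  · calc eLpNorm (f t) q ν = eLpNorm (f t₀ + (f t - f t₀)) q ν := by simp
      _ ≤ _ := eLpNorm_add_le (hf t₀).1 ((hf t).sub (hf t₀)).1 hq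

theorem exists_bound_eLpNorm_curve {α F : Type*} [MeasurableSpace α] [NormedAddCommGroup F]
    {ν : Measure α} {q : ℝ≥0∞} (hq : 1 ≤ q) {f : ℝ → α → F} (hf : ∀ t, MemLp (f t) q ν)
    (hc : ∀ t₀, Tendsto (fun t => eLpNorm (f t - f t₀) q ν) (𝓝 t₀) (𝓝 0)) (R : ℝ) :
    ∃ C : ℝ≥0∞, C ≠ ⊤ ∧ ∀ t ∈ Icc (-R) R, eLpNorm (f t) q ν ≤ C := by
  rcases (Icc (-R) R).eq_empty_or_nonempty with h | h
  · exact ⟨0, by simp, by simp [h]⟩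
  · obtain ⟨t, _, ht⟩ := isCompact_Icc.exists_isMaxOn h
      (continuous_eLpNorm_curve hq hf hc).continuousOn
    exact ⟨_, (hf t).2.ne, fun s hs => ht hs⟩

/-- Used for the difference of two times: Sobolev and Hardy then turn L² continuity of the gradient
into continuity of u in L⁶ and of u/|x| in L². -/
theorem HasWeakGradient.sub {f f' : E3 → ℝ} {g g' : E3 → E3} (hf : MemLp f 6 volume)
    (hf' : MemLp f' 6 volume) (hg : MemLp g 2 volume) (hg' : MemLp g' 2 volume)
    (h : HasWeakGradient f g) (h' : HasWeakGradient f' g') :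
    HasWeakGradient (f - f') (g - g') := by
  intro φ hφ hc e
  have l : ∀ k : E3 → ℝ, MemLp k 6 volume → Integrable fun x => k x * fderiv ℝ φ x e := by
    intro k hk
    exact (hk.locallyIntegrable (by norm_num)).integrable_smul_right_of_hasCompactSupport
      (dirD_contDiff hφ e).continuous (dirD_hasCompactSupport hc e)
  have r : ∀ k : E3 → E3, MemLp k 2 volume → Integrable fun x => inner ℝ (k x) e * φ x := by
    intro k hk
    have : MemLp (fun x => inner ℝ (k x) e) 2 volume :=
      (hk.norm.const_mul ‖e‖).mono (hk.1.inner aestronglyMeasurable_const)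
        (ae_of_all _ fun x => (norm_inner_le_norm _ _).trans (by
          rw [Real.norm_of_nonneg (by positivity), mul_comm]))
    exact (this.locallyIntegrable (by norm_num)).integrable_smul_right_of_hasCompactSupport
      hφ.continuous hc
  simp only [Pi.sub_apply, sub_mul, inner_sub_left]
  rw [integral_sub (l f hf) (l f' hf'), integral_sub (r g hg) (r g' hg'), h φ hφ hc e,
    h' φ hφ hc e]
  ring

theorem dirD_prod_left {φ : ℝ × E3 → ℝ} (hφ : ContDiff ℝ ∞ φ) (z : ℝ × E3) :
    deriv (fun s => φ (s, z.2)) z.1 = dirD ((1 : ℝ), (0 : E3)) φ z := by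
  have h1 : HasFDerivAt φ (fderiv ℝ φ z) (z.1, z.2) := (smooth_differentiable hφ z).hasFDerivAt
  have h2 : HasDerivAt (fun s : ℝ => (s, z.2)) ((1 : ℝ), (0 : E3)) z.1 :=
    (hasDerivAt_id z.1).prodMk (hasDerivAt_const z.1 z.2)
  exact (h1.comp_hasDerivAt z.1 h2).deriv

theorem dirD_prod_right {φ : ℝ × E3 → ℝ} (hφ : ContDiff ℝ ∞ φ) (e : E3) (t : ℝ) (x : E3) :
    dirD e (fun y => φ (t, y)) x = dirD ((0 : ℝ), e) φ (t, x) := by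
  have h1 : HasFDerivAt φ (fderiv ℝ φ (t, x)) (t, x) :=
    (smooth_differentiable hφ (t, x)).hasFDerivAt
  have h2 : HasFDerivAt (fun y : E3 => (t, y)) (ContinuousLinearMap.inr ℝ ℝ E3) x :=
    hasFDerivAt_prodMk_right t x
  have h3 : fderiv ℝ (fun y => φ (t, y)) x = _ := (h1.comp x h2).fderiv
  rw [dirD, h3]; rfl

theorem iteratedDeriv_two_eq {φ : ℝ × E3 → ℝ} (hφ : ContDiff ℝ ∞ φ) (z : ℝ × E3) :
    iteratedDeriv 2 (fun s => φ (s, z.2)) z.1 =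
      dirD ((1 : ℝ), (0 : E3)) (dirD ((1 : ℝ), (0 : E3)) φ) z := by
  have : iteratedDeriv 2 (fun s => φ (s, z.2)) = deriv (deriv fun s => φ (s, z.2)) := by
    rw [iteratedDeriv_succ, iteratedDeriv_one]
  rw [this, ← dirD_prod_left (dirD_contDiff hφ _)]
  congr 1
  ext s
  exact dirD_prod_left hφ (s, z.2)

theorem laplacian_eq_sum {φ : ℝ × E3 → ℝ} (hφ : ContDiff ℝ ∞ φ) (z : ℝ × E3) :
    Laplacian.laplacian (fun y => φ (z.1, y)) z.2 =
      ∑ i, dirD ((0 : ℝ), eb i) (dirD ((0 : ℝ), eb i) φ) z := by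
  have hs : ContDiff ℝ ∞ fun y => φ (z.1, y) := hφ.comp (contDiff_const.prodMk contDiff_id)
  rw [InnerProductSpace.laplacian_eq_iteratedFDeriv_orthonormalBasis _
    (EuclideanSpace.basisFun (Fin 3) ℝ)]
  refine Finset.sum_congr rfl fun i _ => ?_
  rw [iteratedFDeriv_two_apply]
  have hd : DifferentiableAt ℝ (fderiv ℝ fun y => φ (z.1, y)) z.2 :=
    (hs.fderiv_right (m := 1) (by norm_cast)).differentiable one_ne_zero z.2
  have h1 : dirD (eb i) (dirD (eb i) fun y => φ (z.1, y)) z.2 =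
      fderiv ℝ (fderiv ℝ fun y => φ (z.1, y)) z.2 (eb i) (eb i) := by
    have : dirD (eb i) (fun y => φ (z.1, y)) =
      fun x => fderiv ℝ (fun y => φ (z.1, y)) x (eb i) := rfl
    rw [dirD, this, fderiv_clm_apply hd (differentiableAt_const _)]
    simp
  have h2 : dirD (eb i) (fun y => φ (z.1, y)) = fun y => dirD ((0 : ℝ), eb i) φ (z.1, y) := by
    ext y; exact dirD_prod_right hφ _ _ _
  have h3 := dirD_prod_right (dirD_contDiff hφ ((0 : ℝ), eb i)) (eb i) z.1 z.2
  rw [h2, h3] at h1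
  simpa using h1.symm

theorem hasCompactSupport_slice {φ : ℝ × E3 → ℝ} (hc : HasCompactSupport φ) (t : ℝ) :
    HasCompactSupport fun x => φ (t, x) :=
  HasCompactSupport.intro (hc.isCompact.image continuous_snd) fun x hx =>
    image_eq_zero_of_notMem_tsupport fun h => hx ⟨(t, x), h, rfl⟩

/-- The four coordinate directions of space-time. -/
def waveDir : Option (Fin 3) → ℝ × E3
  | none => (1, 0)
  | some i => (0, eb i)

/-- The signature of the wave operator. -/
def waveSign : Option (Fin 3) → ℝ
  | none => 1
  | some _ => -1

/-- The derivative of a solution in a space-time direction. -/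
def stDeriv (ut : ℝ → E3 → ℝ) (gradu : ℝ → E3 → E3) (d z : ℝ × E3) : ℝ :=
  d.1 * ut z.1 z.2 + inner ℝ (gradu z.1 z.2) d.2

/-- The nonlinearity `-|u|^(p-1) u`. -/
def waveSource (p : ℝ) (u : ℝ → E3 → ℝ) (z : ℝ × E3) : ℝ := -(|u z.1 z.2| ^ (p - 1) * u z.1 z.2)

theorem lintegral_box_slice_le {F : Type*} [NormedAddCommGroup F] (f : ℝ × E3 → F) (R t : ℝ) :
    (∫⁻ x, (spaceTimeBox R).indicator (fun z => ‖f z‖ₑ) (t, x) ^ (2 : ℝ)) ^ (1 / 2 : ℝ) ≤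
      (Icc (-R) R).indicator
        (fun s => eLpNorm (fun x => f (s, x)) 2 (volume.restrict (Metric.closedBall 0 R))) t := by
  by_cases ht : t ∈ Icc (-R) R
  · rw [indicator_of_mem ht, eLpNorm_eq_lintegral_rpow_enorm_toReal (by norm_num) (by norm_num)]
    have two : (2 : ℝ≥0∞).toReal = 2 := by norm_num
    rw [two, ← lintegral_indicator Metric.isClosed_closedBall.measurableSet]
    gcongr with x
    by_cases hx : x ∈ Metric.closedBall (0 : E3) R
    · have : (t, x) ∈ spaceTimeBox R := ⟨ht, hx⟩
      rw [indicator_of_mem this, indicator_of_mem hx]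
    · have : (t, x) ∉ spaceTimeBox R := fun h => hx h.2
      rw [indicator_of_notMem this]; simp
  · have : ∀ x, (t, x) ∉ spaceTimeBox R := fun x h => ht h.1
    simp [indicator_of_notMem (this _), indicator_of_notMem ht]

theorem locLinftyL2_of_curve {f : ℝ × E3 → ℝ} (hm : AEStronglyMeasurable f volume)
    (h : ∀ R : ℝ, ∃ C : ℝ≥0∞, C ≠ ⊤ ∧ ∀ t ∈ Icc (-R) R,
      eLpNorm (fun x => f (t, x)) 2 (volume.restrict (Metric.closedBall 0 R)) ≤ C) :
    LocLinftyL2 f := by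
  refine ⟨hm, fun R => ?_⟩
  obtain ⟨C, hC, hb⟩ := h R
  refine ⟨C, hC, ae_of_all _ fun t => (lintegral_box_slice_le f R t).trans ?_⟩
  by_cases ht : t ∈ Icc (-R) R
  · rw [indicator_of_mem ht]; exact hb t ht
  · rw [indicator_of_notMem ht]; exact zero_le

namespace IsEnergySolution

variable {p : ℝ} {u ut : ℝ → E3 → ℝ} {gradu : ℝ → E3 → E3}

theorem hasWeakGradient_sub (hu : IsEnergySolution p u ut gradu) (t s : ℝ) :
    HasWeakGradient (u t - u s) (gradu t - gradu s) :=
  (hu.hasWeakGradient t).sub (hu.memLp_u t) (hu.memLp_u s) (hu.memLp_gradu t) (hu.memLp_gradu s)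
    (hu.hasWeakGradient s)

theorem continuous_u (hu : IsEnergySolution p u ut gradu) (t₀ : ℝ) :
    Tendsto (fun t => eLpNorm (u t - u t₀) 6 volume) (𝓝 t₀) (𝓝 0) := by
  obtain ⟨C, hC, h⟩ := exists_sobolev
  refine tendsto_of_tendsto_of_tendsto_of_le_of_le tendsto_const_nhds ?_ (fun _ => zero_le)
    (fun t => h _ _ ((hu.memLp_u t).sub (hu.memLp_u t₀)) ((hu.memLp_gradu t).sub
      (hu.memLp_gradu t₀)) (hu.hasWeakGradient_sub t t₀))
  simpa using ENNReal.Tendsto.const_mul (a := C) (hu.continuous_gradu t₀) (Or.inr hC)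

theorem memLp_hardy (hu : IsEnergySolution p u ut gradu) (t : ℝ) :
    MemLp (fun x => ‖x‖⁻¹ * u t x) 2 volume :=
  ⟨measurable_norm.inv.aestronglyMeasurable.mul (hu.memLp_u t).1,
    (hardy (hu.memLp_u t) (hu.memLp_gradu t) (hu.hasWeakGradient t)).trans_lt
      (ENNReal.mul_lt_top (by norm_num) (hu.memLp_gradu t).2)⟩

theorem continuous_hardy (hu : IsEnergySolution p u ut gradu) (t₀ : ℝ) :
    Tendsto (fun t => eLpNorm ((fun x => ‖x‖⁻¹ * u t x) - fun x => ‖x‖⁻¹ * u t₀ x) 2 volume)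
      (𝓝 t₀) (𝓝 0) := by
  refine tendsto_of_tendsto_of_tendsto_of_le_of_le tendsto_const_nhds ?_ (fun _ => zero_le)
    (fun t => ?_) (h := fun t => 6 * eLpNorm (gradu t - gradu t₀) 2 volume)
  · simpa using ENNReal.Tendsto.const_mul (a := 6) (hu.continuous_gradu t₀) (Or.inr (by norm_num))
  · refine le_trans (le_of_eq ?_) (hardy ((hu.memLp_u t).sub (hu.memLp_u t₀))
      ((hu.memLp_gradu t).sub (hu.memLp_gradu t₀)) (hu.hasWeakGradient_sub t t₀))
    congr 1
    ext x
    simp; ring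

/-- Hölder's inequality on a ball, from the L⁶ bound, which is uniform on compact time intervals by
continuity. -/
theorem locLinftyL2_u (hu : IsEnergySolution p u ut gradu) :
    LocLinftyL2 fun z : ℝ × E3 => u z.1 z.2 := by
  refine locLinftyL2_of_curve hu.aestronglyMeasurable_u fun R => ?_
  obtain ⟨C, hC, h⟩ := exists_bound_eLpNorm_curve (by norm_num) hu.memLp_u hu.continuous_u R
  set ν := (volume : Measure E3).restrict (Metric.closedBall 0 R)
  have hν : ν univ ≠ ⊤ := by
    simpa [ν] using ((isCompact_closedBall (0 : E3) R).measure_lt_top (μ := volume)).ne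
  refine ⟨C * ν univ ^ (1 / (2 : ℝ≥0∞).toReal - 1 / (6 : ℝ≥0∞).toReal),
    ENNReal.mul_ne_top hC (ENNReal.rpow_ne_top_of_nonneg (by norm_num) hν), fun t ht => ?_⟩
  refine (eLpNorm_le_eLpNorm_mul_rpow_measure_univ (p := 2) (q := 6) (by norm_num)
    ((hu.memLp_u t).1.restrict)).trans ?_
  gcongr
  exact (eLpNorm_mono_measure _ Measure.restrict_le_self).trans (h t ht)

theorem aestronglyMeasurable_stDeriv (hu : IsEnergySolution p u ut gradu) (d : ℝ × E3) :
    AEStronglyMeasurable (stDeriv ut gradu d) volume :=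
  (hu.aestronglyMeasurable_ut.const_mul d.1).add
    (hu.aestronglyMeasurable_gradu.inner aestronglyMeasurable_const)

theorem locLinftyL2_stDeriv (hu : IsEnergySolution p u ut gradu) (d : ℝ × E3) :
    LocLinftyL2 (stDeriv ut gradu d) := by
  refine locLinftyL2_of_curve (hu.aestronglyMeasurable_stDeriv d) fun R => ?_
  obtain ⟨C, hC, h⟩ := exists_bound_eLpNorm_curve (by norm_num) hu.memLp_ut hu.continuous_ut R
  obtain ⟨C', hC', h'⟩ := exists_bound_eLpNorm_curve (by norm_num) hu.memLp_gradu
    hu.continuous_gradu R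
  refine ⟨‖d.1‖ₑ * C + ENNReal.ofReal ‖d.2‖ * C', ENNReal.add_ne_top.2
    ⟨ENNReal.mul_ne_top enorm_ne_top hC, ENNReal.mul_ne_top ENNReal.ofReal_ne_top hC'⟩,
    fun t ht => ?_⟩
  refine (eLpNorm_mono_measure _ Measure.restrict_le_self).trans ?_
  refine (eLpNorm_add_le ((hu.memLp_ut t).1.const_mul d.1)
    ((hu.memLp_gradu t).1.inner aestronglyMeasurable_const) (by norm_num)).trans ?_
  refine add_le_add ?_ ?_
  · refine (eLpNorm_const_smul_le (c := d.1) (f := ut t) (p := 2) (μ := volume)).trans ?_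
    gcongr
    exact h t ht
  · refine (eLpNorm_le_mul_eLpNorm_of_ae_le_mul (g := gradu t) (c := ‖d.2‖)
      (ae_of_all _ fun x => ?_) 2).trans ?_
    · rw [mul_comm]; exact norm_inner_le_norm _ _
    · gcongr
      exact h' t ht

theorem aestronglyMeasurable_source (hp : 3 ≤ p) (hu : IsEnergySolution p u ut gradu) :
    AEStronglyMeasurable (waveSource p u) volume := by
  have hc : Continuous fun s : ℝ => -(|s| ^ (p - 1) * s) :=
    ((continuous_abs.rpow_const fun s => Or.inr (by linarith)).mul continuous_id).neg
  exact hc.comp_aestronglyMeasurable hu.aestronglyMeasurable_u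

/-- The L² norm in x of |u|^p is the p-th power of the L^{2p} norm of u, so it suffices that this
norm is in L^p locally in time; the given time exponent 2p/(p-3) is at least p. -/
theorem locL1L2_source (hp : 3 ≤ p) (hp5 : p < 5) (hu : IsEnergySolution p u ut gradu) :
    LocL1L2 (waveSource p u) := by
  refine ⟨hu.aestronglyMeasurable_source hp, fun R => ?_⟩
  -- For R ≤ 0 the time interval of the box is null, whereas `strichartz` speaks only of intervals
  -- of positive length.
  rcases le_or_gt R 0 with hR | hR
  · refine ne_of_lt ?_
    refine lt_of_le_of_lt (lintegral_mono fun t => lintegral_box_slice_le _ R t) ?_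
    rw [lintegral_indicator measurableSet_Icc, Measure.restrict_zero_set]
    · simp
    · simp; linarith
  set q : ℝ≥0∞ := ENNReal.ofReal (2 * p) with hq
  have hq0 : q ≠ 0 := by rw [hq]; simp; linarith
  have hqt : q ≠ ⊤ := ENNReal.ofReal_ne_top
  have hqr : q.toReal = 2 * p := ENNReal.toReal_ofReal (by linarith)
  set N : ℝ → ℝ≥0∞ := fun t => eLpNorm (u t) q volume with hN
  have hNm : AEMeasurable N volume := by
    have h1 : AEMeasurable (fun z : ℝ × E3 => ‖u z.1 z.2‖ₑ ^ (2 * p))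
        ((volume : Measure ℝ).prod (volume : Measure E3)) :=
      hu.aestronglyMeasurable_u.enorm.pow_const _
    have h2 := (h1.lintegral_prod_right').pow_const (1 / (2 * p))
    refine h2.congr (ae_of_all _ fun t => ?_)
    rw [hN]
    simp only
    rw [eLpNorm_eq_lintegral_rpow_enorm_toReal hq0 hqt, hqr]
  -- This is p(p-3) ≤ 2p, true for p ≤ 5. For p = 3 the quotient is ⊤.
  have hexp : ENNReal.ofReal p ≤ q / ENNReal.ofReal (p - 3) := by
    rw [ENNReal.le_div_iff_mul_le (Or.inr hq0) (Or.inl ENNReal.ofReal_ne_top), hq,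
      ← ENNReal.ofReal_mul (by linarith)]
    apply ENNReal.ofReal_le_ofReal
    nlinarith
  have hfin : eLpNorm N (ENNReal.ofReal p) (volume.restrict (Icc (-R) R)) < ⊤ := by
    have h1 := hu.strichartz (-R) R (by linarith)
    refine lt_of_le_of_lt (eLpNorm_le_eLpNorm_mul_rpow_measure_univ hexp
      hNm.restrict.aestronglyMeasurable) (ENNReal.mul_lt_top h1 ?_)
    refine ENNReal.rpow_lt_top_of_nonneg ?_ (by simp)
    rw [sub_nonneg]
    have h3 : 0 < (ENNReal.ofReal p).toReal := by
      rw [ENNReal.toReal_ofReal (by linarith)]; linarith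
    rcases eq_or_ne (q / ENNReal.ofReal (p - 3)) ⊤ with h | h
    · rw [h]; simp
    · exact one_div_le_one_div_of_le h3 (ENNReal.toReal_mono h hexp)
  rw [eLpNorm_lt_top_iff_lintegral_rpow_enorm_lt_top (by simp; linarith) ENNReal.ofReal_ne_top,
    ENNReal.toReal_ofReal (by linarith)] at hfin
  simp only [enorm_eq_self] at hfin
  refine ne_of_lt (lt_of_le_of_lt ?_ hfin)
  refine (lintegral_mono fun t => lintegral_box_slice_le _ R t).trans ?_
  rw [lintegral_indicator measurableSet_Icc]
  gcongr with t
  refine (eLpNorm_mono_measure _ Measure.restrict_le_self).trans ?_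
  have two : (2 : ℝ≥0∞).toReal = 2 := by norm_num
  rw [hN]
  simp only
  rw [eLpNorm_eq_lintegral_rpow_enorm_toReal (by norm_num) (by norm_num), two,
    eLpNorm_eq_lintegral_rpow_enorm_toReal hq0 hqt, hqr, ← ENNReal.rpow_mul]
  apply le_of_eq
  have e1 : 1 / (2 * p) * p = 1 / 2 := by
    have : p ≠ 0 := by linarith
    field_simp
  rw [e1]
  congr 2 with x
  rw [waveSource, enorm_neg, enorm_mul, Real.enorm_eq_ofReal (Real.rpow_nonneg (abs_nonneg _) _),
    Real.enorm_eq_ofReal_abs, ← ENNReal.ofReal_mul (Real.rpow_nonneg (abs_nonneg _) _),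
    ENNReal.ofReal_rpow_of_nonneg (by positivity) (by norm_num),
    ENNReal.ofReal_rpow_of_nonneg (abs_nonneg _) (by linarith)]
  congr 1
  rcases eq_or_ne (u t x) 0 with h0 | h0
  · simp [h0, Real.zero_rpow (by linarith : 2 * p ≠ 0)]
  · have hpos := abs_pos.2 h0
    nth_rewrite 2 [← Real.rpow_one |u t x|]
    rw [← Real.rpow_add hpos, ← Real.rpow_mul hpos.le]
    congr 1; ring

theorem weakWave (hp : 3 ≤ p) (hp5 : p < 5) (hu : IsEnergySolution p u ut gradu) :
    WeakWave waveSign waveDir (fun z : ℝ × E3 => u z.1 z.2) (stDeriv ut gradu)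
      (waveSource p u) where
  u_loc := hu.locLinftyL2_u
  D_loc := hu.locLinftyL2_stDeriv
  G_loc := hu.locL1L2_source hp hp5
  weak_deriv := by
    intro d ψ hψ hc
    have hul := hu.locLinftyL2_u.locL2.locallyIntegrable
    have hlin : ∀ z, fderiv ℝ ψ z d =
        d.1 * dirD ((1 : ℝ), (0 : E3)) ψ z + dirD ((0 : ℝ), d.2) ψ z := by
      intro z
      have : d = d.1 • ((1 : ℝ), (0 : E3)) + ((0 : ℝ), d.2) := by ext <;> simp
      conv_lhs => rw [this]
      rw [map_add, map_smul]; rfl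
    have hi : ∀ e : ℝ × E3, Integrable fun z : ℝ × E3 => u z.1 z.2 * dirD e ψ z := fun e =>
      hul.integrable_smul_right_of_hasCompactSupport (dirD_contDiff hψ e).continuous
        (dirD_hasCompactSupport hc e)
    have hj : ∀ e : ℝ × E3, Integrable fun z : ℝ × E3 => stDeriv ut gradu e z * ψ z := fun e =>
      (hu.locLinftyL2_stDeriv e).locL2.locallyIntegrable.integrable_smul_right_of_hasCompactSupport
        hψ.continuous hc
    have ht := hu.time_deriv ψ hψ hc
    simp only [dirD_prod_left hψ] at ht
    -- The spatial gradient is known slice by slice; Fubini assembles it over time.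
    have hx : ∫ z : ℝ × E3, u z.1 z.2 * dirD ((0 : ℝ), d.2) ψ z =
        -∫ z : ℝ × E3, stDeriv ut gradu ((0 : ℝ), d.2) z * ψ z := by
      have h1 := hi ((0 : ℝ), d.2)
      have h2 := hj ((0 : ℝ), d.2)
      rw [Measure.volume_eq_prod] at h1 h2 ⊢
      rw [integral_prod _ h1, integral_prod _ h2, ← integral_neg]
      congr 1 with t
      have := hu.hasWeakGradient t (fun x => ψ (t, x)) (hψ.comp (contDiff_const.prodMk contDiff_id))
        (hasCompactSupport_slice hc t) d.2
      simp only [← dirD_prod_right hψ, stDeriv, zero_mul, zero_add]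
      exact this
    have e2 : ∀ z, stDeriv ut gradu d z * ψ z = d.1 * (ut z.1 z.2 * ψ z) +
        stDeriv ut gradu ((0 : ℝ), d.2) z * ψ z := by
      intro z; simp only [stDeriv]; ring
    have hjt : Integrable fun z : ℝ × E3 => ut z.1 z.2 * ψ z := by
      refine (hj ((1 : ℝ), (0 : E3))).congr (ae_of_all _ fun z => ?_)
      simp [stDeriv]
    have e1 : ∀ z : ℝ × E3, u z.1 z.2 * fderiv ℝ ψ z d =
        d.1 * (u z.1 z.2 * dirD ((1 : ℝ), (0 : E3)) ψ z) +
          u z.1 z.2 * dirD ((0 : ℝ), d.2) ψ z := by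
      intro z; rw [hlin]; ring
    simp only [e1, e2]
    rw [integral_add ((hi _).const_mul _) (hi _), integral_add (hjt.const_mul _) (hj _),
      integral_const_mul, integral_const_mul, ht, hx]
    ring
  wave := by
    intro ψ hψ hc
    have h := hu.equation ψ hψ hc
    simp only [iteratedDeriv_two_eq hψ, laplacian_eq_sum hψ] at h
    have e : ∀ z, ∑ i, waveSign i * dirD (waveDir i) (dirD (waveDir i) ψ) z =
        dirD ((1 : ℝ), (0 : E3)) (dirD ((1 : ℝ), (0 : E3)) ψ) z -
          ∑ i, dirD ((0 : ℝ), eb i) (dirD ((0 : ℝ), eb i) ψ) z := by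
      intro z
      rw [Fintype.sum_option]
      simp [waveSign, waveDir, sub_eq_add_neg]
    simp only [e, h, waveSource, neg_mul]
    rw [integral_neg]

end IsEnergySolution

/-! ### Multiplier identities for the solution. -/

/-- `f` is integrable with integral zero. -/
structure NullIntegral {α : Type*} [MeasurableSpace α] (ν : Measure α) (f : α → ℝ) : Prop where
  integrable : Integrable f ν
  integral_eq : ∫ x, f x ∂ν = 0

namespace NullIntegral

variable {α : Type*} [MeasurableSpace α] {ν : Measure α} {f g : α → ℝ}

theorem add (hf : NullIntegral ν f) (hg : NullIntegral ν g) :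
    NullIntegral ν fun x => f x + g x :=
  ⟨hf.1.add hg.1, by rw [integral_add hf.1 hg.1, hf.2, hg.2, add_zero]⟩

theorem const_mul (hf : NullIntegral ν f) (c : ℝ) : NullIntegral ν fun x => c * f x :=
  ⟨hf.1.const_mul c, by rw [integral_const_mul, hf.2, mul_zero]⟩

theorem sum {ι : Type*} [Fintype ι] {F : ι → α → ℝ} (h : ∀ i, NullIntegral ν (F i)) :
    NullIntegral ν fun x => ∑ i, F i x :=
  ⟨integrable_finsetSum _ fun i _ => (h i).1, by
    rw [integral_finsetSum _ fun i _ => (h i).1]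
    exact Finset.sum_eq_zero fun i _ => (h i).2⟩

theorem congr (hf : NullIntegral ν f) (h : ∀ x, f x = g x) : NullIntegral ν g := by
  rwa [← funext h]

end NullIntegral

theorem LocL2.integrable_mul_mul {E : Type*} [NormedAddCommGroup E] [NormedSpace ℝ E]
    [FiniteDimensional ℝ E] [MeasureSpace E] [BorelSpace E] [(volume : Measure E).IsAddHaarMeasure]
    {c v w : E → ℝ} (hv : LocL2 v) (hw : LocL2 w) (hc : Continuous c)
    (hcs : HasCompactSupport c) : Integrable fun z => c z * v z * w z := by
  have h : IntegrableOn (fun z => v z * w z) (tsupport c) volume :=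
    (hv _ hcs).integrable_mul (hw _ hcs)
  obtain ⟨C, hC⟩ := hc.bounded_above_of_compact_support hcs
  have h2 := h.bdd_mul (c := C) hc.aestronglyMeasurable.restrict (ae_of_all _ hC)
  refine ((integrableOn_iff_integrable_of_support_subset ?_).1 h2).congr
    (ae_of_all _ fun z => (mul_assoc _ _ _).symm)
  exact fun z hz => subset_tsupport _ (left_ne_zero_of_mul hz)

theorem sum_dirD_mul (Y : ℝ × E3 → ℝ) (z : ℝ × E3) (v : E3) :
    ∑ i, dirD ((0 : ℝ), eb i) Y z * v i = fderiv ℝ Y z (0, v) := by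
  have : ((0 : ℝ), v) = ∑ i, v i • ((0 : ℝ), eb i) := by
    rw [Fin.sum_univ_three]
    ext k
    · simp
    · fin_cases k <;> simp
  rw [this, map_sum]
  exact Finset.sum_congr rfl fun i _ => by rw [map_smul, smul_eq_mul, mul_comm]; rfl

namespace IsEnergySolution

variable {p : ℝ} {u ut : ℝ → E3 → ℝ} {gradu : ℝ → E3 → E3}

theorem stDeriv_time (z : ℝ × E3) : stDeriv ut gradu ((1 : ℝ), (0 : E3)) z = ut z.1 z.2 := by
  simp [stDeriv]

theorem stDeriv_space (i : Fin 3) (z : ℝ × E3) :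
    stDeriv ut gradu ((0 : ℝ), eb i) z = gradu z.1 z.2 i := by
  rw [stDeriv, zero_mul, zero_add, inner_eb]

/-- The multiplier is Y ∂_b u. By the chain rule |u|^(p-1)u ∂_b u is the derivative of
|u|^(p+1)/(p+1), which moves the source term onto the derivative of Y. -/
theorem null_first (hp : 3 ≤ p) (hp5 : p < 5) (hu : IsEnergySolution p u ut gradu)
    {Y : ℝ × E3 → ℝ} (hY : ContDiff ℝ ∞ Y) (hc : HasCompactSupport Y) (b : ℝ × E3) :
    NullIntegral volume fun z : ℝ × E3 =>
      -(dirD ((1 : ℝ), (0 : E3)) Y z * ut z.1 z.2 * stDeriv ut gradu b z)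
      + 1 / 2 * dirD b Y z * (ut z.1 z.2 ^ 2 - ‖gradu z.1 z.2‖ ^ 2)
      + fderiv ℝ Y z (0, gradu z.1 z.2) * stDeriv ut gradu b z
      - dirD b Y z * |u z.1 z.2| ^ (p + 1) / (p + 1) := by
  have hw := hu.weakWave hp hp5
  have hD := fun d => (hw.D_loc d).locL2
  have i1 : ∀ i, Integrable fun z => dirD (waveDir i) Y z * stDeriv ut gradu (waveDir i) z *
      stDeriv ut gradu b z := fun i => (hD _).integrable_mul_mul (hD _)
        (dirD_contDiff hY _).continuous (dirD_hasCompactSupport hc _)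
  have i2 : ∀ i, Integrable fun z => dirD b Y z * stDeriv ut gradu (waveDir i) z *
      stDeriv ut gradu (waveDir i) z := fun i => (hD _).integrable_mul_mul (hD _)
        (dirD_contDiff hY _).continuous (dirD_hasCompactSupport hc _)
  have i3 := (tendsto_integral_mollify_mul_of_locL1L2 hw.G_loc (hw.D_loc b) hY.continuous hc).1
  have i4 := (tendsto_integral_mollify_mul_of_locL1L2 hw.G_loc hw.u_loc
    (dirD_contDiff hY b).continuous (dirD_hasCompactSupport hc b)).1
  -- Local integrability of |u|^(p+1) comes from pairing the source, in L¹L², with u itself, in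
  -- L^∞L².
  have i4' : Integrable fun z : ℝ × E3 => dirD b Y z * |u z.1 z.2| ^ (p + 1) := by
    refine i4.neg.congr (ae_of_all _ fun z => ?_)
    have := abs_rpow_mul_mul (by linarith : 1 < p) (u z.1 z.2)
    simp only [Pi.neg_apply, waveSource]
    rw [← this]; ring
  have hchain := weak_chain_rule_rpow hw.u_loc.locL2 (hD b) (hw.weak_deriv b) (by linarith : 1 < p)
    hY hc hu.aestronglyMeasurable_u (hu.aestronglyMeasurable_stDeriv b)
    (i3.neg.congr (ae_of_all _ fun z => by simp only [Pi.neg_apply, waveSource]; ring)) i4'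
  have hG : ∫ z, Y z * waveSource p u z * stDeriv ut gradu b z =
      (∫ z : ℝ × E3, dirD b Y z * |u z.1 z.2| ^ (p + 1)) / (p + 1) := by
    have : ∀ z, Y z * waveSource p u z * stDeriv ut gradu b z =
        -(Y z * (|u z.1 z.2| ^ (p - 1) * u z.1 z.2) * stDeriv ut gradu b z) := by
      intro z; rw [waveSource]; ring
    simp only [this]
    rw [integral_neg, hchain]; ring
  have hid := hw.identity_first hY hc b
  rw [hG] at hid
  have i5 : ∀ i, Integrable fun z => waveSign i *
      (-(dirD (waveDir i) Y z * stDeriv ut gradu (waveDir i) z * stDeriv ut gradu b z) +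
        1 / 2 * (dirD b Y z * stDeriv ut gradu (waveDir i) z *
          stDeriv ut gradu (waveDir i) z)) := fun i =>
    (Integrable.add (i1 i).neg ((i2 i).const_mul _)).const_mul _
  have key : NullIntegral volume fun z : ℝ × E3 => (∑ i, waveSign i *
      (-(dirD (waveDir i) Y z * stDeriv ut gradu (waveDir i) z * stDeriv ut gradu b z) +
        1 / 2 * (dirD b Y z * stDeriv ut gradu (waveDir i) z *
          stDeriv ut gradu (waveDir i) z))) -
        dirD b Y z * |u z.1 z.2| ^ (p + 1) / (p + 1) := by
    refine ⟨(integrable_finsetSum _ fun i _ => i5 i).sub (i4'.div_const _), ?_⟩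
    rw [integral_sub (integrable_finsetSum _ fun i _ => i5 i) (i4'.div_const _),
      integral_finsetSum _ fun i _ => i5 i, integral_div, ← hid, sub_eq_zero]
    refine Finset.sum_congr rfl fun i _ => ?_
    rw [integral_const_mul, integral_add (by exact (i1 i).neg) ((i2 i).const_mul _), integral_neg,
      integral_const_mul]
  refine key.congr fun z => ?_
  rw [Fintype.sum_option, ← sum_dirD_mul, norm_sq_eq_sum]
  simp only [waveSign, waveDir, stDeriv_time, stDeriv_space, Fin.sum_univ_three]
  ring

/-- The multiplier is f u. -/
theorem null_second (hp : 3 ≤ p) (hp5 : p < 5) (hu : IsEnergySolution p u ut gradu)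
    {f : ℝ × E3 → ℝ} (hf : ContDiff ℝ ∞ f) (hc : HasCompactSupport f) :
    NullIntegral volume fun z : ℝ × E3 =>
      f z * (‖gradu z.1 z.2‖ ^ 2 - ut z.1 z.2 ^ 2)
      - dirD ((1 : ℝ), (0 : E3)) f z * u z.1 z.2 * ut z.1 z.2
      + fderiv ℝ f z (0, gradu z.1 z.2) * u z.1 z.2
      + f z * |u z.1 z.2| ^ (p + 1) := by
  have hw := hu.weakWave hp hp5
  have hD := fun d => (hw.D_loc d).locL2
  have i1 : ∀ i, Integrable fun z => f z * stDeriv ut gradu (waveDir i) z *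
      stDeriv ut gradu (waveDir i) z := fun i => (hD _).integrable_mul_mul (hD _) hf.continuous hc
  have i2 : ∀ i, Integrable fun z : ℝ × E3 => dirD (waveDir i) f z * u z.1 z.2 *
      stDeriv ut gradu (waveDir i) z := fun i => hw.u_loc.locL2.integrable_mul_mul (hD _)
        (dirD_contDiff hf _).continuous (dirD_hasCompactSupport hc _)
  have i3 := (tendsto_integral_mollify_mul_of_locL1L2 hw.G_loc hw.u_loc hf.continuous hc).1
  have hid := hw.identity_second hf hc
  have i5 : ∀ i, Integrable fun z : ℝ × E3 => waveSign i *
      (-(f z * stDeriv ut gradu (waveDir i) z * stDeriv ut gradu (waveDir i) z) -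
        dirD (waveDir i) f z * u z.1 z.2 * stDeriv ut gradu (waveDir i) z) := fun i =>
    ((i1 i).neg.sub (i2 i)).const_mul _
  have key : NullIntegral volume fun z : ℝ × E3 => (∑ i, waveSign i *
      (-(f z * stDeriv ut gradu (waveDir i) z * stDeriv ut gradu (waveDir i) z) -
        dirD (waveDir i) f z * u z.1 z.2 * stDeriv ut gradu (waveDir i) z)) -
        f z * waveSource p u z * u z.1 z.2 := by
    refine ⟨(integrable_finsetSum _ fun i _ => i5 i).sub i3, ?_⟩
    rw [integral_sub (integrable_finsetSum _ fun i _ => i5 i) i3,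
      integral_finsetSum _ fun i _ => i5 i, ← hid, sub_eq_zero]
    refine Finset.sum_congr rfl fun i _ => ?_
    rw [integral_const_mul, integral_sub (by exact (i1 i).neg) (i2 i), integral_neg]
  refine key.congr fun z => ?_
  rw [Fintype.sum_option, ← sum_dirD_mul, norm_sq_eq_sum, ← abs_rpow_mul_mul (by linarith)]
  simp only [waveSign, waveDir, stDeriv_time, stDeriv_space, Fin.sum_univ_three, waveSource]
  ring

theorem null_zero (hp : 3 ≤ p) (hp5 : p < 5) (hu : IsEnergySolution p u ut gradu)
    {f : ℝ × E3 → ℝ} (hf : ContDiff ℝ ∞ f) (hc : HasCompactSupport f) (d : ℝ × E3) :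
    NullIntegral volume fun z : ℝ × E3 =>
      f z * u z.1 z.2 * stDeriv ut gradu d z + 1 / 2 * dirD d f z * u z.1 z.2 ^ 2 := by
  have hw := hu.weakWave hp hp5
  have i1 : Integrable fun z : ℝ × E3 => f z * u z.1 z.2 * stDeriv ut gradu d z :=
    hw.u_loc.locL2.integrable_mul_mul (hw.D_loc d).locL2 hf.continuous hc
  have i2 : Integrable fun z : ℝ × E3 => dirD d f z * u z.1 z.2 * u z.1 z.2 :=
    hw.u_loc.locL2.integrable_mul_mul hw.u_loc.locL2 (dirD_contDiff hf _).continuous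
      (dirD_hasCompactSupport hc _)
  have key : NullIntegral volume fun z : ℝ × E3 => f z * u z.1 z.2 * stDeriv ut gradu d z +
      1 / 2 * (dirD d f z * u z.1 z.2 * u z.1 z.2) := by
    refine ⟨i1.add (i2.const_mul _), ?_⟩
    rw [integral_add i1 (i2.const_mul _), hw.identity_zero hf hc d, integral_const_mul]
    ring
  exact key.congr fun z => by ring

/-- The position vector as a function on space-time. -/
theorem contDiff_coord (i : Fin 3) : ContDiff ℝ ∞ fun z : ℝ × E3 => z.2 i :=
  ((EuclideanSpace.proj i : E3 →L[ℝ] ℝ).comp (ContinuousLinearMap.snd ℝ ℝ E3)).contDiff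

theorem fderiv_mul_coord {F : ℝ × E3 → ℝ} (hF : ContDiff ℝ ∞ F) (i : Fin 3) (z w : ℝ × E3) :
    fderiv ℝ (fun z : ℝ × E3 => F z * z.2 i) z w = fderiv ℝ F z w * z.2 i + F z * w.2 i := by
  have h1 := (smooth_differentiable hF z).hasFDerivAt
  have h2 : HasFDerivAt (fun z : ℝ × E3 => z.2 i)
      ((EuclideanSpace.proj i : E3 →L[ℝ] ℝ).comp (ContinuousLinearMap.snd ℝ ℝ E3)) z :=
    ((EuclideanSpace.proj i : E3 →L[ℝ] ℝ).comp (ContinuousLinearMap.snd ℝ ℝ E3)).hasFDerivAt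
  have h3 : fderiv ℝ (fun z : ℝ × E3 => F z * z.2 i) z = _ := (h1.mul h2).fderiv
  rw [h3]
  simp; ring

/-- The multiplier is F x·∇u, obtained by summing `null_first` over the coordinates with Y = F xᵢ.
The terms 3F come from the divergence of x. -/
theorem null_radial (hp : 3 ≤ p) (hp5 : p < 5) (hu : IsEnergySolution p u ut gradu)
    {F : ℝ × E3 → ℝ} (hF : ContDiff ℝ ∞ F) (hc : HasCompactSupport F) :
    NullIntegral volume fun z : ℝ × E3 =>
      -(fderiv ℝ F z (1, 0) * ut z.1 z.2 * inner ℝ (gradu z.1 z.2) z.2)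
      + 1 / 2 * (fderiv ℝ F z (0, z.2) + 3 * F z) * (ut z.1 z.2 ^ 2 - ‖gradu z.1 z.2‖ ^ 2)
      + fderiv ℝ F z (0, gradu z.1 z.2) * inner ℝ (gradu z.1 z.2) z.2
      + F z * ‖gradu z.1 z.2‖ ^ 2
      - (fderiv ℝ F z (0, z.2) + 3 * F z) * |u z.1 z.2| ^ (p + 1) / (p + 1) := by
  have key := NullIntegral.sum fun i : Fin 3 => hu.null_first hp hp5 (hF.mul (contDiff_coord i))
    hc.mul_right ((0 : ℝ), eb i)
  refine key.congr fun z => ?_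
  have hs := sum_dirD_mul F z z.2
  have hin : inner ℝ (gradu z.1 z.2) z.2 = ∑ i, gradu z.1 z.2 i * z.2 i := by
    simp [PiLp.inner_apply, mul_comm]
  simp only [dirD, fderiv_mul_coord hF, stDeriv_space, Fin.sum_univ_three] at hs ⊢
  rw [← hs, hin, norm_sq_eq_sum]
  simp only [Fin.sum_univ_three]
  simp
  ring

theorem null_zero_radial (hp : 3 ≤ p) (hp5 : p < 5) (hu : IsEnergySolution p u ut gradu)
    {F : ℝ × E3 → ℝ} (hF : ContDiff ℝ ∞ F) (hc : HasCompactSupport F) :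
    NullIntegral volume fun z : ℝ × E3 =>
      F z * u z.1 z.2 * inner ℝ (gradu z.1 z.2) z.2
      + 1 / 2 * (fderiv ℝ F z (0, z.2) + 3 * F z) * u z.1 z.2 ^ 2 := by
  have key := NullIntegral.sum fun i : Fin 3 => hu.null_zero hp hp5 (hF.mul (contDiff_coord i))
    hc.mul_right ((0 : ℝ), eb i)
  refine key.congr fun z => ?_
  have hs := sum_dirD_mul F z z.2
  have hin : inner ℝ (gradu z.1 z.2) z.2 = ∑ i, gradu z.1 z.2 i * z.2 i := by
    simp [PiLp.inner_apply, mul_comm]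
  simp only [dirD, fderiv_mul_coord hF, stDeriv_space, Fin.sum_univ_three] at hs ⊢
  rw [← hs, hin]
  simp only [Fin.sum_univ_three]
  simp
  ring

end IsEnergySolution

/-! ### Radial test functions and the inward balance law. -/

/-- A test function of `(t, r)` supported away from `r ≤ 0`. -/
structure RadialTest (χ : ℝ × ℝ → ℝ) : Prop where
  contDiff : ContDiff ℝ ∞ χ
  hasCompactSupport : HasCompactSupport χ
  exists_pos : ∃ δ > 0, ∀ q : ℝ × ℝ, q.2 < δ → χ q = 0

/-- The function `(t, x) ↦ χ (t, |x|)`. -/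
def radialLift (χ : ℝ × ℝ → ℝ) (z : ℝ × E3) : ℝ := χ (z.1, ‖z.2‖)

/-- The function `(t, r) ↦ χ (t, r) / r`. -/
def radialDiv (χ : ℝ × ℝ → ℝ) (q : ℝ × ℝ) : ℝ := χ q / q.2

/-- The time derivative on the half-plane. -/
def dT (χ : ℝ × ℝ → ℝ) : ℝ × ℝ → ℝ := dirD ((1 : ℝ), (0 : ℝ)) χ

/-- The radial derivative on the half-plane. -/
def dR (χ : ℝ × ℝ → ℝ) : ℝ × ℝ → ℝ := dirD ((0 : ℝ), (1 : ℝ)) χ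

namespace RadialTest

variable {χ : ℝ × ℝ → ℝ}

theorem eventuallyEq_zero (h : RadialTest χ) {q : ℝ × ℝ} (hq : q.2 ≤ 0) : χ =ᶠ[𝓝 q] 0 := by
  obtain ⟨δ, hδ, h0⟩ := h.exists_pos
  have : ∀ᶠ q' : ℝ × ℝ in 𝓝 q, q'.2 < δ :=
    continuous_snd.continuousAt.eventually_lt continuousAt_const (hq.trans_lt hδ)
  filter_upwards [this] with q' hq' using h0 q' hq'

theorem dirD (h : RadialTest χ) (d : ℝ × ℝ) : RadialTest (dirD d χ) where
  contDiff := dirD_contDiff h.contDiff d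
  hasCompactSupport := dirD_hasCompactSupport h.hasCompactSupport d
  exists_pos := by
    obtain ⟨δ, hδ, h0⟩ := h.exists_pos
    refine ⟨δ, hδ, fun q hq => ?_⟩
    have : ∀ᶠ q' : ℝ × ℝ in 𝓝 q, q'.2 < δ :=
      continuous_snd.continuousAt.eventually_lt continuousAt_const hq
    have h1 : χ =ᶠ[𝓝 q] 0 := by filter_upwards [this] with q' hq' using h0 q' hq'
    rw [_root_.dirD, h1.fderiv_eq]
    simp

theorem dT (h : RadialTest χ) : RadialTest (dT χ) := h.dirD (1, 0)

theorem dR (h : RadialTest χ) : RadialTest (dR χ) := h.dirD (0, 1)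

/-- Vanishing for r < δ makes division by r harmless, so the singular multipliers with powers of 1/r
stay in the class of smooth test functions. -/
theorem div (h : RadialTest χ) : RadialTest (radialDiv χ) where
  contDiff := by
    rw [contDiff_iff_contDiffAt]
    intro q
    rcases le_or_gt q.2 0 with hq | hq
    · have : radialDiv χ =ᶠ[𝓝 q] 0 := by
        filter_upwards [h.eventuallyEq_zero hq] with q' hq'
        simp [radialDiv, hq']
      exact contDiffAt_const.congr_of_eventuallyEq this
    · exact h.contDiff.contDiffAt.div contDiffAt_snd hq.ne'
  hasCompactSupport := h.hasCompactSupport.mono fun q hq => by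
    simp only [Function.mem_support, radialDiv] at hq ⊢
    exact fun h0 => hq (by simp [h0])
  exists_pos := by
    obtain ⟨δ, hδ, h0⟩ := h.exists_pos
    exact ⟨δ, hδ, fun q hq => by simp [radialDiv, h0 q hq]⟩

theorem dT_div (h : RadialTest χ) (q : ℝ × ℝ) :
    _root_.dT (radialDiv χ) q = _root_.dT χ q / q.2 := by
  rcases le_or_gt q.2 0 with hq | hq
  · have h1 := (h.div.dT).eventuallyEq_zero hq
    have h2 := h.dT.eventuallyEq_zero hq
    rw [h1.eq_of_nhds, h2.eq_of_nhds]; simp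
  · have h1 := (smooth_differentiable h.contDiff q).hasFDerivAt
    have h2 : HasFDerivAt (fun q : ℝ × ℝ => q.2⁻¹) _ q := (hasDerivAt_inv hq.ne').comp_hasFDerivAt q
      (hasFDerivAt_snd (𝕜 := ℝ) (p := q))
    have h3 : fderiv ℝ (radialDiv χ) q = _ := (h1.mul h2).fderiv
    simp only [_root_.dT, _root_.dirD]
    rw [h3]
    simp; ring

theorem dR_div (h : RadialTest χ) (q : ℝ × ℝ) :
    _root_.dR (radialDiv χ) q = _root_.dR χ q / q.2 - χ q / q.2 ^ 2 := by
  rcases le_or_gt q.2 0 with hq | hq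
  · have h1 := (h.div.dR).eventuallyEq_zero hq
    have h2 := h.dR.eventuallyEq_zero hq
    rw [h1.eq_of_nhds, h2.eq_of_nhds, (h.eventuallyEq_zero hq).eq_of_nhds]; simp
  · have h1 := (smooth_differentiable h.contDiff q).hasFDerivAt
    have h2 : HasFDerivAt (fun q : ℝ × ℝ => q.2⁻¹) _ q := (hasDerivAt_inv hq.ne').comp_hasFDerivAt q
      (hasFDerivAt_snd (𝕜 := ℝ) (p := q))
    have h3 : fderiv ℝ (radialDiv χ) q = _ := (h1.mul h2).fderiv
    simp only [_root_.dR, _root_.dirD]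
    rw [h3]
    simp; ring

theorem lift_eventuallyEq_zero (h : RadialTest χ) {z : ℝ × E3} (hz : z.2 = 0) :
    radialLift χ =ᶠ[𝓝 z] 0 := by
  have hc : Tendsto (fun z : ℝ × E3 => (z.1, ‖z.2‖)) (𝓝 z) (𝓝 (z.1, ‖z.2‖)) :=
    (by fun_prop : Continuous fun z : ℝ × E3 => (z.1, ‖z.2‖)).continuousAt
  exact hc.eventually (h.eventuallyEq_zero (q := (z.1, ‖z.2‖)) (by simp [hz]))

theorem lift_contDiff (h : RadialTest χ) : ContDiff ℝ ∞ (radialLift χ) := by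
  rw [contDiff_iff_contDiffAt]
  intro z
  by_cases hz : z.2 = 0
  · exact contDiffAt_const.congr_of_eventuallyEq (h.lift_eventuallyEq_zero hz)
  · exact h.contDiff.contDiffAt.comp z
      (contDiffAt_fst.prodMk ((contDiffAt_norm ℝ hz).comp z contDiffAt_snd))

theorem lift_hasCompactSupport (h : RadialTest χ) : HasCompactSupport (radialLift χ) := by
  obtain ⟨R, hR⟩ := h.hasCompactSupport.isCompact.isBounded.subset_closedBall (0 : ℝ × ℝ)
  refine HasCompactSupport.intro (isCompact_closedBall (0 : ℝ × E3) R) fun z hz => ?_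
  refine image_eq_zero_of_notMem_tsupport (f := χ) (x := (z.1, ‖z.2‖)) fun hs => hz ?_
  simpa [Prod.norm_def] using hR hs

theorem fderiv_lift (h : RadialTest χ) (z : ℝ × E3) (s : ℝ) (v : E3) :
    fderiv ℝ (radialLift χ) z (s, v) =
      _root_.dT χ (z.1, ‖z.2‖) * s + _root_.dR χ (z.1, ‖z.2‖) * (inner ℝ v z.2 / ‖z.2‖) := by
  by_cases hz : z.2 = 0
  · rw [(h.lift_eventuallyEq_zero hz).fderiv_eq,
      (h.dT.eventuallyEq_zero (q := (z.1, ‖z.2‖)) (by simp [hz])).eq_of_nhds,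
      (h.dR.eventuallyEq_zero (q := (z.1, ‖z.2‖)) (by simp [hz])).eq_of_nhds]
    simp
  · have hn : ‖z.2‖ ≠ 0 := norm_ne_zero_iff.2 hz
    have hd : HasFDerivAt (fun x : E3 => ‖x‖) (fderiv ℝ (fun x : E3 => ‖x‖) z.2) z.2 :=
      ((contDiffAt_norm ℝ (n := 1) hz).differentiableAt one_ne_zero).hasFDerivAt
    -- The gradient of the norm is read off from two ways of differentiating its square.
    have hv : fderiv ℝ (fun x : E3 => ‖x‖) z.2 v = inner ℝ v z.2 / ‖z.2‖ := by
      have h1 := (hd.mul hd).unique ((hasStrictFDerivAt_norm_sq z.2).hasFDerivAt.congr_of_eventuallyEq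
        (Eventually.of_forall fun x => by simp [pow_two]))
      have h2 := congrArg (fun L : E3 →L[ℝ] ℝ => L v) h1
      simp at h2
      rw [eq_div_iff hn, real_inner_comm]
      linarith
    have h1 : HasFDerivAt (fun z : ℝ × E3 => (z.1, ‖z.2‖)) _ z :=
      hasFDerivAt_fst.prodMk (hd.comp z hasFDerivAt_snd)
    have h2 : fderiv ℝ (radialLift χ) z = _ :=
      ((smooth_differentiable h.contDiff (z.1, ‖z.2‖)).hasFDerivAt.comp z h1).fderiv
    rw [h2]
    have h3 : ((s, inner ℝ v z.2 / ‖z.2‖) : ℝ × ℝ) =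
        s • ((1 : ℝ), (0 : ℝ)) + (inner ℝ v z.2 / ‖z.2‖) • ((0 : ℝ), (1 : ℝ)) := by
      ext <;> simp
    change fderiv ℝ χ (z.1, ‖z.2‖) (s, fderiv ℝ (fun x : E3 => ‖x‖) z.2 v) = _
    rw [hv, h3, map_add, map_smul, map_smul]
    simp only [_root_.dT, _root_.dR, _root_.dirD, smul_eq_mul]
    ring

end RadialTest

/-- The source term in the balance law for the inward energy. -/
def inwardSource (p : ℝ) (f : E3 → ℝ) (g : E3 → E3) (x : E3) : ℝ :=
  1 / 2 * (‖angularGrad g x‖ ^ 2 / ‖x‖) + (p - 1) / (2 * (p + 1)) * (|f x| ^ (p + 1) / ‖x‖)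

theorem norm_angularGrad_sq (g : E3 → E3) {x : E3} (hx : x ≠ 0) :
    ‖angularGrad g x‖ ^ 2 = ‖g x‖ ^ 2 - (inner ℝ (g x) x / ‖x‖) ^ 2 := by
  have hn : ‖x‖ ≠ 0 := norm_ne_zero_iff.2 hx
  rw [angularGrad, norm_sub_sq_real, inner_smul_right, norm_smul, mul_pow, Real.norm_eq_abs, sq_abs]
  field_simp
  ring

namespace IsEnergySolution

variable {p : ℝ} {u ut : ℝ → E3 → ℝ} {gradu : ℝ → E3 → E3}

/-- The inward energy balance law in weak form. -/
theorem null_inward (hp : 3 ≤ p) (hp5 : p < 5) (hu : IsEnergySolution p u ut gradu)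
    {χ : ℝ × ℝ → ℝ} (h : RadialTest χ) :
    NullIntegral volume fun z : ℝ × E3 =>
      -(dT χ (z.1, ‖z.2‖) * inwardEnergyDensity p (u z.1) (ut z.1) (gradu z.1) z.2)
      + dR χ (z.1, ‖z.2‖) * inwardFluxDensity p (u z.1) (ut z.1) (gradu z.1) z.2
      + χ (z.1, ‖z.2‖) * inwardSource p (u z.1) (gradu z.1) z.2 := by
  have hT := h.dT
  have hR := h.dR
  -- The sum `t1 + t2 + t3` is the equation tested with χ 𝐋₊u = χ(uₜ + uᵣ + u/r). The others
  -- integrate exact derivatives of weighted u²; they supply the products u uᵣ and u uₜ that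
  -- complete the square |𝐋₊u|².
  have t1 := hu.null_first hp hp5 h.lift_contDiff h.lift_hasCompactSupport ((1 : ℝ), (0 : E3))
  have t2 := hu.null_radial hp hp5 h.div.lift_contDiff h.div.lift_hasCompactSupport
  have t3 := hu.null_second hp hp5 h.div.lift_contDiff h.div.lift_hasCompactSupport
  have t4 := hu.null_zero_radial hp hp5 hT.div.div.lift_contDiff hT.div.div.lift_hasCompactSupport
  have t5 := hu.null_zero hp hp5 hR.div.lift_contDiff hR.div.lift_hasCompactSupport
    ((1 : ℝ), (0 : E3))
  have t6 := hu.null_zero_radial hp hp5 h.div.div.div.lift_contDiff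
    h.div.div.div.lift_hasCompactSupport
  have key := ((((t1.add t2).add t3).add (t4.const_mul (-1))).add (t5.add t6)).const_mul (1 / 2)
  refine key.congr fun z => ?_
  have hcomm : dT (dR χ) (z.1, ‖z.2‖) = dR (dT χ) (z.1, ‖z.2‖) := dirD_comm h.contDiff _ _ _
  simp only [stDeriv_time, dirD, h.fderiv_lift, h.div.fderiv_lift,
    hT.div.div.fderiv_lift, hR.div.fderiv_lift, h.div.div.div.fderiv_lift]
  simp only [h.dT_div, h.dR_div, h.div.dR_div, h.div.div.dR_div,
    hT.div.dR_div, hT.dR_div, hR.dT_div, hcomm, radialLift, radialDiv]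
  by_cases hz : z.2 = 0
  · have e : ∀ {ψ}, RadialTest ψ → ψ (z.1, ‖z.2‖) = 0 := fun hψ =>
      (hψ.eventuallyEq_zero (q := (z.1, ‖z.2‖)) (by simp [hz])).eq_of_nhds
    rw [e h, e hT, e hR]
    simp [hz]
  · have hn : ‖z.2‖ ≠ 0 := norm_ne_zero_iff.2 hz
    have hp1 : p + 1 ≠ 0 := by linarith
    rw [inwardEnergyDensity, inwardFluxDensity, inwardSource, norm_angularGrad_sq _ hz, Lplus,
      sq_abs, real_inner_self_eq_norm_sq]
    simp only [inner_zero_left]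
    field_simp
    ring

end IsEnergySolution

/-! ### Functions of one variable with an integrable weak derivative. -/

section WeakFTC

variable {J : Set ℝ} {x₀ : ℝ}

theorem exists_Ioo_of_isCompact (hJ : IsOpen J) (hJc : J.OrdConnected) (hx₀ : x₀ ∈ J) {K : Set ℝ}
    (hK : IsCompact K) (hKJ : K ⊆ J) :
    ∃ a b, a < x₀ ∧ x₀ < b ∧ Icc a b ⊆ J ∧ K ⊆ Ioo a b := by
  have hK' : IsCompact (insert x₀ K) := hK.insert x₀
  have hne : (insert x₀ K).Nonempty := ⟨x₀, mem_insert _ _⟩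
  have hsub : insert x₀ K ⊆ J := insert_subset hx₀ hKJ
  obtain ⟨a₀, ha₀, ha⟩ := hK'.exists_isLeast hne
  obtain ⟨b₀, hb₀, hb⟩ := hK'.exists_isGreatest hne
  obtain ⟨ε, hε, hεa⟩ := Metric.isOpen_iff.1 hJ a₀ (hsub ha₀)
  obtain ⟨ε', hε', hεb⟩ := Metric.isOpen_iff.1 hJ b₀ (hsub hb₀)
  have h1 : a₀ - ε / 2 ∈ J := hεa (by simp [abs_of_pos hε]; linarith)
  have h2 : b₀ + ε' / 2 ∈ J := hεb (by simp [abs_of_pos hε']; linarith)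
  have hxa := ha (mem_insert x₀ K)
  have hxb := hb (mem_insert x₀ K)
  refine ⟨a₀ - ε / 2, b₀ + ε' / 2, by linarith, by linarith, hJc.out h1 h2, fun x hx => ?_⟩
  have := ha (mem_insert_of_mem x₀ hx)
  have := hb (mem_insert_of_mem x₀ hx)
  exact ⟨by linarith, by linarith⟩

theorem intervalIntegrable_of_locallyIntegrableOn {B : ℝ → ℝ} (hB : LocallyIntegrableOn B J)
    {a b : ℝ} (hab : uIcc a b ⊆ J) : IntervalIntegrable B volume a b :=
  (hB.integrableOn_compact_subset hab isCompact_uIcc).intervalIntegrable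

theorem integral_deriv_mul_primitive (hJ : IsOpen J) (hJc : J.OrdConnected) (hx₀ : x₀ ∈ J)
    {B : ℝ → ℝ} (hB : LocallyIntegrableOn B J) {θ : ℝ → ℝ} (hθ : ContDiff ℝ ∞ θ)
    (hc : HasCompactSupport θ) (hs : tsupport θ ⊆ J) :
    ∫ x, (deriv θ x * (∫ y in x₀..x, B y) + θ x * B x) = 0 := by
  obtain ⟨a, b, hax, hxb, hab, hK⟩ := exists_Ioo_of_isCompact hJ hJc hx₀ hc hs
  have hle : a ≤ b := by linarith
  have hu : uIcc a b = Icc a b := uIcc_of_le hle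
  have hBi : IntervalIntegrable B volume a b :=
    intervalIntegrable_of_locallyIntegrableOn hB (by rwa [hu])
  have hP := hBi.absolutelyContinuousOnInterval_intervalIntegral (c := x₀)
    (by rw [hu]; exact ⟨hax.le, hxb.le⟩)
  have hθac : AbsolutelyContinuousOnInterval θ a b :=
    (hθ.of_le (by norm_cast : ((1 : ℕ) : WithTop ℕ∞) ≤ _)).contDiffOn.absolutelyContinuousOnInterval
  have h0 : ∀ x, x ∉ Ioo a b → θ x = 0 := fun x hx =>
    image_eq_zero_of_notMem_tsupport fun h => hx (hK h)
  have h1 : ∀ x, x ∉ Ioo a b → deriv θ x = 0 := fun x hx =>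
    image_eq_zero_of_notMem_tsupport fun h => hx (hK (tsupport_deriv_subset h))
  rw [← intervalIntegral.integral_eq_integral_of_support_subset (a := a) (b := b)]
  · have h := hθac.integral_deriv_mul_eq_sub hP
    rw [h0 a (by simp), h0 b (by simp)] at h
    simp only [zero_mul, sub_zero] at h
    rw [← h]
    refine intervalIntegral.integral_congr_ae ?_
    filter_upwards [hBi.ae_hasDerivAt_integral] with x hx hxm
    have hx' := uIoc_subset_uIcc hxm
    rw [(hx hx' x₀ (by rw [hu]; exact ⟨hax.le, hxb.le⟩)).deriv]
  · intro x hx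
    by_contra hn
    have hn' : x ∉ Ioo a b := fun h => hn ⟨h.1, h.2.le⟩
    exact hx (by simp [h0 x hn', h1 x hn'])

theorem hasCompactSupport_of_eq_zero {θ : ℝ → ℝ} {a b : ℝ} (h : ∀ x, x ∉ Icc a b → θ x = 0) :
    HasCompactSupport θ ∧ tsupport θ ⊆ Icc a b :=
  ⟨HasCompactSupport.intro isCompact_Icc h,
    closure_minimal (fun x hx => by_contra fun hn => hx (h x hn)) isClosed_Icc⟩

/-- The primitive from the left of the support vanishes again on the right, because the total
integral is zero. -/
theorem exists_test_of_integral_eq_zero (hJ : IsOpen J) (hJc : J.OrdConnected) (hx₀ : x₀ ∈ J)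
    {ψ : ℝ → ℝ} (hψ : ContDiff ℝ ∞ ψ) (hc : HasCompactSupport ψ) (hs : tsupport ψ ⊆ J)
    (hi : ∫ x, ψ x = 0) :
    ∃ θ : ℝ → ℝ, ContDiff ℝ ∞ θ ∧ HasCompactSupport θ ∧ tsupport θ ⊆ J ∧ deriv θ = ψ := by
  obtain ⟨a, b, hax, hxb, hab, hK⟩ := exists_Ioo_of_isCompact hJ hJc hx₀ hc hs
  have hd : ∀ x, HasDerivAt (fun x => ∫ y in a..x, ψ y) (ψ x) x := fun x =>
    intervalIntegral.integral_hasDerivAt_right (hψ.continuous.intervalIntegrable _ _)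
      (hψ.continuous.stronglyMeasurableAtFilter _ _) hψ.continuous.continuousAt
  have hde : deriv (fun x => ∫ y in a..x, ψ y) = ψ := funext fun x => (hd x).deriv
  have h0 : ∀ x, x ∉ Ioo a b → ψ x = 0 := fun x hx =>
    image_eq_zero_of_notMem_tsupport fun h => hx (hK h)
  have hz : ∀ x, x ∉ Icc a b → ∫ y in a..x, ψ y = 0 := by
    intro x hx
    rcases lt_or_ge x a with h | h
    · rw [intervalIntegral.integral_symm, intervalIntegral.integral_of_le h.le, neg_eq_zero]
      exact setIntegral_eq_zero_of_forall_eq_zero fun y hy => h0 y fun hy' =>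
        absurd hy'.1 (not_lt.2 hy.2)
    · have hb : b < x := not_le.1 fun h' => hx ⟨h, h'⟩
      rw [intervalIntegral.integral_eq_integral_of_support_subset, hi]
      intro y hy
      have := by_contra fun hn => hy (h0 y hn)
      exact ⟨this.1, by linarith [this.2]⟩
  obtain ⟨hc', hs'⟩ := hasCompactSupport_of_eq_zero hz
  refine ⟨fun x => ∫ y in a..x, ψ y, ?_, hc', hs'.trans hab, hde⟩
  rw [contDiff_infty_iff_deriv, hde]
  exact ⟨fun x => (hd x).differentiableAt, hψ⟩

theorem integrable_test_mul {W φ : ℝ → ℝ} (hW : LocallyIntegrableOn W J) (hφ : Continuous φ)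
    (hc : HasCompactSupport φ) (hs : tsupport φ ⊆ J) : Integrable fun x => φ x * W x := by
  have h1 : IntegrableOn (fun x => φ x * W x) (tsupport φ) volume := by
    obtain ⟨C, hC⟩ := hφ.bounded_above_of_compact_support hc
    exact (hW.integrableOn_compact_subset hs hc).bdd_mul (c := C) hφ.aestronglyMeasurable.restrict
      (ae_of_all _ hC)
  refine (integrableOn_iff_integrable_of_support_subset ?_).1 h1
  exact fun z hz => subset_tsupport _ (left_ne_zero_of_mul hz)

/-- The du Bois-Reymond argument: a test function minus its integral times a fixed normalised bump
has mean zero, hence is the derivative of a test function. The constant is the mean of `W` against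
that bump. -/
theorem ae_eq_const_of_weak_deriv_zero (hJ : IsOpen J) (hJc : J.OrdConnected) (hx₀ : x₀ ∈ J)
    {W : ℝ → ℝ} (hW : LocallyIntegrableOn W J)
    (h : ∀ θ : ℝ → ℝ, ContDiff ℝ ∞ θ → HasCompactSupport θ → tsupport θ ⊆ J →
      ∫ x, deriv θ x * W x = 0) :
    ∃ c, ∀ᵐ x, x ∈ J → W x = c := by
  obtain ⟨ε, hε, hεJ⟩ := Metric.isOpen_iff.1 hJ x₀ hx₀
  let β : ContDiffBump x₀ := ⟨ε / 4, ε / 2, by positivity, by linarith⟩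
  have hβs : tsupport (β.normed volume) ⊆ J := by
    rw [β.tsupport_normed_eq]
    exact (Metric.closedBall_subset_ball (by change ε / 2 < ε; linarith)).trans hεJ
  have hβc : ContDiff ℝ ∞ (β.normed volume) := β.contDiff_normed
  have hβk : HasCompactSupport (β.normed volume) := β.hasCompactSupport_normed
  set c := ∫ x, β.normed volume x * W x with hcdef
  refine ⟨c, ?_⟩
  have key := hJ.ae_eq_zero_of_integral_contDiff_smul_eq_zero (μ := volume)
    (f := fun x => W x - c) (hW.sub ((locallyIntegrable_const c).locallyIntegrableOn _)) ?_
  · filter_upwards [key] with x hx hxJ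
    exact sub_eq_zero.1 (hx hxJ)
  intro φ hφ hφc hφs
  set I := ∫ x, φ x
  have hφi : Integrable φ := hφ.continuous.integrable_of_hasCompactSupport hφc
  have hβi : Integrable (β.normed volume) := hβc.continuous.integrable_of_hasCompactSupport hβk
  obtain ⟨θ, hθ, hθc, hθs, hθd⟩ := exists_test_of_integral_eq_zero hJ hJc hx₀
    (ψ := fun x => φ x - I * β.normed volume x) (hφ.sub (contDiff_const.mul hβc))
    (hφc.sub (hβk.mul_left)) ((tsupport_sub _ _).trans (union_subset hφs
      ((tsupport_mul_subset_right).trans hβs)))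
    (by rw [integral_sub hφi (hβi.const_mul _), integral_const_mul, β.integral_normed]; simp [I])
  have h1 := h θ hθ hθc hθs
  rw [hθd] at h1
  have i1 := integrable_test_mul hW hφ.continuous hφc hφs
  have i2 := integrable_test_mul hW hβc.continuous hβk hβs
  have e1 : ∀ x, (φ x - I * β.normed volume x) * W x =
      φ x * W x - I * (β.normed volume x * W x) := fun x => by ring
  simp only [e1] at h1
  rw [integral_sub i1 (i2.const_mul _), integral_const_mul, ← hcdef] at h1
  simp only [smul_eq_mul, mul_sub]
  rw [integral_sub i1 (hφi.mul_const _), integral_mul_const]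
  exact h1

/-- A function with locally integrable weak derivative `B` is a primitive of `B`. -/
theorem ae_eq_primitive_of_weak_deriv (hJ : IsOpen J) (hJc : J.OrdConnected) (hx₀ : x₀ ∈ J)
    {A B : ℝ → ℝ} (hA : LocallyIntegrableOn A J) (hB : LocallyIntegrableOn B J)
    (h : ∀ θ : ℝ → ℝ, ContDiff ℝ ∞ θ → HasCompactSupport θ → tsupport θ ⊆ J →
      ∫ x, (deriv θ x * A x + θ x * B x) = 0) :
    ∃ c, ∀ᵐ x, x ∈ J → A x = c + ∫ y in x₀..x, B y := by
  have hP : LocallyIntegrableOn (fun x => ∫ y in x₀..x, B y) J := by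
    refine ContinuousOn.locallyIntegrableOn (fun x hx => ?_) hJ.measurableSet
    obtain ⟨a, b, hax, hxb, hab, hK⟩ := exists_Ioo_of_isCompact hJ hJc hx₀
      (isCompact_singleton (x := x)) (singleton_subset_iff.2 hx)
    have hu : uIcc a b = Icc a b := uIcc_of_le (by linarith)
    have hxm := hK (mem_singleton x)
    have := ((intervalIntegrable_of_locallyIntegrableOn hB
      (by rwa [hu])).absolutelyContinuousOnInterval_intervalIntegral (c := x₀)
      (by rw [hu]; exact ⟨hax.le, hxb.le⟩)).continuousOn
    rw [hu] at this
    exact (this.continuousAt (Icc_mem_nhds hxm.1 hxm.2)).continuousWithinAt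
  obtain ⟨c, hc⟩ := ae_eq_const_of_weak_deriv_zero hJ hJc hx₀ (hA.sub hP) (fun θ hθ hθc hθs => by
    have hd : Continuous (deriv θ) := (contDiff_infty_iff_deriv.1 hθ).2.continuous
    have hdc : HasCompactSupport (deriv θ) := hθc.deriv
    have hds : tsupport (deriv θ) ⊆ J := (tsupport_deriv_subset).trans hθs
    have h1 := h θ hθ hθc hθs
    have h2 := integral_deriv_mul_primitive hJ hJc hx₀ hB hθ hθc hθs
    have iA := integrable_test_mul hA hd hdc hds
    have iP := integrable_test_mul hP hd hdc hds
    have iB := integrable_test_mul hB hθ.continuous hθc hθs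
    rw [integral_add iA iB] at h1
    rw [integral_add iP iB] at h2
    simp only [Pi.sub_apply, mul_sub]
    rw [integral_sub iA iP]
    linarith)
  exact ⟨c, by filter_upwards [hc] with x hx hxJ; linarith [hx hxJ, Pi.sub_apply A (fun x => ∫ y in x₀..x, B y) x]⟩

/-- A continuous function with weak derivative `B`. -/
theorem sub_eq_integral_of_weak_deriv {A B : ℝ → ℝ} (hA : Continuous A)
    (hB : LocallyIntegrable B volume)
    (h : ∀ θ : ℝ → ℝ, ContDiff ℝ ∞ θ → HasCompactSupport θ →
      ∫ x, (deriv θ x * A x + θ x * B x) = 0) (a b : ℝ) :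
    A b - A a = ∫ y in a..b, B y := by
  obtain ⟨c, hc⟩ := ae_eq_primitive_of_weak_deriv isOpen_univ ordConnected_univ (mem_univ 0)
    (hA.locallyIntegrable.locallyIntegrableOn _) (hB.locallyIntegrableOn _)
    (fun θ hθ hθc _ => h θ hθ hθc)
  have hii : ∀ a b, IntervalIntegrable B volume a b := fun a b =>
    intervalIntegrable_of_locallyIntegrableOn (hB.locallyIntegrableOn univ) (subset_univ _)
  have hP : Continuous fun x => ∫ y in (0 : ℝ)..x, B y :=
    intervalIntegral.continuous_primitive hii 0
  have he : A = fun x => c + ∫ y in (0 : ℝ)..x, B y :=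
    Continuous.ae_eq_iff_eq volume hA (continuous_const.add hP) |>.1
      (by filter_upwards [hc] with x hx using hx (mem_univ x))
  rw [he]
  simp only
  rw [← intervalIntegral.integral_add_adjacent_intervals (hii 0 a) (hii a b)]
  ring

end WeakFTC

/-! ### Continuity in time of weighted integrals. -/

/-- A continuous curve in `L^r`. -/
structure CurveLp {F : Type*} [NormedAddCommGroup F] (r : ℝ≥0∞) (f : ℝ → E3 → F) : Prop where
  memLp : ∀ t, MemLp (f t) r volume
  tendsto : ∀ t₀, Tendsto (fun t => eLpNorm (f t - f t₀) r volume) (𝓝 t₀) (𝓝 0)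

/-- A bounded nonnegative measurable weight with bounded support. -/
structure BddWeight (w : E3 → ℝ) : Prop where
  measurable : Measurable w
  nonneg : ∀ x, 0 ≤ w x
  bound : ∃ C, ∀ x, w x ≤ C
  support : ∃ R, ∀ x, R < ‖x‖ → w x = 0

theorem continuous_integral_norm_rpow {α F : Type*} [MeasurableSpace α] [NormedAddCommGroup F]
    {ν : Measure α} {q : ℝ} (hq : 1 ≤ q) {f : ℝ → α → F}
    (hf : ∀ t, MemLp (f t) (ENNReal.ofReal q) ν)
    (hc : ∀ t₀, Tendsto (fun t => eLpNorm (f t - f t₀) (ENNReal.ofReal q) ν) (𝓝 t₀) (𝓝 0)) :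
    Continuous fun t => ∫ x, ‖f t x‖ ^ q ∂ν := by
  have hq1 : (1 : ℝ≥0∞) ≤ ENNReal.ofReal q := by simpa using ENNReal.ofReal_le_ofReal hq
  have hq0 : ENNReal.ofReal q ≠ 0 := (zero_lt_one.trans_le hq1).ne'
  have hqr : (ENNReal.ofReal q).toReal = q := ENNReal.toReal_ofReal (by linarith)
  have h := continuous_eLpNorm_curve hq1 hf hc
  have e : (fun t => ∫ x, ‖f t x‖ ^ q ∂ν) =
      fun t => (eLpNorm (f t) (ENNReal.ofReal q) ν).toReal ^ q := by
    ext t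
    rw [(hf t).eLpNorm_eq_integral_rpow_norm hq0 ENNReal.ofReal_ne_top, hqr]
    have h0 : 0 ≤ ∫ x, ‖f t x‖ ^ q ∂ν := by positivity
    rw [ENNReal.toReal_ofReal (by positivity), ← Real.rpow_mul h0, inv_mul_cancel₀ (by linarith),
      Real.rpow_one]
  rw [e]
  refine Continuous.rpow_const ?_ fun _ => Or.inr (by linarith)
  exact continuous_iff_continuousAt.2 fun t =>
    ContinuousAt.comp (g := ENNReal.toReal) (f := fun t => eLpNorm (f t) (ENNReal.ofReal q) ν)
      (ENNReal.continuousAt_toReal (hf t).2.ne) h.continuousAt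

/-- The measure with density `w` is finite and at most a multiple of Lebesgue measure, so for it
convergence in L^r implies convergence in L^q whenever q ≤ r. -/
theorem CurveLp.weighted {F : Type*} [NormedAddCommGroup F] {r : ℝ≥0∞} {f : ℝ → E3 → F}
    (hf : CurveLp r f) {q : ℝ} (hq : 1 ≤ q) (hqr : ENNReal.ofReal q ≤ r) {w : E3 → ℝ}
    (hw : BddWeight w) :
    (∀ t, Integrable fun x => w x * ‖f t x‖ ^ q) ∧
      Continuous fun t => ∫ x, w x * ‖f t x‖ ^ q := by
  obtain ⟨C, hC⟩ := hw.bound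
  obtain ⟨R, hR⟩ := hw.support
  set ρ : E3 → NNReal := fun x => (w x).toNNReal
  have hρm : Measurable ρ := hw.measurable.real_toNNReal
  set ν : Measure E3 := volume.withDensity fun x => (ρ x : ℝ≥0∞)
  have hle : ν ≤ ENNReal.ofReal C • volume := by
    rw [← withDensity_const]
    exact withDensity_mono (ae_of_all _ fun x => ENNReal.ofReal_le_ofReal (hC x))
  have hfin : IsFiniteMeasure ν := by
    refine ⟨?_⟩
    rw [withDensity_apply _ MeasurableSet.univ, Measure.restrict_univ]
    calc ∫⁻ x, (ρ x : ℝ≥0∞) ≤ ∫⁻ x, (Metric.closedBall (0 : E3) R).indicator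
          (fun _ => ENNReal.ofReal C) x := by
          refine lintegral_mono fun x => ?_
          by_cases hx : x ∈ Metric.closedBall (0 : E3) R
          · rw [indicator_of_mem hx]; exact ENNReal.ofReal_le_ofReal (hC x)
          · rw [indicator_of_notMem hx]
            have : w x = 0 := hR x (by simpa using hx)
            simp [ρ, this]
      _ < ⊤ := by
          rw [lintegral_indicator Metric.isClosed_closedBall.measurableSet, setLIntegral_const]
          exact ENNReal.mul_lt_top ENNReal.ofReal_lt_top
            ((isCompact_closedBall (0 : E3) R).measure_lt_top (μ := volume))
  have hm : ∀ {g : E3 → F}, MemLp g r volume → MemLp g r ν := fun hg =>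
    hg.of_measure_le_smul ENNReal.ofReal_ne_top hle
  have hr0 : r ≠ 0 := by
    rintro rfl
    simp only [nonpos_iff_eq_zero, ENNReal.ofReal_eq_zero] at hqr
    linarith
  have h1 : ∀ t, MemLp (f t) (ENNReal.ofReal q) ν := fun t =>
    (hm (hf.memLp t)).mono_exponent hqr
  have h2 : ∀ t₀, Tendsto (fun t => eLpNorm (f t - f t₀) (ENNReal.ofReal q) ν) (𝓝 t₀) (𝓝 0) := by
    intro t₀
    set D : ℝ≥0∞ := ENNReal.ofReal C ^ (1 / r.toReal) *
      ν univ ^ (1 / (ENNReal.ofReal q).toReal - 1 / r.toReal)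
    have hexp : 0 ≤ 1 / (ENNReal.ofReal q).toReal - 1 / r.toReal := by
      rw [sub_nonneg]
      rcases eq_or_ne r ⊤ with h | h
      · rw [h]; simp
      · refine one_div_le_one_div_of_le ?_ (ENNReal.toReal_mono h hqr)
        rw [ENNReal.toReal_ofReal (by linarith)]; linarith
    have hD : D ≠ ⊤ := ENNReal.mul_ne_top
      (ENNReal.rpow_ne_top_of_nonneg (by positivity) ENNReal.ofReal_ne_top)
      (ENNReal.rpow_ne_top_of_nonneg hexp (measure_ne_top _ _))
    refine tendsto_of_tendsto_of_tendsto_of_le_of_le tendsto_const_nhds ?_ (fun _ => zero_le)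
      (fun t => ?_) (h := fun t => D * eLpNorm (f t - f t₀) r volume)
    · simpa using ENNReal.Tendsto.const_mul (a := D) (hf.tendsto t₀) (Or.inr hD)
    · have hδ := (hf.memLp t).sub (hf.memLp t₀)
      refine (eLpNorm_le_eLpNorm_mul_rpow_measure_univ hqr (hm hδ).1).trans ?_
      have h3 : eLpNorm (f t - f t₀) r ν ≤ ENNReal.ofReal C ^ (1 / r.toReal) *
          eLpNorm (f t - f t₀) r volume := by
        refine (eLpNorm_mono_measure _ hle).trans ?_
        rcases eq_or_ne r ⊤ with h | h
        · subst h
          simp only [ENNReal.toReal_top, div_zero, ENNReal.rpow_zero, one_mul]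
          exact eLpNormEssSup_mono_measure _ (Measure.smul_absolutelyContinuous)
        · rw [eLpNorm_smul_measure_of_ne_top h, smul_eq_mul, ENNReal.toReal_div, ENNReal.toReal_one]
      calc _ ≤ _ := mul_le_mul_left h3 _
        _ = _ := by simp only [D]; ring
  have hsm : ∀ t x, ρ x • ‖f t x‖ ^ q = w x * ‖f t x‖ ^ q := by
    intro t x
    rw [NNReal.smul_def, smul_eq_mul, Real.coe_toNNReal _ (hw.nonneg x)]
  constructor
  · intro t
    have h3 := (h1 t).integrable_norm_rpow' 
    rw [ENNReal.toReal_ofReal (by linarith), integrable_withDensity_iff_integrable_smul hρm] at h3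
    simpa only [hsm] using h3
  · have h3 := continuous_integral_norm_rpow hq h1 h2
    simpa only [ν, integral_withDensity_eq_integral_smul hρm, hsm] using h3

theorem abs_Lplus_le (f h : E3 → ℝ) (g : E3 → E3) (x : E3) :
    |Lplus f h g x| ≤ ‖g x‖ + |‖x‖⁻¹ * f x| + |h x| := by
  have h1 : |inner ℝ (g x) x / ‖x‖| ≤ ‖g x‖ := by
    rw [abs_div, abs_of_nonneg (norm_nonneg x)]
    exact div_le_of_le_mul₀ (norm_nonneg _) (norm_nonneg _) (abs_real_inner_le_norm _ _)
  have h2 : f x / ‖x‖ = ‖x‖⁻¹ * f x := by rw [div_eq_inv_mul]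
  rw [Lplus, h2]
  exact (abs_add_le _ _).trans (add_le_add_left ((abs_add_le _ _).trans (add_le_add_left h1 _)) _)

theorem norm_angularGrad_le (g : E3 → E3) (x : E3) : ‖angularGrad g x‖ ≤ ‖g x‖ := by
  by_cases hx : x = 0
  · simp [angularGrad, hx]
  · have := norm_angularGrad_sq g hx
    nlinarith [norm_nonneg (angularGrad g x), norm_nonneg (g x), sq_nonneg (inner ℝ (g x) x / ‖x‖)]

theorem measurable_inv_norm : Measurable fun x : E3 => ‖x‖⁻¹ := measurable_norm.inv

theorem aestronglyMeasurable_Lplus {f h : E3 → ℝ} {g : E3 → E3}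
    (hf : AEStronglyMeasurable f volume) (hh : AEStronglyMeasurable h volume)
    (hg : AEStronglyMeasurable g volume) : AEStronglyMeasurable (Lplus f h g) volume := by
  have h0 : AEStronglyMeasurable (fun x : E3 => ‖x‖⁻¹) volume :=
    measurable_inv_norm.aestronglyMeasurable
  refine (((hg.inner (𝕜 := ℝ) aestronglyMeasurable_id).mul h0).add (hf.mul h0)).add hh |>.congr ?_
  exact ae_of_all _ fun x => by simp [Lplus, div_eq_mul_inv]

theorem aestronglyMeasurable_angularGrad {g : E3 → E3} (hg : AEStronglyMeasurable g volume) :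
    AEStronglyMeasurable (angularGrad g) volume := by
  have h0 : AEStronglyMeasurable (fun x : E3 => (‖x‖ ^ 2)⁻¹) volume :=
    (measurable_norm.pow_const 2).inv.aestronglyMeasurable
  refine (hg.sub (((hg.inner (𝕜 := ℝ) aestronglyMeasurable_id).mul h0).smul
    aestronglyMeasurable_id)).congr ?_
  exact ae_of_all _ fun x => by simp [angularGrad, div_eq_mul_inv]

namespace IsEnergySolution

variable {p : ℝ} {u ut : ℝ → E3 → ℝ} {gradu : ℝ → E3 → E3}

theorem curve_u (hu : IsEnergySolution p u ut gradu) : CurveLp 6 u := ⟨hu.memLp_u, hu.continuous_u⟩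

theorem curve_ut (hu : IsEnergySolution p u ut gradu) : CurveLp 2 ut :=
  ⟨hu.memLp_ut, hu.continuous_ut⟩

theorem curve_gradu (hu : IsEnergySolution p u ut gradu) : CurveLp 2 gradu :=
  ⟨hu.memLp_gradu, hu.continuous_gradu⟩

theorem memLp_Lplus_bound (hu : IsEnergySolution p u ut gradu) (t : ℝ) :
    MemLp (fun x => ‖gradu t x‖ + |‖x‖⁻¹ * u t x| + |ut t x|) 2 volume :=
  ((hu.memLp_gradu t).norm.add (hu.memLp_hardy t).abs).add (hu.memLp_ut t).abs

/-- 𝐋₊ is linear, so the difference of two times is 𝐋₊ of the difference; Hardy's inequality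
controls its u/|x| term. -/
theorem curve_Lplus (hu : IsEnergySolution p u ut gradu) :
    CurveLp 2 fun t => Lplus (u t) (ut t) (gradu t) where
  memLp t := (hu.memLp_Lplus_bound t).mono
    (aestronglyMeasurable_Lplus (hu.memLp_u t).1 (hu.memLp_ut t).1 (hu.memLp_gradu t).1)
    (ae_of_all _ fun x => (abs_Lplus_le _ _ _ x).trans (le_abs_self _))
  tendsto t₀ := by
    have h := ((hu.continuous_gradu t₀).add (hu.continuous_hardy t₀)).add (hu.continuous_ut t₀)
    rw [add_zero, add_zero] at h
    refine tendsto_of_tendsto_of_tendsto_of_le_of_le tendsto_const_nhds h (fun _ => zero_le)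
      fun t => ?_
    have hg := ((hu.memLp_gradu t).sub (hu.memLp_gradu t₀)).norm
    have hh := ((hu.memLp_hardy t).sub (hu.memLp_hardy t₀)).norm
    have hut := ((hu.memLp_ut t).sub (hu.memLp_ut t₀)).norm
    have h1 : eLpNorm (Lplus (u t) (ut t) (gradu t) - Lplus (u t₀) (ut t₀) (gradu t₀)) 2 volume ≤
        eLpNorm ((fun x => ‖(gradu t - gradu t₀) x‖) +
          (fun x => ‖((fun x => ‖x‖⁻¹ * u t x) - fun x => ‖x‖⁻¹ * u t₀ x) x‖) +
          fun x => ‖(ut t - ut t₀) x‖) 2 volume := by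
      refine eLpNorm_mono_real fun x => ?_
      have e : (Lplus (u t) (ut t) (gradu t) - Lplus (u t₀) (ut t₀) (gradu t₀)) x =
          Lplus (u t - u t₀) (ut t - ut t₀) (gradu t - gradu t₀) x := by
        simp only [Lplus, Pi.sub_apply, inner_sub_left]; ring
      rw [e]
      refine (abs_Lplus_le _ _ _ x).trans (le_of_eq ?_)
      simp only [Pi.add_apply, Pi.sub_apply, Real.norm_eq_abs, mul_sub]
    refine h1.trans ((eLpNorm_add_le (hg.1.add hh.1) hut.1 (by norm_num)).trans ?_)
    refine (add_le_add_left (eLpNorm_add_le hg.1 hh.1 (by norm_num)) _).trans (le_of_eq ?_)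
    simp only [eLpNorm_norm]

theorem curve_angularGrad (hu : IsEnergySolution p u ut gradu) :
    CurveLp 2 fun t => angularGrad (gradu t) where
  memLp t := (hu.memLp_gradu t).mono (aestronglyMeasurable_angularGrad (hu.memLp_gradu t).1)
    (ae_of_all _ fun x => norm_angularGrad_le _ x)
  tendsto t₀ := by
    refine tendsto_of_tendsto_of_tendsto_of_le_of_le tendsto_const_nhds (hu.continuous_gradu t₀)
      (fun _ => zero_le) fun t => eLpNorm_mono fun x => ?_
    have e : (angularGrad (gradu t) - angularGrad (gradu t₀)) x =
        angularGrad (gradu t - gradu t₀) x := by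
      simp only [angularGrad, Pi.sub_apply, inner_sub_left, sub_div, sub_smul]; abel
    rw [e]
    exact norm_angularGrad_le _ x

/-- Since p+1 < 6, continuity in L⁶ suffices on bounded sets. -/
theorem weighted_rpow_u (hp : 3 ≤ p) (hp5 : p < 5) (hu : IsEnergySolution p u ut gradu)
    {w : E3 → ℝ} (hw : BddWeight w) :
    (∀ t, Integrable fun x => w x * |u t x| ^ (p + 1)) ∧
      Continuous fun t => ∫ x, w x * |u t x| ^ (p + 1) :=
  hu.curve_u.weighted (by linarith) (by
    rw [show (6 : ℝ≥0∞) = ENNReal.ofReal 6 by norm_num]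
    exact ENNReal.ofReal_le_ofReal (by linarith)) hw

end IsEnergySolution

theorem CurveLp.weighted_sq {F : Type*} [NormedAddCommGroup F] {f : ℝ → E3 → F}
    (hf : CurveLp 2 f) {w : E3 → ℝ} (hw : BddWeight w) :
    (∀ t, Integrable fun x => w x * ‖f t x‖ ^ 2) ∧
      Continuous fun t => ∫ x, w x * ‖f t x‖ ^ 2 := by
  have := hf.weighted (q := 2) (by norm_num) (by norm_num) hw
  simpa only [Real.rpow_two] using this

namespace IsEnergySolution

variable {p : ℝ} {u ut : ℝ → E3 → ℝ} {gradu : ℝ → E3 → E3}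

theorem weighted_inward (hp : 3 ≤ p) (hp5 : p < 5) (hu : IsEnergySolution p u ut gradu)
    {w : E3 → ℝ} (hw : BddWeight w) :
    (∀ t, Integrable fun x => w x * inwardEnergyDensity p (u t) (ut t) (gradu t) x) ∧
      Continuous fun t => ∫ x, w x * inwardEnergyDensity p (u t) (ut t) (gradu t) x := by
  obtain ⟨a1, c1⟩ := hu.curve_Lplus.weighted_sq hw
  obtain ⟨a2, c2⟩ := hu.curve_angularGrad.weighted_sq hw
  obtain ⟨a3, c3⟩ := hu.weighted_rpow_u hp hp5 hw
  have e : ∀ t x, w x * inwardEnergyDensity p (u t) (ut t) (gradu t) x =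
      1 / 4 * (w x * ‖Lplus (u t) (ut t) (gradu t) x‖ ^ 2) +
      1 / 4 * (w x * ‖angularGrad (gradu t) x‖ ^ 2) +
      1 / (2 * (p + 1)) * (w x * |u t x| ^ (p + 1)) := by
    intro t x
    rw [inwardEnergyDensity, Real.norm_eq_abs]; ring
  have i12 := fun t => ((a1 t).const_mul (1 / 4)).add ((a2 t).const_mul (1 / 4))
  have i3 := fun t => (a3 t).const_mul (1 / (2 * (p + 1)))
  simp only [e]
  refine ⟨fun t => (i12 t).add (i3 t), ?_⟩
  have e2 := fun t => integral_add (i12 t) (i3 t)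
  have e3 := fun t => integral_add ((a1 t).const_mul (1 / 4)) ((a2 t).const_mul (1 / 4))
  simp only [Pi.add_apply] at e2
  simp only [e2, e3, integral_const_mul]
  exact ((c1.const_mul _).add (c2.const_mul _)).add (c3.const_mul _)

/-- The energy density. -/
def _root_.energyDensity (p : ℝ) (f h : E3 → ℝ) (g : E3 → E3) (x : E3) : ℝ :=
  ‖g x‖ ^ 2 / 2 + |h x| ^ 2 / 2 + |f x| ^ (p + 1) / (p + 1)

theorem weighted_energy (hp : 3 ≤ p) (hp5 : p < 5) (hu : IsEnergySolution p u ut gradu)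
    {w : E3 → ℝ} (hw : BddWeight w) :
    (∀ t, Integrable fun x => w x * energyDensity p (u t) (ut t) (gradu t) x) ∧
      Continuous fun t => ∫ x, w x * energyDensity p (u t) (ut t) (gradu t) x := by
  obtain ⟨a1, c1⟩ := hu.curve_gradu.weighted_sq hw
  obtain ⟨a2, c2⟩ := hu.curve_ut.weighted_sq hw
  obtain ⟨a3, c3⟩ := hu.weighted_rpow_u hp hp5 hw
  have e : ∀ t x, w x * energyDensity p (u t) (ut t) (gradu t) x =
      1 / 2 * (w x * ‖gradu t x‖ ^ 2) + 1 / 2 * (w x * ‖ut t x‖ ^ 2) +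
      1 / (p + 1) * (w x * |u t x| ^ (p + 1)) := by
    intro t x
    rw [energyDensity, Real.norm_eq_abs]; ring
  have i12 := fun t => ((a1 t).const_mul (1 / 2)).add ((a2 t).const_mul (1 / 2))
  have i3 := fun t => (a3 t).const_mul (1 / (p + 1))
  simp only [e]
  refine ⟨fun t => (i12 t).add (i3 t), ?_⟩
  have e2 := fun t => integral_add (i12 t) (i3 t)
  have e3 := fun t => integral_add ((a1 t).const_mul (1 / 2)) ((a2 t).const_mul (1 / 2))
  simp only [Pi.add_apply] at e2
  simp only [e2, e3, integral_const_mul]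
  exact ((c1.const_mul _).add (c2.const_mul _)).add (c3.const_mul _)

end IsEnergySolution

/-! ### The energy never exceeds its initial value. -/

theorem cutoff_bddWeight (n : ℕ) : BddWeight (cutoff n) where
  measurable := (cutoff_contDiff n).continuous.measurable
  nonneg := cutoff_nonneg n
  bound := ⟨1, cutoff_le_one n⟩
  support := ⟨2 * ((n : ℝ) + 1), fun _ hx => cutoff_eq_zero hx.le⟩

theorem energyDensity_nonneg {p : ℝ} (hp : 3 ≤ p) (f h : E3 → ℝ) (g : E3 → E3) (x : E3) :
    0 ≤ energyDensity p f h g x := by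
  have : 0 ≤ |f x| ^ (p + 1) := Real.rpow_nonneg (abs_nonneg _) _
  have : 0 < p + 1 := by linarith
  rw [energyDensity]; positivity

namespace IsEnergySolution

variable {p : ℝ} {u ut : ℝ → E3 → ℝ} {gradu : ℝ → E3 → E3}

theorem continuous_kinetic (hu : IsEnergySolution p u ut gradu) :
    Continuous fun t => (∫ x, ‖gradu t x‖ ^ 2) + ∫ x, ‖ut t x‖ ^ 2 := by
  have h1 := continuous_integral_norm_rpow (q := 2) (by norm_num) (f := gradu)
    (by simpa using hu.memLp_gradu) (by simpa using hu.continuous_gradu)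
  have h2 := continuous_integral_norm_rpow (q := 2) (by norm_num) (f := ut)
    (by simpa using hu.memLp_ut) (by simpa using hu.continuous_ut)
  simp only [Real.rpow_two] at h1 h2
  exact h1.add h2

theorem integrable_sq_gradu (hu : IsEnergySolution p u ut gradu) (t : ℝ) :
    Integrable fun x => ‖gradu t x‖ ^ 2 := (hu.memLp_gradu t).integrable_norm_pow two_ne_zero

theorem integrable_sq_ut (hu : IsEnergySolution p u ut gradu) (t : ℝ) :
    Integrable fun x => ‖ut t x‖ ^ 2 := (hu.memLp_ut t).integrable_norm_pow two_ne_zero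

theorem energy_flux_bound (hu : IsEnergySolution p u ut gradu) {M : ℝ} {n : ℕ} (hM0 : 0 ≤ M)
    (hM : ∀ (x d : E3), |dirD d (cutoff n) x| ≤ M / ((n : ℝ) + 1) * ‖d‖) (t : ℝ) :
    Integrable (fun x => fderiv ℝ (cutoff n) x (gradu t x) * ut t x) ∧
    |∫ x, fderiv ℝ (cutoff n) x (gradu t x) * ut t x| ≤
      M / ((n : ℝ) + 1) * ((∫ x, ‖gradu t x‖ ^ 2) + ∫ x, ‖ut t x‖ ^ 2) := by
  have hb : ∀ x, ‖fderiv ℝ (cutoff n) x (gradu t x) * ut t x‖ ≤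
      M / ((n : ℝ) + 1) * (‖gradu t x‖ ^ 2 + ‖ut t x‖ ^ 2) := by
    intro x
    rw [norm_mul]
    have h1 : ‖fderiv ℝ (cutoff n) x (gradu t x)‖ ≤ _ := hM x (gradu t x)
    have h2 : 0 ≤ M / ((n : ℝ) + 1) := by positivity
    have h3 : ‖gradu t x‖ * ‖ut t x‖ ≤ ‖gradu t x‖ ^ 2 + ‖ut t x‖ ^ 2 := by
      nlinarith [sq_nonneg (‖gradu t x‖ - ‖ut t x‖), norm_nonneg (gradu t x), norm_nonneg (ut t x)]
    refine (mul_le_mul_of_nonneg_right h1 (norm_nonneg _)).trans ?_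
    rw [mul_assoc]
    exact mul_le_mul_of_nonneg_left h3 h2
  have hi : Integrable fun x => M / ((n : ℝ) + 1) * (‖gradu t x‖ ^ 2 + ‖ut t x‖ ^ 2) :=
    ((hu.integrable_sq_gradu t).add (hu.integrable_sq_ut t)).const_mul _
  have hc : Continuous (fderiv ℝ (cutoff n)) :=
    (cutoff_contDiff n).continuous_fderiv (by simp)
  have hm : AEStronglyMeasurable (fun x => fderiv ℝ (cutoff n) x (gradu t x) * ut t x) volume :=
    ((isBoundedBilinearMap_apply.continuous.comp_aestronglyMeasurable
      (hc.aestronglyMeasurable.prodMk (hu.memLp_gradu t).1))).mul (hu.memLp_ut t).1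
  refine ⟨hi.mono' hm (ae_of_all _ hb), ?_⟩
  rw [← integral_add (hu.integrable_sq_gradu t) (hu.integrable_sq_ut t), ← integral_const_mul]
  exact norm_integral_le_of_norm_le hi (ae_of_all _ hb)

theorem hasCompactSupport_prod_mul {θ : ℝ → ℝ} (hθ : HasCompactSupport θ) {ψ : E3 → ℝ}
    (hψ : HasCompactSupport ψ) : HasCompactSupport fun z : ℝ × E3 => θ z.1 * ψ z.2 := by
  refine HasCompactSupport.intro (hθ.isCompact.prod hψ.isCompact) fun z hz => ?_
  by_cases h1 : z.1 ∈ tsupport θ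
  · have h2 : z.2 ∉ tsupport ψ := fun h => hz ⟨h1, h⟩
    rw [image_eq_zero_of_notMem_tsupport h2, mul_zero]
  · rw [image_eq_zero_of_notMem_tsupport h1, zero_mul]

/-- `null_first` with Y = θ(t) times the cutoff, in the time direction, gives the local energy
identity weakly in t. Continuity of the localised energy upgrades it to every pair of times. -/
theorem energy_cutoff_sub (hp : 3 ≤ p) (hp5 : p < 5) (hu : IsEnergySolution p u ut gradu)
    {M : ℝ} {n : ℕ} (hM0 : 0 ≤ M)
    (hM : ∀ (x d : E3), |dirD d (cutoff n) x| ≤ M / ((n : ℝ) + 1) * ‖d‖) (a b : ℝ) :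
    (∫ x, cutoff n x * energyDensity p (u b) (ut b) (gradu b) x) -
      (∫ x, cutoff n x * energyDensity p (u a) (ut a) (gradu a) x) =
      ∫ t in a..b, -∫ x, fderiv ℝ (cutoff n) x (gradu t x) * ut t x := by
  obtain ⟨hAi, hAc⟩ := hu.weighted_energy hp hp5 (cutoff_bddWeight n)
  have hcd : Continuous (fderiv ℝ (cutoff n)) := (cutoff_contDiff n).continuous_fderiv (by simp)
  have hBm : AEStronglyMeasurable (fun t => ∫ x, fderiv ℝ (cutoff n) x (gradu t x) * ut t x)
      volume := by
    have : AEStronglyMeasurable (fun z : ℝ × E3 =>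
        fderiv ℝ (cutoff n) z.2 (gradu z.1 z.2) * ut z.1 z.2)
        ((volume : Measure ℝ).prod (volume : Measure E3)) :=
      ((isBoundedBilinearMap_apply.continuous.comp_aestronglyMeasurable
      ((hcd.comp continuous_snd).aestronglyMeasurable.prodMk hu.aestronglyMeasurable_gradu))).mul
        hu.aestronglyMeasurable_ut
    exact this.integral_prod_right'
  have hBl : LocallyIntegrable (fun t => -∫ x, fderiv ℝ (cutoff n) x (gradu t x) * ut t x)
      volume := by
    have hk := (hu.continuous_kinetic.const_mul (M / ((n : ℝ) + 1))).locallyIntegrable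
      (μ := volume)
    refine hk.mono hBm.neg (ae_of_all _ fun t => ?_)
    rw [norm_neg, Real.norm_eq_abs]
    exact (hu.energy_flux_bound hM0 hM t).2.trans (le_abs_self _)
  refine sub_eq_integral_of_weak_deriv hAc hBl (fun θ hθ hθc => ?_) a b
  have hY : ContDiff ℝ ∞ fun z : ℝ × E3 => θ z.1 * cutoff n z.2 :=
    (hθ.comp contDiff_fst).mul ((cutoff_contDiff n).comp contDiff_snd)
  have hYc := hasCompactSupport_prod_mul hθc (cutoff_hasCompactSupport n)
  have hfd : ∀ (z : ℝ × E3) (s : ℝ) (v : E3),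
      fderiv ℝ (fun z : ℝ × E3 => θ z.1 * cutoff n z.2) z (s, v) =
        deriv θ z.1 * s * cutoff n z.2 + θ z.1 * fderiv ℝ (cutoff n) z.2 v := by
    intro z s v
    have h1 : HasFDerivAt (fun z : ℝ × E3 => θ z.1) _ z :=
      ((hθ.differentiable (by simp)).differentiableAt.hasFDerivAt (x := z.1)).comp z hasFDerivAt_fst
    have h2 : HasFDerivAt (fun z : ℝ × E3 => cutoff n z.2) _ z :=
      (((cutoff_contDiff n).differentiable (by simp)).differentiableAt.hasFDerivAt
        (x := z.2)).comp z hasFDerivAt_snd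
    have h3 : fderiv ℝ (fun z : ℝ × E3 => θ z.1 * cutoff n z.2) z = _ := (h1.mul h2).fderiv
    rw [h3]
    simp [fderiv_eq_smul_deriv]
    ring
  have h := hu.null_first hp hp5 hY hYc ((1 : ℝ), (0 : E3))
  have h' : NullIntegral volume fun z : ℝ × E3 =>
      deriv θ z.1 * (cutoff n z.2 * energyDensity p (u z.1) (ut z.1) (gradu z.1) z.2) +
      θ z.1 * -(fderiv ℝ (cutoff n) z.2 (gradu z.1 z.2) * ut z.1 z.2) := by
    refine (h.const_mul (-1)).congr fun z => ?_
    simp only [dirD, hfd, stDeriv_time, energyDensity, map_zero, sq_abs]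
    ring
  have h2 := h'.integral_eq
  have h1 := h'.integrable
  rw [Measure.volume_eq_prod] at h1 h2
  rw [integral_prod _ h1] at h2
  rw [← h2]
  congr 1 with t
  have i1 : Integrable fun x => deriv θ t *
      (cutoff n x * energyDensity p (u t) (ut t) (gradu t) x) := (hAi t).const_mul _
  have i2 : Integrable fun x => θ t * -(fderiv ℝ (cutoff n) x (gradu t x) * ut t x) :=
    (hu.energy_flux_bound hM0 hM t).1.neg.const_mul _
  simp only
  rw [integral_add i1 i2, integral_const_mul, integral_const_mul, integral_neg]

/-- The flux through the n-th cutoff is O(1/n) times the quadratic part of the energy, which is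
bounded between 0 and t by continuity. Fatou's lemma then gives the inequality, and equality is not
needed. -/
theorem waveEnergy_le (hp : 3 ≤ p) (hp5 : p < 5) (hu : IsEnergySolution p u ut gradu) (t : ℝ) :
    waveEnergy p (u t) (ut t) (gradu t) ≤ waveEnergy p (u 0) (ut 0) (gradu 0) := by
  obtain ⟨M, hM0, hM⟩ := exists_dirD_cutoff_bound
  have hnn := fun t => energyDensity_nonneg hp (u t) (ut t) (gradu t)
  have hA : ∀ n t, ∫⁻ x, ENNReal.ofReal (cutoff n x * energyDensity p (u t) (ut t) (gradu t) x) =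
      ENNReal.ofReal (∫ x, cutoff n x * energyDensity p (u t) (ut t) (gradu t) x) := fun n t =>
    (ofReal_integral_eq_lintegral_ofReal ((hu.weighted_energy hp hp5 (cutoff_bddWeight n)).1 t)
      (ae_of_all _ fun x => mul_nonneg (cutoff_nonneg n x) (hnn t x))).symm
  have h0 : ∀ n, ENNReal.ofReal (∫ x, cutoff n x * energyDensity p (u 0) (ut 0) (gradu 0) x) ≤
      waveEnergy p (u 0) (ut 0) (gradu 0) := fun n => by
    rw [← hA]
    refine lintegral_mono fun x => ENNReal.ofReal_le_ofReal ?_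
    exact mul_le_of_le_one_left (hnn 0 x) (cutoff_le_one n x)
  obtain ⟨C, hC⟩ := (isCompact_uIcc (a := (0 : ℝ)) (b := t)).exists_bound_of_continuousOn
    hu.continuous_kinetic.continuousOn
  have hstep : ∀ n : ℕ, ENNReal.ofReal
      (∫ x, cutoff n x * energyDensity p (u t) (ut t) (gradu t) x) ≤
      waveEnergy p (u 0) (ut 0) (gradu 0) + ENNReal.ofReal (M / ((n : ℝ) + 1) * C * |t|) := by
    intro n
    have h1 := hu.energy_cutoff_sub hp hp5 hM0 (hM n) 0 t
    have h2 : ‖∫ s in (0 : ℝ)..t, -∫ x, fderiv ℝ (cutoff n) x (gradu s x) * ut s x‖ ≤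
        M / ((n : ℝ) + 1) * C * |t - 0| := by
      refine intervalIntegral.norm_integral_le_of_norm_le_const fun s hs => ?_
      rw [norm_neg, Real.norm_eq_abs]
      refine (hu.energy_flux_bound hM0 (hM n) s).2.trans ?_
      exact mul_le_mul_of_nonneg_left ((le_abs_self _).trans (hC s (uIoc_subset_uIcc hs)))
        (by positivity)
    rw [← h1, sub_zero] at h2
    have h3 := (le_abs_self _).trans h2
    calc _ ≤ ENNReal.ofReal ((∫ x, cutoff n x * energyDensity p (u 0) (ut 0) (gradu 0) x) +
          M / ((n : ℝ) + 1) * C * |t|) := ENNReal.ofReal_le_ofReal (by linarith)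
      _ ≤ _ := ENNReal.ofReal_add_le.trans (add_le_add_left (h0 n) _)
  have hlim : Tendsto (fun n : ℕ => waveEnergy p (u 0) (ut 0) (gradu 0) +
      ENNReal.ofReal (M / ((n : ℝ) + 1) * C * |t|)) atTop
      (𝓝 (waveEnergy p (u 0) (ut 0) (gradu 0))) := by
    have h1 : Tendsto (fun n : ℕ => M / ((n : ℝ) + 1) * C * |t|) atTop (𝓝 0) := by
      have := (((tendsto_one_div_add_atTop_nhds_zero_nat (𝕜 := ℝ)).const_mul M).mul_const C).mul_const
        |t|
      simpa [div_eq_mul_inv] using this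
    have h2 := ENNReal.tendsto_ofReal h1
    simpa using tendsto_const_nhds.add h2
  have hmeas : ∀ n, AEMeasurable (fun x => ENNReal.ofReal
      (cutoff n x * energyDensity p (u t) (ut t) (gradu t) x)) volume := fun n =>
    ((hu.weighted_energy hp hp5 (cutoff_bddWeight n)).1 t).1.aemeasurable.ennreal_ofReal
  calc waveEnergy p (u t) (ut t) (gradu t)
      = ∫⁻ x, liminf (fun n => ENNReal.ofReal
          (cutoff n x * energyDensity p (u t) (ut t) (gradu t) x)) atTop := by
        refine lintegral_congr fun x => ?_
        have : Tendsto (fun n => ENNReal.ofReal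
            (cutoff n x * energyDensity p (u t) (ut t) (gradu t) x)) atTop
            (𝓝 (ENNReal.ofReal (energyDensity p (u t) (ut t) (gradu t) x))) := by
          refine tendsto_const_nhds.congr' ?_
          filter_upwards [eventually_ge_atTop ⌈‖x‖⌉₊] with n hn
          have : ‖x‖ ≤ (n : ℝ) := (Nat.le_ceil _).trans (by exact_mod_cast hn)
          rw [cutoff_eq_one (by linarith), one_mul]
        exact this.liminf_eq.symm
    _ ≤ liminf (fun n => ∫⁻ x, ENNReal.ofReal
          (cutoff n x * energyDensity p (u t) (ut t) (gradu t) x)) atTop :=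
        lintegral_liminf_le' hmeas
    _ ≤ liminf (fun n : ℕ => waveEnergy p (u 0) (ut 0) (gradu 0) +
          ENNReal.ofReal (M / ((n : ℝ) + 1) * C * |t|)) atTop := by
        refine liminf_le_liminf (Eventually.of_forall fun n => ?_)
        rw [hA]; exact hstep n
    _ = _ := hlim.liminf_eq

end IsEnergySolution

/-! ### The inward energy as an abstract flow. -/

/-- A balance law `∂ₜe - ∂ᵣf + m = 0` for radially transported densities, with inequalities between
the energy density `e`, the flux density `f` and the source density `m`. -/
structure InwardFlow (e f m : ℝ × E3 → ℝ) : Prop where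
  e_meas : AEStronglyMeasurable e volume
  f_meas : AEStronglyMeasurable f volume
  m_meas : AEStronglyMeasurable m volume
  e_slice : ∀ t, Integrable fun x => e (t, x)
  abs_f_le : ∀ z, |f z| ≤ e z
  m_nonneg : ∀ z, 0 ≤ m z
  norm_mul_m_le : ∀ z, ‖z.2‖ * m z ≤ 4 * e z
  neg_le_f : ∀ z, z.2 ≠ 0 → -(‖z.2‖ / 2 * m z) ≤ f z
  energy_le : ∃ C, ∀ t, ∫ x, e (t, x) ≤ C
  cont : ∀ w, BddWeight w → Continuous fun t => ∫ x, w x * e (t, x)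
  balance : ∀ χ : ℝ × ℝ → ℝ, RadialTest χ → NullIntegral volume fun z : ℝ × E3 =>
    -(dT χ (z.1, ‖z.2‖) * e z) + dR χ (z.1, ‖z.2‖) * f z + χ (z.1, ‖z.2‖) * m z

theorem _root_.MeasureTheory.AEStronglyMeasurable.div_real {α : Type*} [MeasurableSpace α]
    {ν : Measure α} {f : α → ℝ} (hf : AEStronglyMeasurable f ν) (c : ℝ) :
    AEStronglyMeasurable (fun x => f x / c) ν := by
  simpa only [div_eq_mul_inv] using hf.mul_const c⁻¹

section Pointwise

variable {p : ℝ} (f h : E3 → ℝ) (g : E3 → E3) (x : E3)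

theorem abs_inwardFluxDensity_le (hp : 3 ≤ p) :
    |inwardFluxDensity p f h g x| ≤ inwardEnergyDensity p f h g x := by
  have h1 : 0 ≤ |f x| ^ (p + 1) / (2 * (p + 1)) := by
    have : 0 < p + 1 := by linarith
    have := Real.rpow_nonneg (abs_nonneg (f x)) (p + 1)
    positivity
  have h2 := sq_nonneg (|Lplus f h g x|)
  have h3 := sq_nonneg (‖angularGrad g x‖)
  rw [inwardFluxDensity, inwardEnergyDensity, abs_le]
  constructor <;> linarith

theorem inwardSource_nonneg (hp : 3 ≤ p) : 0 ≤ inwardSource p f g x := by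
  have : 0 < p + 1 := by linarith
  have : 0 ≤ p - 1 := by linarith
  have := Real.rpow_nonneg (abs_nonneg (f x)) (p + 1)
  rw [inwardSource]; positivity

/-- The constant 4 comes from p - 1 < 4 in the potential term; the angular term needs only 2. -/
theorem norm_mul_inwardSource_le (hp : 3 ≤ p) (hp5 : p < 5) :
    ‖x‖ * inwardSource p f g x ≤ 4 * inwardEnergyDensity p f h g x := by
  have hp1 : 0 < p + 1 := by linarith
  have h0 := Real.rpow_nonneg (abs_nonneg (f x)) (p + 1)
  have h1 : 0 ≤ |f x| ^ (p + 1) / (2 * (p + 1)) := by positivity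
  have h2 := sq_nonneg (|Lplus f h g x|)
  have h3 := sq_nonneg (‖angularGrad g x‖)
  rw [inwardSource, inwardEnergyDensity]
  rcases eq_or_ne x 0 with rfl | hx
  · simp only [norm_zero, zero_mul]; linarith
  · have hn : ‖x‖ ≠ 0 := norm_ne_zero_iff.2 hx
    have e1 : ‖x‖ * (1 / 2 * (‖angularGrad g x‖ ^ 2 / ‖x‖) +
        (p - 1) / (2 * (p + 1)) * (|f x| ^ (p + 1) / ‖x‖)) =
        1 / 2 * ‖angularGrad g x‖ ^ 2 + (p - 1) * (|f x| ^ (p + 1) / (2 * (p + 1))) := by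
      field_simp
    rw [e1]
    nlinarith

/-- Half of |x|m equals |∇_ω u|²/4 + ((p-1)/2)·|u|^(p+1)/(2(p+1)), and (p-1)/2 ≥ 1 because p ≥ 3; so
it dominates the negative part of the flux. The sign of the axis flux rests on this bound. -/
theorem neg_le_inwardFluxDensity (hp : 3 ≤ p) (hx : x ≠ 0) :
    -(‖x‖ / 2 * inwardSource p f g x) ≤ inwardFluxDensity p f h g x := by
  have hp1 : 0 < p + 1 := by linarith
  have h0 := Real.rpow_nonneg (abs_nonneg (f x)) (p + 1)
  have h1 : 0 ≤ |f x| ^ (p + 1) / (2 * (p + 1)) := by positivity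
  have h2 := sq_nonneg (|Lplus f h g x|)
  have hn : ‖x‖ ≠ 0 := norm_ne_zero_iff.2 hx
  have e1 : ‖x‖ / 2 * inwardSource p f g x =
      1 / 4 * ‖angularGrad g x‖ ^ 2 + (p - 1) / 2 * (|f x| ^ (p + 1) / (2 * (p + 1))) := by
    rw [inwardSource]; field_simp; ring
  rw [e1, inwardFluxDensity]
  nlinarith

theorem inwardEnergyDensity_le (hp : 3 ≤ p) : inwardEnergyDensity p f h g x ≤
    2 * energyDensity p f h g x + 3 / 4 * (‖x‖⁻¹ * f x) ^ 2 := by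
  have hp1 : 0 < p + 1 := by linarith
  have h0 := Real.rpow_nonneg (abs_nonneg (f x)) (p + 1)
  have h1 : 0 ≤ |f x| ^ (p + 1) / (p + 1) := by positivity
  have h2 := abs_Lplus_le f h g x
  have h3 := norm_angularGrad_le g x
  have h4 : ‖angularGrad g x‖ ^ 2 ≤ ‖g x‖ ^ 2 := by gcongr
  have h5 : |Lplus f h g x| ^ 2 ≤ (‖g x‖ + |‖x‖⁻¹ * f x| + |h x|) ^ 2 := by gcongr
  have h6 : |f x| ^ (p + 1) / (2 * (p + 1)) = 1 / 2 * (|f x| ^ (p + 1) / (p + 1)) := by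
    field_simp
  rw [inwardEnergyDensity, energyDensity, h6, ← sq_abs (‖x‖⁻¹ * f x)]
  nlinarith [sq_nonneg (‖g x‖ - |‖x‖⁻¹ * f x|), sq_nonneg (‖g x‖ - |h x|),
    sq_nonneg (|‖x‖⁻¹ * f x| - |h x|), sq_nonneg (|h x|)]

end Pointwise

namespace IsEnergySolution

variable {p : ℝ} {u ut : ℝ → E3 → ℝ} {gradu : ℝ → E3 → E3}

theorem integral_hardy_le (hu : IsEnergySolution p u ut gradu) (t : ℝ) :
    ∫ x, (‖x‖⁻¹ * u t x) ^ 2 ≤ 36 * ∫ x, ‖gradu t x‖ ^ 2 := by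
  have h := hardy (hu.memLp_u t) (hu.memLp_gradu t) (hu.hasWeakGradient t)
  have two : (2 : ℝ≥0∞).toReal = 2 := by norm_num
  rw [(hu.memLp_hardy t).eLpNorm_eq_integral_rpow_norm (by norm_num) (by norm_num),
    (hu.memLp_gradu t).eLpNorm_eq_integral_rpow_norm (by norm_num) (by norm_num), two,
    show (6 : ℝ≥0∞) = ENNReal.ofReal 6 by norm_num, ← ENNReal.ofReal_mul (by norm_num)] at h
  simp only [Real.rpow_two, Real.norm_eq_abs, sq_abs] at h
  have a0 : 0 ≤ ∫ x, (‖x‖⁻¹ * u t x) ^ 2 := by positivity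
  have b0 : 0 ≤ ∫ x, ‖gradu t x‖ ^ 2 := by positivity
  rw [ENNReal.ofReal_le_ofReal_iff (by positivity)] at h
  have h2 := pow_le_pow_left₀ (by positivity) h 2
  rw [mul_pow, ← Real.rpow_natCast, ← Real.rpow_mul a0, ← Real.rpow_natCast (_ ^ _),
    ← Real.rpow_mul b0] at h2
  norm_num at h2
  exact h2

theorem aestronglyMeasurable_energyDensity (hp : 3 ≤ p) (hu : IsEnergySolution p u ut gradu)
    (t : ℝ) : AEStronglyMeasurable (energyDensity p (u t) (ut t) (gradu t)) volume := by
  have hc : Continuous fun s : ℝ => |s| ^ (p + 1) :=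
    continuous_abs.rpow_const fun s => Or.inr (by linarith)
  exact ((((hu.memLp_gradu t).1.norm.pow 2).div_real 2).add
    (((hu.memLp_ut t).1.norm.pow 2).div_real 2)).add
    ((hc.comp_aestronglyMeasurable (hu.memLp_u t).1).div_real (p + 1))

theorem integrable_energyDensity (hp : 3 ≤ p) (hp5 : p < 5) (hu : IsEnergySolution p u ut gradu)
    (hE : waveEnergy p (u 0) (ut 0) (gradu 0) < ⊤) (t : ℝ) :
    Integrable (energyDensity p (u t) (ut t) (gradu t)) := by
  refine ⟨hu.aestronglyMeasurable_energyDensity hp t, ?_⟩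
  rw [hasFiniteIntegral_iff_ofReal (ae_of_all _ fun x => energyDensity_nonneg hp _ _ _ x)]
  exact (hu.waveEnergy_le hp hp5 t).trans_lt hE

theorem integral_energyDensity_le (hp : 3 ≤ p) (hp5 : p < 5) (hu : IsEnergySolution p u ut gradu)
    (hE : waveEnergy p (u 0) (ut 0) (gradu 0) < ⊤) (t : ℝ) :
    ∫ x, energyDensity p (u t) (ut t) (gradu t) x ≤
      (waveEnergy p (u 0) (ut 0) (gradu 0)).toReal := by
  rw [integral_eq_lintegral_of_nonneg_ae (ae_of_all _ fun x => energyDensity_nonneg hp _ _ _ x)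
    (hu.aestronglyMeasurable_energyDensity hp t)]
  exact ENNReal.toReal_mono hE.ne (hu.waveEnergy_le hp hp5 t)

theorem aestronglyMeasurable_Lplus_prod (hu : IsEnergySolution p u ut gradu) :
    AEStronglyMeasurable (fun z : ℝ × E3 => Lplus (u z.1) (ut z.1) (gradu z.1) z.2) volume := by
  have h0 : AEStronglyMeasurable (fun z : ℝ × E3 => ‖z.2‖⁻¹) volume :=
    (measurable_inv_norm.comp measurable_snd).aestronglyMeasurable
  have h1 : AEStronglyMeasurable (fun z : ℝ × E3 => z.2) volume :=
    continuous_snd.aestronglyMeasurable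
  refine ((((hu.aestronglyMeasurable_gradu.inner (𝕜 := ℝ) h1).mul h0).add
    (hu.aestronglyMeasurable_u.mul h0)).add hu.aestronglyMeasurable_ut).congr ?_
  exact ae_of_all _ fun z => by simp [Lplus, div_eq_mul_inv]

theorem aestronglyMeasurable_angularGrad_prod (hu : IsEnergySolution p u ut gradu) :
    AEStronglyMeasurable (fun z : ℝ × E3 => angularGrad (gradu z.1) z.2) volume := by
  have h0 : AEStronglyMeasurable (fun z : ℝ × E3 => (‖z.2‖ ^ 2)⁻¹) volume :=
    ((measurable_norm.comp measurable_snd).pow_const 2).inv.aestronglyMeasurable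
  have h1 : AEStronglyMeasurable (fun z : ℝ × E3 => z.2) volume :=
    continuous_snd.aestronglyMeasurable
  refine (hu.aestronglyMeasurable_gradu.sub
    (((hu.aestronglyMeasurable_gradu.inner (𝕜 := ℝ) h1).mul h0).smul h1)).congr ?_
  exact ae_of_all _ fun z => by simp [angularGrad, div_eq_mul_inv]

theorem aestronglyMeasurable_rpow_u (hp : 3 ≤ p) (hu : IsEnergySolution p u ut gradu) :
    AEStronglyMeasurable (fun z : ℝ × E3 => |u z.1 z.2| ^ (p + 1)) volume :=
  (continuous_abs.rpow_const fun _ => Or.inr (by linarith) :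
    Continuous fun s : ℝ => |s| ^ (p + 1)).comp_aestronglyMeasurable hu.aestronglyMeasurable_u

theorem aestronglyMeasurable_inwardSource (hp : 3 ≤ p) (hu : IsEnergySolution p u ut gradu) :
    AEStronglyMeasurable (fun z : ℝ × E3 => inwardSource p (u z.1) (gradu z.1) z.2) volume := by
  have h0 : AEStronglyMeasurable (fun z : ℝ × E3 => ‖z.2‖⁻¹) volume :=
    (measurable_inv_norm.comp measurable_snd).aestronglyMeasurable
  have ha := hu.aestronglyMeasurable_angularGrad_prod.norm.pow 2
  refine (((ha.mul h0).const_mul (1 / 2)).add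
    (((hu.aestronglyMeasurable_rpow_u hp).mul h0).const_mul ((p - 1) / (2 * (p + 1))))).congr ?_
  exact ae_of_all _ fun z => by simp [inwardSource, div_eq_mul_inv]

theorem inwardFlow (hp : 3 ≤ p) (hp5 : p < 5) (hu : IsEnergySolution p u ut gradu)
    (hE : waveEnergy p (u 0) (ut 0) (gradu 0) < ⊤) :
    InwardFlow (fun z => inwardEnergyDensity p (u z.1) (ut z.1) (gradu z.1) z.2)
      (fun z => inwardFluxDensity p (u z.1) (ut z.1) (gradu z.1) z.2)
      (fun z => inwardSource p (u z.1) (gradu z.1) z.2) := by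
  have hL := (hu.aestronglyMeasurable_Lplus_prod.norm.pow 2).div_real 4
  have ha := (hu.aestronglyMeasurable_angularGrad_prod.norm.pow 2).div_real 4
  have hr := (hu.aestronglyMeasurable_rpow_u hp).div_real (2 * (p + 1))
  have hnn : ∀ t x, 0 ≤ inwardEnergyDensity p (u t) (ut t) (gradu t) x := fun t x =>
    (abs_nonneg _).trans (abs_inwardFluxDensity_le (u t) (ut t) (gradu t) x hp)
  have hh : ∀ t, Integrable fun x => (‖x‖⁻¹ * u t x) ^ 2 := fun t =>
    (hu.memLp_hardy t).integrable_sq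
  have hb : ∀ t, Integrable fun x => 2 * energyDensity p (u t) (ut t) (gradu t) x +
      3 / 4 * (‖x‖⁻¹ * u t x) ^ 2 := fun t =>
    ((hu.integrable_energyDensity hp hp5 hE t).const_mul 2).add ((hh t).const_mul (3 / 4))
  have hslice : ∀ t, Integrable fun x => inwardEnergyDensity p (u t) (ut t) (gradu t) x := by
    intro t
    have hc : Continuous fun s : ℝ => |s| ^ (p + 1) :=
      continuous_abs.rpow_const fun s => Or.inr (by linarith)
    refine (hb t).mono' ?_ (ae_of_all _ fun x => ?_)
    · exact ((((hu.curve_Lplus.memLp t).1.norm.pow 2).div_real 4).add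
        (((hu.curve_angularGrad.memLp t).1.norm.pow 2).div_real 4)).add
        ((hc.comp_aestronglyMeasurable (hu.memLp_u t).1).div_real (2 * (p + 1)))
    · rw [Real.norm_of_nonneg (hnn t x)]
      exact inwardEnergyDensity_le _ _ _ x hp
  exact {
    e_meas := (hL.add ha).add hr
    f_meas := (hL.sub ha).sub hr
    m_meas := hu.aestronglyMeasurable_inwardSource hp
    e_slice := hslice
    abs_f_le := fun z => abs_inwardFluxDensity_le _ _ _ _ hp
    m_nonneg := fun z => inwardSource_nonneg _ _ _ hp
    norm_mul_m_le := fun z => norm_mul_inwardSource_le _ _ _ _ hp hp5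
    neg_le_f := fun z hz => neg_le_inwardFluxDensity _ _ _ _ hp hz
    energy_le := by
      -- 56 = 2 + (3/4)·36·2, from `inwardEnergyDensity_le`, the squared Hardy constant 36, and
      -- |∇u|² ≤ 2 times the energy density.
      refine ⟨56 * (waveEnergy p (u 0) (ut 0) (gradu 0)).toReal, fun t => ?_⟩
      have h1 := integral_mono (hslice t) (hb t) fun x => inwardEnergyDensity_le _ _ _ x hp
      rw [integral_add ((hu.integrable_energyDensity hp hp5 hE t).const_mul 2)
        ((hh t).const_mul (3 / 4)), integral_const_mul, integral_const_mul] at h1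
      have h2 := hu.integral_hardy_le t
      have h3 := hu.integral_energyDensity_le hp hp5 hE t
      have h4 : ∫ x, ‖gradu t x‖ ^ 2 ≤ 2 * ∫ x, energyDensity p (u t) (ut t) (gradu t) x := by
        rw [← integral_const_mul]
        refine integral_mono (hu.integrable_sq_gradu t)
          ((hu.integrable_energyDensity hp hp5 hE t).const_mul 2) fun x => ?_
        have h5 : 0 ≤ |u t x| ^ (p + 1) / (p + 1) :=
          div_nonneg (Real.rpow_nonneg (abs_nonneg _) _) (by linarith)
        have h6 := sq_nonneg (|ut t x|)
        simp only [energyDensity]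
        linarith
      simp only at h1 ⊢
      linarith
    cont := fun w hw => (hu.weighted_inward hp hp5 hw).2
    balance := fun χ hχ => hu.null_inward hp hp5 hχ }

end IsEnergySolution

/-! ### The balance law on a time interval. -/

namespace RadialTest

variable {χ : ℝ × ℝ → ℝ}

theorem smul_time (h : RadialTest χ) {θ : ℝ → ℝ} (hθ : ContDiff ℝ ∞ θ) :
    RadialTest fun q => θ q.1 * χ q where
  contDiff := (hθ.comp contDiff_fst).mul h.contDiff
  hasCompactSupport := h.hasCompactSupport.mul_left
  exists_pos := by
    obtain ⟨δ, hδ, h0⟩ := h.exists_pos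
    exact ⟨δ, hδ, fun q hq => by rw [h0 q hq, mul_zero]⟩

theorem fderiv_smul_time (h : RadialTest χ) {θ : ℝ → ℝ} (hθ : ContDiff ℝ ∞ θ) (q d : ℝ × ℝ) :
    fderiv ℝ (fun q : ℝ × ℝ => θ q.1 * χ q) q d =
      deriv θ q.1 * d.1 * χ q + θ q.1 * fderiv ℝ χ q d := by
  have h1 : HasFDerivAt (fun q : ℝ × ℝ => θ q.1) _ q :=
    ((hθ.differentiable (by simp)).differentiableAt.hasFDerivAt (x := q.1)).comp q hasFDerivAt_fst
  have h2 := (smooth_differentiable h.contDiff q).hasFDerivAt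
  have h3 : fderiv ℝ (fun q : ℝ × ℝ => θ q.1 * χ q) q = _ := (h1.mul h2).fderiv
  rw [h3]
  simp [fderiv_eq_smul_deriv]
  ring

theorem dT_smul_time (h : RadialTest χ) {θ : ℝ → ℝ} (hθ : ContDiff ℝ ∞ θ) (q : ℝ × ℝ) :
    _root_.dT (fun q : ℝ × ℝ => θ q.1 * χ q) q = deriv θ q.1 * χ q + θ q.1 * _root_.dT χ q := by
  simp only [_root_.dT, _root_.dirD, h.fderiv_smul_time hθ, mul_one]

theorem dR_smul_time (h : RadialTest χ) {θ : ℝ → ℝ} (hθ : ContDiff ℝ ∞ θ) (q : ℝ × ℝ) :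
    _root_.dR (fun q : ℝ × ℝ => θ q.1 * χ q) q = θ q.1 * _root_.dR χ q := by
  simp only [_root_.dR, _root_.dirD, h.fderiv_smul_time hθ, mul_zero, zero_mul, zero_add]

end RadialTest

namespace InwardFlow

variable {e f m : ℝ × E3 → ℝ}

theorem e_nonneg (h : InwardFlow e f m) (z : ℝ × E3) : 0 ≤ e z := (abs_nonneg _).trans (h.abs_f_le z)

theorem integrable_mul_e (h : InwardFlow e f m) {w : E3 → ℝ} (hw : AEStronglyMeasurable w volume)
    {C : ℝ} (hC : ∀ x, ‖w x‖ ≤ C) (t : ℝ) : Integrable fun x => w x * e (t, x) :=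
  (h.e_slice t).bdd_mul hw (ae_of_all _ hC)

/-- For a weight frozen at time s, split it into positive and negative parts and use `cont`.
Unfreezing costs the modulus of continuity of `W` times the uniform bound on ∫e. -/
theorem continuous_integral_mul_e (h : InwardFlow e f m) {W : ℝ × E3 → ℝ} (hW : Continuous W)
    (hc : HasCompactSupport W) : Continuous fun t => ∫ x, W (t, x) * e (t, x) := by
  obtain ⟨C, hC⟩ := h.energy_le
  obtain ⟨B, hB⟩ := hW.bounded_above_of_compact_support hc
  obtain ⟨R, hR⟩ := hc.isCompact.isBounded.subset_closedBall (0 : ℝ × E3)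
  have hsl : ∀ t, Continuous fun x => W (t, x) := fun t => hW.comp (by fun_prop)
  have hi : ∀ s t, Integrable fun x => W (s, x) * e (t, x) := fun s t =>
    h.integrable_mul_e (hsl s).aestronglyMeasurable (fun x => hB (s, x)) t
  have hfix : ∀ s, Continuous fun t => ∫ x, W (s, x) * e (t, x) := by
    intro s
    have hsupp : ∀ x, R < ‖x‖ → W (s, x) = 0 := fun x hx =>
      image_eq_zero_of_notMem_tsupport fun hm => by
        have := hR hm
        rw [mem_closedBall_zero_iff, Prod.norm_def] at this
        exact absurd ((le_max_right _ _).trans this) (not_le.2 hx)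
    have w1 : BddWeight fun x => max (W (s, x)) 0 :=
      ⟨((hsl s).max continuous_const).measurable, fun x => le_max_right _ _,
        ⟨B, fun x => max_le ((le_abs_self _).trans (hB _)) ((norm_nonneg _).trans (hB (s, x)))⟩,
        ⟨R, fun x hx => by rw [hsupp x hx, max_self]⟩⟩
    have w2 : BddWeight fun x => max (-W (s, x)) 0 :=
      ⟨((hsl s).neg.max continuous_const).measurable, fun x => le_max_right _ _,
        ⟨B, fun x => max_le ((neg_le_abs _).trans (hB _)) ((norm_nonneg _).trans (hB (s, x)))⟩,
        ⟨R, fun x hx => by rw [hsupp x hx, neg_zero, max_self]⟩⟩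
    have hb : ∀ {w : E3 → ℝ}, BddWeight w → ∀ t, Integrable fun x => w x * e (t, x) := by
      intro w hw t
      obtain ⟨D, hD⟩ := hw.bound
      exact h.integrable_mul_e hw.measurable.aestronglyMeasurable
        (fun x => by rw [Real.norm_of_nonneg (hw.nonneg x)]; exact hD x) t
    refine ((h.cont _ w1).sub (h.cont _ w2)).congr fun t => ?_
    simp only [Pi.sub_apply]
    rw [← integral_sub (hb w1 t) (hb w2 t)]
    congr 1 with x
    rw [← sub_mul]
    congr 1
    rcases le_total (W (s, x)) 0 with h0 | h0
    · rw [max_eq_right h0, max_eq_left (by linarith)]; ring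
    · rw [max_eq_left h0, max_eq_right (by linarith)]; ring
  rw [continuous_iff_continuousAt]
  intro s
  rw [Metric.continuousAt_iff']
  intro ε hε
  have hC0 : 0 ≤ C := (integral_nonneg fun x => h.e_nonneg (s, x)).trans (hC s)
  have huc := hc.uniformContinuous_of_continuous hW
  rw [Metric.uniformContinuous_iff] at huc
  obtain ⟨δ, hδ, hδW⟩ := huc (ε / (2 * (C + 1))) (by positivity)
  have h1 := Metric.continuousAt_iff'.1 ((hfix s).continuousAt (x := s)) (ε / 2) (by positivity)
  filter_upwards [h1, Metric.ball_mem_nhds s hδ] with t ht hts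
  have h2 : |(∫ x, W (t, x) * e (t, x)) - ∫ x, W (s, x) * e (t, x)| ≤ ε / (2 * (C + 1)) * C := by
    rw [← integral_sub (hi t t) (hi s t)]
    calc |∫ x, (W (t, x) * e (t, x) - W (s, x) * e (t, x))|
        ≤ ∫ x, ε / (2 * (C + 1)) * e (t, x) := by
          rw [← Real.norm_eq_abs]
          refine norm_integral_le_of_norm_le ((h.e_slice t).const_mul _) (ae_of_all _ fun x => ?_)
          rw [← sub_mul, norm_mul, Real.norm_of_nonneg (h.e_nonneg (t, x))]
          refine mul_le_mul_of_nonneg_right ?_ (h.e_nonneg _)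
          have : dist (t, x) (s, x) < δ := by
            rw [Prod.dist_eq, dist_self]; exact max_lt hts hδ
          exact (hδW this).le
      _ ≤ _ := by
          rw [integral_const_mul]
          exact mul_le_mul_of_nonneg_left (hC t) (by positivity)
  have h3 : ε / (2 * (C + 1)) * C < ε / 2 := by
    rw [div_mul_eq_mul_div, div_lt_div_iff₀ (by positivity) (by positivity)]
    nlinarith
  rw [Real.dist_eq] at ht ⊢
  calc _ ≤ |(∫ x, W (t, x) * e (t, x)) - ∫ x, W (s, x) * e (t, x)| +
        |(∫ x, W (s, x) * e (t, x)) - ∫ x, W (s, x) * e (s, x)| := abs_sub_le _ _ _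
    _ < ε := by linarith

theorem radialLift_slice_bound {χ : ℝ × ℝ → ℝ} (hχ : RadialTest χ) :
    ∃ C, ∀ t (x : E3), ‖χ (t, ‖x‖)‖ ≤ C := by
  obtain ⟨C, hC⟩ := hχ.contDiff.continuous.bounded_above_of_compact_support hχ.hasCompactSupport
  exact ⟨C, fun t x => hC _⟩

/-- The balance law on a time interval. -/
theorem balance_slab (h : InwardFlow e f m) {χ : ℝ × ℝ → ℝ} (hχ : RadialTest χ) {a b : ℝ}
    (hab : a ≤ b) :
    ∫ z in Ioc a b ×ˢ (univ : Set E3),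
      (-(dT χ (z.1, ‖z.2‖) * e z) + dR χ (z.1, ‖z.2‖) * f z + χ (z.1, ‖z.2‖) * m z) =
      (∫ x, χ (a, ‖x‖) * e (a, x)) - ∫ x, χ (b, ‖x‖) * e (b, x) := by
  set I : ℝ × E3 → ℝ := fun z =>
    -(dT χ (z.1, ‖z.2‖) * e z) + dR χ (z.1, ‖z.2‖) * f z + χ (z.1, ‖z.2‖) * m z with hI
  have hInt : Integrable I ((volume : Measure ℝ).prod (volume : Measure E3)) :=
    (h.balance χ hχ).integrable
  obtain ⟨C, hC⟩ := radialLift_slice_bound hχ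
  have hcs : ∀ t, Continuous fun x : E3 => χ (t, ‖x‖) := fun t =>
    hχ.contDiff.continuous.comp (by fun_prop)
  have hAc := h.continuous_integral_mul_e hχ.lift_contDiff.continuous hχ.lift_hasCompactSupport
  have hAi : ∀ t, Integrable fun x => χ (t, ‖x‖) * e (t, x) := fun t =>
    h.integrable_mul_e (hcs t).aestronglyMeasurable (hC t) t
  -- Testing with θ(t)χ for all θ shows that t ↦ ∫χe has the weak derivative minus the spatial
  -- integral of `I`.
  have key := sub_eq_integral_of_weak_deriv (B := fun t => -∫ x, I (t, x)) hAc
    hInt.integral_prod_left.neg.locallyIntegrable (fun θ hθ hθc => by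
      have h1 := h.balance _ (hχ.smul_time hθ)
      have h2 := h1.integral_eq
      have h1 := h1.integrable
      rw [Measure.volume_eq_prod] at h1 h2
      rw [integral_prod _ h1] at h2
      rw [← neg_eq_zero, ← integral_neg, ← h2]
      refine integral_congr_ae ?_
      filter_upwards [hInt.prod_right_ae] with t ht
      have e1 : ∀ x : E3, -(dT (fun q : ℝ × ℝ => θ q.1 * χ q) (t, ‖x‖) * e (t, x)) +
          dR (fun q : ℝ × ℝ => θ q.1 * χ q) (t, ‖x‖) * f (t, x) + θ t * χ (t, ‖x‖) * m (t, x) =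
          -(deriv θ t * (χ (t, ‖x‖) * e (t, x))) + θ t * I (t, x) := by
        intro x
        rw [hχ.dT_smul_time hθ, hχ.dR_smul_time hθ]
        simp only [I]; ring
      simp only [e1]
      rw [integral_add (by exact ((hAi t).const_mul _).neg) (ht.const_mul _), integral_neg, integral_const_mul,
        integral_const_mul]
      simp only [radialLift]
      ring) a b
  rw [intervalIntegral.integral_neg, intervalIntegral.integral_of_le hab] at key
  have h3 : ∫ z in Ioc a b ×ˢ (univ : Set E3), I z = ∫ t in Ioc a b, ∫ x, I (t, x) := by
    have := setIntegral_prod (μ := (volume : Measure ℝ)) (ν := (volume : Measure E3)) I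
      (s := Ioc a b) (t := univ) hInt.integrableOn
    rw [Measure.restrict_univ] at this
    exact this
  simp only [radialLift] at key
  linarith

/-- The balance law on a time interval, for weights that are compactly supported in radius only. -/
theorem balance_weight (h : InwardFlow e f m) {g : ℝ × ℝ → ℝ} (hg : ContDiff ℝ ∞ g) {a b : ℝ}
    (hab : a ≤ b) {δ R : ℝ} (hδ : 0 < δ) (h0 : ∀ q : ℝ × ℝ, q.2 < δ → g q = 0)
    (hR : ∀ q : ℝ × ℝ, a - 2 ≤ q.1 → R < q.2 → g q = 0) :
    IntegrableOn (fun z : ℝ × E3 => -(dT g (z.1, ‖z.2‖) * e z) + dR g (z.1, ‖z.2‖) * f z +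
      g (z.1, ‖z.2‖) * m z) (Ioc a b ×ˢ univ) ∧
    ∫ z in Ioc a b ×ˢ (univ : Set E3),
      (-(dT g (z.1, ‖z.2‖) * e z) + dR g (z.1, ‖z.2‖) * f z + g (z.1, ‖z.2‖) * m z) =
      (∫ x, g (a, ‖x‖) * e (a, x)) - ∫ x, g (b, ‖x‖) * e (b, x) := by
  -- This cutoff is 1 on [a-1, b+1], so it is invisible on the slab, and it vanishes outside [a-2,
  -- b+2]; hence the bound a-2 in `hR`.
  let θ : ContDiffBump ((a + b) / 2) := ⟨(b - a) / 2 + 1, (b - a) / 2 + 2, by linarith, by linarith⟩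
  have hθ1 : ∀ t, a - 1 ≤ t → t ≤ b + 1 → θ t = 1 := fun t h1 h2 =>
    θ.one_of_mem_closedBall (by
      rw [Metric.mem_closedBall, Real.dist_eq, abs_le]; simp only [θ]; constructor <;> linarith)
  have hθ0 : ∀ t, t < a - 2 ∨ b + 2 < t → θ t = 0 := fun t ht => θ.zero_of_le_dist (by
    rw [Real.dist_eq, le_abs]; simp only [θ]
    rcases ht with ht | ht
    · right; linarith
    · left; linarith)
  have hχ : RadialTest fun q : ℝ × ℝ => θ q.1 * g q := by
    refine ⟨(θ.contDiff.comp contDiff_fst).mul hg, ?_, δ, hδ, fun q hq => by rw [h0 q hq, mul_zero]⟩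
    refine HasCompactSupport.intro ((isCompact_Icc (a := a - 2) (b := b + 2)).prod
      (isCompact_Icc (a := 0) (b := R))) fun q hq => ?_
    by_contra hne
    have h1 : ¬(q.1 < a - 2 ∨ b + 2 < q.1) := fun hc => hne (by rw [hθ0 _ hc, zero_mul])
    push Not at h1
    refine hq ⟨⟨h1.1, h1.2⟩, ?_, ?_⟩
    · by_contra hc
      exact hne (by rw [h0 q (by linarith), mul_zero])
    · by_contra hc
      exact hne (by rw [hR q h1.1 (not_le.1 hc), mul_zero])
  have hev : ∀ t ∈ Icc a b, ∀ r, (fun q : ℝ × ℝ => θ q.1 * g q) =ᶠ[𝓝 (t, r)] g := by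
    intro t ht r
    have : ∀ᶠ q : ℝ × ℝ in 𝓝 (t, r), q.1 ∈ Ioo (a - 1) (b + 1) :=
      continuous_fst.continuousAt.eventually_mem
        (Ioo_mem_nhds (by linarith [ht.1]) (by linarith [ht.2]))
    filter_upwards [this] with q hq
    rw [hθ1 _ hq.1.le hq.2.le, one_mul]
  have hbal := h.balance_slab hχ hab
  have hi := (h.balance _ hχ).integrable.integrableOn (s := Ioc a b ×ˢ (univ : Set E3))
  have heq : EqOn (fun z : ℝ × E3 => -(dT (fun q : ℝ × ℝ => θ q.1 * g q) (z.1, ‖z.2‖) * e z) +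
      dR (fun q : ℝ × ℝ => θ q.1 * g q) (z.1, ‖z.2‖) * f z + θ z.1 * g (z.1, ‖z.2‖) * m z)
      (fun z : ℝ × E3 => -(dT g (z.1, ‖z.2‖) * e z) + dR g (z.1, ‖z.2‖) * f z +
        g (z.1, ‖z.2‖) * m z) (Ioc a b ×ˢ univ) := by
    intro z hz
    have h1 := hev z.1 (Ioc_subset_Icc_self hz.1) ‖z.2‖
    have h2 := h1.fderiv_eq (𝕜 := ℝ)
    have h3 := h1.self_of_nhds
    simp only [dT, dR, dirD]
    rw [h2]
    simp only at h3
    rw [h3]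
  have hmeas : MeasurableSet (Ioc a b ×ˢ (univ : Set E3)) := measurableSet_Ioc.prod .univ
  rw [setIntegral_congr_fun hmeas heq] at hbal
  refine ⟨hi.congr_fun heq hmeas, hbal.trans ?_⟩
  simp only [hθ1 a (by linarith) (by linarith), hθ1 b (by linarith) (by linarith), one_mul]

end InwardFlow

/-! ### Polar coordinates. -/

/-- The unit sphere. -/
abbrev S2 : Type := Metric.sphere (0 : E3) 1

/-- The surface measure of the unit sphere. -/
abbrev sphereMeasure : Measure S2 := (volume : Measure E3).toSphere

/-- The measure `r² dr` on `(0, ∞)`. -/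
def radialMeasure : Measure ℝ :=
  (volume.restrict (Ioi 0)).withDensity fun r => ENNReal.ofReal (r ^ 2)

instance : SFinite radialMeasure := by rw [radialMeasure]; infer_instance

theorem measurePreserving_radial_coe :
    MeasurePreserving (Subtype.val : Ioi (0 : ℝ) → ℝ) (Measure.volumeIoiPow 2) radialMeasure := by
  refine ⟨measurable_subtype_coe, ?_⟩
  have h0 := (MeasurableEmbedding.subtype_coe (measurableSet_Ioi (a := (0 : ℝ))))
  ext s hs
  rw [Measure.map_apply measurable_subtype_coe hs, Measure.volumeIoiPow, radialMeasure,
    withDensity_apply _ (measurable_subtype_coe hs), withDensity_apply _ hs,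
    Measure.restrict_restrict hs,
    setLIntegral_subtype measurableSet_Ioi _ fun a : ℝ => ENNReal.ofReal (a ^ 2),
    Subtype.image_preimage_coe, inter_comm]

theorem measurePreserving_smul_sphere :
    MeasurePreserving (fun q : ℝ × S2 => q.1 • (q.2 : E3)) (radialMeasure.prod sphereMeasure)
      volume := by
  have hd : Module.finrank ℝ E3 - 1 = 2 := by simp [E3]
  have h1 := (volume : Measure E3).measurePreserving_homeomorphUnitSphereProd
  rw [hd] at h1
  have h2 : MeasurePreserving (homeomorphUnitSphereProd E3).symm
      (sphereMeasure.prod (Measure.volumeIoiPow 2)) (Measure.comap Subtype.val volume) :=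
    h1.symm (homeomorphUnitSphereProd E3).toMeasurableEquiv
  have h3 : MeasurePreserving (Subtype.val : ({0}ᶜ : Set E3) → E3) (Measure.comap Subtype.val volume)
      volume := by
    have := measurePreserving_subtype_coe (μa := (volume : Measure E3))
      (measurableSet_singleton (0 : E3)).compl
    rwa [restrict_compl_singleton] at this
  have h4 : MeasurePreserving (Prod.swap : Ioi (0 : ℝ) × S2 → S2 × Ioi (0 : ℝ)) 
      ((Measure.volumeIoiPow 2).prod sphereMeasure) (sphereMeasure.prod (Measure.volumeIoiPow 2)) :=
    Measure.measurePreserving_swap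
  have h5 := h3.comp (h2.comp h4)
  have h6 := measurePreserving_radial_coe.prod (MeasurePreserving.id sphereMeasure)
  have hm : Measurable (fun q : ℝ × S2 => q.1 • (q.2 : E3)) := by fun_prop
  refine ⟨hm, ?_⟩
  rw [← h6.map_eq, Measure.map_map hm h6.measurable, ← h5.map_eq]
  rfl

/-- The radius comes first, so that Fubini slices space-time into the cylinders |x| = r. -/
theorem measurePreserving_polar (ν : Measure ℝ) [SFinite ν] :
    MeasurePreserving (fun q : ℝ × (ℝ × S2) => (q.2.1, q.1 • (q.2.2 : E3)))
      (radialMeasure.prod (ν.prod sphereMeasure)) (ν.prod volume) := by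
  have h1 := (measurePreserving_prodAssoc radialMeasure ν sphereMeasure).symm
  have h2 : MeasurePreserving (Prod.map Prod.swap id)
      ((radialMeasure.prod ν).prod sphereMeasure) ((ν.prod radialMeasure).prod sphereMeasure) :=
    Measure.measurePreserving_swap.prod (MeasurePreserving.id sphereMeasure)
  have h3 := measurePreserving_prodAssoc ν radialMeasure sphereMeasure
  have h4 := (MeasurePreserving.id ν).prod measurePreserving_smul_sphere
  exact h4.comp (h3.comp (h2.comp h1))

/-- The density r² is positive for r > 0, so the null sets are the Lebesgue ones. -/
theorem ae_radialMeasure {P : ℝ → Prop} (h : ∀ᵐ r ∂radialMeasure, P r) :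
    ∀ᵐ r ∂volume.restrict (Ioi (0 : ℝ)), P r := by
  rw [radialMeasure, ae_withDensity_iff (by fun_prop)] at h
  filter_upwards [h, ae_restrict_mem measurableSet_Ioi] with r hr h0
  exact hr (by simpa using (ne_of_gt h0))

theorem integrable_radialMeasure {g : ℝ → ℝ} :
    Integrable g radialMeasure ↔ IntegrableOn (fun r => r ^ 2 * g r) (Ioi 0) := by
  rw [radialMeasure, integrable_withDensity_iff_integrable_smul' (by fun_prop)
    (ae_of_all _ fun r => ENNReal.ofReal_lt_top)]
  simp only [ENNReal.toReal_ofReal (sq_nonneg _), smul_eq_mul, IntegrableOn]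

theorem integral_radialMeasure (g : ℝ → ℝ) :
    ∫ r, g r ∂radialMeasure = ∫ r in Ioi 0, r ^ 2 * g r := by
  rw [radialMeasure, integral_withDensity_eq_integral_toReal_smul (by fun_prop)
    (ae_of_all _ fun r => ENNReal.ofReal_lt_top)]
  simp only [ENNReal.toReal_ofReal (sq_nonneg _), smul_eq_mul]

/-- The integral of `F` over the cylinder of radius `r`, with respect to `ν` in time. -/
def shell (ν : Measure ℝ) (F : ℝ × E3 → ℝ) (r : ℝ) : ℝ :=
  r ^ 2 * ∫ q : ℝ × S2, F (q.1, r • (q.2 : E3)) ∂ν.prod sphereMeasure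

section Shell

variable {ν : Measure ℝ} [SFinite ν] {F G : ℝ × E3 → ℝ}

theorem norm_smul_sphere {r : ℝ} (hr : 0 < r) (θ : S2) : ‖r • (θ : E3)‖ = r := by
  rw [norm_smul, Real.norm_of_nonneg hr.le]; simp

theorem integrableOn_shell (hF : Integrable F (ν.prod volume)) :
    IntegrableOn (shell ν F) (Ioi 0) := by
  have h1 := (measurePreserving_polar ν).integrable_comp_of_integrable hF
  exact integrable_radialMeasure.1 h1.integral_prod_left

theorem integral_shell (hF : Integrable F (ν.prod volume)) :
    ∫ r in Ioi 0, shell ν F r = ∫ z, F z ∂ν.prod volume := by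
  have h0 := measurePreserving_polar ν
  have h1 := h0.integrable_comp_of_integrable hF
  have h2 := integral_prod _ h1
  rw [integral_radialMeasure] at h2
  rw [← h0.map_eq, integral_map h0.measurable.aemeasurable (by rw [h0.map_eq]; exact hF.1)]
  exact h2.symm

theorem ae_integrable_shell (hF : Integrable F (ν.prod volume)) :
    ∀ᵐ r ∂volume.restrict (Ioi (0 : ℝ)),
      Integrable (fun q : ℝ × S2 => F (q.1, r • (q.2 : E3))) (ν.prod sphereMeasure) :=
  ae_radialMeasure ((measurePreserving_polar ν).integrable_comp_of_integrable hF).prod_right_ae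

theorem shell_mul (w : ℝ → ℝ) (F : ℝ × E3 → ℝ) {r : ℝ} (hr : 0 < r) :
    shell ν (fun z => w ‖z.2‖ * F z) r = w r * shell ν F r := by
  simp only [shell, norm_smul_sphere hr]
  rw [integral_const_mul]; ring

theorem shell_nonneg (hF : ∀ z, 0 ≤ F z) (r : ℝ) : 0 ≤ shell ν F r :=
  mul_nonneg (sq_nonneg _) (integral_nonneg fun _ => hF _)

end Shell

/-- The integral of `g` over the sphere of radius `r`. -/
def sphereIntegral (g : E3 → ℝ) (r : ℝ) : ℝ := r ^ 2 * ∫ θ, g (r • (θ : E3)) ∂sphereMeasure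

theorem integrableOn_sphereIntegral {g : E3 → ℝ} (hg : Integrable g) :
    IntegrableOn (sphereIntegral g) (Ioi 0) := by
  have h1 := measurePreserving_smul_sphere.integrable_comp_of_integrable hg
  exact integrable_radialMeasure.1 h1.integral_prod_left

theorem integral_sphereIntegral {g : E3 → ℝ} (hg : Integrable g) :
    ∫ r in Ioi 0, sphereIntegral g r = ∫ x, g x := by
  have h0 := measurePreserving_smul_sphere
  have h1 := h0.integrable_comp_of_integrable hg
  have h2 := integral_prod _ h1
  rw [integral_radialMeasure] at h2
  rw [← h0.map_eq, integral_map h0.measurable.aemeasurable (by rw [h0.map_eq]; exact hg.1)]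
  exact h2.symm

theorem sphereIntegral_mul (w : ℝ → ℝ) (g : E3 → ℝ) {r : ℝ} (hr : 0 < r) :
    sphereIntegral (fun x => w ‖x‖ * g x) r = w r * sphereIntegral g r := by
  simp only [sphereIntegral, norm_smul_sphere hr]
  rw [integral_const_mul]; ring

theorem sphereIntegral_nonneg {g : E3 → ℝ} (hg : ∀ x, 0 ≤ g x) (r : ℝ) : 0 ≤ sphereIntegral g r :=
  mul_nonneg (sq_nonneg _) (integral_nonneg fun _ => hg _)

/-- Lebesgue measure on a time interval. -/
abbrev slab (a b : ℝ) : Measure ℝ := volume.restrict (Ioc a b)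

theorem slab_prod (a b : ℝ) : (slab a b).prod (volume : Measure E3) =
    (volume : Measure (ℝ × E3)).restrict (Ioc a b ×ˢ univ) := by
  rw [Measure.volume_eq_prod, ← Measure.prod_restrict, Measure.restrict_univ]

/-! ### The balance law as an equation in the radius. -/

namespace InwardFlow

variable {e f m : ℝ × E3 → ℝ} {a b : ℝ}

theorem integrable_e (h : InwardFlow e f m) (a b : ℝ) : Integrable e ((slab a b).prod volume) := by
  obtain ⟨C, hC⟩ := h.energy_le
  have hm : AEStronglyMeasurable e ((slab a b).prod volume) := by
    rw [slab_prod]; exact h.e_meas.restrict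
  rw [integrable_prod_iff hm]
  refine ⟨ae_of_all _ h.e_slice, ?_⟩
  refine Integrable.mono' (integrable_const C) hm.norm.integral_prod_right' (ae_of_all _ fun t => ?_)
  rw [Real.norm_of_nonneg (integral_nonneg fun _ => norm_nonneg _)]
  simp only [Real.norm_of_nonneg (h.e_nonneg _)]
  exact hC t

theorem integrable_f (h : InwardFlow e f m) (a b : ℝ) : Integrable f ((slab a b).prod volume) := by
  refine (h.integrable_e a b).mono' ?_ (ae_of_all _ h.abs_f_le)
  rw [slab_prod]; exact h.f_meas.restrict

/-- Near the axis only |x|m is controlled by `e` at this stage. Integrability of the source itself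
is gained later from the sign of the axis flux. -/
theorem integrable_norm_mul_m (h : InwardFlow e f m) (a b : ℝ) :
    Integrable (fun z : ℝ × E3 => ‖z.2‖ * m z) ((slab a b).prod volume) := by
  refine ((h.integrable_e a b).const_mul 4).mono' ?_ (ae_of_all _ fun z => ?_)
  · rw [slab_prod]
    exact (Continuous.aestronglyMeasurable (by fun_prop)).mul h.m_meas.restrict
  · rw [Real.norm_of_nonneg (mul_nonneg (norm_nonneg _) (h.m_nonneg z))]
    exact h.norm_mul_m_le z

theorem integrableOn_mul_shell_m (h : InwardFlow e f m) (a b : ℝ) :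
    IntegrableOn (fun r => r * shell (slab a b) m r) (Ioi 0) :=
  (integrableOn_shell (h.integrable_norm_mul_m a b)).congr_fun
    (fun _ hr => shell_mul (fun s => s) m hr) measurableSet_Ioi

theorem locallyIntegrableOn_shell_m (h : InwardFlow e f m) (a b : ℝ) :
    LocallyIntegrableOn (shell (slab a b) m) (Ioi 0) := by
  have h1 := (h.integrableOn_mul_shell_m a b).locallyIntegrableOn
  have h2 := h1.continuousOn_mul (g := fun r : ℝ => r⁻¹)
    (continuousOn_inv₀.mono fun r (hr : 0 < r) => hr.ne') isOpen_Ioi.isLocallyClosed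
  rw [locallyIntegrableOn_iff isOpen_Ioi.isLocallyClosed] at h2 ⊢
  refine fun k hk hkc => (h2 k hk hkc).congr_fun (fun r hr => ?_) hkc.measurableSet
  exact inv_mul_cancel_left₀ (ne_of_gt (hk hr)) _

theorem neg_le_shell_f (h : InwardFlow e f m) (a b : ℝ) :
    ∀ᵐ r ∂volume.restrict (Ioi (0 : ℝ)),
      -(r / 2 * shell (slab a b) m r) ≤ shell (slab a b) f r := by
  filter_upwards [ae_integrable_shell (h.integrable_norm_mul_m a b),
    ae_integrable_shell (h.integrable_f a b), ae_restrict_mem measurableSet_Ioi] with r hm hf hr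
  have hr : 0 < r := hr
  have h1 : ∫ q : ℝ × S2, -(1 / 2 * (‖r • (q.2 : E3)‖ * m (q.1, r • (q.2 : E3))))
      ∂(slab a b).prod sphereMeasure ≤ ∫ q : ℝ × S2, f (q.1, r • (q.2 : E3))
      ∂(slab a b).prod sphereMeasure := by
    refine integral_mono (hm.const_mul _).neg hf fun q => ?_
    have := h.neg_le_f (q.1, r • (q.2 : E3))
      (norm_ne_zero_iff.1 (by rw [norm_smul_sphere hr]; exact hr.ne'))
    simp only at this ⊢
    linarith
  rw [integral_neg, integral_const_mul] at h1
  simp only [norm_smul_sphere hr] at h1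
  rw [integral_const_mul] at h1
  have h2 := mul_le_mul_of_nonneg_left h1 (sq_nonneg r)
  simp only [shell]
  linarith

/-- A weight κ(r) independent of time, used on (a,b], gives Φ' = M + N weakly on (0,∞); the term N
comes from the energies at the two ends. -/
theorem shell_weak_deriv (h : InwardFlow e f m) (hab : a ≤ b) {κ : ℝ → ℝ} (hκ : ContDiff ℝ ∞ κ)
    (hc : HasCompactSupport κ) (hs : tsupport κ ⊆ Ioi 0) :
    ∫ r, (deriv κ r * shell (slab a b) f r + κ r * (shell (slab a b) m r +
      (sphereIntegral (fun x => e (b, x)) r - sphereIntegral (fun x => e (a, x)) r))) = 0 := by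
  obtain ⟨δ, R, hδ1, hR1, hsub, hK⟩ := exists_Ioo_of_isCompact isOpen_Ioi ordConnected_Ioi
    (mem_Ioi.2 one_pos) hc hs
  have hδ : 0 < δ := hsub ⟨le_rfl, by linarith⟩
  have hz : ∀ r, r ∉ Ioo δ R → κ r = 0 := fun r hr =>
    image_eq_zero_of_notMem_tsupport fun hm => hr (hK hm)
  have hz' : ∀ r, r ∉ Ioo δ R → deriv κ r = 0 := fun r hr =>
    image_eq_zero_of_notMem_tsupport fun hm => hr (hK (tsupport_deriv_subset hm))
  set g : ℝ × ℝ → ℝ := fun q => κ q.2 with hgdef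
  have hg : ContDiff ℝ ∞ g := hκ.comp contDiff_snd
  have hgf : ∀ q d : ℝ × ℝ, fderiv ℝ g q d = deriv κ q.2 * d.2 := by
    intro q d
    have h1 : HasFDerivAt g _ q :=
      ((hκ.differentiable (by simp)).differentiableAt.hasFDerivAt (x := q.2)).comp q hasFDerivAt_snd
    rw [h1.fderiv]
    simp [fderiv_eq_smul_deriv]; ring
  have hT : ∀ q, dT g q = 0 := fun q => by simp [dT, dirD, hgf]
  have hRd : ∀ q, dR g q = deriv κ q.2 := fun q => by simp [dR, dirD, hgf]
  obtain ⟨hi, heq⟩ := h.balance_weight hg hab hδ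
    (fun q hq => hz _ fun hm => by linarith [hm.1])
    (R := R) (fun q _ hq => hz _ fun hm => by linarith [hm.2])
  simp only [hT, hRd, zero_mul, neg_zero, zero_add] at hi heq
  simp only [hgdef] at hi heq
  rw [IntegrableOn, ← slab_prod] at hi
  rw [← slab_prod] at heq
  have hκ'c : Continuous (deriv κ) := hκ.continuous_deriv (by simp)
  obtain ⟨C, hC⟩ := hκ'c.bounded_above_of_compact_support hc.deriv
  obtain ⟨C', hC'⟩ := hκ.continuous.bounded_above_of_compact_support hc
  have hif : Integrable (fun z : ℝ × E3 => deriv κ ‖z.2‖ * f z) ((slab a b).prod volume) :=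
    (h.integrable_f a b).bdd_mul (Continuous.aestronglyMeasurable (by fun_prop))
      (ae_of_all _ fun z => hC _)
  have him : Integrable (fun z : ℝ × E3 => κ ‖z.2‖ * m z) ((slab a b).prod volume) := by
    refine (hi.sub hif).congr (ae_of_all _ fun z => ?_)
    simp only [Pi.sub_apply]; ring
  have hie : ∀ t, Integrable fun x => κ ‖x‖ * e (t, x) := fun t =>
    h.integrable_mul_e (hκ.continuous.comp continuous_norm).aestronglyMeasurable (fun x => hC' _) t
  rw [integral_add hif him] at heq
  have s1 := integral_shell hif
  have s2 := integral_shell him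
  have s3 := integral_sphereIntegral (hie a)
  have s4 := integral_sphereIntegral (hie b)
  have i1 := integrableOn_shell hif
  have i2 := integrableOn_shell him
  have i3 := integrableOn_sphereIntegral (hie a)
  have i4 := integrableOn_sphereIntegral (hie b)
  rw [← setIntegral_eq_integral_of_forall_compl_eq_zero (s := Ioi 0) (fun r hr => by
    have : r ∉ Ioo δ R := fun hm => hr (hδ.trans hm.1)
    rw [hz r this, hz' r this]; ring)]
  have hfin : ∫ r in Ioi 0, (shell (slab a b) (fun z => deriv κ ‖z.2‖ * f z) r +
      shell (slab a b) (fun z => κ ‖z.2‖ * m z) r + (sphereIntegral (fun x => κ ‖x‖ * e (b, x)) r -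
      sphereIntegral (fun x => κ ‖x‖ * e (a, x)) r)) = 0 := by
    rw [integral_add (by exact i1.add i2) (by exact i4.sub i3), integral_add i1 i2,
      integral_sub i4 i3, s1, s2, s3, s4]
    linarith
  refine (setIntegral_congr_fun measurableSet_Ioi fun r hr => ?_).trans hfin
  rw [shell_mul _ _ hr, shell_mul _ _ hr, sphereIntegral_mul _ _ hr, sphereIntegral_mul _ _ hr]
  ring

end InwardFlow

/-! ### The limit of the flux at the axis. -/

section AxisLimit

variable {Φ M N : ℝ → ℝ}

theorem intervalIntegrable_Ioi (hM : LocallyIntegrableOn M (Ioi 0)) {a b : ℝ} (ha : 0 < a)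
    (hb : 0 < b) : IntervalIntegrable M volume a b :=
  intervalIntegrable_of_locallyIntegrableOn hM fun _ hx => (lt_min ha hb).trans_le hx.1

theorem intervalIntegrable_of_Ioi (hN : IntegrableOn N (Ioi 0)) {a b : ℝ} (ha : 0 ≤ a)
    (hb : 0 ≤ b) : IntervalIntegrable N volume a b := by
  rw [intervalIntegrable_iff]
  exact hN.mono_set fun x hx => (le_min ha hb).trans_lt hx.1

/-- The monotone part of a flux function that is bounded below by `-r M / 2` is nonnegative. -/
theorem nonneg_of_flux (hΦ : IntegrableOn Φ (Ioi 0)) (hN : IntegrableOn N (Ioi 0))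
    (hM0 : ∀ r, 0 ≤ M r) (hM : LocallyIntegrableOn M (Ioi 0))
    (hle : ∀ᵐ r ∂volume.restrict (Ioi (0 : ℝ)), -(r / 2 * M r) ≤ Φ r) {d : ℝ}
    (hd : ∀ᵐ r ∂volume.restrict (Ioi (0 : ℝ)),
      Φ r = (d + ∫ y in (1 : ℝ)..r, M y) + ∫ y in (0 : ℝ)..r, N y) {r₀ : ℝ} (hr₀ : 0 < r₀) :
    0 ≤ d + ∫ y in (1 : ℝ)..r₀, M y := by
  set H : ℝ → ℝ := fun r => d + ∫ y in (1 : ℝ)..r, M y with hH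
  set J : ℝ → ℝ := fun r => ∫ y in (0 : ℝ)..r, N y with hJ
  have hii : ∀ {a b : ℝ}, 0 < a → 0 < b → IntervalIntegrable M volume a b :=
    fun ha hb => intervalIntegrable_Ioi hM ha hb
  have hHs : ∀ {a b : ℝ}, 0 < a → 0 < b → H b = H a + ∫ y in a..b, M y := fun ha hb => by
    rw [hH]; simp only
    rw [add_assoc, intervalIntegral.integral_add_adjacent_intervals (hii one_pos ha) (hii ha hb)]
  have hmono : ∀ {a b : ℝ}, 0 < a → a ≤ b → H a ≤ H b := fun ha hab => by
    rw [hHs ha (ha.trans_le hab)]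
    linarith [intervalIntegral.integral_nonneg (μ := volume) hab fun y _ => hM0 y]
  by_contra hneg
  push Not at hneg
  change H r₀ < 0 at hneg
  have hJc : Tendsto J (𝓝[>] 0) (𝓝 0) := by
    have h1 := intervalIntegral.continuousOn_primitive_interval' (f := N) (μ := volume)
      (intervalIntegrable_of_Ioi hN le_rfl zero_le_one) (a := 0) left_mem_uIcc
    have h2 := h1 0 left_mem_uIcc
    rw [ContinuousWithinAt, intervalIntegral.integral_same, uIcc_of_le zero_le_one] at h2
    exact h2.mono_left (nhdsWithin_le_of_mem (mem_of_superset
      (Ioc_mem_nhdsGT one_pos) Ioc_subset_Icc_self))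
  -- The continuous part J vanishes at 0, so near 0 it is at most half of |H(r₀)|.
  obtain ⟨s, hs, hJs⟩ : ∃ s, 0 < s ∧ ∀ r ∈ Ioc 0 s, |J r| ≤ -H r₀ / 2 := by
    have h1 := (Metric.tendsto_nhds.1 hJc (-H r₀ / 2) (by linarith))
    obtain ⟨s, hs, h2⟩ := mem_nhdsGT_iff_exists_Ioc_subset.1 h1
    exact ⟨s, hs, fun r hr => by
      have := h2 hr
      rw [mem_ofPred_eq, Real.dist_eq, sub_zero] at this
      exact this.le⟩
  set r₁ := min s r₀ with hr₁
  have hr₁0 : 0 < r₁ := lt_min hs hr₀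
  have hG : ∀ r ∈ Ioc 0 r₁, H r ≤ H r₀ ∧ |J r| ≤ -H r₀ / 2 := fun r hr =>
    ⟨hmono hr.1 (hr.2.trans (min_le_right _ _)), hJs r ⟨hr.1, hr.2.trans (min_le_left _ _)⟩⟩
  -- As J ≤ -H(r₀)/2 ≤ -H(r)/2, the bound Φ ≥ -rM/2 becomes H/2 ≥ -rM/2. This says that rH has
  -- nonnegative derivative.
  have hae : ∀ᵐ r, r ∈ Ioc 0 r₁ → 0 ≤ H r + r * M r := by
    have h1 := (ae_restrict_iff' measurableSet_Ioi).1 hle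
    have h2 := (ae_restrict_iff' measurableSet_Ioi).1 hd
    filter_upwards [h1, h2] with r h1 h2 hr
    have h3 := h1 hr.1
    rw [h2 hr.1] at h3
    change -(r / 2 * M r) ≤ H r + J r at h3
    have := hG r hr
    have := (abs_le.1 this.2).2
    linarith [(hG r hr).1]
  have hkey : ∀ r ∈ Ioc 0 r₁, r * H r ≤ r₁ * H r₁ := by
    intro r hr
    have hac := (hii hr.1 hr₁0).absolutelyContinuousOnInterval_intervalIntegral (c := r₁)
      right_mem_uIcc
    have hid : AbsolutelyContinuousOnInterval (fun x : ℝ => x) r r₁ :=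
      (contDiff_id.contDiffOn).absolutelyContinuousOnInterval
    have h1 := hid.integral_deriv_mul_eq_sub hac
    rw [intervalIntegral.integral_same, mul_zero, zero_sub] at h1
    have h2 : ∫ x in r..r₁, (deriv (fun x : ℝ => x) x * (∫ y in r₁..x, M y) +
        x * deriv (fun x => ∫ y in r₁..x, M y) x) = ∫ x in r..r₁, ((∫ y in r₁..x, M y) + x * M x) := by
      refine intervalIntegral.integral_congr_ae ?_
      filter_upwards [(hii hr.1 hr₁0).ae_hasDerivAt_integral] with x hx hxm
      rw [(hx (uIoc_subset_uIcc hxm) r₁ right_mem_uIcc).deriv]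
      simp
    rw [h2] at h1
    have hcont : IntervalIntegrable (fun x => ∫ y in r₁..x, M y) volume r r₁ :=
      hac.continuousOn.intervalIntegrable
    have hxM : IntervalIntegrable (fun x => x * M x) volume r r₁ :=
      (hii hr.1 hr₁0).continuousOn_mul (by fun_prop)
    have h3 : 0 ≤ ∫ x in r..r₁, (H r₁ + ((∫ y in r₁..x, M y) + x * M x)) := by
      refine intervalIntegral.integral_nonneg_of_ae_restrict hr.2 ?_
      have : ∀ᵐ x, x ∈ Icc r r₁ → 0 ≤ H r₁ + ((∫ y in r₁..x, M y) + x * M x) := by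
        filter_upwards [hae] with x hx hxm
        have := hx ⟨hr.1.trans_le hxm.1, hxm.2⟩
        rw [hHs hr₁0 (hr.1.trans_le hxm.1)] at this
        linarith
      exact (ae_restrict_iff' measurableSet_Icc).2 this
    rw [intervalIntegral.integral_add (by simp) (hcont.add hxM), h1,
      intervalIntegral.integral_const, smul_eq_mul] at h3
    rw [hHs hr₁0 hr.1]
    linarith
  have hη : H r₁ < 0 := (hG r₁ ⟨hr₁0, le_rfl⟩).1.trans_lt hneg
  have hk : 0 < -(r₁ * H r₁) := by nlinarith
  -- By `hkey`, H ≤ -k/r with k = -r₁H(r₁) > 0, and |Φ| ≥ |H|/2, so integrability of Φ would force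
  -- that of 1/r.
  have hint : IntegrableOn (fun r : ℝ => r⁻¹) (Ioc 0 r₁) := by
    have h1 : IntegrableOn (fun r => 2 / -(r₁ * H r₁) * ‖Φ r‖) (Ioc 0 r₁) :=
      (hΦ.mono_set Ioc_subset_Ioi_self).norm.const_mul _
    refine h1.mono' (measurable_inv.aestronglyMeasurable) ?_
    have h2 := (ae_restrict_iff' measurableSet_Ioi).1 hd
    refine (ae_restrict_iff' measurableSet_Ioc).2 ?_
    filter_upwards [h2] with r h2 hr
    rw [Real.norm_of_nonneg (inv_nonneg.2 hr.1.le), Real.norm_eq_abs, div_mul_eq_mul_div,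
      le_div_iff₀ hk, inv_mul_le_iff₀ hr.1, h2 hr.1]
    change _ ≤ r * (2 * |H r + J r|)
    have h3 := hkey r hr
    have h4 := hG r hr
    have h5 := neg_abs_le (H r + J r)
    have h6 := (abs_le.1 h4.2).2
    have h7 : -H r ≤ 2 * |H r + J r| := by linarith [h4.1]
    nlinarith [hr.1]
  have := intervalIntegrable_inv_iff.1 ((intervalIntegrable_iff_integrableOn_Ioc_of_le hr₁0.le).2 hint)
  rcases this with h | h
  · exact hr₁0.ne h
  · exact h left_mem_uIcc

/-- Write H(r) = d + ∫₁ʳ M for the monotone part. H ≥ 0 bounds the integral of M over [r,1] by d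
uniformly in r, so M is integrable up to 0 and l = H(0+) is finite and nonnegative. -/
theorem exists_axis_limit (hΦ : IntegrableOn Φ (Ioi 0)) (hN : IntegrableOn N (Ioi 0))
    (hM0 : ∀ r, 0 ≤ M r) (hM : LocallyIntegrableOn M (Ioi 0))
    (hle : ∀ᵐ r ∂volume.restrict (Ioi (0 : ℝ)), -(r / 2 * M r) ≤ Φ r)
    (hw : ∀ θ : ℝ → ℝ, ContDiff ℝ ∞ θ → HasCompactSupport θ → tsupport θ ⊆ Ioi 0 →
      ∫ r, (deriv θ r * Φ r + θ r * (M r + N r)) = 0) :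
    ∃ l, 0 ≤ l ∧ IntegrableOn M (Ioc 0 1) ∧ ∀ᵐ r ∂volume.restrict (Ioi (0 : ℝ)),
      Φ r = l + (∫ y in (0 : ℝ)..r, M y) + ∫ y in (0 : ℝ)..r, N y := by
  have hii : ∀ {a b : ℝ}, 0 < a → 0 < b → IntervalIntegrable M volume a b :=
    fun ha hb => intervalIntegrable_Ioi hM ha hb
  have hNi : ∀ {a b : ℝ}, 0 ≤ a → 0 ≤ b → IntervalIntegrable N volume a b :=
    fun ha hb => intervalIntegrable_of_Ioi hN ha hb
  obtain ⟨c, hc⟩ := ae_eq_primitive_of_weak_deriv isOpen_Ioi ordConnected_Ioi (mem_Ioi.2 one_pos)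
    hΦ.locallyIntegrableOn (hM.add hN.locallyIntegrableOn) hw
  set d := c - ∫ y in (0 : ℝ)..1, N y with hd
  have hd' : ∀ᵐ r ∂volume.restrict (Ioi (0 : ℝ)),
      Φ r = (d + ∫ y in (1 : ℝ)..r, M y) + ∫ y in (0 : ℝ)..r, N y := by
    refine (ae_restrict_iff' measurableSet_Ioi).2 ?_
    filter_upwards [hc] with r hr h0
    have h0' : 0 < r := h0
    rw [hr h0, ← intervalIntegral.integral_add_adjacent_intervals (hNi le_rfl zero_le_one)
      (hNi zero_le_one h0'.le)]
    simp only [Pi.add_apply]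
    rw [intervalIntegral.integral_add (hii one_pos h0') (hNi zero_le_one h0'.le)]
    ring
  have hpos := fun r₀ (h : 0 < r₀) => nonneg_of_flux hΦ hN hM0 hM hle hd' h
  have hseq : Tendsto (fun n : ℕ => 1 / ((n : ℝ) + 1)) atTop (𝓝 0) :=
    tendsto_one_div_add_atTop_nhds_zero_nat
  have hs0 : ∀ n : ℕ, (0 : ℝ) < 1 / ((n : ℝ) + 1) := fun n => by positivity
  have hs1 : ∀ n : ℕ, 1 / ((n : ℝ) + 1) ≤ 1 := fun n => by
    rw [div_le_one (by positivity)]; linarith [(Nat.cast_nonneg n : (0 : ℝ) ≤ n)]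
  have hbd : ∀ n : ℕ, ∫ x in (1 / ((n : ℝ) + 1))..1, M x ≤ d := fun n => by
    have := hpos _ (hs0 n)
    rw [intervalIntegral.integral_symm] at this
    linarith
  have hMi : IntegrableOn M (Ioc 0 1) := by
    refine integrableOn_Ioc_of_intervalIntegral_norm_bounded_left (I := d)
      (a := fun n : ℕ => 1 / ((n : ℝ) + 1)) (l := atTop) (fun n => ?_) hseq
      (Eventually.of_forall fun n => ?_)
    · exact (hii (hs0 n) one_pos).1
    · have := hbd n
      rw [intervalIntegral.integral_of_le (hs1 n)] at this
      simpa only [Real.norm_of_nonneg (hM0 _)] using this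
  have hM01 : IntervalIntegrable M volume 0 1 :=
    (intervalIntegrable_iff_integrableOn_Ioc_of_le zero_le_one).2 hMi
  refine ⟨d - ∫ y in (0 : ℝ)..1, M y, ?_, hMi, ?_⟩
  · rw [sub_nonneg]
    have h1 := intervalIntegral.continuousOn_primitive_interval' hM01 (a := 1) right_mem_uIcc
    have h2 := h1 0 left_mem_uIcc
    have h3 : Tendsto (fun n : ℕ => ∫ x in (1 : ℝ)..(1 / ((n : ℝ) + 1)), M x) atTop
        (𝓝 (∫ x in (1 : ℝ)..0, M x)) := by
      refine h2.tendsto.comp (tendsto_nhdsWithin_iff.2 ⟨hseq, Eventually.of_forall fun n => ?_⟩)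
      rw [uIcc_of_le zero_le_one]
      exact ⟨(hs0 n).le, hs1 n⟩
    have h4 := ge_of_tendsto h3 (b := -d) (Eventually.of_forall fun n => by
      have := hpos _ (hs0 n); linarith)
    rw [intervalIntegral.integral_symm] at h4
    linarith
  · filter_upwards [hd', ae_restrict_mem measurableSet_Ioi] with r hr h0
    rw [hr, ← intervalIntegral.integral_add_adjacent_intervals hM01 (hii one_pos h0)]
    ring

end AxisLimit

/-! ### The measure on the time axis. -/

instance neBot_nhdsGT_inf_ae : (𝓝[>] (0 : ℝ) ⊓ ae volume).NeBot := by
  rw [inf_neBot_iff]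
  intro s hs t ht
  by_contra hne
  obtain ⟨c, hc, hcs⟩ := mem_nhdsGT_iff_exists_Ioc_subset.1 hs
  have h0 : volume (Ioc 0 c) ≤ 0 := by
    rw [← mem_ae_iff.1 ht]
    refine measure_mono fun x hx hxt => hne ⟨x, hcs hx, hxt⟩
  rw [Real.volume_Ioc, sub_zero] at h0
  exact absurd h0 (not_le.2 (ENNReal.ofReal_pos.2 hc))

theorem eventually_of_ae_Ioi {P : ℝ → Prop} (h : ∀ᵐ r ∂volume.restrict (Ioi (0 : ℝ)), P r) :
    ∀ᶠ r in 𝓝[>] (0 : ℝ) ⊓ ae volume, P r := by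
  rw [ae_restrict_iff' measurableSet_Ioi] at h
  filter_upwards [h.filter_mono (inf_le_right (a := 𝓝[>] (0 : ℝ))),
    (self_mem_nhdsWithin : Ioi (0 : ℝ) ∈ 𝓝[>] (0 : ℝ)) |> mem_inf_of_left] with r hr h0
  exact hr h0

/-- A function on the line given by nonnegative additive increments. -/
def primitiveOf (L : ℝ → ℝ → ℝ) (t : ℝ) : ℝ := if 0 ≤ t then L 0 t else -L t 0

theorem primitiveOf_sub {L : ℝ → ℝ → ℝ} (hL : ∀ a b c, a ≤ b → b ≤ c → L a c = L a b + L b c)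
    {a b : ℝ} (hab : a ≤ b) : primitiveOf L b - primitiveOf L a = L a b := by
  simp only [primitiveOf]
  split_ifs with h1 h2 h2
  · rw [hL 0 a b h2 hab]; ring
  · rw [hL a 0 b (not_le.1 h2).le h1]; ring
  · exact absurd (h2.trans hab) h1
  · rw [hL a b 0 hab (not_le.1 h1).le]; ring

namespace InwardFlow

variable {e f m : ℝ × E3 → ℝ} {a b : ℝ}

/-- The radial derivative of the flux, without its source term. -/
def energyJump (e : ℝ × E3 → ℝ) (a b r : ℝ) : ℝ :=
  sphereIntegral (fun x => e (b, x)) r - sphereIntegral (fun x => e (a, x)) r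

/-- `l` is the flux through the axis during `(a, b]`. -/
structure IsAxisFlux (e f m : ℝ × E3 → ℝ) (a b l : ℝ) : Prop where
  nonneg : 0 ≤ l
  integrableOn_m : IntegrableOn (shell (slab a b) m) (Ioc 0 1)
  eq : ∀ᵐ r ∂volume.restrict (Ioi (0 : ℝ)), shell (slab a b) f r =
    l + (∫ y in (0 : ℝ)..r, shell (slab a b) m y) + ∫ y in (0 : ℝ)..r, energyJump e a b y

theorem integrableOn_energyJump (h : InwardFlow e f m) (a b : ℝ) :
    IntegrableOn (energyJump e a b) (Ioi 0) :=
  (integrableOn_sphereIntegral (h.e_slice b)).sub (integrableOn_sphereIntegral (h.e_slice a))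

theorem exists_isAxisFlux (h : InwardFlow e f m) (hab : a ≤ b) : ∃ l, IsAxisFlux e f m a b l := by
  obtain ⟨l, h1, h2, h3⟩ := exists_axis_limit (integrableOn_shell (h.integrable_f a b))
    (h.integrableOn_energyJump a b) (fun r => shell_nonneg h.m_nonneg r)
    (h.locallyIntegrableOn_shell_m a b) (h.neg_le_shell_f a b)
    (fun θ hθ hc hs => h.shell_weak_deriv hab hθ hc hs)
  exact ⟨l, h1, h2, h3⟩

theorem tendsto_primitive {g : ℝ → ℝ} (hg : IntegrableOn g (Ioc 0 1)) :
    Tendsto (fun r => ∫ y in (0 : ℝ)..r, g y) (𝓝[>] 0) (𝓝 0) := by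
  have h1 := intervalIntegral.continuousOn_primitive_interval' (f := g) (μ := volume) (a := 0)
    ((intervalIntegrable_iff_integrableOn_Ioc_of_le zero_le_one).2 hg) left_mem_uIcc
  have h2 := h1 0 left_mem_uIcc
  rw [ContinuousWithinAt, intervalIntegral.integral_same, uIcc_of_le zero_le_one] at h2
  exact h2.mono_left (nhdsWithin_le_of_mem (mem_of_superset
    (Ioc_mem_nhdsGT one_pos) Ioc_subset_Icc_self))

theorem IsAxisFlux.tendsto (h : InwardFlow e f m) {l : ℝ} (hl : IsAxisFlux e f m a b l) :
    Tendsto (shell (slab a b) f) (𝓝[>] 0 ⊓ ae volume) (𝓝 l) := by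
  have h1 := tendsto_primitive hl.integrableOn_m
  have h2 := tendsto_primitive ((h.integrableOn_energyJump a b).mono_set
    Ioc_subset_Ioi_self)
  have h3 := ((tendsto_const_nhds (x := l)).add h1).add h2
  rw [add_zero, add_zero] at h3
  exact (h3.mono_left inf_le_left).congr' ((eventually_of_ae_Ioi hl.eq).mono fun r hr => hr.symm)

theorem IsAxisFlux.add (h : InwardFlow e f m) {c l l' l'' : ℝ} (hab : a ≤ b) (hbc : b ≤ c)
    (hl : IsAxisFlux e f m a b l) (hl' : IsAxisFlux e f m b c l')
    (hl'' : IsAxisFlux e f m a c l'') : l'' = l + l' := by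
  refine tendsto_nhds_unique (hl''.tendsto h) (((hl.tendsto h).add (hl'.tendsto h)).congr' ?_)
  refine eventually_of_ae_Ioi ?_
  filter_upwards [ae_integrable_shell (h.integrable_f a b),
    ae_integrable_shell (h.integrable_f b c)] with r h1 h2
  have : (slab a c).prod sphereMeasure =
      (slab a b).prod sphereMeasure + (slab b c).prod sphereMeasure := by
    rw [← Measure.add_prod, slab, slab, slab, ← Ioc_union_Ioc_eq_Ioc hab hbc,
      Measure.restrict_union (Ioc_disjoint_Ioc_of_le le_rfl) measurableSet_Ioc]
  simp only [shell]
  rw [this, integral_add_measure h1 h2]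
  ring

/-- For r ≤ ρ the formula for the flux, with M ≥ 0, the energy at time b dropped, and f ≤ e, shows
that l minus the energy at time a in the ball of radius ρ is at most the shell integral of e.
Integrate over 0 < r ≤ ρ and use the bound C(b-a) on the space-time integral of e. -/
theorem IsAxisFlux.le (h : InwardFlow e f m) {l : ℝ} (hl : IsAxisFlux e f m a b l) (hab : a ≤ b)
    {C : ℝ} (hC : ∀ t, ∫ x, e (t, x) ≤ C) {ρ : ℝ} (hρ : 0 < ρ) :
    l ≤ C * (b - a) / ρ + ∫ x, (Iic ρ).indicator 1 ‖x‖ * e (a, x) := by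
  set β := ∫ x, (Iic ρ).indicator 1 ‖x‖ * e (a, x) with hβ
  have hb1 : ∀ s : ℝ, ‖(Iic ρ).indicator (1 : ℝ → ℝ) s‖ ≤ 1 := fun s => by
    by_cases hs : s ∈ Iic ρ <;> simp [hs]
  have hiβ : Integrable fun x : E3 => (Iic ρ).indicator 1 ‖x‖ * e (a, x) :=
    h.integrable_mul_e (((measurable_one.indicator measurableSet_Iic).comp
      measurable_norm).aestronglyMeasurable) (fun x => hb1 _) a
  have hea : IntegrableOn (sphereIntegral fun x => e (a, x)) (Ioi 0) :=
    integrableOn_sphereIntegral (h.e_slice a)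
  have heb : IntegrableOn (sphereIntegral fun x => e (b, x)) (Ioi 0) :=
    integrableOn_sphereIntegral (h.e_slice b)
  have hβ' : ∫ y in Ioc 0 ρ, sphereIntegral (fun x => e (a, x)) y = β := by
    rw [hβ, ← integral_sphereIntegral hiβ, ← Ioi_inter_Iic, ← setIntegral_indicator measurableSet_Iic]
    refine setIntegral_congr_fun measurableSet_Ioi fun y hy => ?_
    rw [sphereIntegral_mul _ _ hy]
    by_cases hs : y ∈ Iic ρ <;> simp only [hs, indicator_of_mem, indicator_of_notMem,
      not_false_eq_true, Pi.one_apply, one_mul, zero_mul]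
  have h1 : ∀ᵐ r ∂volume.restrict (Ioc 0 ρ), l - β ≤ shell (slab a b) e r := by
    refine (ae_restrict_iff' measurableSet_Ioc).2 ?_
    filter_upwards [(ae_restrict_iff' measurableSet_Ioi).1 hl.eq,
      (ae_restrict_iff' measurableSet_Ioi).1 (ae_integrable_shell (h.integrable_f a b)),
      (ae_restrict_iff' measurableSet_Ioi).1 (ae_integrable_shell (h.integrable_e a b))]
      with r h1 h2 h3 hr
    have h1 := h1 hr.1
    have h4 : shell (slab a b) f r ≤ shell (slab a b) e r :=
      mul_le_mul_of_nonneg_left (integral_mono (h2 hr.1) (h3 hr.1)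
        fun q => (le_abs_self _).trans (h.abs_f_le _)) (sq_nonneg r)
    have h5 : 0 ≤ ∫ y in (0 : ℝ)..r, shell (slab a b) m y :=
      intervalIntegral.integral_nonneg (μ := volume) hr.1.le fun y _ => shell_nonneg h.m_nonneg y
    have h6 : -β ≤ ∫ y in (0 : ℝ)..r, energyJump e a b y := by
      simp only [energyJump]
      rw [intervalIntegral.integral_sub (intervalIntegrable_of_Ioi heb le_rfl hr.1.le)
        (intervalIntegrable_of_Ioi hea le_rfl hr.1.le)]
      have h7 : 0 ≤ ∫ y in (0 : ℝ)..r, sphereIntegral (fun x => e (b, x)) y :=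
        intervalIntegral.integral_nonneg (μ := volume) hr.1.le
          fun y _ => sphereIntegral_nonneg (fun x => h.e_nonneg _) y
      have h8 : ∫ y in (0 : ℝ)..r, sphereIntegral (fun x => e (a, x)) y ≤ β := by
        rw [intervalIntegral.integral_of_le hr.1.le, ← hβ']
        exact setIntegral_mono_set (hea.mono_set Ioc_subset_Ioi_self)
          (ae_of_all _ fun y => sphereIntegral_nonneg (fun x => h.e_nonneg _) y)
          (Ioc_subset_Ioc_right hr.2).eventuallyLE
      linarith
    linarith
  have h2 : IntegrableOn (shell (slab a b) e) (Ioi 0) := integrableOn_shell (h.integrable_e a b)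
  have h3 := setIntegral_mono_ae_restrict (μ := volume) (s := Ioc 0 ρ) (integrableOn_const (by simp))
    (h2.mono_set Ioc_subset_Ioi_self) h1
  have h4 : ∫ r in Ioc 0 ρ, shell (slab a b) e r ≤ C * (b - a) := by
    calc _ ≤ ∫ r in Ioi 0, shell (slab a b) e r :=
          setIntegral_mono_set h2 (ae_of_all _ fun y => shell_nonneg h.e_nonneg y)
            Ioc_subset_Ioi_self.eventuallyLE
      _ = ∫ t in Ioc a b, ∫ x, e (t, x) := by
          rw [integral_shell (h.integrable_e a b), integral_prod _ (h.integrable_e a b)]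
      _ ≤ ∫ t in Ioc a b, C :=
          integral_mono (h.integrable_e a b).integral_prod_left (integrable_const C) fun t => hC t
      _ = C * (b - a) := by simp [hab, mul_comm]
  have h5 : ρ * (l - β) ≤ C * (b - a) := by
    rw [setIntegral_const] at h3
    simp [hρ.le] at h3
    linarith
  rw [← sub_le_iff_le_add, le_div_iff₀ hρ]
  linarith

/-- The flux through the axis, as a function of the time interval. -/
def axisFlux (e f m : ℝ × E3 → ℝ) (a b : ℝ) : ℝ :=
  open Classical in if h : ∃ l, IsAxisFlux e f m a b l then h.choose else 0

theorem isAxisFlux_axisFlux (h : InwardFlow e f m) (hab : a ≤ b) :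
    IsAxisFlux e f m a b (axisFlux e f m a b) := by
  have := h.exists_isAxisFlux hab
  rw [axisFlux, dif_pos this]
  exact this.choose_spec

/-- Let ρ tend to infinity in `IsAxisFlux.le`. The bound does not depend on the length of the
interval, which makes the measure finite. -/
theorem axisFlux_le (h : InwardFlow e f m) {C : ℝ} (hC : ∀ t, ∫ x, e (t, x) ≤ C) (hab : a ≤ b) :
    axisFlux e f m a b ≤ C := by
  have h1 : Tendsto (fun ρ : ℝ => C * (b - a) / ρ + C) atTop (𝓝 (0 + C)) :=
    (tendsto_const_nhds.div_atTop tendsto_id).add tendsto_const_nhds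
  rw [zero_add] at h1
  refine ge_of_tendsto h1 ?_
  filter_upwards [eventually_gt_atTop 0] with ρ hρ
  refine ((h.isAxisFlux_axisFlux hab).le h hab hC hρ).trans (add_le_add_right ?_ _)
  refine (integral_mono_of_nonneg (ae_of_all _ fun x => ?_) (h.e_slice a)
    (ae_of_all _ fun x => ?_)).trans (hC a)
  · exact mul_nonneg (indicator_nonneg (fun _ _ => zero_le_one) _) (h.e_nonneg _)
  · exact mul_le_of_le_one_left (h.e_nonneg _)
      (indicator_le_self' (f := (1 : ℝ → ℝ)) (fun _ _ => zero_le_one) _)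

/-- Small time intervals carry little flux. -/
theorem exists_axisFlux_lt (h : InwardFlow e f m) (t₀ : ℝ) {ε : ℝ} (hε : 0 < ε) :
    ∃ δ > 0, ∀ a b, a ≤ b → t₀ - δ ≤ a → b ≤ t₀ + δ → axisFlux e f m a b < ε := by
  obtain ⟨C, hC⟩ := h.energy_le
  have hC0 : 0 ≤ C := (integral_nonneg fun x => h.e_nonneg (0, x)).trans (hC 0)
  have hw : ∀ ρ : ℝ, BddWeight fun x : E3 => (Iic ρ).indicator 1 ‖x‖ := fun ρ =>
    ⟨(measurable_one.indicator measurableSet_Iic).comp measurable_norm,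
      fun x => indicator_nonneg (fun _ _ => zero_le_one) _,
      ⟨1, fun x => indicator_le_self' (f := (1 : ℝ → ℝ)) (fun _ _ => zero_le_one) _⟩,
      ⟨ρ, fun x hx => indicator_of_notMem (show ‖x‖ ∉ Iic ρ from not_le.2 hx) _⟩⟩
  have h1 : Tendsto (fun n : ℕ => ∫ x, (Iic (1 / ((n : ℝ) + 1))).indicator 1 ‖x‖ * e (t₀, x)) atTop
      (𝓝 (∫ _x : E3, (0 : ℝ))) := by
    refine tendsto_integral_of_dominated_convergence (fun x => e (t₀, x)) (fun n => ?_)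
      (h.e_slice t₀) (fun n => ae_of_all _ fun x => ?_) ?_
    · exact (hw _).measurable.aestronglyMeasurable.mul (h.e_slice t₀).1
    · rw [norm_mul, Real.norm_of_nonneg ((hw _).nonneg x), Real.norm_of_nonneg (h.e_nonneg _)]
      exact mul_le_of_le_one_left (h.e_nonneg _)
        (indicator_le_self' (f := (1 : ℝ → ℝ)) (fun _ _ => zero_le_one) _)
    · have : ∀ᵐ x : E3, x ≠ 0 := by simp [ae_iff]
      filter_upwards [this] with x hx
      refine tendsto_const_nhds.congr' ?_
      filter_upwards [(tendsto_one_div_add_atTop_nhds_zero_nat (𝕜 := ℝ)).eventually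
        (gt_mem_nhds (norm_pos_iff.2 hx))] with n hn
      rw [indicator_of_notMem (show ‖x‖ ∉ Iic (1 / ((n : ℝ) + 1)) from not_le.2 hn), zero_mul]
  rw [integral_zero] at h1
  -- First fix ρ so that the ball carries energy below ε/2 at time t₀, hence at nearby times by
  -- continuity; only then shorten the interval relative to ρ.
  obtain ⟨n, hn⟩ := (h1.eventually (gt_mem_nhds (half_pos hε))).exists
  set ρ := 1 / ((n : ℝ) + 1) with hρ
  have hρ0 : 0 < ρ := by positivity
  have h2 := ((h.cont _ (hw ρ)).continuousAt (x := t₀)).eventually (gt_mem_nhds hn)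
  obtain ⟨δ, hδ, h3⟩ := Metric.eventually_nhds_iff.1 h2
  have hpos : 0 < ρ * ε / (8 * (C + 1)) := by positivity
  refine ⟨min (δ / 2) (ρ * ε / (8 * (C + 1))), lt_min (by linarith) hpos, fun a b hab ha hb => ?_⟩
  have hd1 := min_le_left (δ / 2) (ρ * ε / (8 * (C + 1)))
  have hd2 := min_le_right (δ / 2) (ρ * ε / (8 * (C + 1)))
  have h4 := (h.isAxisFlux_axisFlux hab).le h hab hC hρ0
  have h5 : ∫ x, (Iic ρ).indicator 1 ‖x‖ * e (a, x) < ε / 2 := h3 (by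
    rw [Real.dist_eq, abs_lt]; constructor <;> linarith)
  have h6 : C * (b - a) / ρ ≤ ε / 2 := by
    rw [div_le_iff₀ hρ0]
    calc C * (b - a) ≤ (C + 1) * (2 * (ρ * ε / (8 * (C + 1)))) :=
          mul_le_mul (by linarith) (by linarith) (by linarith) (by linarith)
      _ = ρ * ε / 4 := by field_simp; ring
      _ ≤ ε / 2 * ρ := by nlinarith [mul_pos hρ0 hε]
  linarith

/-- The measure on the time axis given by the flux through the axis. -/
theorem exists_axisMeasure (h : InwardFlow e f m) :
    ∃ μ : Measure ℝ, IsFiniteMeasure μ ∧ (∀ t, μ {t} = 0) ∧ ∀ a b, a ≤ b →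
      Tendsto (shell (slab a b) f) (𝓝[>] 0 ⊓ ae volume) (𝓝 (Real.pi * (μ (Icc a b)).toReal)) := by
  obtain ⟨C, hC⟩ := h.energy_le
  set L := axisFlux e f m with hL
  have hadd : ∀ a b c, a ≤ b → b ≤ c → L a c = L a b + L b c := fun a b c hab hbc =>
    (h.isAxisFlux_axisFlux hab).add h hab hbc (h.isAxisFlux_axisFlux hbc)
      (h.isAxisFlux_axisFlux (hab.trans hbc))
  have hL0 : ∀ a b, a ≤ b → 0 ≤ L a b := fun a b hab => (h.isAxisFlux_axisFlux hab).nonneg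
  have hsub := fun {a b : ℝ} (hab : a ≤ b) => primitiveOf_sub hadd hab
  -- Continuity of the primitive is what makes the Stieltjes measure atomless.
  have hcont : Continuous fun t => primitiveOf L t / Real.pi := by
    refine Continuous.div_const ?_ _
    rw [Metric.continuous_iff']
    intro t₀ ε hε
    obtain ⟨δ, hδ, hlt⟩ := h.exists_axisFlux_lt t₀ hε
    filter_upwards [Metric.ball_mem_nhds t₀ hδ] with t ht
    rw [Metric.mem_ball, Real.dist_eq, abs_lt] at ht
    rw [Real.dist_eq]
    rcases le_total t t₀ with htt | htt
    · rw [abs_sub_comm, hsub htt, abs_of_nonneg (hL0 _ _ htt)]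
      exact hlt _ _ htt (by linarith) (by linarith)
    · rw [hsub htt, abs_of_nonneg (hL0 _ _ htt)]
      exact hlt _ _ htt (by linarith) (by linarith)
  let F : StieltjesFunction ℝ := ⟨fun t => primitiveOf L t / Real.pi, fun a b hab => by
    have := hL0 a b hab
    rw [← hsub hab] at this
    exact div_le_div_of_nonneg_right (by linarith) Real.pi_pos.le,
    fun x => hcont.continuousWithinAt⟩
  have hleft : ∀ t, Function.leftLim F t = F t := fun t =>
    (hcont.continuousAt (x := t)).continuousWithinAt.leftLim_eq
  refine ⟨F.measure, ?_, fun t => ?_, fun a b hab => ?_⟩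
  · refine F.isFiniteMeasure_of_forall_abs_le (C := C / Real.pi) fun t => ?_
    change |primitiveOf L t / Real.pi| ≤ _
    rw [abs_div, abs_of_pos Real.pi_pos]
    refine div_le_div_of_nonneg_right ?_ Real.pi_pos.le
    simp only [primitiveOf]
    split_ifs with h0
    · rw [abs_of_nonneg (hL0 _ _ h0)]
      exact h.axisFlux_le hC h0
    · rw [abs_neg, abs_of_nonneg (hL0 _ _ (not_le.1 h0).le)]
      exact h.axisFlux_le hC (not_le.1 h0).le
  · rw [F.measure_singleton, hleft, sub_self, ENNReal.ofReal_zero]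
  · have : Real.pi * (F.measure (Icc a b)).toReal = L a b := by
      rw [F.measure_Icc, hleft]
      change Real.pi * (ENNReal.ofReal (primitiveOf L b / Real.pi -
        primitiveOf L a / Real.pi)).toReal = _
      rw [← sub_div, hsub hab, ENNReal.toReal_ofReal (div_nonneg (hL0 _ _ hab) Real.pi_pos.le),
        mul_div_cancel₀ _ Real.pi_ne_zero]
    rw [this]
    exact (h.isAxisFlux_axisFlux hab).tendsto h

end InwardFlow

/-! ### Cutoffs near the axis. -/

/-- A smooth cutoff that vanishes for `r ≤ ρ` and equals `1` for `2 ρ ≤ r`. -/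
def radialCutoff (ρ r : ℝ) : ℝ := Real.smoothTransition (r / ρ - 1)

namespace radialCutoff

variable {ρ r : ℝ}

theorem nonneg (ρ r : ℝ) : 0 ≤ radialCutoff ρ r := Real.smoothTransition.nonneg _

theorem le_one (ρ r : ℝ) : radialCutoff ρ r ≤ 1 := Real.smoothTransition.le_one _

theorem contDiff (ρ : ℝ) : ContDiff ℝ ∞ (radialCutoff ρ) :=
  Real.smoothTransition.contDiff.comp ((contDiff_id.div_const ρ).sub contDiff_const)

theorem eq_zero (hρ : 0 < ρ) (hr : r ≤ ρ) : radialCutoff ρ r = 0 :=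
  Real.smoothTransition.zero_of_nonpos (by rw [sub_nonpos, div_le_one hρ]; exact hr)

theorem eq_one (hρ : 0 < ρ) (hr : 2 * ρ ≤ r) : radialCutoff ρ r = 1 :=
  Real.smoothTransition.one_of_one_le (by
    have : 2 ≤ r / ρ := by rwa [le_div_iff₀ hρ]
    linarith)

theorem monotone (hρ : 0 < ρ) : Monotone (radialCutoff ρ) := fun _ _ hxy =>
  Real.smoothTransition.monotone (sub_le_sub_right (div_le_div_of_nonneg_right hxy hρ.le) _)

theorem deriv_nonneg (hρ : 0 < ρ) (r : ℝ) : 0 ≤ deriv (radialCutoff ρ) r :=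
  (monotone hρ).deriv_nonneg

theorem deriv_eq (ρ r : ℝ) :
    deriv (radialCutoff ρ) r = deriv Real.smoothTransition (r / ρ - 1) / ρ := by
  have h1 : HasDerivAt Real.smoothTransition (deriv Real.smoothTransition (r / ρ - 1)) (r / ρ - 1) :=
    ((Real.smoothTransition.contDiff (n := 1)).differentiable (by simp)).differentiableAt.hasDerivAt
  have h2 : HasDerivAt (fun r : ℝ => r / ρ - 1) (1 / ρ) r := ((hasDerivAt_id r).div_const ρ).sub_const 1
  rw [show radialCutoff ρ = Real.smoothTransition ∘ fun r => r / ρ - 1 from rfl, (h1.comp r h2).deriv]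
  ring

theorem deriv_eq_zero (hρ : 0 < ρ) (hr : r ≤ ρ ∨ 2 * ρ ≤ r) : deriv (radialCutoff ρ) r = 0 := by
  have hclosed : IsClosed {r | deriv (radialCutoff ρ) r = 0} :=
    isClosed_eq ((contDiff ρ).continuous_deriv (by simp)) continuous_const
  have h1 : ∀ r < ρ, deriv (radialCutoff ρ) r = 0 := fun r hr => by
    have : radialCutoff ρ =ᶠ[𝓝 r] fun _ => 0 := by
      filter_upwards [gt_mem_nhds hr] with s hs using eq_zero hρ hs.le
    rw [this.deriv_eq, deriv_const]
  have h2 : ∀ r, 2 * ρ < r → deriv (radialCutoff ρ) r = 0 := fun r hr => by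
    have : radialCutoff ρ =ᶠ[𝓝 r] fun _ => 1 := by
      filter_upwards [lt_mem_nhds hr] with s hs using eq_one hρ hs.le
    rw [this.deriv_eq, deriv_const]
  rcases hr with hr | hr
  · have := hclosed.closure_subset_iff.2 (fun r hr => h1 r hr : Iio ρ ⊆ _)
    rw [closure_Iio] at this
    exact this hr
  · have := hclosed.closure_subset_iff.2 (fun r hr => h2 r hr : Ioi (2 * ρ) ⊆ _)
    rw [closure_Ioi] at this
    exact this hr

/-- The derivative scales like 1/ρ and is supported in [ρ, 2ρ], so its product with r is bounded
independently of ρ. -/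
theorem exists_deriv_le : ∃ C, 0 ≤ C ∧ ∀ ρ, 0 < ρ → ∀ r, deriv (radialCutoff ρ) r ≤ C / ρ ∧
    r * deriv (radialCutoff ρ) r ≤ 2 * C := by
  have hc : Continuous (deriv Real.smoothTransition) :=
    (Real.smoothTransition.contDiff (n := 1)).continuous_deriv (by simp)
  obtain ⟨C, hC⟩ := (isCompact_Icc (a := (0 : ℝ)) (b := 1)).exists_bound_of_continuousOn
    hc.continuousOn
  have hC0 : 0 ≤ C := (norm_nonneg _).trans (hC 0 (by simp))
  refine ⟨C, hC0, fun ρ hρ r => ?_⟩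
  by_cases hr : r ≤ ρ ∨ 2 * ρ ≤ r
  · rw [deriv_eq_zero hρ hr, mul_zero]
    exact ⟨by positivity, by positivity⟩
  · push Not at hr
    have h1 : deriv (radialCutoff ρ) r ≤ C / ρ := by
      rw [deriv_eq]
      refine div_le_div_of_nonneg_right ((le_abs_self _).trans (hC _ ⟨?_, ?_⟩)) hρ.le
      · rw [sub_nonneg, one_le_div hρ]; exact hr.1.le
      · rw [sub_le_iff_le_add, div_le_iff₀ hρ]; linarith [hr.2]
    refine ⟨h1, ?_⟩
    calc r * deriv (radialCutoff ρ) r ≤ 2 * ρ * (C / ρ) :=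
          mul_le_mul hr.2.le h1 (deriv_nonneg hρ r) (by linarith)
      _ = 2 * C := by field_simp

theorem continuous_deriv (ρ : ℝ) : Continuous (deriv (radialCutoff ρ)) :=
  (contDiff ρ).continuous_deriv (by simp)

theorem norm_deriv_le (hρ : 0 < ρ) : ∃ C, ∀ r, ‖deriv (radialCutoff ρ) r‖ ≤ C := by
  obtain ⟨C, hC0, hC⟩ := exists_deriv_le
  exact ⟨C / ρ, fun r => by
    rw [Real.norm_of_nonneg (deriv_nonneg hρ r)]; exact (hC ρ hρ r).1⟩

theorem setIntegral_deriv_mul (hρ : 0 < ρ) (g : ℝ → ℝ) :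
    ∫ r in Ioi 0, deriv (radialCutoff ρ) r * g r =
      ∫ r in Ioc 0 (2 * ρ), deriv (radialCutoff ρ) r * g r := by
  refine (setIntegral_eq_of_subset_of_forall_sdiff_eq_zero measurableSet_Ioi Ioc_subset_Ioi_self
    fun r hr => ?_)
  rw [deriv_eq_zero hρ (Or.inr _), zero_mul]
  by_contra hc
  exact hr.2 ⟨hr.1, (not_le.1 hc).le⟩

theorem integral_deriv (hρ : 0 < ρ) : ∫ r in Ioc 0 (2 * ρ), deriv (radialCutoff ρ) r = 1 := by
  rw [← intervalIntegral.integral_of_le (by linarith), intervalIntegral.integral_deriv_eq_sub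
    (fun x _ => ((contDiff ρ).differentiable (by simp)).differentiableAt)
    ((continuous_deriv ρ).intervalIntegrable _ _), eq_one hρ le_rfl, eq_zero hρ hρ.le, sub_zero]

theorem integrableOn_deriv_mul (hρ : 0 < ρ) {Φ : ℝ → ℝ} {s : Set ℝ} (hΦ : IntegrableOn Φ s) :
    IntegrableOn (fun r => deriv (radialCutoff ρ) r * Φ r) s := by
  obtain ⟨C, hC⟩ := norm_deriv_le hρ
  exact Integrable.bdd_mul hΦ (continuous_deriv ρ).aestronglyMeasurable (ae_of_all _ hC)

theorem tendsto_two_mul : Tendsto (fun ρ : ℝ => 2 * ρ) (𝓝[>] 0) (𝓝[>] 0) := by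
  refine tendsto_nhdsWithin_iff.2 ⟨?_, ?_⟩
  · have : Tendsto (fun ρ : ℝ => 2 * ρ) (𝓝 0) (𝓝 (2 * 0)) := (continuous_const_mul 2).tendsto 0
    rw [mul_zero] at this
    exact this.mono_left nhdsWithin_le_nhds
  · filter_upwards [self_mem_nhdsWithin] with ρ (hρ : 0 < ρ)
    exact mul_pos two_pos hρ

theorem eventually_Ioc_subset {s : Set ℝ} (hs : s ∈ 𝓝[>] (0 : ℝ)) :
    ∀ᶠ r in 𝓝[>] (0 : ℝ), Ioc 0 r ⊆ s := by
  obtain ⟨c, hc, hcs⟩ := mem_nhdsGT_iff_exists_Ioc_subset.1 hs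
  filter_upwards [Ioc_mem_nhdsGT hc] with r hr using (Ioc_subset_Ioc_right hr.2).trans hcs

/-- The derivatives of the cutoffs concentrate at the origin. -/
theorem tendsto_integral_deriv_mul {Φ : ℝ → ℝ} (hΦ : IntegrableOn Φ (Ioi 0)) {l : ℝ}
    (hl : Tendsto Φ (𝓝[>] 0 ⊓ ae volume) (𝓝 l)) :
    Tendsto (fun ρ => ∫ r in Ioi 0, deriv (radialCutoff ρ) r * Φ r) (𝓝[>] 0) (𝓝 l) := by
  rw [Metric.tendsto_nhds]
  intro ε hε
  have h1 := Metric.tendsto_nhds.1 hl (ε / 2) (by positivity)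
  obtain ⟨s, hs, t, ht, hst⟩ := mem_inf_iff_superset.1 h1
  filter_upwards [tendsto_two_mul.eventually (eventually_Ioc_subset hs), self_mem_nhdsWithin]
    with ρ hρs (hρ : 0 < ρ)
  have hi := integrableOn_deriv_mul hρ (s := Ioc 0 (2 * ρ))
    (hΦ.mono_set Ioc_subset_Ioi_self)
  have hi1 : IntegrableOn (deriv (radialCutoff ρ)) (Ioc 0 (2 * ρ)) :=
    ((continuous_deriv ρ).integrableOn_Icc).mono_set Ioc_subset_Icc_self
  have h2 : (∫ r in Ioi 0, deriv (radialCutoff ρ) r * Φ r) - l =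
      ∫ r in Ioc 0 (2 * ρ), deriv (radialCutoff ρ) r * (Φ r - l) := by
    simp only [mul_sub]
    rw [setIntegral_deriv_mul hρ, integral_sub hi (hi1.mul_const l), integral_mul_const,
      integral_deriv hρ, one_mul]
  rw [Real.dist_eq, h2]
  have h3 : ‖∫ r in Ioc 0 (2 * ρ), deriv (radialCutoff ρ) r * (Φ r - l)‖ ≤
      ∫ r in Ioc 0 (2 * ρ), deriv (radialCutoff ρ) r * (ε / 2) := by
    refine norm_integral_le_of_norm_le (hi1.mul_const _) ?_
    refine (ae_restrict_iff' measurableSet_Ioc).2 ?_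
    filter_upwards [ht] with r hrt hr
    have h4 : dist (Φ r) l < ε / 2 := hst ⟨hρs hr, hrt⟩
    rw [norm_mul, Real.norm_of_nonneg (deriv_nonneg hρ r)]
    exact mul_le_mul_of_nonneg_left h4.le (deriv_nonneg hρ r)
  rw [integral_mul_const, integral_deriv hρ, one_mul] at h3
  exact h3.trans_lt (by linarith)

/-- The product of r and the cutoff derivative is bounded uniformly in ρ and lives on (0, 2ρ], over
which the integral of `M` vanishes in the limit. This disposes of the error made by comparing the
weight near the axis with a function of time alone. -/
theorem tendsto_integral_mul_deriv_mul {M : ℝ → ℝ} (hM0 : ∀ r, 0 ≤ M r)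
    (hM : IntegrableOn M (Ioc 0 1)) :
    Tendsto (fun ρ => ∫ r in Ioi 0, deriv (radialCutoff ρ) r * (r * M r)) (𝓝[>] 0) (𝓝 0) := by
  obtain ⟨C, hC0, hC⟩ := exists_deriv_le
  have h1 := ((InwardFlow.tendsto_primitive hM).comp tendsto_two_mul).const_mul (2 * C)
  rw [mul_zero] at h1
  refine tendsto_of_tendsto_of_tendsto_of_le_of_le' tendsto_const_nhds h1 ?_ ?_
  · filter_upwards [self_mem_nhdsWithin] with ρ (hρ : 0 < ρ)
    exact setIntegral_nonneg measurableSet_Ioi fun r (hr : 0 < r) =>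
      mul_nonneg (deriv_nonneg hρ r) (mul_nonneg hr.le (hM0 r))
  · filter_upwards [self_mem_nhdsWithin, Ioc_mem_nhdsGT (show (0 : ℝ) < 1 / 2 by norm_num)]
      with ρ (hρ : 0 < ρ) hρ1
    have hM' : IntegrableOn M (Ioc 0 (2 * ρ)) :=
      hM.mono_set (Ioc_subset_Ioc_right (by linarith [hρ1.2]))
    rw [setIntegral_deriv_mul hρ, Function.comp_apply,
      intervalIntegral.integral_of_le (by linarith), ← integral_const_mul]
    refine setIntegral_mono_on ?_ (hM'.const_mul _) measurableSet_Ioc fun r hr => ?_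
    · refine integrableOn_deriv_mul hρ ?_
      exact IntegrableOn.continuousOn_mul_of_subset (g := fun r : ℝ => r) (by fun_prop) hM'
        isCompact_Icc measurableSet_Ioc Ioc_subset_Icc_self
    · calc deriv (radialCutoff ρ) r * (r * M r) = r * deriv (radialCutoff ρ) r * M r := by ring
        _ ≤ 2 * C * M r := mul_le_mul_of_nonneg_right (hC ρ hρ r).2 (hM0 r)

end radialCutoff

/-! ### The weighted balance law for smooth weights. -/

/-- A smooth increasing weight on `(0, ∞)` that grows at most like the power `s ^ γ`. -/
structure SmoothWeight (γ : ℝ) (w : ℝ → ℝ) : Prop where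
  contDiffAt : ∀ s, 0 < s → ContDiffAt ℝ ∞ w s
  nonneg : ∀ s, 0 < s → 0 ≤ w s
  deriv_nonneg : ∀ s, 0 < s → 0 ≤ deriv w s
  mul_deriv_le : ∀ s, 0 < s → s * deriv w s ≤ γ * w s

/-- A weight cut off near the origin and at infinity. -/
def cutWeight (w : ℝ → ℝ) (ρ R s : ℝ) : ℝ :=
  w s * Real.smoothTransition (R + 1 - s) * radialCutoff (ρ / 2) s

namespace SmoothWeight

variable {γ : ℝ} {w : ℝ → ℝ} {ρ R s : ℝ}

theorem monotoneOn (h : SmoothWeight γ w) : MonotoneOn w (Ioi 0) := by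
  refine monotoneOn_of_deriv_nonneg (convex_Ioi 0)
    (fun s hs => (h.contDiffAt s hs).continuousAt.continuousWithinAt) ?_ ?_
  · rw [interior_Ioi]
    exact fun s hs => ((h.contDiffAt s hs).differentiableAt (by simp)).differentiableWithinAt
  · rw [interior_Ioi]
    exact fun s hs => h.deriv_nonneg s hs

theorem cut_eq_zero_of_le (w : ℝ → ℝ) (R : ℝ) (hρ : 0 < ρ) (hs : s ≤ ρ / 2) :
    cutWeight w ρ R s = 0 := by
  rw [cutWeight, radialCutoff.eq_zero (by positivity) hs, mul_zero]

theorem cut_eq_zero_of_ge (w : ℝ → ℝ) (ρ : ℝ) (hs : R + 1 ≤ s) : cutWeight w ρ R s = 0 := by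
  rw [cutWeight, Real.smoothTransition.zero_of_nonpos (by linarith), mul_zero, zero_mul]

theorem cut_eq (w : ℝ → ℝ) (R : ℝ) (hρ : 0 < ρ) (hs : ρ ≤ s) :
    cutWeight w ρ R s = w s * Real.smoothTransition (R + 1 - s) := by
  rw [cutWeight, radialCutoff.eq_one (by positivity) (by linarith), mul_one]

theorem cut_eq_self (w : ℝ → ℝ) (hρ : 0 < ρ) (hs : ρ ≤ s) (hR : s ≤ R) :
    cutWeight w ρ R s = w s := by
  rw [cut_eq w R hρ hs, Real.smoothTransition.one_of_one_le (by linarith), mul_one]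

theorem cut_nonneg (h : SmoothWeight γ w) (hρ : 0 < ρ) (R s : ℝ) : 0 ≤ cutWeight w ρ R s := by
  rcases le_or_gt s (ρ / 2) with hs | hs
  · rw [cut_eq_zero_of_le w R hρ hs]
  · exact mul_nonneg (mul_nonneg (h.nonneg s (by linarith)) (Real.smoothTransition.nonneg _))
      (radialCutoff.nonneg _ _)

theorem cut_le (h : SmoothWeight γ w) (hs : 0 < s) (ρ R : ℝ) : cutWeight w ρ R s ≤ w s := by
  have h0 := h.nonneg s hs
  rw [cutWeight, mul_assoc]
  exact mul_le_of_le_one_right h0 (mul_le_one₀ (Real.smoothTransition.le_one _)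
    (radialCutoff.nonneg _ _) (radialCutoff.le_one _ _))

theorem cut_contDiff (h : SmoothWeight γ w) (hρ : 0 < ρ) (R : ℝ) :
    ContDiff ℝ ∞ (cutWeight w ρ R) := by
  have hη : ContDiff ℝ ∞ fun s : ℝ => Real.smoothTransition (R + 1 - s) :=
    Real.smoothTransition.contDiff.comp (contDiff_const.sub contDiff_id)
  rw [contDiff_iff_contDiffAt]
  intro s
  rcases lt_or_ge 0 s with hs | hs
  · exact ((h.contDiffAt s hs).mul hη.contDiffAt).mul (radialCutoff.contDiff _).contDiffAt
  · have : cutWeight w ρ R =ᶠ[𝓝 s] fun _ => 0 := by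
      filter_upwards [gt_mem_nhds (show s < ρ / 2 by linarith)] with y hy
      exact cut_eq_zero_of_le w R hρ hy.le
    exact contDiffAt_const.congr_of_eventuallyEq this

/-- The outer cutoff decreases, which only helps, and the inner one is identically 1 for s > ρ. So
the power bound on `w` survives truncation, even with the smaller factor r in place of s. -/
theorem mul_deriv_cut_le (h : SmoothWeight γ w) (hρ : 0 < ρ) (R : ℝ) {r : ℝ} (hr : 0 ≤ r)
    (hrs : r ≤ s) (hs : ρ < s) : r * deriv (cutWeight w ρ R) s ≤ γ * cutWeight w ρ R s := by
  have hs0 : 0 < s := hρ.trans hs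
  set η : ℝ → ℝ := fun s => Real.smoothTransition (R + 1 - s) with hη
  have hηd : DifferentiableAt ℝ η s :=
    ((Real.smoothTransition.contDiff (n := 1)).comp
      (contDiff_const.sub contDiff_id)).differentiable (by simp) s
  have hηm : Antitone η := fun x y hxy => Real.smoothTransition.monotone (by linarith)
  have heq : cutWeight w ρ R =ᶠ[𝓝 s] fun s => w s * η s := by
    filter_upwards [lt_mem_nhds hs] with y hy using cut_eq w R hρ hy.le
  have hwd := (h.contDiffAt s hs0).differentiableAt (by simp)
  rw [heq.deriv_eq, cut_eq w R hρ hs.le, deriv_fun_mul hwd hηd]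
  have h1 : deriv η s ≤ 0 := hηm.deriv_nonpos
  have h2 := h.deriv_nonneg s hs0
  have h3 := h.mul_deriv_le s hs0
  have h4 : 0 ≤ η s := Real.smoothTransition.nonneg _
  have h5 := h.nonneg s hs0
  have h6 : r * deriv w s ≤ γ * w s := (mul_le_mul_of_nonneg_right hrs h2).trans h3
  have h7 : r * (w s * deriv η s) ≤ 0 :=
    mul_nonpos_of_nonneg_of_nonpos hr (mul_nonpos_of_nonneg_of_nonpos h5 h1)
  have h8 := mul_le_mul_of_nonneg_right h6 h4
  change r * (deriv w s * η s + w s * deriv η s) ≤ γ * (w s * η s)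
  linarith

end SmoothWeight

/-- The weight in space-time. -/
def lightWeight (w : ℝ → ℝ) (ρ R : ℝ) (q : ℝ × ℝ) : ℝ :=
  cutWeight w ρ R (q.1 + q.2) * radialCutoff ρ q.2

/-- The factor depending on t + r has equal time and radial derivatives, so in the balance law its
derivative meets only e - f. -/
theorem SmoothWeight.fderiv_lightWeight {γ : ℝ} {w : ℝ → ℝ} {ρ : ℝ} (h : SmoothWeight γ w)
    (hρ : 0 < ρ) (R : ℝ) (q d : ℝ × ℝ) : fderiv ℝ (lightWeight w ρ R) q d =
      deriv (cutWeight w ρ R) (q.1 + q.2) * (d.1 + d.2) * radialCutoff ρ q.2 +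
      cutWeight w ρ R (q.1 + q.2) * (deriv (radialCutoff ρ) q.2 * d.2) := by
  have h0 : HasFDerivAt (fun q : ℝ × ℝ => q.1 + q.2)
      (ContinuousLinearMap.fst ℝ ℝ ℝ + ContinuousLinearMap.snd ℝ ℝ ℝ) q :=
    hasFDerivAt_fst.fun_add hasFDerivAt_snd
  have hb : HasFDerivAt (cutWeight w ρ R) _ (q.1 + q.2) :=
    ((h.cut_contDiff hρ R).differentiable (by simp)).differentiableAt.hasFDerivAt
  have h1 : HasFDerivAt (fun q : ℝ × ℝ => cutWeight w ρ R (q.1 + q.2)) _ q :=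
    HasFDerivAt.comp (g := cutWeight w ρ R) q hb h0
  have h2 : HasFDerivAt (fun q : ℝ × ℝ => radialCutoff ρ q.2) _ q :=
    (((radialCutoff.contDiff ρ).differentiable (by simp)).differentiableAt.hasFDerivAt
      (x := q.2)).comp q hasFDerivAt_snd
  have h3 : fderiv ℝ (lightWeight w ρ R) q = _ := (h1.mul h2).fderiv
  rw [h3]
  simp [fderiv_eq_smul_deriv]
  ring

namespace InwardFlow

variable {e f m G : ℝ × E3 → ℝ} {γ : ℝ} {w : ℝ → ℝ} {ρ R T : ℝ}

/-- The pointwise lower bound for the integrand of the balance law. -/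
theorem lightWeight_pointwise (h : InwardFlow e f m) (hw : SmoothWeight γ w) (hρ : 0 < ρ)
    (hρ1 : 2 * ρ ≤ 1) (hR : T + 1 ≤ R)
    (hG : ∀ z : ℝ × E3, z.2 ≠ 0 → G z + γ * ((e z - f z) / ‖z.2‖) ≤ m z) {c : ℝ → ℝ}
    (hc0 : ∀ t, 0 ≤ c t) (hc : ∀ t ∈ Ioc 0 T, ∀ r, 0 < r → c t ≤ w (t + r)) {z : ℝ × E3}
    (hz : z.1 ∈ Ioc 0 T) :
    c z.1 * deriv (radialCutoff ρ) ‖z.2‖ * f z -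
        w (T + 1) / 2 * (deriv (radialCutoff ρ) ‖z.2‖ * (‖z.2‖ * m z)) +
        lightWeight w ρ R (z.1, ‖z.2‖) * G z ≤
      -(dT (lightWeight w ρ R) (z.1, ‖z.2‖) * e z) + dR (lightWeight w ρ R) (z.1, ‖z.2‖) * f z +
        lightWeight w ρ R (z.1, ‖z.2‖) * m z := by
  simp only [dT, dR, dirD, hw.fderiv_lightWeight hρ R, lightWeight]
  set r := ‖z.2‖ with hr
  rcases le_or_gt r ρ with hrρ | hrρ
  · rw [radialCutoff.eq_zero hρ hrρ, radialCutoff.deriv_eq_zero hρ (Or.inl hrρ)]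
    simp
  have hr0 : 0 < r := hρ.trans hrρ
  have hx : z.2 ≠ 0 := norm_pos_iff.1 hr0
  set s := z.1 + r with hs
  have hsρ : ρ < s := by linarith [hz.1]
  set κ := radialCutoff ρ r with hκ
  set κ' := deriv (radialCutoff ρ) r with hκ'
  set b := cutWeight w ρ R s with hb
  set b' := deriv (cutWeight w ρ R) s with hb'
  have hκ0 : 0 ≤ κ := radialCutoff.nonneg _ _
  have hκ'0 : 0 ≤ κ' := radialCutoff.deriv_nonneg hρ _
  have hb0 : 0 ≤ b := hw.cut_nonneg hρ R s
  have hbb : r * b' ≤ γ * b := hw.mul_deriv_cut_le hρ R hr0.le (by linarith [hz.1]) hsρ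
  have hef : 0 ≤ e z - f z := sub_nonneg.2 ((le_abs_self _).trans (h.abs_f_le z))
  have hf := h.neg_le_f z hx
  have hm := h.m_nonneg z
  -- The derivative of the weight is absorbed by the part γ(e-f)/r of the source.
  have hA : b' * (e z - f z) ≤ b * (m z - G z) := by
    have h1 := hG z hx
    calc b' * (e z - f z) = r * b' * ((e z - f z) / r) := by field_simp
      _ ≤ γ * b * ((e z - f z) / r) := mul_le_mul_of_nonneg_right hbb (div_nonneg hef hr0.le)
      _ = b * (γ * ((e z - f z) / r)) := by ring
      _ ≤ b * (m z - G z) := mul_le_mul_of_nonneg_left (by linarith) hb0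
  -- Since f may be negative, b cannot simply be replaced by the smaller c. But f + rm/2 ≥ 0, so
  -- (b-c)κ'(f + rm/2) ≥ 0, and b-c ≤ w(T+1) bounds the correction.
  have hB : c z.1 * κ' * f z - w (T + 1) / 2 * (κ' * (r * m z)) ≤ b * κ' * f z := by
    rcases le_or_gt (2 * ρ) r with h2 | h2
    · rw [hκ', radialCutoff.deriv_eq_zero hρ (Or.inr h2)]; simp
    · have hsT : s ≤ T + 1 := by linarith [hz.2]
      have hbw : b = w s := SmoothWeight.cut_eq_self w hρ hsρ.le (hsT.trans hR)
      have h3 : w s ≤ w (T + 1) :=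
        hw.monotoneOn (show (0 : ℝ) < s by linarith) (show (0 : ℝ) < T + 1 by linarith) hsT
      have h4 := hc z.1 hz r hr0
      rw [← hs] at h4
      have h5 : 0 ≤ (b - c z.1) * (κ' * (f z + r / 2 * m z)) :=
        mul_nonneg (by linarith) (mul_nonneg hκ'0 (by linarith))
      have h6 : 0 ≤ (w (T + 1) - b + c z.1) * (κ' * (r * m z)) :=
        mul_nonneg (by linarith [hc0 z.1]) (by positivity)
      linarith
  have hC := mul_le_mul_of_nonneg_left hA hκ0
  simp only [mul_one, mul_zero, add_zero, zero_add]
  linarith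

/-- On the support of the cutoff r ≥ ρ, so G ≤ m ≤ |x|m/ρ there, and |x|m is integrable on the slab.
-/
theorem integrable_lightWeight_mul (h : InwardFlow e f m) (hw : SmoothWeight γ w) (hρ : 0 < ρ)
    (R : ℝ) (hGm : AEStronglyMeasurable G volume) (hG0 : ∀ z, 0 ≤ G z)
    (hG1 : ∀ z : ℝ × E3, z.2 ≠ 0 → G z ≤ m z) (a b : ℝ) :
    Integrable (fun z : ℝ × E3 => lightWeight w ρ R (z.1, ‖z.2‖) * G z)
      ((slab a b).prod volume) := by
  have hcs : HasCompactSupport (cutWeight w ρ R) :=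
    HasCompactSupport.intro (isCompact_Icc (a := ρ / 2) (b := R + 1)) fun s hs => by
      by_contra hne
      refine hs ⟨?_, ?_⟩
      · by_contra hc
        exact hne (SmoothWeight.cut_eq_zero_of_le w R hρ (not_le.1 hc).le)
      · by_contra hc
        exact hne (SmoothWeight.cut_eq_zero_of_ge w ρ (not_le.1 hc).le)
  obtain ⟨C, hC⟩ := (hw.cut_contDiff hρ R).continuous.bounded_above_of_compact_support hcs
  have hC0 : 0 ≤ C := (norm_nonneg _).trans (hC 0)
  have hcont : Continuous fun z : ℝ × E3 => lightWeight w ρ R (z.1, ‖z.2‖) :=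
    ((hw.cut_contDiff hρ R).continuous.comp (by fun_prop)).mul
      ((radialCutoff.contDiff ρ).continuous.comp (by fun_prop))
  refine ((h.integrable_norm_mul_m a b).const_mul (C / ρ)).mono' ?_ (ae_of_all _ fun z => ?_)
  · rw [slab_prod]
    exact hcont.aestronglyMeasurable.mul hGm.restrict
  · have hl0 : 0 ≤ lightWeight w ρ R (z.1, ‖z.2‖) :=
      mul_nonneg (hw.cut_nonneg hρ R _) (radialCutoff.nonneg _ _)
    rw [norm_mul, Real.norm_of_nonneg (hG0 z), Real.norm_of_nonneg hl0]
    rcases le_or_gt ‖z.2‖ ρ with hr | hr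
    · rw [lightWeight, radialCutoff.eq_zero hρ hr, mul_zero, zero_mul]
      exact mul_nonneg (by positivity) (mul_nonneg (norm_nonneg _) (h.m_nonneg z))
    · have h1 := hG1 z (norm_pos_iff.1 (hρ.trans hr))
      have h2 : lightWeight w ρ R (z.1, ‖z.2‖) ≤ C :=
        (mul_le_of_le_one_right (hw.cut_nonneg hρ R _) (radialCutoff.le_one _ _)).trans
          ((le_abs_self _).trans (hC _))
      calc _ ≤ C * m z := mul_le_mul h2 h1 (hG0 z) hC0
        _ = C / ρ * (ρ * m z) := by field_simp
        _ ≤ _ := mul_le_mul_of_nonneg_left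
          (mul_le_mul_of_nonneg_right hr.le (h.m_nonneg z)) (by positivity)

theorem integrable_deriv_cutoff_mul {ν : Measure (ℝ × E3)} {F : ℝ × E3 → ℝ} (hρ : 0 < ρ)
    (hF : Integrable F ν) :
    Integrable (fun z : ℝ × E3 => deriv (radialCutoff ρ) ‖z.2‖ * F z) ν := by
  obtain ⟨C, hC⟩ := radialCutoff.norm_deriv_le hρ
  exact hF.bdd_mul ((radialCutoff.continuous_deriv ρ).comp
    (by fun_prop : Continuous fun z : ℝ × E3 => ‖z.2‖)).aestronglyMeasurable
    (ae_of_all _ fun z => hC _)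

/-- The weighted energy inequality, away from the axis. -/
theorem lightWeight_integral_le (h : InwardFlow e f m) (hw : SmoothWeight γ w) (hγ : 0 ≤ γ)
    (hρ : 0 < ρ) (hρ1 : 2 * ρ ≤ 1) (hT : 0 ≤ T) (hR : T + 1 ≤ R)
    (hGm : AEStronglyMeasurable G volume) (hG0 : ∀ z, 0 ≤ G z)
    (hG : ∀ z : ℝ × E3, z.2 ≠ 0 → G z + γ * ((e z - f z) / ‖z.2‖) ≤ m z) {c : ℝ → ℝ}
    (hcm : Measurable c) (hc0 : ∀ t, 0 ≤ c t) {B : ℝ} (hcB : ∀ t, c t ≤ B)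
    (hc : ∀ t ∈ Ioc 0 T, ∀ r, 0 < r → c t ≤ w (t + r)) :
    (∫ z, c z.1 * deriv (radialCutoff ρ) ‖z.2‖ * f z ∂(slab 0 T).prod (volume : Measure E3)) -
        w (T + 1) / 2 * (∫ z, deriv (radialCutoff ρ) ‖z.2‖ * (‖z.2‖ * m z)
          ∂(slab 0 T).prod (volume : Measure E3)) +
        ∫ z, lightWeight w ρ R (z.1, ‖z.2‖) * G z ∂(slab 0 T).prod (volume : Measure E3) ≤
      ∫ x, lightWeight w ρ R (0, ‖x‖) * e (0, x) := by
  have hg : ContDiff ℝ ∞ (lightWeight w ρ R) :=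
    ((hw.cut_contDiff hρ R).comp (contDiff_fst.add contDiff_snd)).mul
      ((radialCutoff.contDiff ρ).comp contDiff_snd)
  have hG1 : ∀ z : ℝ × E3, z.2 ≠ 0 → G z ≤ m z := fun z hz => by
    have h1 : 0 ≤ (e z - f z) / ‖z.2‖ :=
      div_nonneg (sub_nonneg.2 ((le_abs_self _).trans (h.abs_f_le z))) (norm_nonneg _)
    have := mul_nonneg hγ h1
    linarith [hG z hz]
  -- With times down to -2 allowed, r > R + 3 guarantees t + r > R + 1, where the weight vanishes.
  obtain ⟨hi, heq⟩ := h.balance_weight hg hT hρ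
    (fun q hq => by rw [lightWeight, radialCutoff.eq_zero hρ hq.le, mul_zero]) (R := R + 3)
    (fun q hq1 hq2 => by
      rw [lightWeight, SmoothWeight.cut_eq_zero_of_ge w ρ (by linarith), zero_mul])
  rw [IntegrableOn, ← slab_prod] at hi
  rw [← slab_prod] at heq
  have h1 : Integrable (fun z : ℝ × E3 => c z.1 * deriv (radialCutoff ρ) ‖z.2‖ * f z)
      ((slab 0 T).prod volume) := by
    refine ((integrable_deriv_cutoff_mul hρ (h.integrable_f 0 T)).bdd_mul
      (hcm.comp measurable_fst).aestronglyMeasurable (c := B)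
      (ae_of_all _ fun z => ?_)).congr (ae_of_all _ fun z => ?_)
    · rw [Function.comp_apply, Real.norm_of_nonneg (hc0 _)]; exact hcB _
    · simp only [Function.comp_apply]; ring
  have h2 := integrable_deriv_cutoff_mul hρ (h.integrable_norm_mul_m 0 T)
  have h3 := h.integrable_lightWeight_mul hw hρ R hGm hG0 hG1 0 T
  -- The energy at the final time is nonnegative and is discarded.
  have h4 : 0 ≤ ∫ x, lightWeight w ρ R (T, ‖x‖) * e (T, x) := integral_nonneg fun x =>
    mul_nonneg (mul_nonneg (hw.cut_nonneg hρ R _) (radialCutoff.nonneg _ _)) (h.e_nonneg _)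
  rw [← integral_const_mul, ← integral_sub h1 (h2.const_mul _),
    ← integral_add (by exact h1.sub (h2.const_mul _)) h3]
  have hT' : ∀ᵐ z ∂(slab 0 T).prod (volume : Measure E3), z.1 ∈ Ioc 0 T := by
    rw [slab_prod]
    filter_upwards [ae_restrict_mem (measurableSet_Ioc.prod .univ)] with z hz using hz.1
  have h5 := integral_mono_ae ((h1.sub (h2.const_mul (w (T + 1) / 2))).add h3) hi
    (hT'.mono fun z hz => h.lightWeight_pointwise hw hρ hρ1 hR hG hc0 hc hz)
  rw [heq] at h5
  refine le_trans (le_of_eq ?_) (h5.trans (by linarith))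
  rfl

end InwardFlow

/-! ### Lower sums on the axis and the limit ρ → 0. -/

/-- The lower step function of a weight for a partition. -/
def lowerStep (w : ℝ → ℝ) (t : ℕ → ℝ) (n : ℕ) (s : ℝ) : ℝ :=
  ∑ k ∈ Finset.range n, (Ioc (t k) (t (k + 1))).indicator (fun _ => w (t k)) s

/-- The half-open intervals are disjoint, so at most one term of the sum is active. -/
theorem lowerStep_eq (w : ℝ → ℝ) {t : ℕ → ℝ} (ht : Monotone t) (n : ℕ) (s : ℝ) :
    lowerStep w t n s = 0 ∨ ∃ k < n, t k < s ∧ lowerStep w t n s = w (t k) := by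
  by_cases h : ∃ k < n, s ∈ Ioc (t k) (t (k + 1))
  · obtain ⟨k, hk, hs⟩ := h
    refine Or.inr ⟨k, hk, hs.1, ?_⟩
    rw [lowerStep, Finset.sum_eq_single k, indicator_of_mem hs]
    · intro l _ hlk
      refine indicator_of_notMem (fun hl => ?_) _
      rcases lt_or_gt_of_ne hlk with h1 | h1
      · exact absurd (hl.2.trans (ht (Nat.succ_le_of_lt h1))) (not_le.2 hs.1)
      · exact absurd (hs.2.trans (ht (Nat.succ_le_of_lt h1))) (not_le.2 hl.1)
    · exact fun h => absurd (Finset.mem_range.2 hk) h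
  · push Not at h
    exact Or.inl (Finset.sum_eq_zero fun k hk => indicator_of_notMem (h k (Finset.mem_range.1 hk)) _)

theorem measurable_lowerStep (w : ℝ → ℝ) (t : ℕ → ℝ) (n : ℕ) : Measurable (lowerStep w t n) :=
  Finset.measurable_fun_sum _ fun _ _ => measurable_const.indicator measurableSet_Ioc

/-- A region of space-time away from the axis. -/
def tubeRegion (T ρ R : ℝ) : Set (ℝ × E3) :=
  {z | z.1 ∈ Ioc 0 T ∧ ρ ≤ ‖z.2‖ ∧ z.1 + ‖z.2‖ ≤ R}

theorem measurableSet_tubeRegion (T ρ R : ℝ) : MeasurableSet (tubeRegion T ρ R) :=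
  (measurableSet_Ioc.preimage measurable_fst).inter
    ((measurableSet_le measurable_const (measurable_norm.comp measurable_snd)).inter
      (measurableSet_le (measurable_fst.add (measurable_norm.comp measurable_snd))
        measurable_const))

namespace InwardFlow

variable {e f m G : ℝ × E3 → ℝ} {γ : ℝ} {w : ℝ → ℝ} {R T : ℝ}

theorem integral_lowerStep_mul (h : InwardFlow e f m) {t : ℕ → ℝ} (ht : Monotone t) (ht0 : 0 < t 0)
    (n : ℕ) {ρ : ℝ} (hρ : 0 < ρ) (w : ℝ → ℝ) :
    ∫ z, lowerStep w t n z.1 * deriv (radialCutoff ρ) ‖z.2‖ * f z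
        ∂(slab 0 (t n)).prod (volume : Measure E3) =
      ∑ k ∈ Finset.range n, w (t k) *
        ∫ r in Ioi 0, deriv (radialCutoff ρ) r * shell (slab (t k) (t (k + 1))) f r := by
  have hi : ∀ a b, Integrable (fun z : ℝ × E3 => deriv (radialCutoff ρ) ‖z.2‖ * f z)
      ((slab a b).prod volume) := fun a b => integrable_deriv_cutoff_mul hρ (h.integrable_f a b)
  have h1 : ∀ k, ∀ z : ℝ × E3, (Ioc (t k) (t (k + 1))).indicator (fun _ => w (t k)) z.1 *
      deriv (radialCutoff ρ) ‖z.2‖ * f z = (Ioc (t k) (t (k + 1)) ×ˢ univ).indicator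
        (fun z : ℝ × E3 => w (t k) * (deriv (radialCutoff ρ) ‖z.2‖ * f z)) z := by
    intro k z
    by_cases hz : z.1 ∈ Ioc (t k) (t (k + 1))
    · rw [indicator_of_mem hz, indicator_of_mem (show z ∈ _ ×ˢ _ from ⟨hz, mem_univ _⟩), mul_assoc]
    · rw [indicator_of_notMem hz, indicator_of_notMem (fun hc => hz hc.1), zero_mul, zero_mul]
  simp only [lowerStep, Finset.sum_mul, h1]
  have hm : ∀ k, MeasurableSet (Ioc (t k) (t (k + 1)) ×ˢ (univ : Set E3)) := fun k =>
    measurableSet_Ioc.prod .univ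
  rw [integral_finsetSum _ fun k _ => ((hi 0 (t n)).const_mul _).indicator (hm k)]
  refine Finset.sum_congr rfl fun k hk => ?_
  have hsub : Ioc (t k) (t (k + 1)) ⊆ Ioc 0 (t n) := Ioc_subset_Ioc
    (ht0.le.trans (ht (Nat.zero_le k))) (ht (Nat.succ_le_of_lt (Finset.mem_range.1 hk)))
  rw [integral_indicator (hm k), slab_prod, Measure.restrict_restrict (hm k),
    inter_eq_self_of_subset_left (prod_mono hsub Subset.rfl), ← slab_prod, integral_const_mul,
    ← integral_shell (hi _ _)]
  congr 1
  exact setIntegral_congr_fun measurableSet_Ioi fun r hr => shell_mul _ _ hr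

theorem lintegral_tubeRegion_le (h : InwardFlow e f m) (hw : SmoothWeight γ w) {ρ ρ₀ : ℝ}
    (hρ : 0 < ρ) (hρ₀ : 2 * ρ ≤ ρ₀) (hGm : AEStronglyMeasurable G volume) (hG0 : ∀ z, 0 ≤ G z)
    (hG1 : ∀ z : ℝ × E3, z.2 ≠ 0 → G z ≤ m z) (T R : ℝ) :
    ∫⁻ z in tubeRegion T ρ₀ R, ENNReal.ofReal (w (z.1 + ‖z.2‖) * G z) ≤
      ENNReal.ofReal (∫ z, lightWeight w ρ R (z.1, ‖z.2‖) * G z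
        ∂(slab 0 T).prod (volume : Measure E3)) := by
  rw [ofReal_integral_eq_lintegral_ofReal (h.integrable_lightWeight_mul hw hρ R hGm hG0 hG1 0 T)
    (ae_of_all _ fun z => mul_nonneg (mul_nonneg (hw.cut_nonneg hρ R _)
      (radialCutoff.nonneg _ _)) (hG0 z)), slab_prod]
  have hsub : tubeRegion T ρ₀ R ⊆ Ioc 0 T ×ˢ univ := fun z hz => ⟨hz.1, mem_univ _⟩
  refine le_trans ?_ (lintegral_mono_set hsub)
  refine setLIntegral_mono' (measurableSet_tubeRegion _ _ _) fun z hz => ?_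
  have h1 : ρ ≤ z.1 + ‖z.2‖ := by linarith [hz.1.1, hz.2.1]
  rw [lightWeight]
  simp only
  rw [SmoothWeight.cut_eq_self w hρ h1 hz.2.2, radialCutoff.eq_one hρ (hρ₀.trans hz.2.1), mul_one]

theorem lintegral_initial_le (h : InwardFlow e f m) (hw : SmoothWeight γ w) {ρ : ℝ}
    (hρ : 0 < ρ) (R : ℝ) : ENNReal.ofReal (∫ x, lightWeight w ρ R (0, ‖x‖) * e (0, x)) ≤
      ∫⁻ x, ENNReal.ofReal (w ‖x‖ * e (0, x)) := by
  have hn : ∀ x : E3, 0 ≤ lightWeight w ρ R (0, ‖x‖) * e (0, x) := fun x =>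
    mul_nonneg (mul_nonneg (hw.cut_nonneg hρ R _) (radialCutoff.nonneg _ _)) (h.e_nonneg _)
  by_cases hi : Integrable fun x => lightWeight w ρ R (0, ‖x‖) * e (0, x)
  · rw [ofReal_integral_eq_lintegral_ofReal hi (ae_of_all _ hn)]
    refine lintegral_mono_ae ?_
    have : ∀ᵐ x : E3, x ≠ 0 := by simp [ae_iff]
    filter_upwards [this] with x hx
    refine ENNReal.ofReal_le_ofReal (mul_le_mul_of_nonneg_right ?_ (h.e_nonneg _))
    rw [lightWeight]
    simp only [zero_add]
    exact (mul_le_of_le_one_right (hw.cut_nonneg hρ R _) (radialCutoff.le_one _ _)).trans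
      (hw.cut_le (norm_pos_iff.2 hx) ρ R)
  -- A non-integrable integrand has Bochner integral 0, and the bound is trivial.
  · rw [integral_undef hi, ENNReal.ofReal_zero]
    exact zero_le

/-- The weighted inequality for a smooth weight, with a lower sum on the axis. -/
theorem lowerSum_add_lintegral_le (h : InwardFlow e f m) (hw : SmoothWeight γ w) (hγ : 0 ≤ γ)
    (hGm : AEStronglyMeasurable G volume) (hG0 : ∀ z, 0 ≤ G z)
    (hG : ∀ z : ℝ × E3, z.2 ≠ 0 → G z + γ * ((e z - f z) / ‖z.2‖) ≤ m z)
    {μ : Measure ℝ} [IsFiniteMeasure μ]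
    (hμ : ∀ a b, a ≤ b → Tendsto (shell (slab a b) f) (𝓝[>] 0 ⊓ ae volume)
      (𝓝 (Real.pi * (μ (Icc a b)).toReal)))
    {t : ℕ → ℝ} (ht : Monotone t) (ht0 : 0 < t 0) (n : ℕ) (hR : t n + 1 ≤ R) {ρ₀ : ℝ}
    (hρ₀ : 0 < ρ₀) :
    ENNReal.ofReal Real.pi *
        ∑ k ∈ Finset.range n, ENNReal.ofReal (w (t k)) * μ (Icc (t k) (t (k + 1))) +
        ∫⁻ z in tubeRegion (t n) ρ₀ R, ENNReal.ofReal (w (z.1 + ‖z.2‖) * G z) ≤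
      ∫⁻ x, ENNReal.ofReal (w ‖x‖ * e (0, x)) := by
  have htp : ∀ k, 0 < t k := fun k => ht0.trans_le (ht (Nat.zero_le k))
  have hG1 : ∀ z : ℝ × E3, z.2 ≠ 0 → G z ≤ m z := fun z hz => by
    have h1 : 0 ≤ (e z - f z) / ‖z.2‖ :=
      div_nonneg (sub_nonneg.2 ((le_abs_self _).trans (h.abs_f_le z))) (norm_nonneg _)
    have := mul_nonneg hγ h1
    linarith [hG z hz]
  set K := ∫⁻ x, ENNReal.ofReal (w ‖x‖ * e (0, x)) with hK
  set Y := ∫⁻ z in tubeRegion (t n) ρ₀ R, ENNReal.ofReal (w (z.1 + ‖z.2‖) * G z) with hY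
  rcases eq_or_ne K ⊤ with hKt | hKt
  · rw [hKt]; exact le_top
  have hYt : Y ≠ ⊤ := ne_top_of_le_ne_top ENNReal.ofReal_ne_top
    (h.lintegral_tubeRegion_le hw (half_pos hρ₀) (by linarith) hGm hG0 hG1 (t n) R)
  set S := ∑ k ∈ Finset.range n, w (t k) * (Real.pi * (μ (Icc (t k) (t (k + 1)))).toReal) with hS
  have hstep : ∀ s, 0 ≤ lowerStep w t n s ∧ lowerStep w t n s ≤ w (t n) ∧
      (0 < s → lowerStep w t n s ≤ w s) := fun s => by
    rcases lowerStep_eq w ht n s with h0 | ⟨k, hk, hks, h0⟩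
    · rw [h0]; exact ⟨le_rfl, hw.nonneg _ (htp n), fun hs => hw.nonneg s hs⟩
    · rw [h0]
      exact ⟨hw.nonneg _ (htp k), hw.monotoneOn (htp k) (htp n) (ht hk.le),
        fun hs => hw.monotoneOn (htp k) hs hks.le⟩
  -- As ρ → 0 the cutoff derivative picks out the axis flux on each interval of the partition, and
  -- the correction weighted by r M(r) disappears.
  have hlim : Tendsto (fun ρ => (∑ k ∈ Finset.range n, w (t k) *
        ∫ r in Ioi 0, deriv (radialCutoff ρ) r * shell (slab (t k) (t (k + 1))) f r) -
        w (t n + 1) / 2 * (∫ r in Ioi 0, deriv (radialCutoff ρ) r *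
          (r * shell (slab 0 (t n)) m r)) + Y.toReal) (𝓝[>] 0)
      (𝓝 (S - w (t n + 1) / 2 * 0 + Y.toReal)) := by
    refine ((tendsto_finsetSum _ fun k _ => ?_).sub (Tendsto.const_mul _ ?_)).add_const _
    · exact (radialCutoff.tendsto_integral_deriv_mul (integrableOn_shell (h.integrable_f _ _))
        (hμ _ _ (ht (Nat.le_succ k)))).const_mul _
    · exact radialCutoff.tendsto_integral_mul_deriv_mul (shell_nonneg h.m_nonneg)
        (h.isAxisFlux_axisFlux (htp n).le).integrableOn_m
  rw [mul_zero, sub_zero] at hlim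
  have hle : S + Y.toReal ≤ K.toReal := by
    refine le_of_tendsto hlim ?_
    filter_upwards [Ioc_mem_nhdsGT (show (0 : ℝ) < 1 / 2 by norm_num),
      Ioc_mem_nhdsGT (half_pos hρ₀)] with ρ hρ hρ'
    have h1 := h.lightWeight_integral_le hw hγ hρ.1 (by linarith [hρ.2]) (htp n).le hR hGm hG0 hG
      (measurable_lowerStep w t n) (fun s => (hstep s).1) (fun s => (hstep s).2.1)
      (fun s hs r hr => (hstep s).2.2 hs.1 |>.trans
        (hw.monotoneOn hs.1 (show (0 : ℝ) < s + r by linarith [hs.1]) (by linarith)))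
    rw [h.integral_lowerStep_mul ht ht0 n hρ.1 w, ← integral_shell
      (integrable_deriv_cutoff_mul hρ.1 (h.integrable_norm_mul_m 0 (t n)))] at h1
    have h2 : ∫ r in Ioi 0, shell (slab 0 (t n))
        (fun z => deriv (radialCutoff ρ) ‖z.2‖ * (‖z.2‖ * m z)) r =
        ∫ r in Ioi 0, deriv (radialCutoff ρ) r * (r * shell (slab 0 (t n)) m r) :=
      setIntegral_congr_fun measurableSet_Ioi fun r hr => by
        rw [shell_mul _ _ hr, shell_mul (fun r => r) _ hr]
    rw [h2] at h1
    have h3 : Y.toReal ≤ ∫ z, lightWeight w ρ R (z.1, ‖z.2‖) * G z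
        ∂(slab 0 (t n)).prod (volume : Measure E3) := ENNReal.toReal_le_of_le_ofReal
      (integral_nonneg fun z => mul_nonneg (mul_nonneg (hw.cut_nonneg hρ.1 R _)
        (radialCutoff.nonneg _ _)) (hG0 z))
      (h.lintegral_tubeRegion_le hw hρ.1 (show 2 * ρ ≤ ρ₀ by linarith [hρ'.2]) hGm hG0
        hG1 (t n) R)
    have h4 := (ENNReal.ofReal_le_iff_le_toReal hKt).1 (h.lintegral_initial_le hw hρ.1 R)
    linarith
  have hS' : ENNReal.ofReal S = ENNReal.ofReal Real.pi *
      ∑ k ∈ Finset.range n, ENNReal.ofReal (w (t k)) * μ (Icc (t k) (t (k + 1))) := by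
    rw [hS, ENNReal.ofReal_sum_of_nonneg fun k _ => mul_nonneg (hw.nonneg _ (htp k))
      (mul_nonneg Real.pi_pos.le ENNReal.toReal_nonneg), Finset.mul_sum]
    refine Finset.sum_congr rfl fun k _ => ?_
    rw [ENNReal.ofReal_mul (hw.nonneg _ (htp k)), ENNReal.ofReal_mul Real.pi_pos.le,
      ENNReal.ofReal_toReal (measure_ne_top μ _)]
    ring
  have hS0 : 0 ≤ S := Finset.sum_nonneg fun k _ => mul_nonneg (hw.nonneg _ (htp k))
    (mul_nonneg Real.pi_pos.le ENNReal.toReal_nonneg)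
  rw [← hS', ← ENNReal.ofReal_toReal hYt, ← ENNReal.ofReal_add hS0 ENNReal.toReal_nonneg]
  exact (ENNReal.ofReal_le_iff_le_toReal hKt).2 hle

end InwardFlow

/-! ### Weights of power growth and their smooth approximation. -/

/-- An increasing weight on `(0, ∞)` that grows at most like the power `s ^ γ`. -/
structure PowerWeight (γ : ℝ) (a : ℝ → ℝ) : Prop where
  continuousOn : ContinuousOn a (Ioi 0)
  nonneg : ∀ s, 0 < s → 0 ≤ a s
  monotoneOn : MonotoneOn a (Ioi 0)
  le_rpow_mul : ∀ s, 0 < s → ∀ c, 1 ≤ c → a (c * s) ≤ c ^ γ * a s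

/-- Almost everywhere (r^(-γ) a)' = r^(-γ)(a' - γa/r) ≤ 0, and absolute continuity makes r^(-γ) a
nonincreasing, which is the scaling bound. -/
theorem PowerWeight.of_deriv_le {γ : ℝ} {a : ℝ → ℝ} (ha_cont : ContinuousOn a (Ici 0))
    (ha_ac : ∀ R : ℝ, 0 < R → AbsolutelyContinuousOnInterval a 0 R)
    (ha_deriv : ∀ᵐ r ∂(volume.restrict (Ioi (0 : ℝ))), 0 ≤ deriv a r ∧ deriv a r ≤ γ * a r / r)
    (hγ : 0 < γ) : PowerWeight γ a := by
  have hac : ∀ {x y : ℝ}, 0 < x → x ≤ y → AbsolutelyContinuousOnInterval a x y := fun hx hxy =>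
    (ha_ac _ (hx.trans_le hxy)).mono (by
      rw [uIcc_of_le hxy, uIcc_of_le (hx.le.trans hxy)]; exact Icc_subset_Icc_left hx.le)
  have hd := (ae_restrict_iff' measurableSet_Ioi).1 ha_deriv
  have hmono : MonotoneOn a (Ioi 0) := by
    intro x hx y hy hxy
    have h1 := (hac hx hxy).integral_deriv_eq_sub
    have h2 : 0 ≤ ∫ s in x..y, deriv a s := by
      refine intervalIntegral.integral_nonneg_of_ae_restrict hxy ?_
      refine (ae_restrict_iff' measurableSet_Icc).2 ?_
      filter_upwards [hd] with s hs hsm using (hs (lt_of_lt_of_le hx hsm.1)).1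
    linarith
  have hnn : ∀ s, 0 < s → 0 ≤ a s := by
    intro s hs
    -- No sign of `a` is assumed. At almost every r the hypothesis gives 0 ≤ γa(r)/r, and
    -- monotonicity carries this to every larger point.
    have h1 : ∃ᵐ r, r ∈ Ioo 0 s := frequently_ae_mem_iff.2 (by simpa using hs)
    obtain ⟨r, hr, hr'⟩ := (h1.and_eventually hd).exists
    have h2 := hr' hr.1
    have h3 : 0 ≤ γ * a r := by
      have h4 := mul_nonneg (h2.1.trans h2.2) (le_of_lt hr.1)
      rwa [div_mul_cancel₀ _ (ne_of_gt hr.1)] at h4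
    exact (nonneg_of_mul_nonneg_right h3 hγ).trans (hmono hr.1 hs hr.2.le)
  refine ⟨ha_cont.mono Ioi_subset_Ici_self, hnn, hmono, fun s hs c hc => ?_⟩
  have hle : s ≤ c * s := le_mul_of_one_le_left hs.le hc
  have hg : AbsolutelyContinuousOnInterval (fun r : ℝ => r ^ (-γ)) s (c * s) := by
    refine ContDiffOn.absolutelyContinuousOnInterval fun r hr => ?_
    rw [uIcc_of_le hle] at hr
    exact (Real.contDiffAt_rpow_const_of_ne (hs.trans_le hr.1).ne').contDiffWithinAt
  have h1 := (hac hs hle).integral_deriv_mul_eq_sub hg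
  have h2 : ∫ r in s..(c * s), (deriv a r * r ^ (-γ) + a r * deriv (fun r : ℝ => r ^ (-γ)) r) ≤ 0 := by
    rw [← neg_nonneg, ← intervalIntegral.integral_neg]
    refine intervalIntegral.integral_nonneg_of_ae_restrict hle ?_
    refine (ae_restrict_iff' measurableSet_Icc).2 ?_
    filter_upwards [hd] with r hr hrm
    have hr0 : 0 < r := lt_of_lt_of_le hs hrm.1
    have h3 := (hr hr0).2
    have h4 : deriv (fun r : ℝ => r ^ (-γ)) r = -γ * r ^ (-γ - 1) :=
      (Real.hasDerivAt_rpow_const (Or.inl hr0.ne')).deriv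
    have h5 : r ^ (-γ - 1) = r ^ (-γ) / r := by rw [Real.rpow_sub_one hr0.ne']
    have h6 := mul_le_mul_of_nonneg_right h3 (Real.rpow_nonneg hr0.le (-γ))
    have h7 : a r * (-γ * (r ^ (-γ) / r)) = -(γ * a r / r * r ^ (-γ)) := by ring
    simp only [Pi.zero_apply]
    rw [h4, h5, h7]
    linarith
  rw [h1, Real.mul_rpow (by linarith) hs.le, Real.rpow_neg (by linarith : 0 ≤ c)] at h2
  have hsp : 0 < s ^ (-γ) := Real.rpow_pos_of_pos hs _
  have hcp : 0 < c ^ γ := Real.rpow_pos_of_pos (by linarith) _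
  have h8 : a (c * s) * (c ^ γ)⁻¹ * s ^ (-γ) ≤ a s * s ^ (-γ) := by linarith
  have h9 := le_of_mul_le_mul_right h8 hsp
  rw [← div_eq_mul_inv, div_le_iff₀ hcp] at h9
  exact h9.trans_eq (mul_comm _ _)

theorem integrable_bumpMeasure (n : ℕ) {A : ℝ → ℝ} (hA : Continuous A) (y : ℝ) :
    Integrable (fun z => A (y - z)) (bumpMeasure ℝ n) := by
  obtain ⟨C, hC⟩ := (isCompact_closedBall y 1).exists_bound_of_continuousOn hA.continuousOn
  refine Integrable.of_bound (by fun_prop : Continuous fun z => A (y - z)).aestronglyMeasurable C ?_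
  filter_upwards [bumpMeasure_ae_mem_ball (E := ℝ) n] with z hz
  refine hC _ ?_
  rw [mem_closedBall_iff_norm, sub_sub_cancel_left, norm_neg]
  rw [mem_ball_zero_iff] at hz
  exact hz.le.trans (stdBump_rOut_le_one n)

/-- A power weight is comparable to a smooth weight. -/
theorem PowerWeight.exists_smoothWeight {γ : ℝ} {a : ℝ → ℝ} (ha : PowerWeight γ a) {c : ℝ}
    (hc : 1 < c) : ∃ w, SmoothWeight γ w ∧ ∀ s, 0 < s → a s ≤ c ^ γ * w s ∧ w s ≤ c ^ γ * a s := by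
  -- In the variable log s scaling becomes translation, and monotonicity together with A(y+h) ≤
  -- e^(γh) A(y) is preserved by averaging translates.
  set A : ℝ → ℝ := fun y => a (Real.exp y) with hA
  have hAc : Continuous A :=
    ha.continuousOn.comp_continuous Real.continuous_exp fun y => Real.exp_pos y
  have hAm : Monotone A := fun x y hxy =>
    ha.monotoneOn (Real.exp_pos x) (Real.exp_pos y) (Real.exp_le_exp.2 hxy)
  have hAe : ∀ y h, 0 ≤ h → A (y + h) ≤ Real.exp (γ * h) * A y := fun y h hh => by
    have := ha.le_rpow_mul _ (Real.exp_pos y) _ (Real.one_le_exp hh)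
    rwa [← Real.exp_add, add_comm h y, ← Real.exp_mul, mul_comm h γ] at this
  obtain ⟨n, hn⟩ := (stdBump_tendsto (E := ℝ).eventually (gt_mem_nhds (Real.log_pos hc))).exists
  set δ := Real.log c with hδ
  have hcγ : c ^ γ = Real.exp (γ * δ) := by
    rw [Real.rpow_def_of_pos (by linarith), mul_comm]
  set W := mollify n A with hW
  have hWi : ∀ y, W y = ∫ z, A (y - z) ∂bumpMeasure ℝ n := mollify_eq_integral n A
  have hWs : ContDiff ℝ ∞ W := mollify_contDiff n hAc.locallyIntegrable
  have hint := integrable_bumpMeasure n hAc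
  have hWm : Monotone W := fun x y hxy => by
    rw [hWi, hWi]
    exact integral_mono (hint x) (hint y) fun z => hAm (by linarith)
  have hWe : ∀ y h, 0 ≤ h → W (y + h) ≤ Real.exp (γ * h) * W y := fun y h hh => by
    rw [hWi, hWi, ← integral_const_mul]
    refine integral_mono (hint _) ((hint y).const_mul _) fun z => ?_
    have := hAe (y - z) h hh
    rwa [sub_add_eq_add_sub] at this
  have hW0 : ∀ y, 0 ≤ W y := fun y => by
    rw [hWi]; exact integral_nonneg fun z => ha.nonneg _ (Real.exp_pos _)
  -- The growth bound says that e^(-γy)W is nonincreasing; differentiate.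
  have hWd : ∀ y, deriv W y ≤ γ * W y := fun y => by
    have hanti : Antitone fun y => Real.exp (-γ * y) * W y := fun x y hxy => by
      have h1 := hWe x (y - x) (by linarith)
      rw [add_sub_cancel] at h1
      calc Real.exp (-γ * y) * W y ≤ Real.exp (-γ * y) * (Real.exp (γ * (y - x)) * W x) :=
            mul_le_mul_of_nonneg_left h1 (Real.exp_pos _).le
        _ = Real.exp (-γ * x) * W x := by
            rw [← mul_assoc, ← Real.exp_add]; congr 2; ring
    have h1 : HasDerivAt (fun y => Real.exp (-γ * y)) (Real.exp (-γ * y) * (-γ)) y := by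
      simpa using ((hasDerivAt_id y).const_mul (-γ)).exp
    have h2 : HasDerivAt W (deriv W y) y :=
      ((hWs.differentiable (by simp)).differentiableAt).hasDerivAt
    have h3 : deriv (fun y => Real.exp (-γ * y) * W y) y ≤ 0 := hanti.deriv_nonpos
    rw [(h1.fun_mul h2).deriv] at h3
    have h4 : Real.exp (-γ * y) * (deriv W y - γ * W y) ≤ 0 := by linarith
    have h5 := nonpos_of_mul_nonpos_right h4 (Real.exp_pos _)
    linarith
  have hball : ∀ᵐ z ∂bumpMeasure ℝ n, |z| < δ := by
    filter_upwards [bumpMeasure_ae_mem_ball (E := ℝ) n] with z hz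
    rw [mem_ball_zero_iff] at hz
    exact hz.trans hn
  have hδ0 : 0 < δ := Real.log_pos hc
  have hup : ∀ y, W y ≤ c ^ γ * A y := fun y => by
    have h1 : W y ≤ ∫ _z, A (y + δ) ∂bumpMeasure ℝ n := by
      rw [hWi]
      refine integral_mono_ae (hint y) (integrable_const _) ?_
      filter_upwards [hball] with z hz
      exact hAm (by linarith [(abs_lt.1 hz).1])
    rw [integral_const, probReal_univ, one_smul] at h1
    rw [hcγ]
    exact h1.trans (hAe y δ hδ0.le)
  have hlow : ∀ y, A y ≤ c ^ γ * W y := fun y => by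
    have h1 : ∫ _z, A (y - δ) ∂bumpMeasure ℝ n ≤ W y := by
      rw [hWi]
      refine integral_mono_ae (integrable_const _) (hint y) ?_
      filter_upwards [hball] with z hz
      exact hAm (by linarith [(abs_lt.1 hz).2])
    rw [integral_const, probReal_univ, one_smul] at h1
    rw [hcγ]
    have h2 := hAe (y - δ) δ hδ0.le
    rw [sub_add_cancel] at h2
    exact h2.trans (mul_le_mul_of_nonneg_left h1 (Real.exp_pos _).le)
  have hwd : ∀ s, 0 < s → HasDerivAt (fun s => W (Real.log s)) (deriv W (Real.log s) * s⁻¹) s :=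
    fun s hs => HasDerivAt.comp s
      (((hWs.differentiable (by simp)).differentiableAt (x := Real.log s)).hasDerivAt)
      (Real.hasDerivAt_log hs.ne')
  refine ⟨fun s => W (Real.log s), ⟨fun s hs => ?_, fun s _ => hW0 _, fun s hs => ?_, fun s hs => ?_⟩,
    fun s hs => ?_⟩
  · exact hWs.contDiffAt.comp s (Real.contDiffAt_log.2 hs.ne')
  · rw [(hwd s hs).deriv]
    exact mul_nonneg hWm.deriv_nonneg (inv_nonneg.2 hs.le)
  · rw [(hwd s hs).deriv, mul_comm (deriv W _), mul_inv_cancel_left₀ hs.ne']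
    exact hWd _
  · have h1 : A (Real.log s) = a s := by rw [hA]; simp only [Real.exp_log hs]
    rw [← h1]
    exact ⟨hlow _, hup _⟩

/-! ### From smooth weights to the given weight. -/

theorem lintegral_Ioc_le_sum {μ : Measure ℝ} (F : ℝ → ℝ≥0∞) {t : ℕ → ℝ} (ht : Monotone t)
    {C : ℝ≥0∞} {v : ℕ → ℝ≥0∞} (h : ∀ k, ∀ s ∈ Ioc (t k) (t (k + 1)), F s ≤ C * v k) (n : ℕ) :
    ∫⁻ s in Ioc (t 0) (t n), F s ∂μ ≤
      C * ∑ k ∈ Finset.range n, v k * μ (Icc (t k) (t (k + 1))) := by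
  induction n with
  | zero => simp
  | succ n ih =>
    rw [← Ioc_union_Ioc_eq_Ioc (ht (Nat.zero_le n)) (ht (Nat.le_succ n)), Finset.sum_range_succ,
      mul_add]
    refine (lintegral_union_le _ _ _).trans (add_le_add ih ?_)
    calc ∫⁻ s in Ioc (t n) (t (n + 1)), F s ∂μ ≤ ∫⁻ s in Ioc (t n) (t (n + 1)), C * v n ∂μ :=
          setLIntegral_mono' measurableSet_Ioc (h n)
      _ = C * v n * μ (Ioc (t n) (t (n + 1))) := setLIntegral_const _ _
      _ ≤ C * (v n * μ (Icc (t n) (t (n + 1)))) := by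
          rw [mul_assoc]
          gcongr
          exact Ioc_subset_Icc_self

namespace InwardFlow

variable {e f m G : ℝ × E3 → ℝ} {γ : ℝ} {a : ℝ → ℝ}

/-- The weighted inequality on a bounded region, up to a constant factor. -/
theorem lintegral_Ioc_add_lintegral_le (h : InwardFlow e f m) (ha : PowerWeight γ a) (hγ : 0 ≤ γ)
    (hGm : AEStronglyMeasurable G volume) (hG0 : ∀ z, 0 ≤ G z)
    (hG : ∀ z : ℝ × E3, z.2 ≠ 0 → G z + γ * ((e z - f z) / ‖z.2‖) ≤ m z)
    {μ : Measure ℝ} [IsFiniteMeasure μ]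
    (hμ : ∀ a b, a ≤ b → Tendsto (shell (slab a b) f) (𝓝[>] 0 ⊓ ae volume)
      (𝓝 (Real.pi * (μ (Icc a b)).toReal))) {c : ℝ} (hc : 1 < c) (j : ℕ) :
    ENNReal.ofReal Real.pi * ∫⁻ t in Ioc (c ^ j)⁻¹ (c ^ j), ENNReal.ofReal (a t) ∂μ +
        ∫⁻ z in tubeRegion (c ^ j) (c ^ j)⁻¹ (2 * c ^ j),
          ENNReal.ofReal (a (‖z.2‖ + z.1) * G z) ≤
      ENNReal.ofReal ((c ^ γ) ^ 3) * ∫⁻ x, ENNReal.ofReal (a ‖x‖ * e (0, x)) := by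
  obtain ⟨w, hw, hwa⟩ := ha.exists_smoothWeight hc
  have hc0 : 0 < c := by linarith
  set L := c ^ γ with hL
  have hL1 : 1 ≤ L := Real.one_le_rpow hc.le hγ
  have hL0 : 0 ≤ L := by linarith
  have hcj : 1 ≤ c ^ j := one_le_pow₀ hc.le
  -- A geometric partition from c^(-j) to c^j in 2j steps: over one step `a` grows by at most the
  -- factor c^γ.
  set t : ℕ → ℝ := fun k => (c ^ j)⁻¹ * c ^ k with ht
  have htm : Monotone t := fun k l hkl =>
    mul_le_mul_of_nonneg_left (pow_le_pow_right₀ hc.le hkl) (by positivity)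
  have htp : ∀ k, 0 < t k := fun k => by positivity
  have ht0 : t 0 = (c ^ j)⁻¹ := by simp [ht]
  have htn : t (2 * j) = c ^ j := by
    simp only [ht]; rw [two_mul, pow_add, inv_mul_cancel_left₀ (by positivity)]
  have hts : ∀ k, t (k + 1) = c * t k := fun k => by simp only [ht]; ring
  have h1 := h.lowerSum_add_lintegral_le hw hγ hGm hG0 hG hμ htm (htp 0) (2 * j)
    (R := 2 * c ^ j) (by rw [htn]; linarith) (ρ₀ := (c ^ j)⁻¹) (by positivity)
  rw [htn] at h1
  -- One factor L pays for the step of the partition and one for passing from `a` to `w`. The third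
  -- factor of the statement comes from the initial energy in `hC`.
  have hA := lintegral_Ioc_le_sum (μ := μ) (fun s => ENNReal.ofReal (a s)) htm
    (C := ENNReal.ofReal (L ^ 2)) (v := fun k => ENNReal.ofReal (w (t k))) (fun k s hs => by
      rw [← ENNReal.ofReal_mul (by positivity)]
      refine ENNReal.ofReal_le_ofReal ?_
      have hs0 : 0 < s := (htp k).trans hs.1
      have h2 := hs.2
      rw [hts] at h2
      calc a s ≤ a (c * t k) := ha.monotoneOn hs0 (mul_pos hc0 (htp k)) h2
        _ ≤ L * a (t k) := ha.le_rpow_mul _ (htp k) _ hc.le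
        _ ≤ L * (L * w (t k)) := mul_le_mul_of_nonneg_left (hwa _ (htp k)).1 hL0
        _ = L ^ 2 * w (t k) := by ring) (2 * j)
  rw [ht0, htn] at hA
  have hLL : L ≤ L ^ 2 := by nlinarith
  have hB : ∫⁻ z in tubeRegion (c ^ j) (c ^ j)⁻¹ (2 * c ^ j),
      ENNReal.ofReal (a (‖z.2‖ + z.1) * G z) ≤ ENNReal.ofReal (L ^ 2) *
      ∫⁻ z in tubeRegion (c ^ j) (c ^ j)⁻¹ (2 * c ^ j),
        ENNReal.ofReal (w (z.1 + ‖z.2‖) * G z) := by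
    rw [← lintegral_const_mul' _ _ ENNReal.ofReal_ne_top]
    refine setLIntegral_mono' (measurableSet_tubeRegion _ _ _) fun z hz => ?_
    rw [← ENNReal.ofReal_mul (by positivity), ← mul_assoc, add_comm ‖z.2‖]
    have hs0 : 0 < z.1 + ‖z.2‖ := add_pos_of_pos_of_nonneg hz.1.1 (norm_nonneg _)
    refine ENNReal.ofReal_le_ofReal (mul_le_mul_of_nonneg_right ?_ (hG0 z))
    exact (hwa _ hs0).1.trans (mul_le_mul_of_nonneg_right hLL (hw.nonneg _ hs0))
  have hC : ∫⁻ x, ENNReal.ofReal (w ‖x‖ * e (0, x)) ≤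
      ENNReal.ofReal L * ∫⁻ x, ENNReal.ofReal (a ‖x‖ * e (0, x)) := by
    rw [← lintegral_const_mul' _ _ ENNReal.ofReal_ne_top]
    have : ∀ᵐ x : E3, x ≠ 0 := by simp [ae_iff]
    refine lintegral_mono_ae (this.mono fun x hx => ?_)
    rw [← ENNReal.ofReal_mul hL0, ← mul_assoc]
    exact ENNReal.ofReal_le_ofReal
      (mul_le_mul_of_nonneg_right (hwa _ (norm_pos_iff.2 hx)).2 (h.e_nonneg _))
  calc _ ≤ ENNReal.ofReal Real.pi * (ENNReal.ofReal (L ^ 2) *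
          ∑ k ∈ Finset.range (2 * j), ENNReal.ofReal (w (t k)) * μ (Icc (t k) (t (k + 1)))) +
        ENNReal.ofReal (L ^ 2) * ∫⁻ z in tubeRegion (c ^ j) (c ^ j)⁻¹ (2 * c ^ j),
          ENNReal.ofReal (w (z.1 + ‖z.2‖) * G z) := by gcongr
    _ = ENNReal.ofReal (L ^ 2) * (ENNReal.ofReal Real.pi *
          ∑ k ∈ Finset.range (2 * j), ENNReal.ofReal (w (t k)) * μ (Icc (t k) (t (k + 1))) +
        ∫⁻ z in tubeRegion (c ^ j) (c ^ j)⁻¹ (2 * c ^ j),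
          ENNReal.ofReal (w (z.1 + ‖z.2‖) * G z)) := by ring
    _ ≤ ENNReal.ofReal (L ^ 2) * (ENNReal.ofReal L *
        ∫⁻ x, ENNReal.ofReal (a ‖x‖ * e (0, x))) := by
        gcongr
        exact h1.trans hC
    _ = _ := by
        rw [← mul_assoc, ← ENNReal.ofReal_mul (by positivity)]
        congr 2

theorem iUnion_Ioc_pow {c : ℝ} (hc : 1 < c) : ⋃ j : ℕ, Ioc (c ^ j)⁻¹ (c ^ j) = Ioi (0 : ℝ) := by
  ext s
  simp only [mem_iUnion, mem_Ioc, mem_Ioi]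
  refine ⟨fun ⟨j, hj⟩ => lt_of_le_of_lt (by positivity) hj.1, fun hs => ?_⟩
  have h1 := (tendsto_pow_atTop_atTop_of_one_lt hc).eventually (eventually_ge_atTop s)
  have h2 := (tendsto_pow_atTop_atTop_of_one_lt hc).eventually (eventually_gt_atTop s⁻¹)
  obtain ⟨j, hj1, hj2⟩ := (h1.and h2).exists
  exact ⟨j, (inv_lt_comm₀ hs (by positivity)).1 hj2, hj1⟩

theorem iUnion_tubeRegion_pow {c : ℝ} (hc : 1 < c) :
    ⋃ j : ℕ, tubeRegion (c ^ j) (c ^ j)⁻¹ (2 * c ^ j) = Ioi (0 : ℝ) ×ˢ {(0 : E3)}ᶜ := by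
  ext z
  simp only [mem_iUnion, tubeRegion, mem_ofPred_eq, mem_Ioc, mem_prod, mem_Ioi, mem_compl_iff,
    mem_singleton_iff]
  refine ⟨fun ⟨j, hj⟩ => ⟨hj.1.1, fun h0 => ?_⟩, fun ⟨ht, hx⟩ => ?_⟩
  · have h1 := hj.2.1
    rw [h0, norm_zero] at h1
    exact absurd h1 (not_le.2 (by positivity))
  · have hx0 := norm_pos_iff.2 hx
    have ht' := tendsto_pow_atTop_atTop_of_one_lt hc
    obtain ⟨j, ⟨hj1, hj2⟩, hj3⟩ := (((ht'.eventually (eventually_ge_atTop z.1)).and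
      (ht'.eventually (eventually_ge_atTop ‖z.2‖⁻¹))).and
      (ht'.eventually (eventually_ge_atTop ‖z.2‖))).exists
    exact ⟨j, ⟨ht, hj1⟩, (inv_le_comm₀ hx0 (by positivity)).1 hj2, by linarith⟩

/-- The weighted inequality. -/
theorem lintegral_axis_add_lintegral_le (h : InwardFlow e f m) (ha : PowerWeight γ a) (hγ : 0 ≤ γ)
    (hGm : AEStronglyMeasurable G volume) (hG0 : ∀ z, 0 ≤ G z)
    (hG : ∀ z : ℝ × E3, z.2 ≠ 0 → G z + γ * ((e z - f z) / ‖z.2‖) ≤ m z)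
    {μ : Measure ℝ} [IsFiniteMeasure μ] (hμ0 : μ {0} = 0)
    (hμ : ∀ a b, a ≤ b → Tendsto (shell (slab a b) f) (𝓝[>] 0 ⊓ ae volume)
      (𝓝 (Real.pi * (μ (Icc a b)).toReal)))
    (hK : ∫⁻ x, ENNReal.ofReal (a ‖x‖ * e (0, x)) < ⊤) :
    ENNReal.ofReal Real.pi * ∫⁻ t in Ici (0 : ℝ), ENNReal.ofReal (a t) ∂μ +
        ∫⁻ z in Ioi (0 : ℝ) ×ˢ (univ : Set E3), ENNReal.ofReal (a (‖z.2‖ + z.1) * G z) ≤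
      ∫⁻ x, ENNReal.ofReal (a ‖x‖ * e (0, x)) := by
  -- The point 0 carries no mass, so the value of `a` there, of which `PowerWeight` says nothing, is
  -- irrelevant.
  have e1 : ∫⁻ t in Ici (0 : ℝ), ENNReal.ofReal (a t) ∂μ =
      ∫⁻ t in Ioi (0 : ℝ), ENNReal.ofReal (a t) ∂μ := by
    rw [Measure.restrict_congr_set (Ioi_ae_eq_Ici' hμ0)]
  have e2 : ∫⁻ z in Ioi (0 : ℝ) ×ˢ (univ : Set E3), ENNReal.ofReal (a (‖z.2‖ + z.1) * G z) =
      ∫⁻ z in Ioi (0 : ℝ) ×ˢ {(0 : E3)}ᶜ, ENNReal.ofReal (a (‖z.2‖ + z.1) * G z) := by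
    rw [Measure.volume_eq_prod, ← Measure.prod_restrict, ← Measure.prod_restrict,
      Measure.restrict_univ, restrict_compl_singleton]
  rw [e1, e2]
  have hmain : ∀ c : ℝ, 1 < c →
      ENNReal.ofReal Real.pi * ∫⁻ t in Ioi (0 : ℝ), ENNReal.ofReal (a t) ∂μ +
        ∫⁻ z in Ioi (0 : ℝ) ×ˢ {(0 : E3)}ᶜ, ENNReal.ofReal (a (‖z.2‖ + z.1) * G z) ≤
      ENNReal.ofReal ((c ^ γ) ^ 3) * ∫⁻ x, ENNReal.ofReal (a ‖x‖ * e (0, x)) := by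
    intro c hc
    have hpow : ∀ i j : ℕ, i ≤ j → c ^ i ≤ c ^ j := fun i j hij => pow_le_pow_right₀ hc.le hij
    have hinv : ∀ i j : ℕ, i ≤ j → (c ^ j)⁻¹ ≤ (c ^ i)⁻¹ := fun i j hij =>
      inv_anti₀ (pow_pos (by linarith) _) (hpow i j hij)
    have m1 : Monotone fun j : ℕ => Ioc (c ^ j)⁻¹ (c ^ j) := fun i j hij =>
      Ioc_subset_Ioc (hinv i j hij) (hpow i j hij)
    have m2 : Monotone fun j : ℕ => tubeRegion (c ^ j) (c ^ j)⁻¹ (2 * c ^ j) :=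
      fun i j hij z hz => ⟨⟨hz.1.1, hz.1.2.trans (hpow i j hij)⟩, (hinv i j hij).trans hz.2.1,
        hz.2.2.trans (by linarith [hpow i j hij])⟩
    rw [← iUnion_tubeRegion_pow hc, ← iUnion_Ioc_pow hc,
      setLIntegral_iUnion_of_directed _ m1.directed_le,
      setLIntegral_iUnion_of_directed _ m2.directed_le, ENNReal.mul_iSup,
      ENNReal.iSup_add_iSup_of_monotone]
    · exact iSup_le fun j => h.lintegral_Ioc_add_lintegral_le ha hγ hGm hG0 hG hμ hc j
    · exact fun i j hij => mul_le_mul_right (lintegral_mono_set (m1 hij)) _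
    · exact fun i j hij => lintegral_mono_set (m2 hij)
  -- Finiteness of the weighted initial energy lets the constant c^(3γ) tend to 1.
  have hlim : Tendsto (fun c : ℝ => ENNReal.ofReal ((c ^ γ) ^ 3) *
      ∫⁻ x, ENNReal.ofReal (a ‖x‖ * e (0, x))) (𝓝[>] 1)
      (𝓝 (ENNReal.ofReal (((1 : ℝ) ^ γ) ^ 3) * ∫⁻ x, ENNReal.ofReal (a ‖x‖ * e (0, x)))) := by
    refine ENNReal.Tendsto.mul_const (ENNReal.tendsto_ofReal ?_) (Or.inr hK.ne)
    exact (((Real.continuousAt_rpow_const 1 γ (Or.inl one_ne_zero)).tendsto).pow 3).mono_left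
      nhdsWithin_le_nhds
  rw [Real.one_rpow, one_pow, ENNReal.ofReal_one, one_mul] at hlim
  exact ge_of_tendsto hlim (eventually_mem_nhdsWithin.mono fun c hc => hmain c hc)

end InwardFlow

/-! ### Conclusion for energy solutions. -/

/-- The density of the coercive part of the weighted source term. -/
def coerciveSource (p γ : ℝ) (f : E3 → ℝ) (g : E3 → E3) (x : E3) : ℝ :=
  (p - 1 - 2 * γ) / (2 * (p + 1)) * (|f x| ^ (p + 1) / ‖x‖) +
    (1 - γ) / 2 * (‖angularGrad g x‖ ^ 2 / ‖x‖)

theorem coerciveSource_nonneg {p γ : ℝ} (hp : 3 ≤ p) (hγ : γ < 1) (f : E3 → ℝ) (g : E3 → E3)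
    (x : E3) : 0 ≤ coerciveSource p γ f g x := by
  have h1 : 0 < p + 1 := by linarith
  have h2 : 0 ≤ p - 1 - 2 * γ := by linarith
  have h3 : 0 ≤ 1 - γ := by linarith
  have h4 := Real.rpow_nonneg (abs_nonneg (f x)) (p + 1)
  rw [coerciveSource]
  positivity

/-- Since e - f = |∇_ω u|²/2 + |u|^(p+1)/(p+1), subtracting γ(e-f)/|x| from the source leaves
exactly these coefficients. -/
theorem coerciveSource_add {p : ℝ} (γ : ℝ) (hp : 3 ≤ p) (f h : E3 → ℝ) (g : E3 → E3) {x : E3}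
    (hx : x ≠ 0) : coerciveSource p γ f g x + γ * ((inwardEnergyDensity p f h g x -
      inwardFluxDensity p f h g x) / ‖x‖) = inwardSource p f g x := by
  have h1 : p + 1 ≠ 0 := by linarith
  have h2 : ‖x‖ ≠ 0 := norm_ne_zero_iff.2 hx
  rw [coerciveSource, inwardEnergyDensity, inwardFluxDensity, inwardSource]
  field_simp
  ring

namespace IsEnergySolution

variable {p γ : ℝ} {u ut : ℝ → E3 → ℝ} {gradu : ℝ → E3 → E3}

theorem aestronglyMeasurable_coerciveSource (hp : 3 ≤ p) (hu : IsEnergySolution p u ut gradu) :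
    AEStronglyMeasurable (fun z : ℝ × E3 => coerciveSource p γ (u z.1) (gradu z.1) z.2) volume := by
  have h0 : AEStronglyMeasurable (fun z : ℝ × E3 => ‖z.2‖⁻¹) volume :=
    (measurable_inv_norm.comp measurable_snd).aestronglyMeasurable
  have ha := hu.aestronglyMeasurable_angularGrad_prod.norm.pow 2
  refine ((((hu.aestronglyMeasurable_rpow_u hp).mul h0).const_mul
    ((p - 1 - 2 * γ) / (2 * (p + 1)))).add ((ha.mul h0).const_mul ((1 - γ) / 2))).congr ?_
  exact ae_of_all _ fun z => by simp [coerciveSource, div_eq_mul_inv]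

/-- The iterated integral over the open interval and the product integral over the half-open one
agree wherever Fubini applies, that is, for almost every radius. -/
theorem cylinderFlux_eq_shell (hp : 3 ≤ p) (hp5 : p < 5) (hu : IsEnergySolution p u ut gradu)
    (hE : waveEnergy p (u 0) (ut 0) (gradu 0) < ⊤) (a b : ℝ) :
    ∀ᶠ r in 𝓝[>] (0 : ℝ) ⊓ ae volume, cylinderFlux p u ut gradu a b r = shell (slab a b)
      (fun z => inwardFluxDensity p (u z.1) (ut z.1) (gradu z.1) z.2) r := by
  refine eventually_of_ae_Ioi ?_
  filter_upwards [ae_integrable_shell ((hu.inwardFlow hp hp5 hE).integrable_f a b)] with r hr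
  rw [shell, integral_prod _ hr, cylinderFlux, Measure.restrict_congr_set Ioo_ae_eq_Ioc]
  simp only [integral_const_mul]

theorem tendsto_cylinderFlux_iff (hp : 3 ≤ p) (hp5 : p < 5) (hu : IsEnergySolution p u ut gradu)
    (hE : waveEnergy p (u 0) (ut 0) (gradu 0) < ⊤) {a b l : ℝ} :
    Tendsto (fun r => cylinderFlux p u ut gradu a b r) (𝓝[>] (0 : ℝ) ⊓ ae volume) (𝓝 l) ↔
      Tendsto (shell (slab a b) (fun z => inwardFluxDensity p (u z.1) (ut z.1) (gradu z.1) z.2))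
        (𝓝[>] (0 : ℝ) ⊓ ae volume) (𝓝 l) :=
  tendsto_congr' (hu.cylinderFlux_eq_shell hp hp5 hE a b)

end IsEnergySolution

/-- Compact intervals determine a finite measure. The limit describes only nondegenerate ones; on
single points both measures vanish. -/
theorem IsAxisFluxMeasure.unique {p : ℝ} {u ut : ℝ → E3 → ℝ} {gradu : ℝ → E3 → E3} {μ ν : Measure ℝ}
    (hμ : IsAxisFluxMeasure p u ut gradu μ) (hν : IsAxisFluxMeasure p u ut gradu ν) : ν = μ := by
  have := hμ.finite
  have := hν.finite
  refine Measure.ext_of_Icc _ _ fun a b hab => ?_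
  rcases hab.eq_or_lt with rfl | hab
  · rw [Icc_self, hμ.continuous, hν.continuous]
  · have h1 := mul_left_cancel₀ Real.pi_ne_zero
      (tendsto_nhds_unique (hν.tendsto a b hab) (hμ.tendsto a b hab))
    exact (ENNReal.toReal_eq_toReal_iff' (measure_ne_top _ _) (measure_ne_top _ _)).1 h1

end

theorem mainTheorem7 (p γ : ℝ) (hp₃ : 3 ≤ p) (hp₅ : p < 5) (hγ₀ : 0 < γ) (hγ₁ : γ < 1)
    (a : ℝ → ℝ) (ha_cont : ContinuousOn a (Ici 0))
    (ha_ac : ∀ R : ℝ, 0 < R → AbsolutelyContinuousOnInterval a 0 R)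
    (ha_deriv : ∀ᵐ r ∂(volume.restrict (Ioi (0 : ℝ))), 0 ≤ deriv a r ∧ deriv a r ≤ γ * a r / r)
    (u ut : ℝ → E3 → ℝ) (gradu : ℝ → E3 → E3)
    (hu : IsEnergySolution p u ut gradu)
    (hE : waveEnergy p (u 0) (ut 0) (gradu 0) < ⊤)
    (hK₁ : weightedInwardEnergy p a (u 0) (ut 0) (gradu 0) < ⊤) :
    ∃ μ : Measure ℝ, IsAxisFluxMeasure p u ut gradu μ ∧
      (∀ ν : Measure ℝ, IsAxisFluxMeasure p u ut gradu ν → ν = μ) ∧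
      ENNReal.ofReal Real.pi * ∫⁻ t in Ici (0 : ℝ), ENNReal.ofReal (a t) ∂μ +
        ∫⁻ z in Ioi (0 : ℝ) ×ˢ (univ : Set E3),
          ENNReal.ofReal (a (‖z.2‖ + z.1) *
            ((p - 1 - 2 * γ) / (2 * (p + 1)) * (|u z.1 z.2| ^ (p + 1) / ‖z.2‖) +
              (1 - γ) / 2 * (‖angularGrad (gradu z.1) z.2‖ ^ 2 / ‖z.2‖)))
        ≤ weightedInwardEnergy p a (u 0) (ut 0) (gradu 0) := by
  have h := hu.inwardFlow hp₃ hp₅ hE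
  obtain ⟨μ, hfin, hatom, hμ⟩ := h.exists_axisMeasure
  have hflux : IsAxisFluxMeasure p u ut gradu μ :=
    ⟨hfin, hatom, fun t₁ t₂ ht => (hu.tendsto_cylinderFlux_iff hp₃ hp₅ hE).2 (hμ t₁ t₂ ht.le)⟩
  refine ⟨μ, hflux, fun ν hν => hflux.unique hν, ?_⟩
  exact h.lintegral_axis_add_lintegral_le (PowerWeight.of_deriv_le ha_cont ha_ac ha_deriv hγ₀)
    hγ₀.le (hu.aestronglyMeasurable_coerciveSource hp₃)
    (fun z => coerciveSource_nonneg hp₃ hγ₁ _ _ _)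
    (fun z hz => (coerciveSource_add γ hp₃ _ _ _ hz).le) (hatom 0) hμ hK₁
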